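/- **Setting.** Let $m,N\ge 0$ be integers, $m$ odd and $N$ even; all vector spaces are over $\mathbb Q$. Consider finite graphs (loops and multiple edges allowed) with external and internal vertices. An orientation of a graph is a direction of every edge together with a total order of its orientation set, consisting of the external vertices (of degree $-m$), the internal vertices (of degree $-N$) and the edges (of degree $N-1$). Oriented graphs are considered up to isomorphism, and modulo the relations that reversing an edge gives the sign $(-1)^N$ and that reordering the orientation set gives the Koszul sign. The differential $\partial$ is the sum of all expansions of internal vertices into an edge such that both vertices of the new edge have valence $\ge 3$ (the two descriptions of an expansion that differ by exchanging the two ends of the new edge are counted once); the new edge is directed from the old vertex to the new one, and the new vertex and the new edge are put in the first two places of the orientation set. A graph is admissible if it is connected, has at least one external vertex, all external vertices have valence $1$ and all internal vertices have valence $\ge 3$. An edge is tree-type if its removal disconnects the graph and exactly one of the resulting components is a tree; the frame is the subgraph generated by the edges that are not tree-type; a hair is a tree-type edge one of whose vertices is univalent while the other one belongs to the frame and meets no other tree-type edge. A two-loop hairy graph is an admissible graph with first Betti number $2$ whose frame has no cut vertices (points whose removal disconnects the frame as a topological space) and whose tree-type edges are all hairs. Let $\mathcal C_{i}(t)$ be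 the span of the two-loop hairy graphs of defect $\sum_v(|v|-3)=i$ ($v$ running over the internal vertices) and of Hodge degree (number of external vertices) $t$. Let $H_i(t)=\ker(\partial|_{\mathcal C_i(t)})/\partial\,\mathcal C_{i+1}(t)$, $h_i(x)=\sum_{t}\dim H_i(t)\,x^t$, and $\chi(x)=\sum_t\chi_t x^t$, where $\chi_t$ is the Euler characteristic of the Hodge degree $t$ part with respect to the total degree of a graph (the sum of the degrees of the elements of its orientation set). Let $\mathbb Q\langle\xi_1,\xi_2,\xi_3\rangle$ be the algebra with generators $\xi_i$ and relations $\xi_i\xi_j=-\xi_j\xi_i$ for $i\ne j$ (and no relation $\xi_i^2=0$), on which $S_3$ acts by renumbering the generators. Let $e_1=\xi_1+\xi_2+\xi_3$, let $A$ be the linear map $\xi_1^{k_1}\xi_2^{k_2}\xi_3^{k_3}\mapsto(-1)^{\sum_i k_i(k_i+1)/2}\,\xi_1^{k_1}\xi_2^{k_2}\xi_3^{k_3}$, call $f$ $*$even if $A(f)=f$, and put $[f]_{*\mathrm{even}}=\frac12(f+A(f))$. Let $\mathrm{ASym}$ be the space of antisymmetric elements and $\mathrm{ASym}^{*\mathrm{even}}$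 its subspace of $*$even elements. Let $[k_1,k_2,k_3]\in\mathrm{ASym}$ be the antisymmetrization of $\xi_1^{k_1}\xi_2^{k_2}\xi_3^{k_3}$ normalized to have coefficient $1$ at this monomial. **Theorem.** (a) The frame of every two-loop hairy graph is a theta graph, and its defect is $0$, $1$ or $2$. The spaces $\mathcal C_i(t)$ are finite dimensional and form a complex $0\to\mathcal C_2\xrightarrow{\partial_2}\mathcal C_1\xrightarrow{\partial_1}\mathcal C_0\to0$, which is isomorphic to $$0\to\mathrm{ASym}^{*\mathrm{even}}\xrightarrow{\partial_2}\mathrm{ASym}\xrightarrow{\partial_1}\mathrm{ASym}^{*\mathrm{even}}\to0,\qquad \partial_2f=(-1)^{|f|}\,2fe_1,\quad \partial_1f=[e_1f]_{*\mathrm{even}},$$ where $|f|$ is the degree of a homogeneous $f$. The isomorphism identifies $\mathcal C_i(t)$ with the homogeneous part of degree $t-i$, and it sends a graph of defect $i$ with $k_1,k_2,k_3$ hairs on the three edges of the theta graph (not counting hairs at its two trivalent vertices), up to sign, to $f=\frac16\sum_{\sigma\in S_3}\operatorname{sgn}(\sigma)\,\sigma(\xi_1^{k_1}\xi_2^{k_2}\xi_3^{k_3})$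 if $i=1$, and to $[f]_{*\mathrm{even}}$ if $i=0,2$. (b) Under this isomorphism, the classes of the following elements form a basis of $H_0$: $[k_2+1,k_2,k_3]$ with $k_2$ even, $k_3\equiv1\bmod 4$, $k_2>k_3$; $[k_2+1,k_2,k_3]$ with $k_2$ even, $k_3\equiv2\bmod 4$, $k_2>k_3$; $[k_3+1,k_3+1,k_3]$ with $k_3\equiv0\bmod4$. The classes of the following elements form a basis of $H_1$: $2[k_2+1,k_2+1,k_3]+[k_2+1,k_2,k_3+1]$ with $k_2$ even, $k_3\equiv2\bmod4$, $k_2>k_3$; $[k_2,k_2,k_3]$ with $k_2$ odd, $k_3\equiv1\bmod4$, $k_2\ge k_3$. (In each Hodge degree $t$, those of degree $t$, respectively $t-1$, form a basis of $H_0(t)$, respectively $H_1(t)$.) (c) The generating functions of the ranks of the homology and of the Euler characteristics are $$h_0(x)=\frac{x^2+x^{11}}{(1-x^4)(1-x^{12})},\qquad h_1(x)=\frac{x^4+x^{13}}{(1-x^4)(1-x^{12})},\qquad \chi(x)=\frac{-x^2+x^{11}}{(1+x^2)(1-x^{12})}.$$ -/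

import Mathlib

namespace TwoLoop

/-! ### Oriented graphs -/

/-- A finite graph with external vertices `Ext`, internal vertices `Inn` and edges `Edge` (loops and
multiple edges allowed), together with an orientation: every edge `a` is directed from
`ends a false` to `ends a true`, and the orientation set (vertices and edges) is ordered by the
injective function `rank`. -/
structure OGraph : Type 1 where
  Ext : Type
  Inn : Type
  Edge : Type
  [fintypeExt : Fintype Ext]
  [fintypeInn : Fintype Inn]
  [fintypeEdge : Fintype Edge]
  ends : Edge → Bool → Ext ⊕ Inn
  rank : (Ext ⊕ Inn) ⊕ Edge → ℕ
  rank_injective : Function.Injective rank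

attribute [instance] OGraph.fintypeExt OGraph.fintypeInn OGraph.fintypeEdge

namespace OGraph

/-- Vertices of a graph. -/
abbrev Vert (Γ : OGraph) : Type := Γ.Ext ⊕ Γ.Inn

/-- The orientation set of a graph. -/
abbrev Elem (Γ : OGraph) : Type := (Γ.Ext ⊕ Γ.Inn) ⊕ Γ.Edge

/-- Degrees of the elements of the orientation set: `-m` for external vertices, `-N` for internal
vertices, `N - 1` for edges. -/
def elemDegree (m N : ℕ) {X V E : Type} : (X ⊕ V) ⊕ E → ℤ
  | .inl (.inl _) => -(m : ℤ)
  | .inl (.inr _) => -(N : ℤ)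
  | .inr _ => (N : ℤ) - 1

open Classical in
/-- The Koszul sign of passing from the order given by `r` to the order given by `r'`: every pair
of elements whose relative order changes contributes `(-1) ^ (product of degrees)`. -/
noncomputable def koszulSign (m N : ℕ) {X V E : Type} [Fintype X] [Fintype V] [Fintype E]
    (r r' : (X ⊕ V) ⊕ E → ℕ) : ℤˣ :=
  ∏ a, ∏ b, if r a < r b ∧ r' b < r' a then
    (elemDegree m N a * elemDegree m N b).negOnePow else 1

/-- Change the order of the orientation set. -/
def reorder (Γ : OGraph) (r : Γ.Elem → ℕ) (hr : Function.Injective r) : OGraph :=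
  { Γ with rank := r, rank_injective := hr }

open Classical in
/-- Exchange source and target of the edge `a`. -/
noncomputable def flipEnds {X V E : Type} (ends : E → Bool → X ⊕ V) (a : E) :
    E → Bool → X ⊕ V :=
  fun b s => if b = a then ends b (!s) else ends b s

/-- Reverse the direction of the edge `a`. -/
noncomputable def flip (Γ : OGraph) (a : Γ.Edge) : OGraph :=
  { Γ with ends := flipEnds Γ.ends a }

/-- Equivalence of oriented graphs: bijections of vertices and edges that respect the incidences,
the directions of the edges, and the order of the orientation sets. -/
structure Equivalence (Γ Γ' : OGraph) where
  ext : Γ.Ext ≃ Γ'.Ext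
  inn : Γ.Inn ≃ Γ'.Inn
  edge : Γ.Edge ≃ Γ'.Edge
  ends_eq : ∀ a s, Γ'.ends (edge a) s = Sum.map ext inn (Γ.ends a s)
  rank_lt_iff : ∀ x y, Γ'.rank (Sum.map (Sum.map ext inn) edge x) <
    Γ'.rank (Sum.map (Sum.map ext inn) edge y) ↔ Γ.rank x < Γ.rank y

/-- The relations: equivalent oriented graphs are identified; reversing an edge gives the sign
`(-1) ^ N`; reordering the orientation set gives the Koszul sign. -/
inductive Rel (m N : ℕ) : (OGraph →₀ ℚ) → Prop
  | equiv {Γ Γ' : OGraph} (φ : Equivalence Γ Γ') :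
      Rel m N (Finsupp.single Γ 1 - Finsupp.single Γ' 1)
  | flip (Γ : OGraph) (a : Γ.Edge) :
      Rel m N (Finsupp.single Γ 1 - (-1 : ℚ) ^ N • Finsupp.single (Γ.flip a) 1)
  | reorder (Γ : OGraph) (r : Γ.Elem → ℕ) (hr : Function.Injective r) :
      Rel m N (Finsupp.single Γ 1 -
        ((koszulSign m N Γ.rank r : ℤ) : ℚ) • Finsupp.single (Γ.reorder r hr) 1)

/-! ### The differential -/

open Classical in
/-- The half-edges at a vertex. -/
noncomputable def halfEdges (Γ : OGraph) (x : Γ.Vert) : Finset (Γ.Edge × Bool) :=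
  Finset.univ.filter fun h => Γ.ends h.1 h.2 = x

/-- The valence of a vertex (a loop counts twice). -/
noncomputable def valence (Γ : OGraph) (x : Γ.Vert) : ℕ := (Γ.halfEdges x).card

/-- The order of the orientation set of an expanded graph: first the new vertex, then the new edge,
then the old elements in their old order. -/
def expandRank {X V E : Type} (r : (X ⊕ V) ⊕ E → ℕ) : (X ⊕ Option V) ⊕ Option E → ℕ
  | .inl (.inl u) => r (.inl (.inl u)) + 2
  | .inl (.inr none) => 0
  | .inl (.inr (some v)) => r (.inl (.inr v)) + 2
  | .inr none => 1
  | .inr (some a) => r (.inr a) + 2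

theorem expandRank_injective {X V E : Type} {r : (X ⊕ V) ⊕ E → ℕ} (hr : Function.Injective r) :
    Function.Injective (expandRank r) := by
  rintro ((x | _ | x) | _ | x) ((y | _ | y) | _ | y) h <;>
    simp [expandRank, hr.eq_iff] at h ⊢ <;> exact h

theorem expandRank_lt_iff {X V E X' V' E' : Type} {r : (X ⊕ V) ⊕ E → ℕ} {r' : (X' ⊕ V') ⊕ E' → ℕ}
    {f : X → X'} {g : V → V'} {e : E → E'}
    (h : ∀ x y, r' (Sum.map (Sum.map f g) e x) < r' (Sum.map (Sum.map f g) e y) ↔ r x < r y)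
    (x y : (X ⊕ Option V) ⊕ Option E) :
    expandRank r' (Sum.map (Sum.map f (Option.map g)) (Option.map e) x) <
      expandRank r' (Sum.map (Sum.map f (Option.map g)) (Option.map e) y) ↔
      expandRank r x < expandRank r y := by
  obtain ((x | _ | x) | _ | x) := x <;> obtain ((y | _ | y) | _ | y) := y <;>
    simp [expandRank] <;> simp [← h]

open Classical in
/-- The ends of the edges of an expanded graph: the new edge `none` is directed from the old vertex
`x` to the new vertex `none`, and the half-edges in `S` are attached to the new vertex. -/
noncomputable def expandEnds {X V E : Type} (ends : E → Bool → X ⊕ V) (x : V)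
    (S : Finset (E × Bool)) : Option E → Bool → X ⊕ Option V
  | none, false => .inr (some x)
  | none, true => .inr none
  | some a, s => if (a, s) ∈ S then .inr none else Sum.map id some (ends a s)

/-- Expansion of the internal vertex `x`: the half-edges in `S` are moved from `x` to a new
vertex, which is joined to `x` by a new edge. -/
noncomputable def expand (Γ : OGraph) (x : Γ.Inn) (S : Finset (Γ.Edge × Bool)) : OGraph where
  Ext := Γ.Ext
  Inn := Option Γ.Inn
  Edge := Option Γ.Edge
  ends := expandEnds Γ.ends x S
  rank := expandRank Γ.rank
  rank_injective := expandRank_injective Γ.rank_injective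

open Classical in
/-- The sets of half-edges at `x` that may be moved to the new vertex: both vertices of the
new edge must have valence at least three. -/
noncomputable def splittings (Γ : OGraph) (x : Γ.Inn) : Finset (Finset (Γ.Edge × Bool)) :=
  (Γ.halfEdges (.inr x)).powerset.filter fun S =>
    2 ≤ S.card ∧ 2 ≤ (Γ.halfEdges (.inr x) \ S).card

/-- Sum of all expansions of all internal vertices. Every expansion is obtained from two
splittings (`S` and its complement), whence the factor `1 / 2`. -/
noncomputable def expansions (Γ : OGraph) : OGraph →₀ ℚ :=
  (1 / 2 : ℚ) • ∑ x, ∑ S ∈ Γ.splittings x, Finsupp.single (Γ.expand x S) 1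

end OGraph

open OGraph

/-- The span of the orientation relations. -/
noncomputable def relations (m N : ℕ) : Submodule ℚ (OGraph →₀ ℚ) :=
  Submodule.span ℚ {f | Rel m N f}

/-- Linear combinations of oriented graphs modulo the orientation relations. -/
abbrev GraphSpace (m N : ℕ) : Type 1 := (OGraph →₀ ℚ) ⧸ relations m N

/-- The class of an oriented graph. -/
noncomputable def graphClass (m N : ℕ) (Γ : OGraph) : GraphSpace m N :=
  (relations m N).mkQ (Finsupp.single Γ 1)

/-- The differential on linear combinations of oriented graphs. -/
noncomputable def freeDifferential : (OGraph →₀ ℚ) →ₗ[ℚ] (OGraph →₀ ℚ) :=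
  Finsupp.linearCombination ℚ OGraph.expansions

namespace OGraph

theorem mem_halfEdges {Γ : OGraph} {x : Γ.Vert} {h : Γ.Edge × Bool} :
    h ∈ Γ.halfEdges x ↔ Γ.ends h.1 h.2 = x := by
  simp [halfEdges]

theorem mem_splittings {Γ : OGraph} {x : Γ.Inn} {S : Finset (Γ.Edge × Bool)} :
    S ∈ Γ.splittings x ↔ S ⊆ Γ.halfEdges (.inr x) ∧ 2 ≤ S.card ∧
      S.card + 2 ≤ (Γ.halfEdges (.inr x)).card := by
  classical
  simp only [splittings, Finset.mem_filter, Finset.mem_powerset]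
  constructor
  · rintro ⟨h, h1, h2⟩
    have := Finset.card_sdiff_add_card_eq_card h
    exact ⟨h, h1, by omega⟩
  · rintro ⟨h, h1, h2⟩
    have := Finset.card_sdiff_add_card_eq_card h
    exact ⟨h, h1, by omega⟩

/-- Two families of expansions that correspond to each other modulo the relations. -/
theorem expansions_sub_mem (m N : ℕ) (Γ Γ' : OGraph) (c : ℚ) (f : Γ.Inn ≃ Γ'.Inn)
    (g : Γ.Edge × Bool ≃ Γ'.Edge × Bool)
    (hg : ∀ x h, Γ'.ends (g h).1 (g h).2 = .inr (f x) ↔ Γ.ends h.1 h.2 = .inr x)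
    (hrel : ∀ x S, Finsupp.single (Γ.expand x S) 1 -
      c • Finsupp.single (Γ'.expand (f x) (S.map g.toEmbedding)) 1 ∈ relations m N) :
    Γ.expansions - c • Γ'.expansions ∈ relations m N := by
  classical
  have hhalf : ∀ x, Γ'.halfEdges (.inr (f x)) = (Γ.halfEdges (.inr x)).map g.toEmbedding := by
    intro x
    ext h
    obtain ⟨h, rfl⟩ := g.surjective h
    simp [mem_halfEdges, hg]
  have hsum : ∀ x, ∑ S ∈ Γ'.splittings (f x), Finsupp.single (Γ'.expand (f x) S) (1 : ℚ) =
      ∑ S ∈ Γ.splittings x,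
        Finsupp.single (Γ'.expand (f x) (S.map g.toEmbedding)) (1 : ℚ) := by
    intro x
    symm
    refine Finset.sum_equiv g.finsetCongr ?_ ?_
    · intro S
      simp [mem_splittings, hhalf]
    · intro S _
      rfl
  have : Γ.expansions - c • Γ'.expansions = (1 / 2 : ℚ) • ∑ x, ∑ S ∈ Γ.splittings x,
      (Finsupp.single (Γ.expand x S) (1 : ℚ) -
        c • Finsupp.single (Γ'.expand (f x) (S.map g.toEmbedding)) 1) := by
    rw [expansions, expansions, smul_comm c, ← smul_sub, ← Equiv.sum_comp f]
    simp only [hsum, Finset.sum_sub_distrib, Finset.smul_sum]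
  rw [this]
  exact Submodule.smul_mem _ _ (Submodule.sum_mem _ fun x _ =>
    Submodule.sum_mem _ fun S _ => hrel x S)

/-- Equivalent graphs have equivalent expansions. -/
def Equivalence.expand {Γ Γ' : OGraph} (φ : Equivalence Γ Γ') (x : Γ.Inn)
    (S : Finset (Γ.Edge × Bool)) :
    Equivalence (Γ.expand x S) (Γ'.expand (φ.inn x)
      (S.map (φ.edge.prodCongr (Equiv.refl Bool)).toEmbedding)) where
  ext := φ.ext
  inn := φ.inn.optionCongr
  edge := φ.edge.optionCongr
  ends_eq := by
    change ∀ (a : Option Γ.Edge) (s : Bool), expandEnds Γ'.ends (φ.inn x)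
      (S.map (φ.edge.prodCongr (Equiv.refl Bool)).toEmbedding) (a.map φ.edge) s =
      Sum.map φ.ext (Option.map φ.inn) (expandEnds Γ.ends x S a s)
    rintro (_ | a) s
    · cases s <;> rfl
    · have h : (φ.edge a, s) ∈ S.map (φ.edge.prodCongr (Equiv.refl Bool)).toEmbedding ↔
          (a, s) ∈ S := by
        simp
      by_cases hS : (a, s) ∈ S
      · simp [expandEnds, hS]
      · simp only [expandEnds, Option.map_some, h, hS, if_false, φ.ends_eq]
        rcases Γ.ends a s with u | u <;> rfl
  rank_lt_iff := expandRank_lt_iff φ.rank_lt_iff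

open Classical in
/-- Exchange the two half-edges of `a`. -/
noncomputable def swapHalves {E : Type} (a : E) : E × Bool ≃ E × Bool :=
  Function.Involutive.toPerm (fun h => (h.1, if h.1 = a then !h.2 else h.2)) (by
    rintro ⟨b, s⟩
    by_cases h : b = a <;> simp [h])

theorem swapHalves_self {E : Type} (a : E) (s : Bool) : swapHalves a (a, s) = (a, !s) := by
  classical
  change (a, if a = a then !s else s) = (a, !s)
  rw [if_pos rfl]

theorem swapHalves_ne {E : Type} {a b : E} (h : b ≠ a) (s : Bool) :
    swapHalves a (b, s) = (b, s) := by
  classical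
  change (b, if b = a then !s else s) = (b, s)
  rw [if_neg h]

theorem expandEnds_flipEnds {X V E : Type} (ends : E → Bool → X ⊕ V) (a : E) (x : V)
    (S : Finset (E × Bool)) :
    expandEnds (flipEnds ends a) x (S.map (swapHalves a).toEmbedding) =
      flipEnds (expandEnds ends x S) (some a) := by
  classical
  have hmem : ∀ h, h ∈ S.map (swapHalves a).toEmbedding ↔ swapHalves a h ∈ S := by
    intro h
    rw [Finset.mem_map_equiv]
    rfl
  funext b s
  rcases b with _ | b
  · cases s <;> simp [flipEnds, expandEnds]
  · by_cases hb : b = a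
    · subst hb
      have h := hmem (b, s)
      rw [swapHalves_self] at h
      simp only [flipEnds, expandEnds, if_true]
      exact if_congr h rfl rfl
    · have h := hmem (b, s)
      rw [swapHalves_ne hb] at h
      simp only [flipEnds, expandEnds, Option.some.injEq, hb, if_false]
      exact if_congr h rfl rfl

theorem flip_expand (Γ : OGraph) (a : Γ.Edge) (x : Γ.Inn) (S : Finset (Γ.Edge × Bool)) :
    (Γ.flip a).expand x (S.map (swapHalves a).toEmbedding) = (Γ.expand x S).flip (some a) := by
  unfold OGraph.expand OGraph.flip
  congr 1
  exact expandEnds_flipEnds Γ.ends a x S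

theorem koszulSign_expandRank (m N : ℕ) {X V E : Type} [Fintype X] [Fintype V] [Fintype E]
    (r r' : (X ⊕ V) ⊕ E → ℕ) :
    koszulSign m N (expandRank r) (expandRank r') = koszulSign m N r r' := by
  simp [koszulSign, Fintype.prod_sum_type, Fintype.prod_option, expandRank, elemDegree]

theorem freeDifferential_mem (m N : ℕ) :
    relations m N ≤ (relations m N).comap freeDifferential := by
  refine Submodule.span_le.2 ?_
  rintro _ (⟨φ⟩ | ⟨Γ, a⟩ | ⟨Γ, r, hr⟩)
  · rename_i Γ Γ'
    simp only [Submodule.comap_coe, Set.mem_preimage, SetLike.mem_coe, map_sub, freeDifferential,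
      Finsupp.linearCombination_single, one_smul]
    rw [← one_smul ℚ Γ'.expansions]
    refine expansions_sub_mem m N Γ Γ' 1 φ.inn (φ.edge.prodCongr (Equiv.refl Bool)) ?_ ?_
    · intro x h
      simp only [Equiv.prodCongr_apply, Prod.map_fst, Prod.map_snd, Equiv.coe_refl, id,
        φ.ends_eq]
      rcases Γ.ends h.1 h.2 with u | u <;> simp
    · intro x S
      rw [one_smul]
      exact Submodule.subset_span (Rel.equiv (φ.expand x S))
  · simp only [Submodule.comap_coe, Set.mem_preimage, SetLike.mem_coe, map_sub, map_smul,
      freeDifferential, Finsupp.linearCombination_single, one_smul]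
    refine expansions_sub_mem m N Γ (Γ.flip a) _ (Equiv.refl Γ.Inn) (swapHalves a) ?_ ?_
    · change ∀ (x : Γ.Inn) (h : Γ.Edge × Bool),
        flipEnds Γ.ends a (swapHalves a h).1 (swapHalves a h).2 = .inr x ↔
          Γ.ends h.1 h.2 = .inr x
      rintro x ⟨b, s⟩
      by_cases hb : b = a
      · subst hb
        simp [swapHalves_self, flipEnds]
      · simp [swapHalves_ne hb, flipEnds, hb]
    · intro x S
      have := Rel.flip (m := m) (N := N) (Γ.expand x S) (some a)
      rw [← flip_expand Γ a x S] at this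
      exact Submodule.subset_span this
  · simp only [Submodule.comap_coe, Set.mem_preimage, SetLike.mem_coe, map_sub, map_smul,
      freeDifferential, Finsupp.linearCombination_single, one_smul]
    refine expansions_sub_mem m N Γ (Γ.reorder r hr) _ (Equiv.refl _) (Equiv.refl _) ?_ ?_
    · intro x h
      rfl
    · intro x S
      have := Rel.reorder (m := m) (N := N) (Γ.expand x S) (expandRank r) (expandRank_injective hr)
      have h2 := koszulSign_expandRank m N Γ.rank r
      erw [h2] at this
      convert Submodule.subset_span this using 4
      simp [OGraph.expand, OGraph.reorder]
      rfl

end OGraph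

/-- The differential of the graph complex. -/
noncomputable def differential (m N : ℕ) : GraphSpace m N →ₗ[ℚ] GraphSpace m N :=
  (relations m N).mapQ (relations m N) freeDifferential (freeDifferential_mem m N)

/-! ### Two-loop hairy graphs -/

namespace OGraph

/-- The simple graph on the vertices of `Γ` in which two distinct vertices are adjacent if they are
joined by an edge of `Γ` that belongs to `A`. -/
def skeleton (Γ : OGraph) (A : Set Γ.Edge) : SimpleGraph Γ.Vert :=
  SimpleGraph.fromRel fun x y => ∃ a ∈ A, Γ.ends a false = x ∧ Γ.ends a true = y

/-- Connected graphs with a nonempty set of external vertices, all of valence one, and with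
internal vertices of valence at least three. -/
structure Admissible (Γ : OGraph) : Prop where
  connected : (Γ.skeleton Set.univ).Connected
  nonempty_ext : Nonempty Γ.Ext
  valence_ext : ∀ u : Γ.Ext, Γ.valence (.inl u) = 1
  valence_inn : ∀ x : Γ.Inn, 3 ≤ Γ.valence (.inr x)

/-- The number of loops (first Betti number) of a connected graph. -/
def loops (Γ : OGraph) : ℤ := Fintype.card Γ.Edge - Fintype.card Γ.Vert + 1

/-- The Hodge degree: the number of external vertices. -/
def hodge (Γ : OGraph) : ℕ := Fintype.card Γ.Ext

/-- The defect of a graph. -/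
noncomputable def defect (Γ : OGraph) : ℤ := ∑ x : Γ.Inn, ((Γ.valence (.inr x) : ℤ) - 3)

/-- The total degree: the sum of the degrees of the elements of the orientation set. -/
def totalDegree (m N : ℕ) (Γ : OGraph) : ℤ := ∑ x : Γ.Elem, elemDegree m N x

/-- A connected component of the graph without the edge `a` is a tree: it has one vertex more than
it has edges. -/
def IsTreeComponent (Γ : OGraph) (a : Γ.Edge)
    (c : (Γ.skeleton {a}ᶜ).ConnectedComponent) : Prop :=
  c.supp.ncard = {b | b ≠ a ∧ Γ.ends b false ∈ c.supp}.ncard + 1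

/-- An edge is tree-type if its removal disconnects the graph and exactly one of the resulting
components is a tree. -/
def IsTreeType (Γ : OGraph) (a : Γ.Edge) : Prop :=
  ¬ (Γ.skeleton {a}ᶜ).Connected ∧ ∃! c, Γ.IsTreeComponent a c

/-- The vertices of the frame, i.e. of the subgraph generated by the edges that are not
tree-type. -/
def InFrame (Γ : OGraph) (x : Γ.Vert) : Prop :=
  ∃ a s, ¬ Γ.IsTreeType a ∧ Γ.ends a s = x

/-- A tree-type edge is a hair if one of its vertices is univalent and the other one belongs to the
frame and is adjacent to no other tree-type edge. -/
def IsHair (Γ : OGraph) (a : Γ.Edge) : Prop :=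
  Γ.IsTreeType a ∧ ∃ s, Γ.valence (Γ.ends a s) = 1 ∧ Γ.InFrame (Γ.ends a (!s)) ∧
    ∀ b, b ≠ a → Γ.IsTreeType b → ∀ s', Γ.ends b s' ≠ Γ.ends a (!s)

/-- `x` is a cut vertex of the frame: removing the point `x` from the frame, as a topological space,
disconnects it, i.e. the edges of the frame split into two nonempty sets which have no vertex other
than `x` in common. (In particular a vertex with a loop at it is cut unless the loop is the
whole frame.) -/
def IsFrameCut (Γ : OGraph) (x : Γ.Vert) : Prop :=
  ∃ A : Set Γ.Edge, (∃ a, ¬ Γ.IsTreeType a ∧ a ∈ A) ∧ (∃ a, ¬ Γ.IsTreeType a ∧ a ∉ A) ∧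
    ∀ a b s s', ¬ Γ.IsTreeType a → ¬ Γ.IsTreeType b → a ∈ A → b ∉ A →
      Γ.ends a s = Γ.ends b s' → Γ.ends a s = x

/-- Two-loop hairy graphs: the frame has no cut vertices and all tree-type edges are hairs. -/
structure IsTwoLoopHairy (Γ : OGraph) : Prop where
  admissible : Γ.Admissible
  loops_eq : Γ.loops = 2
  not_cut : ∀ x, ¬ Γ.IsFrameCut x
  hair : ∀ a, Γ.IsTreeType a → Γ.IsHair a

/-- `Γ` contains a theta graph formed by three paths with common end points, otherwise disjoint,
such that the `j`-th path has `k j` interior vertices. For a two-loop hairy graph this says that the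
frame is a theta graph whose three edges carry `k 0`, `k 1`, `k 2` hairs. -/
def IsTheta (Γ : OGraph) (k : Fin 3 → ℕ) : Prop :=
  ∃ (p : ∀ j, Fin (k j + 2) → Γ.Inn) (e : ∀ j, Fin (k j + 1) → Γ.Edge),
    (∀ j l, ∃ s, Γ.ends (e j l) s = .inr (p j l.castSucc) ∧
      Γ.ends (e j l) (!s) = .inr (p j l.succ)) ∧
    (∀ j l j' l', e j l = e j' l' → j = j' ∧ (l : ℕ) = l') ∧
    (∀ j l j' l', p j l = p j' l' ↔ (j = j' ∧ (l : ℕ) = l') ∨ ((l : ℕ) = 0 ∧ (l' : ℕ) = 0) ∨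
      ((l : ℕ) = k j + 1 ∧ (l' : ℕ) = k j' + 1))

end OGraph

/-- The space of two-loop hairy graphs of defect `i` and Hodge degree `t`. -/
noncomputable def hairy (m N i t : ℕ) : Submodule ℚ (GraphSpace m N) :=
  Submodule.span ℚ {z | ∃ Γ : OGraph, Γ.IsTwoLoopHairy ∧ Γ.defect = i ∧ Γ.hodge = t ∧
    z = graphClass m N Γ}

/-- Cycles of defect `i` and Hodge degree `t` in the two-loop hairy graph complex. -/
noncomputable def cycles (m N i t : ℕ) : Submodule ℚ (GraphSpace m N) :=
  hairy m N i t ⊓ LinearMap.ker (differential m N)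

/-- Boundaries of defect `i` and Hodge degree `t` in the two-loop hairy graph complex. -/
noncomputable def boundaries (m N i t : ℕ) : Submodule ℚ (GraphSpace m N) :=
  (hairy m N (i + 1) t).map (differential m N)

/-- The two-loop homology `H i` in Hodge degree `t`. -/
abbrev Homology (m N i t : ℕ) : Type 1 :=
  cycles m N i t ⧸ (boundaries m N i t).submoduleOf (cycles m N i t)

/-- The generating function of the ranks of `H i`. -/
noncomputable def homologySeries (m N i : ℕ) : PowerSeries ℤ :=
  PowerSeries.mk fun t => (Module.finrank ℚ (Homology m N i t) : ℤ)

/-- The space of two-loop hairy graphs of Hodge degree `t` and total degree `d`. -/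
noncomputable def hairyOfDegree (m N t : ℕ) (d : ℤ) : Submodule ℚ (GraphSpace m N) :=
  Submodule.span ℚ {z | ∃ Γ : OGraph, Γ.IsTwoLoopHairy ∧ Γ.hodge = t ∧ Γ.totalDegree m N = d ∧
    z = graphClass m N Γ}

/-- The generating function of the Euler characteristics of the two-loop hairy graph complex. -/
noncomputable def eulerSeries (m N : ℕ) : PowerSeries ℤ :=
  PowerSeries.mk fun t =>
    ∑ᶠ d : ℤ, (d.negOnePow : ℤ) * Module.finrank ℚ (hairyOfDegree m N t d)

/-! ### The algebra `ℚ⟨ξ₁, ξ₂, ξ₃⟩` -/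

/-- The algebra generated by `ξ 0`, `ξ 1`, `ξ 2` with `ξ i * ξ j = - ξ j * ξ i` for `i ≠ j`,
written in its basis of monomials `ξ 0 ^ k 0 * ξ 1 ^ k 1 * ξ 2 ^ k 2`. -/
def SkewPoly : Type := (Fin 3 → ℕ) →₀ ℚ

namespace SkewPoly

noncomputable instance : AddCommGroup SkewPoly := inferInstanceAs (AddCommGroup (_ →₀ ℚ))
noncomputable instance : Module ℚ SkewPoly := inferInstanceAs (Module ℚ (_ →₀ ℚ))

/-- The monomial `ξ 0 ^ k 0 * ξ 1 ^ k 1 * ξ 2 ^ k 2`. -/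
noncomputable def monomial (k : Fin 3 → ℕ) : SkewPoly := Finsupp.single k (1 : ℚ)

/-- The monomials form a basis. -/
noncomputable def monomialBasis : Module.Basis (Fin 3 → ℕ) ℚ SkewPoly :=
  Module.Basis.ofRepr (LinearEquiv.refl ℚ ((Fin 3 → ℕ) →₀ ℚ))

theorem monomialBasis_apply (k : Fin 3 → ℕ) : monomialBasis k = monomial k := rfl

/-- The number of transpositions of distinct generators needed to sort the product of the monomials
with exponents `a` and `b`. -/
def swaps (a b : Fin 3 → ℕ) : ℕ := a 1 * b 0 + a 2 * b 0 + a 2 * b 1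

/-- The multiplication as a bilinear map. -/
noncomputable def mulHom : SkewPoly →ₗ[ℚ] SkewPoly →ₗ[ℚ] SkewPoly :=
  monomialBasis.constr ℚ fun a => monomialBasis.constr ℚ fun b =>
    (-1 : ℚ) ^ swaps a b • monomial (a + b)

noncomputable instance : Mul SkewPoly := ⟨fun f g => mulHom f g⟩
noncomputable instance : One SkewPoly := ⟨monomial 0⟩

theorem mul_def (f g : SkewPoly) : f * g = mulHom f g := rfl

theorem one_def : (1 : SkewPoly) = monomial 0 := rfl

theorem mulHom_monomial (a b : Fin 3 → ℕ) :
    mulHom (monomial a) (monomial b) = (-1 : ℚ) ^ swaps a b • monomial (a + b) := by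
  rw [mulHom, ← monomialBasis_apply, Module.Basis.constr_basis, ← monomialBasis_apply,
    Module.Basis.constr_basis]

theorem monomial_mul_monomial (a b : Fin 3 → ℕ) :
    monomial a * monomial b = (-1 : ℚ) ^ swaps a b • monomial (a + b) :=
  mulHom_monomial a b

theorem induction_linear {p : SkewPoly → Prop} (f : SkewPoly) (zero : p 0)
    (add : ∀ f g, p f → p g → p (f + g)) (mon : ∀ (c : ℚ) k, p (c • monomial k)) : p f := by
  refine Finsupp.induction_linear (motive := p) f zero add fun k c => ?_
  have h := mon c k
  have h2 : c • monomial k = Finsupp.single k c := by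
    change c • (Finsupp.single k (1 : ℚ)) = _
    rw [Finsupp.smul_single, smul_eq_mul, mul_one]
  rwa [h2] at h

theorem mulHom_assoc (f g h : SkewPoly) : mulHom (mulHom f g) h = mulHom f (mulHom g h) := by
  induction f using induction_linear with
  | zero => simp only [map_zero, LinearMap.zero_apply]
  | add f f' hf hf' => simp only [map_add, LinearMap.add_apply, hf, hf']
  | mon a x =>
    induction g using induction_linear with
    | zero => simp only [map_zero, LinearMap.zero_apply]
    | add f f' hf hf' => simp only [map_add, LinearMap.add_apply, hf, hf']
    | mon b y =>
      induction h using induction_linear with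
      | zero => simp only [map_zero]
      | add f f' hf hf' => simp only [map_add, hf, hf']
      | mon c z =>
        simp only [map_smul, LinearMap.smul_apply, mulHom_monomial, smul_smul, add_assoc]
        congr 1
        have : (-1 : ℚ) ^ swaps x y * (-1) ^ swaps (x + y) z =
            (-1) ^ swaps y z * (-1) ^ swaps x (y + z) := by
          rw [← pow_add, ← pow_add]
          congr 1
          simp only [swaps, Pi.add_apply]
          ring
        linear_combination a * b * c * this

theorem one_mulHom (f : SkewPoly) : mulHom 1 f = f := by
  induction f using induction_linear with
  | zero => simp only [map_zero]
  | add f f' hf hf' => simp only [map_add, hf, hf']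
  | mon a x => simp [one_def, mulHom_monomial, swaps]

theorem mulHom_one (f : SkewPoly) : mulHom f 1 = f := by
  induction f using induction_linear with
  | zero => simp only [map_zero, LinearMap.zero_apply]
  | add f f' hf hf' => simp only [map_add, LinearMap.add_apply, hf, hf']
  | mon a x => simp [one_def, mulHom_monomial, swaps]

noncomputable instance : Ring SkewPoly :=
  { (inferInstance : AddCommGroup SkewPoly) with
    mul := (· * ·)
    one := 1
    left_distrib := fun f g h => by simp only [mul_def, map_add]
    right_distrib := fun f g h => by simp only [mul_def, map_add, LinearMap.add_apply]
    zero_mul := fun f => by simp only [mul_def, map_zero, LinearMap.zero_apply]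
    mul_zero := fun f => by simp only [mul_def, map_zero]
    mul_assoc := mulHom_assoc
    one_mul := one_mulHom
    mul_one := mulHom_one }

noncomputable instance : Algebra ℚ SkewPoly :=
  Algebra.ofModule
    (fun c f g => by simp only [mul_def, map_smul, LinearMap.smul_apply])
    (fun c f g => by simp only [mul_def, map_smul])

/-- The generators. -/
noncomputable def ξ (j : Fin 3) : SkewPoly := monomial (Pi.single j 1)

theorem ξ_anticomm {i j : Fin 3} (h : i ≠ j) : ξ i * ξ j = -(ξ j * ξ i) := by
  rw [ξ, ξ, monomial_mul_monomial, monomial_mul_monomial,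
    add_comm (Pi.single j 1 : Fin 3 → ℕ), ← neg_smul]
  congr 1
  fin_cases i <;> fin_cases j <;> simp [swaps] at h ⊢

theorem ξ_pow (j : Fin 3) (n : ℕ) : ξ j ^ n = monomial (Pi.single j n) := by
  induction n with
  | zero => rw [pow_zero, Pi.single_zero, one_def]
  | succ n ih =>
    rw [pow_succ, ih, ξ, monomial_mul_monomial, ← Pi.single_add]
    fin_cases j <;> simp [swaps]

theorem monomial_eq (k : Fin 3 → ℕ) : monomial k = ξ 0 ^ k 0 * ξ 1 ^ k 1 * ξ 2 ^ k 2 := by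
  have h : k = Pi.single 0 (k 0) + Pi.single 1 (k 1) + Pi.single 2 (k 2) := by
    funext j
    fin_cases j <;> simp
  rw [ξ_pow, ξ_pow, ξ_pow, monomial_mul_monomial, smul_mul_assoc, monomial_mul_monomial, ← h]
  simp [swaps]

/-- The element `e₁ = ξ₁ + ξ₂ + ξ₃`. -/
noncomputable def e₁ : SkewPoly := ξ 0 + ξ 1 + ξ 2

/-- The action of a permutation by renumbering the generators. -/
noncomputable def renumber (σ : Equiv.Perm (Fin 3)) : SkewPoly →ₗ[ℚ] SkewPoly :=
  monomialBasis.constr ℚ fun k => ξ (σ 0) ^ k 0 * ξ (σ 1) ^ k 1 * ξ (σ 2) ^ k 2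

/-- The antisymmetric elements. -/
noncomputable def ASym : Submodule ℚ SkewPoly :=
  ⨅ σ : Equiv.Perm (Fin 3),
    LinearMap.eqLocus (renumber σ) (((Equiv.Perm.sign σ : ℤ) : ℚ) • LinearMap.id)

/-- The linear map `A` multiplying the monomial with exponents `k` by
`(-1) ^ ∑ i, k i * (k i + 1) / 2`. -/
noncomputable def A : SkewPoly →ₗ[ℚ] SkewPoly :=
  monomialBasis.constr ℚ fun k => (-1 : ℚ) ^ (∑ j, k j * (k j + 1) / 2) • monomial k

/-- The `*`even elements. -/
noncomputable def starEven : Submodule ℚ SkewPoly := LinearMap.eqLocus A LinearMap.id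

/-- The projection onto the `*`even part. -/
noncomputable def starEvenPart : SkewPoly →ₗ[ℚ] SkewPoly := (1 / 2 : ℚ) • (LinearMap.id + A)

/-- The linear map `f ↦ (-1) ^ |f| f`. -/
noncomputable def parity : SkewPoly →ₗ[ℚ] SkewPoly :=
  monomialBasis.constr ℚ fun k => (-1 : ℚ) ^ (∑ j, k j) • monomial k

/-- The homogeneous elements of degree `d`. -/
noncomputable def homogeneous (d : ℕ) : Submodule ℚ SkewPoly :=
  Submodule.span ℚ {f | ∃ k : Fin 3 → ℕ, ∑ j, k j = d ∧ f = monomial k}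

/-- The signed sum over all renumberings of the monomial with exponents `k`. -/
noncomputable def signedSum (k : Fin 3 → ℕ) : SkewPoly :=
  ∑ σ : Equiv.Perm (Fin 3), ((Equiv.Perm.sign σ : ℤ) : ℚ) • renumber σ (monomial k)

/-- The element `[k₁, k₂, k₃]`: the antisymmetrization of `ξ₁ ^ k₁ ξ₂ ^ k₂ ξ₃ ^ k₃` normalized such
that (if it is nonzero) the coefficient of `ξ₁ ^ k₁ ξ₂ ^ k₂ ξ₃ ^ k₃` is one. -/
noncomputable def bracket (k₁ k₂ k₃ : ℕ) : SkewPoly :=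
  (Nat.card {σ : Equiv.Perm (Fin 3) // ![k₁, k₂, k₃] ∘ σ = ![k₁, k₂, k₃]} : ℚ)⁻¹ •
    signedSum ![k₁, k₂, k₃]

/-- The algebraic model of the graphs of defect `i`: `ASym^{*even}`, `ASym`, `ASym^{*even}` for
`i = 0, 1, 2`. -/
noncomputable def model : ℕ → Submodule ℚ SkewPoly
  | 0 => ASym ⊓ starEven
  | 1 => ASym
  | 2 => ASym ⊓ starEven
  | _ => ⊥

/-- The part of the model of Hodge degree `t`: elements of degree `t - i`. -/
noncomputable def modelPart (i t : ℕ) : Submodule ℚ SkewPoly :=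
  model i ⊓ ⨆ (d : ℕ) (_ : d + i = t), homogeneous d

/-- The differentials of the model: `∂₂ f = (-1) ^ |f| 2 f e₁` and
`∂₁ f = (e₁ f + A (e₁ f)) / 2`. -/
noncomputable def modelDifferential : ℕ → SkewPoly → SkewPoly
  | 1, f => starEvenPart (e₁ * f)
  | 2, f => (2 : ℚ) • (parity f * e₁)
  | _, _ => 0

/-- The element of the model that represents a graph of defect `i` with `k j` hairs on the `j`-th
edge of the theta graph. -/
noncomputable def thetaElement (i : ℕ) (k : Fin 3 → ℕ) : SkewPoly :=
  if i = 1 then (1 / 6 : ℚ) • signedSum k else starEvenPart ((1 / 6 : ℚ) • signedSum k)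

/-- The triples `(k₁, k₂, k₃)` for which the elements `[k₁, k₂, k₃]` form a basis of `H 0`. -/
def basisTriples : Set (ℕ × ℕ × ℕ) :=
  {k | ∃ k₂ k₃, k = (k₂ + 1, k₂, k₃) ∧ Even k₂ ∧ k₃ % 4 = 1 ∧ k₃ < k₂} ∪
  {k | ∃ k₂ k₃, k = (k₂ + 1, k₂, k₃) ∧ Even k₂ ∧ k₃ % 4 = 2 ∧ k₃ < k₂} ∪
  {k | ∃ k₃, k = (k₃ + 1, k₃ + 1, k₃) ∧ k₃ % 4 = 0}

end SkewPoly

end TwoLoop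

/-! For `m` odd and `N` even only external vertices and edges are odd, and reversing an edge costs
no sign. The class of a graph therefore depends only on the order of its odd elements up to even
permutations, and `GraphSpace` is the space of coinvariants under isomorphisms that ignore
orientations: `graphClass_eq` computes classes along a `WeakIso`, and `map_graphClass` builds maps
out of the quotient.

Graphs. The frame has one edge more than it has vertices, all its valences are at least two, and it
has no cut vertex. Hence the valences exceed two by two in total, and the edges leaving one branch
vertex continue to three disjoint paths ending at a second branch vertex (`exists_theta`,
`exhaust`). So every two-loop hairy graph is a standard graph `theta s k` (`exists_weakIso`), where
`s` records which end points carry hairs. Isomorphisms of these graphs are, up to their effect on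
orientations, renumberings of the paths and the exchange of the end points (`weakIso_theta`). An
external vertex and its hair form an even pair, so only the path edges produce signs: renumberings
act as on monomials in anticommuting variables, twisted by the sign of the permutation
(`sign_permIso_mul`), and the exchange of the end points acts by `A` (`sign_flipIso`). Expanding a
four-valent end point pushes its hair onto one of the three paths. At the start this is left
multiplication by `e₁`, at the end right multiplication up to sign (`differential_thetaMap`). This
gives the algebraic model; the isomorphism is `modelEquiv`, and `differential_hairy` identifies the
differentials.

Homology of the model. Split left multiplication by `e₁` into `mulOdd` and `mulEven`, according to
the parity of the exponent that is raised. They commute and anticommute with `A`, respectively; both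
square to zero; their anticommutator is multiplication by the central element `ξ₁² + ξ₂² + ξ₃²`
(`mulSq`); and both are exact on antisymmetric elements (`exists_mulEven`, `exists_mulOdd`). The
operator `A` is `±1` on a monomial according to the degree plus the number `q` of odd exponents,
modulo 4. So in a fixed Hodge degree `t` the terms of defect 0 and 2 consist of a single value of
`q`, and the term of defect 1 of two values. In each residue class of `t` modulo 4 a short diagram
chase shows that one of `H 0`, `H 1` vanishes, while the other one is the cokernel of `mulSq` on the
part with `q = 0` or `q = 3`.

These two parts are antisymmetric polynomials in the squares of the variables and `ξ₁ξ₂ξ₃` times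
symmetric ones. Modulo the first power sum of the squares, a basis is given by the sorted exponents
whose largest entry cannot be lowered by two (`Rest`, `exists_sub_mulSq`, `mulSq_rest`). The bases
in the theorem correspond to these under the isomorphisms of the diagram chase. Counting them gives
the series of the ranks. Injectivity of `mulSq` gives injectivity of `∂₂` and hence the Euler
characteristics. -/

set_option autoImplicit false

namespace TwoLoop
open OGraph

/-! ### Signs -/

section InvSign

variable {O O' : Type*} [Fintype O] [Fintype O']

open Classical in
/-- The sign of the permutation relating the orders given by two ranking functions. -/
noncomputable def invSign (r r' : O → ℕ) : ℤˣ :=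
  ∏ a, ∏ b, if r a < r b ∧ r' b < r' a then -1 else 1

theorem invSign_self (r : O → ℕ) : invSign r r = 1 := by
  refine Finset.prod_eq_one fun a _ => Finset.prod_eq_one fun b _ => if_neg ?_
  omega

/-- For a pair of elements, the number of changes of their relative order around the triangle `r`,
`r'`, `r''` is even. So the product of the three signs is one, each factor at `(a, b)` being
cancelled by the one at `(b, a)`. -/
theorem invSign_mul {r r' r'' : O → ℕ} (h : Function.Injective r) (h' : Function.Injective r')
    (h'' : Function.Injective r'') : invSign r r' * invSign r' r'' = invSign r r'' := by
  classical
  suffices H : invSign r r' * invSign r' r'' * invSign r r'' = 1 by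
    rw [mul_eq_one_iff_eq_inv.1 H, Int.units_inv_eq_self]
  simp only [invSign, ← Finset.prod_mul_distrib]
  rw [← Finset.prod_product']
  refine Finset.prod_involution (fun x _ => (x.2, x.1)) ?_ ?_ ?_ ?_
  · rintro ⟨a, b⟩ -
    rcases eq_or_ne a b with rfl | hab
    · simp
    · have h1 := h.ne hab
      have h2 := h'.ne hab
      have h3 := h''.ne hab
      rcases lt_or_gt_of_ne h1 with h1 | h1 <;> rcases lt_or_gt_of_ne h2 with h2 | h2 <;>
        rcases lt_or_gt_of_ne h3 with h3 | h3 <;> simp [h1, h2, h3, h1.not_gt, h2.not_gt, h3.not_gt]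
  · rintro ⟨a, b⟩ - hne heq
    simp only [Prod.mk.injEq] at heq
    rw [heq.1] at hne
    simp at hne
  · simp
  · simp

theorem invSign_comp_equiv (e : O ≃ O') (r r' : O' → ℕ) :
    invSign (r ∘ e) (r' ∘ e) = invSign r r' := by
  classical
  simp only [invSign, Function.comp_apply]
  rw [← Equiv.prod_comp e]
  refine Finset.prod_congr rfl fun a _ => ?_
  exact Equiv.prod_comp e (fun b => if r (e a) < r b ∧ r' b < r' (e a) then (-1 : ℤˣ) else 1)

theorem invSign_congr {r r' r₁ r₁' : O → ℕ} (h : ∀ a b, r a < r b ↔ r₁ a < r₁ b)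
    (h' : ∀ a b, r' a < r' b ↔ r₁' a < r₁' b) : invSign r r' = invSign r₁ r₁' := by
  simp only [invSign, h, h']

end InvSign

/-- A unit of `ℤ` as a rational number. -/
def unitCast (u : ℤˣ) : ℚ := ((u : ℤ) : ℚ)

theorem unitCast_mul (u v : ℤˣ) : unitCast (u * v) = unitCast u * unitCast v := by
  simp [unitCast]

@[simp] theorem unitCast_one : unitCast 1 = 1 := by simp [unitCast]

@[simp] theorem unitCast_neg (u : ℤˣ) : unitCast (-u) = -unitCast u := by simp [unitCast]

theorem unitCast_pow (u : ℤˣ) (n : ℕ) : unitCast (u ^ n) = unitCast u ^ n := by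
  simp [unitCast]

/-- The inclusion of the elements of odd degree into the orientation set. -/
def oddElem {X V E : Type} : X ⊕ E → (X ⊕ V) ⊕ E := Sum.map Sum.inl id

theorem oddElem_injective {X V E : Type} : Function.Injective (oddElem (X := X) (V := V) (E := E)) :=
  Sum.map_injective.2 ⟨Sum.inl_injective, Function.injective_id⟩

/-- Pairs that contain an internal vertex contribute an even product of degrees; all other pairs
contribute an odd one. -/
theorem koszulSign_eq {m N : ℕ} (hm : Odd m) (hN : Even N) {X V E : Type} [Fintype X] [Fintype V]
    [Fintype E] (r r' : (X ⊕ V) ⊕ E → ℕ) :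
    koszulSign m N r r' = invSign (r ∘ oddElem) (r' ∘ oddElem) := by
  have h1 : ((-(m : ℤ)) * -(m : ℤ)).negOnePow = -1 := by
    rw [Int.negOnePow_odd]; rw [neg_mul_neg]; exact_mod_cast hm.mul hm
  have h2 : ∀ z : ℤ, ((-(N : ℤ)) * z).negOnePow = 1 := by
    intro z; rw [Int.negOnePow_even]; exact (Even.neg (by exact_mod_cast hN)).mul_right z
  have h3 : ∀ z : ℤ, (z * (-(N : ℤ))).negOnePow = 1 := by
    intro z; rw [mul_comm, h2]
  have hN1 : Odd ((N : ℤ) - 1) := by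
    have : Even (N : ℤ) := by exact_mod_cast hN
    exact this.sub_odd odd_one
  have hm1 : Odd (-(m : ℤ)) := Odd.neg (by exact_mod_cast hm)
  have h4 : (((N : ℤ) - 1) * ((N : ℤ) - 1)).negOnePow = -1 := Int.negOnePow_odd _ (hN1.mul hN1)
  have h5 : ((-(m : ℤ)) * ((N : ℤ) - 1)).negOnePow = -1 := Int.negOnePow_odd _ (hm1.mul hN1)
  have h6 : (((N : ℤ) - 1) * (-(m : ℤ))).negOnePow = -1 := Int.negOnePow_odd _ (hN1.mul hm1)
  simp only [koszulSign, invSign, Fintype.prod_sum_type, elemDegree, h1, h2, h3, h4, h5, h6, oddElem,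
    Function.comp_apply, Sum.map_inl, Sum.map_inr, id, ite_self, Finset.prod_const_one, mul_one]
  convert rfl using 5 <;> exact if_congr Iff.rfl rfl rfl

/-! ### Isomorphisms of graphs without orientations -/

/-- Isomorphisms of graphs that need not respect orientations. -/
structure WeakIso (Γ Γ' : OGraph) where
  ext : Γ.Ext ≃ Γ'.Ext
  inn : Γ.Inn ≃ Γ'.Inn
  edge : Γ.Edge ≃ Γ'.Edge
  ends_eq : ∀ a, ∃ t, ∀ s, Γ'.ends (edge a) (xor t s) = Sum.map ext inn (Γ.ends a s)

namespace WeakIso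

/-- The induced bijection on elements of odd degree. -/
def odd {Γ Γ' : OGraph} (φ : WeakIso Γ Γ') : Γ.Ext ⊕ Γ.Edge ≃ Γ'.Ext ⊕ Γ'.Edge :=
  φ.ext.sumCongr φ.edge

/-- The ranks of the elements of odd degree. -/
def _root_.TwoLoop.OGraph.oddRank (Γ : OGraph) : Γ.Ext ⊕ Γ.Edge → ℕ := Γ.rank ∘ oddElem

theorem _root_.TwoLoop.OGraph.oddRank_injective (Γ : OGraph) : Function.Injective Γ.oddRank :=
  Γ.rank_injective.comp oddElem_injective

/-- The effect of an isomorphism on orientations. -/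
noncomputable def sign {Γ Γ' : OGraph} (φ : WeakIso Γ Γ') : ℤˣ :=
  invSign Γ.oddRank (Γ'.oddRank ∘ φ.odd)

/-- The identity. -/
def refl (Γ : OGraph) : WeakIso Γ Γ where
  ext := Equiv.refl _
  inn := Equiv.refl _
  edge := Equiv.refl _
  ends_eq a := ⟨false, fun s => by simp⟩

/-- The composition. -/
def trans {Γ Γ' Γ'' : OGraph} (φ : WeakIso Γ Γ') (ψ : WeakIso Γ' Γ'') : WeakIso Γ Γ'' where
  ext := φ.ext.trans ψ.ext
  inn := φ.inn.trans ψ.inn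
  edge := φ.edge.trans ψ.edge
  ends_eq a := by
    obtain ⟨t, ht⟩ := φ.ends_eq a
    obtain ⟨t', ht'⟩ := ψ.ends_eq (φ.edge a)
    refine ⟨xor t' t, fun s => ?_⟩
    rw [Bool.xor_assoc, Equiv.trans_apply, ht', ht, Sum.map_map]
    rfl

/-- The inverse. -/
def symm {Γ Γ' : OGraph} (φ : WeakIso Γ Γ') : WeakIso Γ' Γ where
  ext := φ.ext.symm
  inn := φ.inn.symm
  edge := φ.edge.symm
  ends_eq a := by
    obtain ⟨t, ht⟩ := φ.ends_eq (φ.edge.symm a)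
    refine ⟨t, fun s => ?_⟩
    have h := ht (xor t s)
    rw [← Bool.xor_assoc, Bool.xor_self, Bool.false_xor, Equiv.apply_symm_apply] at h
    rw [h, Sum.map_map]
    simp

theorem sign_refl (Γ : OGraph) : (refl Γ).sign = 1 := by
  have : Γ.oddRank ∘ (refl Γ).odd = Γ.oddRank := by
    funext x; rcases x with x | x <;> rfl
  rw [sign, this, invSign_self]

theorem sign_trans {Γ Γ' Γ'' : OGraph} (φ : WeakIso Γ Γ') (ψ : WeakIso Γ' Γ'') :
    (φ.trans ψ).sign = φ.sign * ψ.sign := by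
  have h : Γ''.oddRank ∘ (φ.trans ψ).odd = (Γ''.oddRank ∘ ψ.odd) ∘ φ.odd := by
    funext x; rcases x with x | x <;> rfl
  rw [sign, sign, sign, h, ← invSign_comp_equiv φ.odd Γ'.oddRank]
  exact (invSign_mul Γ.oddRank_injective (Γ'.oddRank_injective.comp φ.odd.injective)
    ((Γ''.oddRank_injective.comp ψ.odd.injective).comp φ.odd.injective)).symm

theorem sign_symm {Γ Γ' : OGraph} (φ : WeakIso Γ Γ') : φ.symm.sign = φ.sign := by
  have h : (φ.trans φ.symm).sign = 1 := by
    have : Γ.oddRank ∘ (φ.trans φ.symm).odd = Γ.oddRank := by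
      funext x; rcases x with x | x <;> simp [odd, trans, symm]
    rw [sign, this, invSign_self]
  rw [sign_trans] at h
  rw [mul_eq_one_iff_eq_inv.1 h, Int.units_inv_eq_self]

end WeakIso

/-! ### Classes of graphs as coinvariants under isomorphisms. -/

open WeakIso

variable {m N : ℕ}

theorem graphClass_flip (hN : Even N) (Γ : OGraph) (a : Γ.Edge) :
    graphClass m N (Γ.flip a) = graphClass m N Γ := by
  have h : Finsupp.single Γ 1 - (-1 : ℚ) ^ N • Finsupp.single (Γ.flip a) 1 ∈ relations m N :=
    Submodule.subset_span (Rel.flip Γ a)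
  rw [hN.neg_one_pow, one_smul] at h
  exact ((Submodule.Quotient.eq _).2 h).symm

theorem graphClass_reorder (Γ : OGraph) (r : Γ.Elem → ℕ) (hr : Function.Injective r) :
    graphClass m N Γ = unitCast (koszulSign m N Γ.rank r) • graphClass m N (Γ.reorder r hr) := by
  have h : _ ∈ relations m N := Submodule.subset_span (Rel.reorder (m := m) (N := N) Γ r hr)
  rw [graphClass, graphClass, ← map_smul]
  exact (Submodule.Quotient.eq _).2 h

theorem graphClass_equiv {Γ Γ' : OGraph} (φ : OGraph.Equivalence Γ Γ') :
    graphClass m N Γ = graphClass m N Γ' := by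
  have h : _ ∈ relations m N := Submodule.subset_span (Rel.equiv (m := m) (N := N) φ)
  exact (Submodule.Quotient.eq _).2 h

open Classical in
theorem graphClass_flipSet (hN : Even N) (Γ : OGraph) (S : Finset Γ.Edge) :
    graphClass m N { Γ with ends := fun b s => if b ∈ S then Γ.ends b (!s) else Γ.ends b s } =
      graphClass m N Γ := by
  induction S using Finset.induction_on with
  | empty => simp
  | insert a S ha ih =>
    rw [← ih, ← graphClass_flip hN (OGraph.mk Γ.Ext Γ.Inn Γ.Edge
      (fun b s => if b ∈ S then Γ.ends b (!s) else Γ.ends b s) Γ.rank Γ.rank_injective) a]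
    congr 1
    unfold OGraph.flip
    congr 1
    funext b s
    by_cases hb : b = a
    · subst hb; simp [flipEnds, ha]
    · simp [flipEnds, hb]

/-- Isomorphic graphs have the same class up to the effect on orientations. -/
theorem graphClass_eq (hm : Odd m) (hN : Even N) {Γ Γ' : OGraph} (φ : WeakIso Γ Γ') :
    graphClass m N Γ = unitCast φ.sign • graphClass m N Γ' := by
  classical
  choose t ht using φ.ends_eq
  -- Reverse exactly the edges whose direction `φ` does not respect. With the order pulled back from
  -- `Γ'`, the map `φ` is then an equivalence of oriented graphs.
  rw [← graphClass_flipSet hN Γ (Finset.univ.filter fun a => t a = true)]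
  set e : Γ.Elem ≃ Γ'.Elem := (φ.ext.sumCongr φ.inn).sumCongr φ.edge
  set Γ₁ : OGraph := { Γ with ends := fun b s =>
    if b ∈ (Finset.univ.filter fun a => t a = true : Finset Γ.Edge) then Γ.ends b (!s) else Γ.ends b s } with hΓ₁
  have key : ∀ (a : Γ.Edge) (s : Bool), Γ'.ends (φ.edge a) s = Sum.map φ.ext φ.inn
      (if a ∈ (Finset.univ.filter fun a => t a = true : Finset Γ.Edge) then Γ.ends a (!s)
        else Γ.ends a s) := by
    intro a s
    cases h : t a
    · simp [h, ← ht]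
    · simp [h, ← ht]
  rw [graphClass_reorder Γ₁ (Γ'.rank ∘ e) (Γ'.rank_injective.comp e.injective)]
  congr 1
  · rw [koszulSign_eq hm hN, WeakIso.sign]
    congr 2
    funext x
    rcases x with x | x <;> rfl
  · refine graphClass_equiv ⟨φ.ext, φ.inn, φ.edge, ?_, ?_⟩
    · exact key
    · intro x y
      rfl

/-- Each of the three relations comes from a `WeakIso`: equivalences and edge reversals have sign
one, and a reordering is the identity with the Koszul sign. Equivariance under all `WeakIso`
therefore kills the relations. -/
theorem map_graphClass {M : Type*} [AddCommGroup M] [Module ℚ M] (F : OGraph → M)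
    (hm : Odd m) (hN : Even N)
    (hF : ∀ (Γ Γ' : OGraph) (φ : WeakIso Γ Γ'), F Γ = unitCast φ.sign • F Γ') :
    ∃ L : GraphSpace m N →ₗ[ℚ] M, ∀ Γ, L (graphClass m N Γ) = F Γ := by
  refine ⟨(relations m N).liftQ (Finsupp.linearCombination ℚ F) ?_, fun Γ => ?_⟩
  · refine Submodule.span_le.2 ?_
    rintro _ (⟨φ⟩ | ⟨Γ, a⟩ | ⟨Γ, r, hr⟩)
    · rename_i Γ Γ'
      have h := hF Γ Γ' ⟨φ.ext, φ.inn, φ.edge, fun a => ⟨false, fun s => by simp [φ.ends_eq]⟩⟩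
      have hs : WeakIso.sign (Γ := Γ) (Γ' := Γ')
          ⟨φ.ext, φ.inn, φ.edge, fun a => ⟨false, fun s => by simp [φ.ends_eq]⟩⟩ = 1 := by
        rw [WeakIso.sign, ← invSign_self Γ.oddRank]
        refine invSign_congr (fun _ _ => Iff.rfl) fun a b => ?_
        have := φ.rank_lt_iff (oddElem a) (oddElem b)
        rcases a with a | a
        · rcases b with b | b <;> exact this
        · rcases b with b | b <;> exact this
      rw [hs, unitCast_one, one_smul] at h
      simp [h]
    · have h := hF Γ (Γ.flip a) ⟨Equiv.refl _, Equiv.refl _, Equiv.refl _, fun b => by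
        classical
        refine ⟨decide (b = a), fun s => ?_⟩
        change flipEnds Γ.ends a b _ = _
        by_cases hb : b = a <;> simp [flipEnds, hb] <;> exact Sum.map_id_id.symm ▸ rfl⟩
      have hs : ∀ H, WeakIso.sign (Γ := Γ) (Γ' := Γ.flip a)
          ⟨Equiv.refl _, Equiv.refl _, Equiv.refl _, H⟩ = 1 := by
        intro H
        rw [WeakIso.sign, ← invSign_self Γ.oddRank]
        congr 1
        funext x
        rcases x with x | x <;> rfl
      rw [hs, unitCast_one, one_smul] at h
      simp [hN.neg_one_pow, h]
    · have h := hF Γ (Γ.reorder r hr) ⟨Equiv.refl _, Equiv.refl _, Equiv.refl _, fun b =>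
        ⟨false, fun s => by
          change Γ.ends b _ = _
          simp only [Bool.false_xor]
          rcases Γ.ends b s with x | x <;> rfl⟩⟩
      have hs : ∀ H, WeakIso.sign (Γ := Γ) (Γ' := Γ.reorder r hr)
          ⟨Equiv.refl _, Equiv.refl _, Equiv.refl _, H⟩ = koszulSign m N Γ.rank r := by
        intro H
        rw [WeakIso.sign, koszulSign_eq hm hN]
        congr 1
        funext x
        rcases x with x | x <;> rfl
      rw [hs] at h
      simp only [SetLike.mem_coe, LinearMap.mem_ker, map_sub, map_smul,
        Finsupp.linearCombination_single, one_smul]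
      rw [h, sub_eq_zero]
      rfl
  · change Finsupp.linearCombination ℚ F (Finsupp.single Γ 1) = F Γ
    simp

end TwoLoop

namespace TwoLoop
open OGraph

/-! ### The standard theta graphs -/

/-- Positions on three paths of lengths `n 0`, `n 1`, `n 2`. -/
abbrev Pos (n : Fin 3 → ℕ) : Type := Σ j, Fin (n j)

theorem Pos.ext {n : Fin 3 → ℕ} {p q : Pos n} (h : p.1 = q.1) (h' : (p.2 : ℕ) = q.2) : p = q := by
  obtain ⟨i, l⟩ := p
  obtain ⟨j, l'⟩ := q
  cases h
  cases Fin.ext h'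
  rfl

theorem Pos.mk_inj {n : Fin 3 → ℕ} {i j : Fin 3} {l : Fin (n i)} {l' : Fin (n j)} :
    (⟨i, l⟩ : Pos n) = ⟨j, l'⟩ ↔ i = j ∧ (l : ℕ) = l' :=
  ⟨fun h => by cases h; exact ⟨rfl, rfl⟩, fun h => Pos.ext h.1 h.2⟩

/-- The code of a position in the order path by path. -/
def Pos.code {n : Fin 3 → ℕ} (p : Pos n) : ℕ := p.1 * (n 0 + n 1 + n 2 + 1) + p.2

theorem Pos.code_lt {n : Fin 3 → ℕ} (p : Pos n) : p.code < 3 * (n 0 + n 1 + n 2 + 1) := by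
  obtain ⟨j, l, hl⟩ := p
  fin_cases j <;> simp [Pos.code] at hl ⊢ <;> omega

theorem Pos.code_lt_iff {n : Fin 3 → ℕ} (p q : Pos n) :
    p.code < q.code ↔ p.1 < q.1 ∨ p.1 = q.1 ∧ (p.2 : ℕ) < q.2 := by
  obtain ⟨i, l, hl⟩ := p
  obtain ⟨j, l', hl'⟩ := q
  fin_cases i <;> fin_cases j <;> simp [Pos.code] at hl hl' ⊢ <;> omega

theorem Pos.code_injective {n : Fin 3 → ℕ} : Function.Injective (Pos.code (n := n)) := by
  intro p q h
  have h1 := Pos.code_lt_iff p q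
  have h2 := Pos.code_lt_iff q p
  rw [h] at h1 h2
  simp only [lt_irrefl, false_iff, not_or, not_and, not_lt] at h1 h2
  have := le_antisymm h2.1 h1.1
  exact Pos.ext this (le_antisymm (h2.2 this.symm) (h1.2 this))

/-- The vertices of the theta graph with `k j` interior vertices on the `j`-th path: these and the
two end points, the start `false` and the end `true`. -/
abbrev TVert (k : Fin 3 → ℕ) : Type := Pos k ⊕ Bool

/-- All interior vertices carry a hair, and the end points that are marked by `s`. -/
def HasHair {k : Fin 3 → ℕ} (s : Bool → Bool) : TVert k → Prop
  | .inl _ => True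
  | .inr b => s b = true

instance {k : Fin 3 → ℕ} (s : Bool → Bool) : DecidablePred (HasHair (k := k) s)
  | .inl _ => inferInstanceAs (Decidable True)
  | .inr b => inferInstanceAs (Decidable (s b = true))

/-- The hairs of the standard theta graph. -/
abbrev Hair (s : Bool → Bool) (k : Fin 3 → ℕ) : Type := {x : TVert k // HasHair s x}

/-- The `l`-th vertex on the `j`-th path, the start and the end included. -/
def tvert (k : Fin 3 → ℕ) (j : Fin 3) (l : ℕ) : TVert k :=
  if l = 0 then .inr false else if h : l - 1 < k j then .inl ⟨j, l - 1, h⟩ else .inr true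

/-- The ends of the edges of the theta graph. -/
def thetaEnds (s : Bool → Bool) (k : Fin 3 → ℕ) :
    Pos (fun j => k j + 1) ⊕ Hair s k → Bool → Hair s k ⊕ TVert k
  | .inl p, b => .inr (tvert k p.1 (p.2 + b.toNat))
  | .inr x, false => .inr x.1
  | .inr x, true => .inl x

/-- An arbitrary numbering of the hairs. -/
noncomputable def hairCode {s : Bool → Bool} {k : Fin 3 → ℕ} (x : Hair s k) : ℕ :=
  Fintype.equivFin _ x

theorem hairCode_injective {s : Bool → Bool} {k : Fin 3 → ℕ} :
    Function.Injective (hairCode (s := s) (k := k)) :=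
  fun _ _ h => (Fintype.equivFin _).injective (Fin.ext h)

/-- The order of the orientation set of the theta graph. -/
noncomputable def thetaRank (s : Bool → Bool) (k : Fin 3 → ℕ) :
    (Hair s k ⊕ TVert k) ⊕ (Pos (fun j => k j + 1) ⊕ Hair s k) → ℕ
  | .inr (.inl p) => p.code
  | .inl (.inl x) => 3 * (k 0 + 1 + (k 1 + 1) + (k 2 + 1) + 1) + 2 * hairCode x
  | .inr (.inr x) => 3 * (k 0 + 1 + (k 1 + 1) + (k 2 + 1) + 1) + 2 * hairCode x + 1
  | .inl (.inr v) => 3 * (k 0 + 1 + (k 1 + 1) + (k 2 + 1) + 1) + 2 * Fintype.card (Hair s k) +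
      Fintype.equivFin _ v

theorem thetaRank_injective (s : Bool → Bool) (k : Fin 3 → ℕ) :
    Function.Injective (thetaRank s k) := by
  have hc : ∀ x : Hair s k, hairCode x < Fintype.card (Hair s k) :=
    fun x => (Fintype.equivFin _ x).2
  have hp : ∀ p : Pos (fun j => k j + 1), p.code < _ := Pos.code_lt
  have hi : ∀ x y : Hair s k, hairCode x = hairCode y → x = y := fun x y h => hairCode_injective h
  have hi' : ∀ x y : TVert k, (Fintype.equivFin _ x : ℕ) = Fintype.equivFin _ y → x = y :=
    fun x y h => (Fintype.equivFin _).injective (Fin.ext h)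
  rintro ((x | x) | x | x) ((y | y) | y | y) h <;> simp only [thetaRank] at h
  · rw [hi x y (by omega)]
  · have := hc x; omega
  · have := hp y; omega
  · omega
  · have := hc y; omega
  · rw [hi' x y (by omega)]
  · have := hp y; omega
  · have := hc y; omega
  · have := hp x; omega
  · have := hp x; omega
  · rw [Pos.code_injective h]
  · have := hp x; omega
  · omega
  · have := hc x; omega
  · have := hp y; omega
  · rw [hi x y (by omega)]

/-- The theta graph with `k j` interior vertices on the `j`-th path, a hair at each of these, and
hairs at the end points marked by `s`. -/
noncomputable abbrev theta (s : Bool → Bool) (k : Fin 3 → ℕ) : OGraph where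
  Ext := Hair s k
  Inn := TVert k
  Edge := Pos (fun j => k j + 1) ⊕ Hair s k
  ends := thetaEnds s k
  rank := thetaRank s k
  rank_injective := thetaRank_injective s k

/-! ### Orientations in which external vertices and hairs are paired -/

/-- The elements of `F` come first, then pairs of elements labelled by `H`. -/
structure PairedRank {H F : Type*} (r : H ⊕ (F ⊕ H) → ℕ) (c : H → ℕ) : Prop where
  inj : Function.Injective c
  lt_left : ∀ p x, r (.inr (.inl p)) < r (.inl x)
  lt_right : ∀ p x, r (.inr (.inl p)) < r (.inr (.inr x))
  ll : ∀ x y, r (.inl x) < r (.inl y) ↔ c x < c y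
  lr : ∀ x y, r (.inl x) < r (.inr (.inr y)) ↔ c x ≤ c y
  rl : ∀ x y, r (.inr (.inr x)) < r (.inl y) ↔ c x < c y
  rr : ∀ x y, r (.inr (.inr x)) < r (.inr (.inr y)) ↔ c x < c y

/-- Two pairs that change their relative order produce four equal contributions, which cancel, and
the elements of `F` precede all pairs in both orders. -/
theorem PairedRank.invSign_eq {H F : Type*} [Fintype H] [Fintype F] {r r' : H ⊕ (F ⊕ H) → ℕ}
    {c c' : H → ℕ} (h : PairedRank r c) (h' : PairedRank r' c') :
    invSign r r' = invSign (fun p => r (.inr (.inl p))) (fun p => r' (.inr (.inl p))) := by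
  -- The weak inequality accounts for the two members of one pair, whose relative order never
  -- changes.
  have e1 : ∀ x y, (c x ≤ c y ∧ c' y < c' x) ↔ (c x < c y ∧ c' y < c' x) := by
    intro x y
    refine and_congr_left fun hlt => ⟨fun hle => lt_of_le_of_ne hle fun he => ?_, le_of_lt⟩
    rw [h.inj he] at hlt
    exact lt_irrefl _ hlt
  have e2 : ∀ x y, (c x < c y ∧ c' y ≤ c' x) ↔ (c x < c y ∧ c' y < c' x) := by
    intro x y
    refine and_congr_right fun hlt => ⟨fun hle => lt_of_le_of_ne hle fun he => ?_, le_of_lt⟩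
    rw [h'.inj he] at hlt
    exact lt_irrefl _ hlt
  have e3 : ∀ p x, (r (.inr (.inl p)) < r (.inl x) ∧ r' (.inl x) < r' (.inr (.inl p))) ↔ False :=
    fun p x => iff_false_intro fun hh => lt_asymm hh.2 (h'.lt_left p x)
  have e4 : ∀ p x, (r (.inr (.inl p)) < r (.inr (.inr x)) ∧
      r' (.inr (.inr x)) < r' (.inr (.inl p))) ↔ False :=
    fun p x => iff_false_intro fun hh => lt_asymm hh.2 (h'.lt_right p x)
  have e5 : ∀ p x, (r (.inl x) < r (.inr (.inl p)) ∧ r' (.inr (.inl p)) < r' (.inl x)) ↔ False :=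
    fun p x => iff_false_intro fun hh => lt_asymm hh.1 (h.lt_left p x)
  have e6 : ∀ p x, (r (.inr (.inr x)) < r (.inr (.inl p)) ∧
      r' (.inr (.inl p)) < r' (.inr (.inr x))) ↔ False :=
    fun p x => iff_false_intro fun hh => lt_asymm hh.1 (h.lt_right p x)
  simp only [invSign, Fintype.prod_sum_type, e3, e4, e5, e6, h.ll, h.lr, h.rl, h.rr, h'.ll, h'.lr,
    h'.rl, h'.rr, e1, e2, if_false, Finset.prod_const_one, one_mul, mul_one,
    Finset.prod_mul_distrib, Int.units_mul_self]

theorem pairedRank_theta (s : Bool → Bool) (k : Fin 3 → ℕ) :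
    PairedRank (theta s k).oddRank (hairCode (s := s) (k := k)) where
  inj := hairCode_injective
  lt_left p x := by
    have := Pos.code_lt p
    change p.code < 3 * (k 0 + 1 + (k 1 + 1) + (k 2 + 1) + 1) + 2 * hairCode x
    omega
  lt_right p x := by
    have := Pos.code_lt p
    change p.code < 3 * (k 0 + 1 + (k 1 + 1) + (k 2 + 1) + 1) + 2 * hairCode x + 1
    omega
  ll x y := by
    change _ + 2 * hairCode (k := k) x < _ + 2 * hairCode (k := k) y ↔ _
    omega
  lr x y := by
    change _ + 2 * hairCode (k := k) x < _ + 2 * hairCode (k := k) y + 1 ↔ _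
    omega
  rl x y := by
    change _ + 2 * hairCode (k := k) x + 1 < _ + 2 * hairCode (k := k) y ↔ _
    omega
  rr x y := by
    change _ + 2 * hairCode (k := k) x + 1 < _ + 2 * hairCode (k := k) y + 1 ↔ _
    omega

theorem PairedRank.comp {H F H' F' : Type*} {r : H' ⊕ (F' ⊕ H') → ℕ} {c : H' → ℕ}
    (h : PairedRank r c) (f : F → F') (g : H ≃ H') :
    PairedRank (r ∘ Sum.map g (Sum.map f g)) (c ∘ g) where
  inj := h.inj.comp g.injective
  lt_left p x := h.lt_left _ _
  lt_right p x := h.lt_right _ _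
  ll x y := h.ll _ _
  lr x y := h.lr _ _
  rl x y := h.rl _ _
  rr x y := h.rr _ _

theorem sign_theta_eq {s s' : Bool → Bool} {k k' : Fin 3 → ℕ} (φ : WeakIso (theta s k) (theta s' k'))
    (f : Pos (fun j => k j + 1) → Pos (fun j => k' j + 1)) (g : Hair s k ≃ Hair s' k')
    (hext : ∀ x, φ.ext x = g x)
    (hedge : ∀ x, φ.edge x = Sum.map f g x) :
    φ.sign = invSign (fun p => Pos.code p) (fun p => (f p).code) := by
  have h : (theta s' k').oddRank ∘ φ.odd = (theta s' k').oddRank ∘ Sum.map g (Sum.map f g) := by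
    funext x
    rcases x with x | x
    · exact congrArg (fun y => (theta s' k').oddRank (Sum.inl y)) (hext x)
    · exact congrArg (fun y => (theta s' k').oddRank (Sum.inr y)) (hedge x)
  rw [WeakIso.sign, h]
  exact (pairedRank_theta s k).invSign_eq ((pairedRank_theta s' k').comp f g)

end TwoLoop

/-! ### Symmetries of theta graphs and their signs. -/

namespace TwoLoop
open OGraph

theorem tvert_zero (k : Fin 3 → ℕ) (j : Fin 3) : tvert k j 0 = .inr false := rfl

theorem tvert_succ {k : Fin 3 → ℕ} {j : Fin 3} {l : ℕ} (h : l < k j) :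
    tvert k j (l + 1) = .inl ⟨j, l, h⟩ := by
  simp [tvert, h]

theorem tvert_pos {k : Fin 3 → ℕ} {j : Fin 3} {l : ℕ} (h0 : l ≠ 0) (h : l - 1 < k j) :
    tvert k j l = .inl ⟨j, l - 1, h⟩ := by
  simp [tvert, h, h0]

theorem tvert_last {k : Fin 3 → ℕ} {j : Fin 3} {l : ℕ} (h : k j < l) :
    tvert k j l = .inr true := by
  rw [tvert, if_neg (by omega), dif_neg (by omega)]

section ThetaIso

variable {s s' : Bool → Bool} {k k' : Fin 3 → ℕ} (inn : TVert k ≃ TVert k')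
  (f : Pos (fun j => k j + 1) ≃ Pos (fun j => k' j + 1))
  (hh : ∀ x, HasHair s x ↔ HasHair s' (inn x))
  (hf : ∀ p, ∃ t, ∀ b : Bool, tvert k' (f p).1 ((f p).2 + (xor t b).toNat) =
    inn (tvert k p.1 (p.2 + b.toNat)))

/-- An isomorphism of theta graphs given by its effect on the frame. -/
def thetaIso : WeakIso (theta s k) (theta s' k') where
  ext := inn.subtypeEquiv hh
  inn := inn
  edge := f.sumCongr (inn.subtypeEquiv hh)
  ends_eq := by
    rintro (p | x)
    · obtain ⟨t, ht⟩ := hf p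
      exact ⟨t, fun b => congrArg Sum.inr (ht b)⟩
    · refine ⟨false, fun b => ?_⟩
      cases b <;> rfl

theorem sign_thetaIso :
    (thetaIso inn f hh hf).sign = invSign (fun p => Pos.code p) (fun p => (f p).code) := by
  refine sign_theta_eq _ f (inn.subtypeEquiv hh) (fun x => rfl) ?_
  rintro (x | x) <;> rfl

end ThetaIso

/-- Renumbering of the paths. -/
def posPerm (σ : Equiv.Perm (Fin 3)) {n n' : Fin 3 → ℕ} (h : ∀ j, n' (σ j) = n j) :
    Pos n ≃ Pos n' where
  toFun p := ⟨σ p.1, p.2, by rw [h]; exact p.2.2⟩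
  invFun p := ⟨σ.symm p.1, p.2, by rw [← h, Equiv.apply_symm_apply]; exact p.2.2⟩
  left_inv p := Pos.ext (by simp) rfl
  right_inv p := Pos.ext (by simp) rfl

/-- Renumbering the paths of a theta graph. -/
def permIso (s : Bool → Bool) (σ : Equiv.Perm (Fin 3)) {k k' : Fin 3 → ℕ}
    (h : ∀ j, k' (σ j) = k j) : WeakIso (theta s k) (theta s k') :=
  thetaIso ((posPerm σ h).sumCongr (Equiv.refl _))
    (posPerm σ (n := fun j => k j + 1) (n' := fun j => k' j + 1) fun j => by simp [h])
    (by rintro (x | x) <;> exact Iff.rfl)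
    (by
      rintro ⟨j, l, hl⟩
      replace hl : l < k j + 1 := hl
      refine ⟨false, fun b => ?_⟩
      rw [Bool.false_xor]
      change tvert k' (σ j) (l + b.toNat) = Sum.map _ _ (tvert k j (l + b.toNat))
      generalize l + b.toNat = n
      rcases Nat.eq_zero_or_pos n with rfl | hn
      · rfl
      · by_cases h' : n - 1 < k j
        · rw [tvert_pos hn.ne' h', tvert_pos hn.ne' (by rwa [h])]
          rfl
        · rw [tvert_last (k := k) (by omega), tvert_last (k := k') (by rw [h]; omega)]
          rfl)

/-- Whole paths are moved as blocks: exchanging the order of paths `i` and `j` inverts all `(k i +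
1) * (k j + 1)` pairs of their edges, and nothing changes within a path. -/
theorem sign_permIso (s : Bool → Bool) (σ : Equiv.Perm (Fin 3)) {k k' : Fin 3 → ℕ}
    (h : ∀ j, k' (σ j) = k j) :
    (permIso s σ h).sign =
      ∏ i, ∏ j, if i < j ∧ σ j < σ i then (-1) ^ ((k i + 1) * (k j + 1)) else 1 := by
  rw [permIso, sign_thetaIso, invSign, Fintype.prod_sigma]
  refine Finset.prod_congr rfl fun i _ => ?_
  simp_rw [Fintype.prod_sigma]
  rw [Finset.prod_comm]
  refine Finset.prod_congr rfl fun j _ => ?_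
  have : ∀ (l : Fin (k i + 1)) (l' : Fin (k j + 1)),
      (Pos.code (n := fun j => k j + 1) ⟨i, l⟩ < Pos.code (n := fun j => k j + 1) ⟨j, l'⟩ ∧
        Pos.code (posPerm σ (n := fun j => k j + 1) (n' := fun j => k' j + 1) (fun j => by simp [h])
          ⟨j, l'⟩) < Pos.code (posPerm σ (n := fun j => k j + 1) (n' := fun j => k' j + 1)
          (fun j => by simp [h]) ⟨i, l⟩)) ↔ i < j ∧ σ j < σ i := by
    intro l l'
    rw [Pos.code_lt_iff, Pos.code_lt_iff]
    simp only [posPerm, Equiv.coe_fn_mk, EmbeddingLike.apply_eq_iff_eq]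
    constructor
    · rintro ⟨h1 | ⟨rfl, h1⟩, h2 | ⟨h2, h3⟩⟩
      · exact ⟨h1, h2⟩
      · exact absurd h2 h1.ne'
      · exact absurd h2 (lt_irrefl _)
      · omega
    · rintro ⟨h1, h2⟩
      exact ⟨.inl h1, .inl h2⟩
  simp only [this]
  split_ifs
  · simp [← pow_mul, mul_comm]
  · simp

/-- Reversing the paths. -/
def posFlip (n : Fin 3 → ℕ) : Pos n ≃ Pos n := Equiv.sigmaCongrRight fun _ => Fin.revPerm

theorem posFlip_fst {n : Fin 3 → ℕ} (p : Pos n) : (posFlip n p).1 = p.1 := rfl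

theorem posFlip_snd {n : Fin 3 → ℕ} (p : Pos n) : ((posFlip n p).2 : ℕ) = n p.1 - (p.2 + 1) :=
  Fin.val_rev _

/-- Exchanging the end points of a theta graph. -/
def flipIso {s s' : Bool → Bool} (h : ∀ b, s' (!b) = s b) (k : Fin 3 → ℕ) :
    WeakIso (theta s k) (theta s' k) :=
  thetaIso ((posFlip k).sumCongr Equiv.boolNot) (posFlip _)
    (by
      rintro (x | x)
      · exact Iff.rfl
      · change s x = true ↔ s' (!x) = true
        rw [h])
    (by
      rintro ⟨j, l, hl⟩
      replace hl : l < k j + 1 := hl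
      refine ⟨true, fun b => ?_⟩
      rw [posFlip_snd, posFlip_fst, Bool.true_xor]
      change tvert k j (k j + 1 - (l + 1) + (!b).toNat) = Sum.map _ _ (tvert k j (l + b.toNat))
      -- The vertex number `n` on a path goes to number `k j + 1 - n`, with the end points counted
      -- as `0` and `k j + 1`.
      have : k j + 1 - (l + 1) + (!b).toNat = k j + 1 - (l + b.toNat) := by
        cases b <;> simp <;> omega
      rw [this]
      have hn : l + b.toNat ≤ k j + 1 := by cases b <;> simp <;> omega
      generalize l + b.toNat = n at hn ⊢
      rcases Nat.eq_zero_or_pos n with rfl | hn0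
      · rw [tvert_zero, tvert_last (by omega)]
        rfl
      · by_cases h' : n - 1 < k j
        · rw [tvert_pos hn0.ne' h', tvert_pos (by omega) (by omega)]
          refine congrArg Sum.inl (Pos.ext rfl ?_)
          rw [posFlip_snd]
          simp only
          omega
        · rw [tvert_last (l := n) (by omega), show k j + 1 - n = 0 by omega]
          rfl)

theorem prod_fin_lt (n : ℕ) :
    ∏ i : Fin (n + 1), ∏ j : Fin (n + 1), (if i < j then -1 else 1 : ℤˣ) =
      (-1) ^ (n * (n + 1) / 2) := by
  have h : ∀ j : Fin (n + 1), ∏ i : Fin (n + 1), (if i < j then -1 else 1 : ℤˣ) =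
      (-1) ^ (j : ℕ) := by
    intro j
    rw [Finset.prod_ite, Finset.prod_const_one, mul_one, Finset.prod_const]
    congr 1
    exact Fin.card_Iio j ▸ congrArg Finset.card (by ext; simp)
  rw [Finset.prod_comm]
  simp_rw [h]
  rw [Finset.prod_pow_eq_pow_sum, Fin.sum_univ_eq_sum_range (fun i => i), Finset.sum_range_id,
    Nat.add_sub_cancel, mul_comm]

/-- Reversing the `k j + 1` edges of a path inverts all pairs among them, while edges of different
paths keep their order. This is the origin of the operator `A`. -/
theorem sign_flipIso {s s' : Bool → Bool} (h : ∀ b, s' (!b) = s b) (k : Fin 3 → ℕ) :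
    (flipIso h k).sign = (-1) ^ (∑ j, k j * (k j + 1) / 2) := by
  rw [flipIso, sign_thetaIso, invSign, Fintype.prod_sigma, ← Finset.prod_pow_eq_pow_sum]
  refine Finset.prod_congr rfl fun i _ => ?_
  simp_rw [Fintype.prod_sigma]
  rw [← prod_fin_lt]
  refine Finset.prod_congr rfl fun l _ => ?_
  rw [Finset.prod_eq_single i]
  · refine Finset.prod_congr rfl fun l' _ => if_congr ?_ rfl rfl
    rw [Pos.code_lt_iff, Pos.code_lt_iff]
    simp only [posFlip_fst, posFlip_snd, lt_irrefl, true_and, false_or, Fin.lt_def]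
    omega
  · intro j _ hij
    refine Finset.prod_eq_one fun l' _ => if_neg ?_
    rw [Pos.code_lt_iff, Pos.code_lt_iff]
    simp only [posFlip_fst]
    rintro ⟨h1 | ⟨h1, -⟩, h2 | ⟨h2, -⟩⟩
    · exact lt_asymm h1 h2
    · exact hij h2
    · exact hij h1.symm
    · exact hij h2
  · simp

end TwoLoop

namespace TwoLoop
open OGraph

/-! ### Expansions of theta graphs -/

/-- Splitting off a point. -/
def optionSum (α β : Type*) : Option (α ⊕ β) ≃ Option α ⊕ β where
  toFun
    | none => .inl none
    | some (.inl a) => .inl (some a)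
    | some (.inr b) => .inr b
  invFun
    | .inl none => none
    | .inl (some a) => some (.inl a)
    | .inr b => some (.inr b)
  left_inv := by rintro (_ | _ | _) <;> rfl
  right_inv := by rintro ((_ | _) | _) <;> rfl

section PosIns

variable (b : Bool) (j : Fin 3) {n n' : Fin 3 → ℕ} (h : ∀ i, n' i = n i + if i = j then 1 else 0)

/-- Insertion of a new position on the `j`-th path, at its beginning or at its end. -/
def posInsFun : Option (Pos n) → Pos n'
  | none => ⟨j, if b then n j else 0, by rw [h]; split_ifs <;> simp_all⟩
  | some p => ⟨p.1, p.2 + if p.1 = j ∧ b = false then 1 else 0, by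
      rw [h]; have := p.2.2; split_ifs <;> simp_all <;> omega⟩

theorem posInsFun_injective : Function.Injective (posInsFun b j h) := by
  rintro (_ | ⟨i, l⟩) (_ | ⟨i', l'⟩) he
  · rfl
  · rw [posInsFun, posInsFun, Pos.mk_inj] at he
    obtain ⟨rfl, he⟩ := he
    cases b <;> simp at he
    omega
  · rw [posInsFun, posInsFun, Pos.mk_inj] at he
    obtain ⟨rfl, he⟩ := he
    cases b <;> simp at he
    omega
  · rw [posInsFun, posInsFun, Pos.mk_inj] at he
    obtain ⟨h1, he⟩ := he
    dsimp only at h1 he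
    subst h1
    exact congrArg some (Pos.ext rfl (by simpa using he))

/-- Insertion of a new position on the `j`-th path, at its beginning or at its end. -/
noncomputable def posIns : Option (Pos n) ≃ Pos n' :=
  Equiv.ofBijective (posInsFun b j h) <| by
    rw [Fintype.bijective_iff_injective_and_card]
    refine ⟨posInsFun_injective b j h, ?_⟩
    simp [h, Finset.sum_add_distrib]

theorem posIns_some_snd (p : Pos n) : ((posIns b j h (some p)).2 : ℕ) =
    p.2 + if p.1 = j ∧ b = false then 1 else 0 := rfl

theorem posIns_code_lt (p q : Pos n) : (posIns b j h (some p)).code < (posIns b j h (some q)).code ↔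
    p.code < q.code := by
  rw [Pos.code_lt_iff, Pos.code_lt_iff]
  change (p.1 < q.1 ∨ p.1 = q.1 ∧ (p.2 : ℕ) + (if p.1 = j ∧ b = false then 1 else 0) <
    q.2 + if q.1 = j ∧ b = false then 1 else 0) ↔ _
  refine or_congr Iff.rfl (and_congr_right fun he => ?_)
  obtain ⟨i, l⟩ := p
  obtain ⟨i', l'⟩ := q
  dsimp only at he ⊢
  subst he
  omega

theorem posIns_code_lt_none (q : Pos n) : (posIns b j h (some q)).code < (posIns b j h none).code ↔
    q.1 < j ∨ q.1 = j ∧ b = true := by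
  rw [Pos.code_lt_iff]
  change (q.1 < j ∨ q.1 = j ∧ (q.2 : ℕ) + (if q.1 = j ∧ b = false then 1 else 0) <
    if b then n j else 0) ↔ _
  refine or_congr Iff.rfl (and_congr_right fun he => ?_)
  obtain ⟨i, l, hl⟩ := q
  dsimp only at he ⊢
  subst he
  cases b <;> simp [hl]

end PosIns

section Expand

variable {s : Bool → Bool} {b : Bool} (hs : s b = true) (j : Fin 3) {k k' : Fin 3 → ℕ}
  (h : ∀ i, k' i = k i + if i = j then 1 else 0)

/-- The effect of an expansion on the vertices. -/
noncomputable def innIns (b : Bool) : Option (TVert k) ≃ TVert k' :=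
  (optionSum _ _).trans ((posIns b j h).sumCongr (Equiv.refl _))

/-- The effect of an expansion on the hairs. -/
noncomputable def hairInsFun : Hair s k → Hair (Function.update s b false) k'
  | ⟨.inl p, _⟩ => ⟨.inl (posIns b j h (some p)), trivial⟩
  | ⟨.inr c, hc⟩ => if hcb : c = b then ⟨.inl (posIns b j h none), trivial⟩ else
      ⟨.inr c, by
        change Function.update s b false c = true
        rw [Function.update_of_ne hcb]
        exact hc⟩

/-- The hair lost by the end point `b` is the hair of the new interior vertex; all other hairs stay
where they are. -/
theorem hairInsFun_bijective (hs : s b = true) :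
    Function.Bijective (hairInsFun (s := s) (b := b) j h) := by
  constructor
  · rintro ⟨p | c, hx⟩ ⟨p' | c', hx'⟩ he <;> replace he := congrArg Subtype.val he
    · simp [hairInsFun] at he
      subst he
      rfl
    · by_cases hc : c' = b <;> simp [hairInsFun, hc] at he
    · by_cases hc : c = b <;> simp [hairInsFun, hc] at he
    · by_cases hc : c = b <;> by_cases hc' : c' = b <;> simp [hairInsFun, hc, hc'] at he
      · subst hc; subst hc'; rfl
      · subst he; rfl
  · rintro ⟨q | c, hx⟩
    · obtain ⟨_ | p, rfl⟩ := (posIns b j h).surjective q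
      · exact ⟨⟨.inr b, hs⟩, by simp [hairInsFun]⟩
      · exact ⟨⟨.inl p, trivial⟩, rfl⟩
    · change Function.update s b false c = true at hx
      have hcb : c ≠ b := by rintro rfl; simp at hx
      rw [Function.update_of_ne hcb] at hx
      exact ⟨⟨.inr c, hx⟩, by simp [hairInsFun, hcb]⟩

/-- The effect of an expansion on the hairs. -/
noncomputable def hairIns : Hair s k ≃ Hair (Function.update s b false) k' :=
  Equiv.ofBijective _ (hairInsFun_bijective j h hs)

/-- The half-edge at the end point `b` that belongs to the `j`-th path. -/
def endHalf (s : Bool → Bool) (k : Fin 3 → ℕ) (b : Bool) (j : Fin 3) :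
    (Pos (fun j => k j + 1) ⊕ Hair s k) × Bool :=
  (.inl ⟨j, if b then k j else 0, by
    change _ < k j + 1
    split_ifs <;> omega⟩, b)

/-- The hair at the end point `b`. -/
def hairHalf (k : Fin 3 → ℕ) (hs : s b = true) : (Pos (fun j => k j + 1) ⊕ Hair s k) × Bool :=
  (.inr ⟨.inr b, hs⟩, false)

/-- The hypothesis `hS` excludes the half-edge that is moved to the new vertex; every other
half-edge keeps its vertex, up to the shift of positions caused by an insertion at the start. -/
theorem tvert_ins (i : Fin 3) {l : ℕ} (hl : l < k i + 1) (c : Bool)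
    (hS : ¬ (i = j ∧ l = (if b then k j else 0) ∧ c = b)) :
    tvert k' i ((l + if i = j ∧ b = false then 1 else 0) + c.toNat) =
      innIns j h b (some (tvert k i (l + c.toNat))) := by
  have hk := h i
  rcases Nat.eq_zero_or_pos (l + c.toNat) with h0 | h0
  · have hl0 : l = 0 := by omega
    have hc0 : c = false := by cases c <;> simp at h0 ⊢
    subst hl0
    subst hc0
    rw [if_neg]
    · rfl
    · rintro ⟨rfl, rfl⟩
      simp at hS
  · by_cases h1 : l + c.toNat - 1 < k i
    · rw [tvert_pos (k := k) h0.ne' h1, tvert_pos (k := k') (by omega)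
        (by rw [hk]; split_ifs <;> simp_all <;> omega)]
      refine congrArg Sum.inl (Pos.ext rfl ?_)
      rw [posIns_some_snd]
      dsimp only
      omega
    · rw [tvert_last (k := k) (by omega), tvert_last (k := k')]
      · rfl
      · have hc1 : c = true := by
          by_contra hc
          have : c = false := by simpa using hc
          subst this
          simp at h0 h1
          omega
        subst hc1
        simp only [Bool.toNat_true] at h1 ⊢
        by_cases hij : i = j
        · subst hij
          cases b <;> simp at hS hk ⊢ <;> omega
        · simp [hij] at hk ⊢
          omega

open Classical in
/-- Expanding an end point such that its hair moves to the `j`-th path. -/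
noncomputable def expandIso :
    WeakIso ((theta s k).expand (.inr b) ({hairHalf k hs, endHalf s k b j} : Finset _))
      (theta (Function.update s b false) k') where
  ext := hairIns hs j h
  inn := innIns j h b
  edge := (optionSum _ _).trans ((posIns b j (n := fun j => k j + 1) (n' := fun j => k' j + 1)
    (fun i => by rw [h]; omega)).sumCongr (hairIns hs j h))
  ends_eq := by
    change ∀ a : Option (Pos (fun j => k j + 1) ⊕ Hair s k), ∃ t : Bool, ∀ c : Bool,
      thetaEnds (Function.update s b false) k' (((optionSum _ _).trans
        ((posIns b j (n := fun j => k j + 1) (n' := fun j => k' j + 1)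
          (fun i => by rw [h]; omega)).sumCongr (hairIns hs j h))) a) (xor t c) =
      Sum.map (hairIns hs j h) (innIns j h b) (expandEnds (thetaEnds s k) (.inr b)
        ({hairHalf k hs, endHalf s k b j} : Finset _) a c)
    have hk := h j
    rw [if_pos rfl] at hk
    rintro (_ | ⟨i, l, hl⟩ | ⟨x, hx⟩)
    -- The new edge leaves the end point, so it runs along the path if `b` is the start and against
    -- it if `b` is the end.
    · refine ⟨b, fun c => ?_⟩
      change Sum.inr (tvert k' j ((if b then k j + 1 else 0) + (xor b c).toNat)) = _
      cases b <;> cases c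
      · rfl
      · refine congrArg Sum.inr ?_
        change tvert k' j (0 + 1) = _
        rw [tvert_succ (by omega)]
        rfl
      · refine congrArg Sum.inr ?_
        change tvert k' j (k j + 1 + 1) = _
        rw [tvert_last (by omega)]
        rfl
      · refine congrArg Sum.inr ?_
        change tvert k' j (k j + 1) = _
        rw [tvert_succ (by omega)]
        rfl
    · refine ⟨false, fun c => ?_⟩
      replace hl : l < k i + 1 := hl
      rw [Bool.false_xor]
      change Sum.inr (tvert k' i ((l + if i = j ∧ b = false then 1 else 0) + c.toNat)) = _
      have hmem : ((Sum.inl ⟨i, l, hl⟩, c) : (Pos (fun j => k j + 1) ⊕ Hair s k) × Bool) ∈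
          ({hairHalf k hs, endHalf s k b j} : Finset _) ↔
          (i = j ∧ l = (if b then k j else 0) ∧ c = b) := by
        simp only [Finset.mem_insert, Finset.mem_singleton, hairHalf, endHalf, Prod.mk.injEq,
          Sum.inl.injEq, reduceCtorEq, false_and, false_or]
        exact (and_congr_left' (Pos.mk_inj (n := fun j => k j + 1))).trans and_assoc
      by_cases hS : i = j ∧ l = (if b then k j else 0) ∧ c = b
      · rw [expandEnds, if_pos (hmem.2 hS)]
        refine congrArg Sum.inr ?_
        obtain ⟨rfl, rfl, rfl⟩ := hS
        cases c
        · rw [if_neg (by simp), if_pos (by simp), Bool.toNat_false, Nat.add_zero,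
            tvert_succ (by omega)]
          rfl
        · rw [if_pos rfl, if_neg (by simp), Bool.toNat_true, Nat.add_zero, tvert_succ (by omega)]
          rfl
      · rw [expandEnds, if_neg (fun hm => hS (hmem.1 hm))]
        exact congrArg Sum.inr (tvert_ins j h i hl c hS)
    · refine ⟨false, fun c => ?_⟩
      rw [Bool.false_xor]
      have hmem : ((Sum.inr ⟨x, hx⟩, c) : (Pos (fun j => k j + 1) ⊕ Hair s k) × Bool) ∈
          ({hairHalf k hs, endHalf s k b j} : Finset _) ↔ x = .inr b ∧ c = false := by
        simp only [Finset.mem_insert, Finset.mem_singleton, hairHalf, endHalf, Prod.mk.injEq,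
          Sum.inr.injEq, reduceCtorEq, false_and, or_false]
        exact and_congr_left' Subtype.ext_iff
      rw [expandEnds]
      cases c
      · rcases x with p | c'
        · rw [if_neg (by rw [hmem]; simp)]
          rfl
        · by_cases hc : c' = b
          · subst hc
            rw [if_pos (by rw [hmem]; simp)]
            refine congrArg Sum.inr ?_
            change (hairInsFun j h ⟨.inr c', hx⟩).1 = _
            rw [hairInsFun, dif_pos rfl]
            rfl
          · rw [if_neg (by rw [hmem]; simp [hc])]
            refine congrArg Sum.inr ?_
            change (hairInsFun j h ⟨.inr c', hx⟩).1 = _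
            rw [hairInsFun, dif_neg hc]
            rfl
      · rw [if_neg (by rw [hmem]; simp)]
        rfl

/-- The new edge is the first odd element. It has to move past all edges of the paths before `j`,
and past those of the path `j` too if it is inserted at its end. -/
theorem sign_expandIso : (expandIso hs j h).sign =
    ∏ i, if i < j ∨ i = j ∧ b = true then (-1) ^ (k i + 1) else 1 := by
  classical
  -- Counting the new edge among the frame edges makes both orders paired, so that the hairs drop
  -- out.
  set e : Hair s k ⊕ (Option (Pos (fun j => k j + 1)) ⊕ Hair s k) ≃
    Hair s k ⊕ Option (Pos (fun j => k j + 1) ⊕ Hair s k) :=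
    (Equiv.refl _).sumCongr (optionSum _ _).symm with he
  set Γ := (theta s k).expand (.inr b) ({hairHalf k hs, endHalf s k b j} : Finset _)
  have h1 : PairedRank (Γ.oddRank ∘ e) (hairCode (s := s) (k := k)) := by
    have h0 := pairedRank_theta s k
    refine ⟨h0.inj, ?_, ?_, ?_, ?_, ?_, ?_⟩
    · rintro (_ | p) x
      · change 1 < _ + 2
        omega
      · exact Nat.add_lt_add_right (h0.lt_left p x) 2
    · rintro (_ | p) x
      · change 1 < _ + 2
        omega
      · exact Nat.add_lt_add_right (h0.lt_right p x) 2
    · exact fun x y => Nat.add_lt_add_iff_right.trans (h0.ll x y)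
    · exact fun x y => Nat.add_lt_add_iff_right.trans (h0.lr x y)
    · exact fun x y => Nat.add_lt_add_iff_right.trans (h0.rl x y)
    · exact fun x y => Nat.add_lt_add_iff_right.trans (h0.rr x y)
  have h2 : (theta (Function.update s b false) k').oddRank ∘ (expandIso hs j h).odd ∘ e =
      (theta (Function.update s b false) k').oddRank ∘ Sum.map (hairIns hs j h)
        (Sum.map (posIns b j (n := fun j => k j + 1) (n' := fun j => k' j + 1)
          (fun i => by rw [h]; omega)) (hairIns hs j h)) := by
    funext x
    rcases x with x | (_ | p) | x <;> rfl
  rw [WeakIso.sign]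
  refine (invSign_comp_equiv e _ _).symm.trans
    ((congrArg (invSign (Γ.oddRank ∘ e)) h2).trans ?_)
  refine (h1.invSign_eq ((pairedRank_theta _ _).comp _ _)).trans ?_
  set r : Option (Pos (fun j => k j + 1)) → ℕ := fun p => (Γ.oddRank ∘ e) (.inr (.inl p)) with hr
  have hr0 : r none = 1 := rfl
  have hr1 : ∀ p, r (some p) = p.code + 2 := fun p => rfl
  change invSign r (fun p => (posIns b j (n := fun j => k j + 1) (n' := fun j => k' j + 1)
          (fun i => by rw [h]; omega) p).code) = _
  rw [invSign, Fintype.prod_option, Fintype.prod_option, if_neg (by omega), one_mul,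
    Finset.prod_eq_one (s := Finset.univ (α := Pos fun j => k j + 1)) (f := fun a => ∏ b, _),
    mul_one]
  · rw [Fintype.prod_sigma]
    refine Finset.prod_congr rfl fun i _ => ?_
    simp only [posIns_code_lt_none, hr0, hr1, show ∀ n, 1 < n + 2 by omega, true_and]
    split_ifs <;> simp
  · intro p _
    rw [Fintype.prod_option, if_neg (by rw [hr0, hr1]; omega), one_mul]
    refine Finset.prod_eq_one fun q _ => if_neg ?_
    rw [hr1, hr1, posIns_code_lt]
    omega

end Expand

end TwoLoop

/-! ### Incidences of theta graphs and expansions of their end points. -/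

namespace TwoLoop
open OGraph

theorem tvert_eq_inl {k : Fin 3 → ℕ} {j : Fin 3} {n : ℕ} {p : Pos k} :
    tvert k j n = .inl p ↔ j = p.1 ∧ n = p.2 + 1 := by
  obtain ⟨i, l, hl⟩ := p
  rcases Nat.eq_zero_or_pos n with rfl | hn
  · simp [tvert_zero]
  · by_cases h : n - 1 < k j
    · rw [tvert_pos hn.ne' h, Sum.inl.injEq, Pos.mk_inj]
      refine and_congr_right fun _ => ?_
      dsimp only
      omega
    · rw [tvert_last (by omega)]
      simp only [reduceCtorEq, false_iff, not_and]
      rintro rfl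
      omega

theorem tvert_eq_false {k : Fin 3 → ℕ} {j : Fin 3} {n : ℕ} :
    tvert k j n = .inr false ↔ n = 0 := by
  rcases Nat.eq_zero_or_pos n with rfl | hn
  · simp [tvert_zero]
  · by_cases h : n - 1 < k j
    · simp [tvert_pos hn.ne' h, hn.ne']
    · simp [tvert_last (show k j < n by omega), hn.ne']

theorem tvert_eq_true {k : Fin 3 → ℕ} {j : Fin 3} {n : ℕ} :
    tvert k j n = .inr true ↔ k j < n := by
  rcases Nat.eq_zero_or_pos n with rfl | hn
  · simp [tvert_zero]
  · by_cases h : n - 1 < k j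
    · simp only [tvert_pos hn.ne' h, reduceCtorEq, false_iff]
      omega
    · simp [tvert_last (show k j < n by omega), show k j < n by omega]

/-! ### Half-edges of theta graphs -/

section HalfEdges

variable {s : Bool → Bool} {k : Fin 3 → ℕ}

open Classical in
theorem halfEdges_ext (x : Hair s k) :
    (theta s k).halfEdges (.inl x) = ({(.inr x, true)} : Finset _) := by
  ext ⟨a, c⟩
  rw [mem_halfEdges, Finset.mem_singleton, Prod.mk.injEq]
  rcases a with p | y
  · exact ⟨fun h => (by cases h), fun h => (by cases h.1)⟩
  · cases c
    · exact ⟨fun h => (by cases h), fun h => (by cases h.2)⟩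
    · exact ⟨fun h => ⟨congrArg Sum.inr (Sum.inl_injective h), rfl⟩,
        fun h => congrArg Sum.inl (Sum.inr_injective h.1)⟩

open Classical in
theorem halfEdges_interior (p : Pos k) :
    (theta s k).halfEdges (.inr (.inl p)) =
      ({(.inl ⟨p.1, p.2, Nat.lt_succ_of_lt p.2.2⟩, true),
        (.inl ⟨p.1, p.2 + 1, Nat.succ_lt_succ p.2.2⟩, false),
        (.inr ⟨.inl p, trivial⟩, false)} : Finset _) := by
  ext ⟨a, c⟩
  rw [mem_halfEdges, Finset.mem_insert, Finset.mem_insert, Finset.mem_singleton, Prod.mk.injEq,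
    Prod.mk.injEq, Prod.mk.injEq]
  rcases a with ⟨i, n, hn⟩ | y
  · change (Sum.inr (tvert k i (n + c.toNat)) : Hair s k ⊕ TVert k) = .inr (.inl p) ↔ _
    rw [Sum.inr.injEq, tvert_eq_inl]
    have e : ∀ n' h, (Sum.inl (⟨i, n, hn⟩ : Pos (fun j => k j + 1)) :
        Pos (fun j => k j + 1) ⊕ Hair s k) = .inl ⟨p.1, n', h⟩ ↔ i = p.1 ∧ n = n' :=
      fun n' h => Sum.inl_injective.eq_iff.trans (Pos.mk_inj (n := fun j => k j + 1))
    refine Iff.trans ?_ (or_congr (and_congr_left' (e _ _).symm)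
      (or_congr (and_congr_left' (e _ _).symm) (iff_of_eq (eq_false fun h => by cases h.1).symm)))
    cases c <;> simp
  · cases c
    · change (Sum.inr y.1 : Hair s k ⊕ TVert k) = .inr (.inl p) ↔ _
      rw [Sum.inr.injEq]
      constructor
      · intro h
        refine .inr (.inr ⟨?_, rfl⟩)
        exact congrArg Sum.inr (Subtype.ext h)
      · rintro (h | h | h)
        · cases h.1
        · cases h.1
        · have := Sum.inr_injective h.1
          rw [this]
    · constructor
      · intro h
        cases h
      · rintro (h | h | h)
        · cases h.1
        · cases h.1
        · cases h.2

theorem card_halfEdges_interior (p : Pos k) :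
    ((theta s k).halfEdges (.inr (.inl p))).card = 3 := by
  classical
  rw [halfEdges_interior, Finset.card_insert_of_notMem, Finset.card_insert_of_notMem,
    Finset.card_singleton]
  · rw [Finset.mem_singleton, Prod.mk.injEq]
    rintro ⟨h, -⟩
    cases h
  · rw [Finset.mem_insert, Finset.mem_singleton, Prod.mk.injEq, Prod.mk.injEq]
    rintro (⟨-, h⟩ | ⟨-, h⟩) <;> cases h

theorem mem_halfEdges_end (b : Bool) (h : (Pos (fun j => k j + 1) ⊕ Hair s k) × Bool) :
    h ∈ (theta s k).halfEdges (.inr (.inr b)) ↔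
      (∃ j, h = endHalf s k b j) ∨ ∃ hs : s b = true, h = hairHalf k hs := by
  obtain ⟨a, c⟩ := h
  refine mem_halfEdges.trans ?_
  rcases a with ⟨i, n, hn⟩ | ⟨y, hy⟩
  · change (Sum.inr (tvert k i (n + c.toNat)) : Hair s k ⊕ TVert k) = .inr (.inr b) ↔ _
    rw [Sum.inr.injEq, or_iff_left (by rintro ⟨_, h⟩; cases h)]
    have e : ∀ j, ((.inl ⟨i, n, hn⟩, c) : (Pos (fun j => k j + 1) ⊕ Hair s k) × Bool) =
        endHalf s k b j ↔ i = j ∧ n = (if b then k j else 0) ∧ c = b := by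
      intro j
      rw [endHalf, Prod.mk.injEq, Sum.inl.injEq]
      exact (and_congr_left' (Pos.mk_inj (n := fun j => k j + 1))).trans and_assoc
    simp only [e, exists_eq_left']
    replace hn : n < k i + 1 := hn
    cases b
    · rw [tvert_eq_false]
      cases c <;> simp
    · rw [tvert_eq_true]
      cases c <;> simp <;> omega
  · rw [or_iff_right (by rintro ⟨_, h⟩; cases h)]
    cases c
    · change (Sum.inr y : Hair s k ⊕ TVert k) = .inr (.inr b) ↔ _
      rw [Sum.inr.injEq]
      constructor
      · rintro rfl
        exact ⟨hy, rfl⟩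
      · rintro ⟨hs, h⟩
        cases h
        rfl
    · constructor
      · intro h
        cases h
      · rintro ⟨hs, h⟩
        cases h

theorem endHalf_injective (s : Bool → Bool) (k : Fin 3 → ℕ) (b : Bool) :
    Function.Injective (endHalf s k b) := by
  intro i j h
  exact congrArg Sigma.fst (Sum.inl_injective (congrArg Prod.fst h))

theorem halfEdges_end_of_not {b : Bool} (hs : s b = false) :
    (theta s k).halfEdges (.inr (.inr b)) =
      Finset.univ.map ⟨endHalf s k b, endHalf_injective s k b⟩ := by
  ext h
  rw [mem_halfEdges_end, Finset.mem_map]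
  simp [hs, eq_comm]

/-- The half-edges at an end point with a hair. -/
def endHalves {b : Bool} (hs : s b = true) :
    Option (Fin 3) ↪ (Pos (fun j => k j + 1) ⊕ Hair s k) × Bool where
  toFun
    | none => hairHalf k hs
    | some j => endHalf s k b j
  inj' := by
    rintro (_ | i) (_ | j) h
    · rfl
    · cases h
    · cases h
    · rw [endHalf_injective s k b h]

theorem halfEdges_end {b : Bool} (hs : s b = true) :
    (theta s k).halfEdges (.inr (.inr b)) = Finset.univ.map (endHalves hs) := by
  ext h
  rw [mem_halfEdges_end, Finset.mem_map]
  constructor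
  · rintro (⟨j, rfl⟩ | ⟨hs, rfl⟩)
    · exact ⟨some j, Finset.mem_univ _, rfl⟩
    · exact ⟨none, Finset.mem_univ _, rfl⟩
  · rintro ⟨_ | j, -, rfl⟩
    · exact .inr ⟨hs, rfl⟩
    · exact .inl ⟨j, rfl⟩

theorem card_halfEdges_end (b : Bool) :
    ((theta s k).halfEdges (.inr (.inr b))).card = 3 + (s b).toNat := by
  cases h : s b
  · rw [halfEdges_end_of_not h, Finset.card_map]
    rfl
  · rw [halfEdges_end h, Finset.card_map]
    rfl

theorem sum_splittings_eq_zero {M : Type*} [AddCommMonoid M] (Γ : OGraph) (x : Γ.Inn)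
    (h : (Γ.halfEdges (.inr x)).card ≤ 3) (F : Finset (Γ.Edge × Bool) → M) :
    ∑ S ∈ Γ.splittings x, F S = 0 := by
  refine Finset.sum_eq_zero fun S hS => ?_
  have := (mem_splittings.1 hS).2
  omega

-- An end point with a hair has four half-edges, so both halves of a splitting have two elements.
-- One of them contains the hair together with the half-edge of a path `j`, which leaves three
-- complementary pairs of splittings.
open Classical in
theorem sum_splittings_end {M : Type*} [AddCommMonoid M] {b : Bool} (hs : s b = true)
    (F : Finset ((Pos (fun j => k j + 1) ⊕ Hair s k) × Bool) → M) :
    ∑ S ∈ (theta s k).splittings (.inr b), F S =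
      ∑ j, (F {hairHalf k hs, endHalf s k b j} +
        F ((theta s k).halfEdges (.inr (.inr b)) \ {hairHalf k hs, endHalf s k b j})) := by
  have h1 : (theta s k).splittings (.inr b) =
      (Finset.powersetCard 2 Finset.univ).map (Finset.mapEmbedding (endHalves hs)).toEmbedding := by
    ext S
    rw [mem_splittings, halfEdges_end hs, Finset.card_map, Finset.mem_map]
    constructor
    · rintro ⟨h1, h2, h3⟩
      obtain ⟨T, -, rfl⟩ := Finset.subset_map_iff.1 h1
      refine ⟨T, Finset.mem_powersetCard.2 ⟨Finset.subset_univ _, ?_⟩, rfl⟩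
      simp at h2 h3
      omega
    · rintro ⟨T, hT, rfl⟩
      rw [Finset.mem_powersetCard] at hT
      refine ⟨Finset.map_subset_map.2 hT.1, ?_, ?_⟩ <;>
        simp [Finset.mapEmbedding_apply, hT.2]
  -- The label `none` stands for the hair: the two-element sets of labels are those that contain it
  -- and their complements.
  have h2 : Finset.powersetCard 2 (Finset.univ : Finset (Option (Fin 3))) =
      (Finset.univ : Finset (Fin 3)).image (fun j => {none, some j}) ∪
        (Finset.univ : Finset (Fin 3)).image (fun j => Finset.univ \ {none, some j}) := by
    decide
  have h3 : Disjoint ((Finset.univ : Finset (Fin 3)).image (fun j => {none, some j}))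
      ((Finset.univ : Finset (Fin 3)).image (fun j => Finset.univ \ {none, some j})) := by
    decide
  have h4 : Function.Injective (fun j : Fin 3 => ({none, some j} : Finset (Option (Fin 3)))) := by
    decide
  have h5 : Function.Injective
      (fun j : Fin 3 => (Finset.univ \ {none, some j} : Finset (Option (Fin 3)))) := by
    decide
  rw [h1, Finset.sum_map]
  simp only [RelEmbedding.coe_toEmbedding, Finset.mapEmbedding_apply]
  have h6 : ∑ T ∈ Finset.powersetCard 2 (Finset.univ : Finset (Option (Fin 3))),
      F (T.map (endHalves hs)) = ∑ j : Fin 3, (F (Finset.map (endHalves hs) {none, some j}) +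
        F (Finset.map (endHalves hs) (Finset.univ \ {none, some j}))) := by
    rw [h2, Finset.sum_union h3, Finset.sum_image h4.injOn, Finset.sum_image h5.injOn,
      Finset.sum_add_distrib]
  rw [h6]
  refine Finset.sum_congr rfl fun j _ => ?_
  have h7 : Finset.map (endHalves hs) {none, some j} = {hairHalf k hs, endHalf s k b j} := by
    rw [Finset.map_insert, Finset.map_singleton]
    rfl
  congr 2
  rw [halfEdges_end hs, Finset.map_sdiff, h7]

end HalfEdges

/-- The two splittings that describe the same expansion. -/
def complIso (Γ : OGraph) [DecidableEq Γ.Edge] [DecidableEq Γ.Inn] (x : Γ.Inn)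
    (S : Finset (Γ.Edge × Bool)) (hS : S ⊆ Γ.halfEdges (.inr x)) :
    WeakIso (Γ.expand x S) (Γ.expand x (Γ.halfEdges (.inr x) \ S)) where
  ext := Equiv.refl _
  inn := (Equiv.swap none (some x) : Option Γ.Inn ≃ Option Γ.Inn)
  edge := Equiv.refl _
  ends_eq := by
    classical
    change ∀ a : Option Γ.Edge, ∃ t : Bool, ∀ c : Bool,
      expandEnds Γ.ends x (Γ.halfEdges (.inr x) \ S) a (xor t c) =
        Sum.map id (Equiv.swap none (some x)) (expandEnds Γ.ends x S a c)
    rintro (_ | a)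
    · refine ⟨true, fun c => ?_⟩
      cases c <;> simp [expandEnds]
    · refine ⟨false, fun c => ?_⟩
      rw [Bool.false_xor, expandEnds, expandEnds]
      by_cases h : (a, c) ∈ Γ.halfEdges (.inr x)
      · have h' := mem_halfEdges.1 h
        simp only at h'
        by_cases h2 : (a, c) ∈ S <;> simp [h, h2, h']
      · have h2 : (a, c) ∉ S := fun h' => h (hS h')
        rw [mem_halfEdges] at h
        rw [if_neg (by simp [h2, mem_halfEdges, h]), if_neg h2]
        simp only at h
        rcases hv : Γ.ends a c with u | v
        · rfl
        · rw [hv] at h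
          simp only [Sum.map_inr]
          rw [Equiv.swap_apply_of_ne_of_ne (by simp)]
          simpa using h

/-- The isomorphism exchanges two internal vertices, which are even, and reverses the new edge; the
odd elements stay in place. -/
theorem sign_complIso (Γ : OGraph) [DecidableEq Γ.Edge] [DecidableEq Γ.Inn] (x : Γ.Inn)
    (S : Finset (Γ.Edge × Bool)) (hS : S ⊆ Γ.halfEdges (.inr x)) :
    (complIso Γ x S hS).sign = 1 := by
  rw [WeakIso.sign, ← invSign_self (Γ.expand x S).oddRank]
  congr 1
  funext y
  rcases y with y | y <;> rfl

/-! ### The differential of a theta graph. -/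

theorem differential_graphClass (m N : ℕ) (Γ : OGraph) :
    differential m N (graphClass m N Γ) =
      (1 / 2 : ℚ) • ∑ x, ∑ S ∈ Γ.splittings x, graphClass m N (Γ.expand x S) := by
  change (relations m N).mkQ (freeDifferential (Finsupp.single Γ 1)) = _
  rw [freeDifferential, Finsupp.linearCombination_single, one_smul, OGraph.expansions, map_smul,
    map_sum]
  simp only [map_sum]
  rfl

/-- The exponents with the `j`-th one increased by one. -/
def bump (k : Fin 3 → ℕ) (j : Fin 3) : Fin 3 → ℕ := fun i => k i + if i = j then 1 else 0

/-- The sign of the expansion of the end point `b` towards the `j`-th path. -/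
def expandSign (b : Bool) (j : Fin 3) (k : Fin 3 → ℕ) : ℤˣ :=
  ∏ i, if i < j ∨ i = j ∧ b = true then (-1) ^ (k i + 1) else 1

/-- Trivalent vertices have no splittings. At an end point with a hair, the two complementary
splittings give the same class, which cancels the factor `1 / 2` in the definition of the
expansions. -/
theorem differential_theta {m N : ℕ} (hm : Odd m) (hN : Even N) (s : Bool → Bool)
    (k : Fin 3 → ℕ) :
    differential m N (graphClass m N (theta s k)) = ∑ b, if s b = true then
      ∑ j, unitCast (expandSign b j k) •
        graphClass m N (theta (Function.update s b false) (bump k j)) else 0 := by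
  classical
  rw [differential_graphClass]
  change (1 / 2 : ℚ) • ∑ x : Pos k ⊕ Bool, ∑ S ∈ (theta s k).splittings x,
    graphClass m N ((theta s k).expand x S) = _
  rw [Fintype.sum_sum_type, Finset.sum_eq_zero, zero_add, Finset.smul_sum]
  · refine Finset.sum_congr rfl fun b _ => ?_
    split_ifs with hs
    · refine (congrArg _ (sum_splittings_end hs
        (fun S => graphClass m N ((theta s k).expand (.inr b) S)))).trans ?_
      rw [Finset.smul_sum]
      refine Finset.sum_congr rfl fun j _ => ?_
      have hS : ({hairHalf k hs, endHalf s k b j} : Finset _) ⊆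
          (theta s k).halfEdges (.inr (.inr b)) := by
        intro h hh
        rw [Finset.mem_insert, Finset.mem_singleton] at hh
        rw [mem_halfEdges_end]
        rcases hh with rfl | rfl
        · exact .inr ⟨hs, rfl⟩
        · exact .inl ⟨j, rfl⟩
      have hb : ∀ i, bump k j i = k i + if i = j then 1 else 0 := fun i => rfl
      have h1 := graphClass_eq hm hN (complIso (theta s k) (.inr b) _ hS)
      have h2 := graphClass_eq hm hN (expandIso hs j (k := k) (k' := bump k j) hb)
      rw [sign_complIso, unitCast_one, one_smul] at h1
      rw [sign_expandIso] at h2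
      rw [← h1, ← two_smul ℚ, smul_smul, h2]
      norm_num
      rfl
    · refine (congrArg _ (sum_splittings_eq_zero (theta s k) (.inr b) ?_ _)).trans (smul_zero _)
      rw [card_halfEdges_end]
      simp [hs]
  · intro p _
    exact sum_splittings_eq_zero (theta s k) (.inl p) (card_halfEdges_interior p).le _

end TwoLoop

namespace TwoLoop
open OGraph

/-! ### Tree-type edges -/

theorem reachable_map {V W : Type*} {G : SimpleGraph V} {H : SimpleGraph W} (π : V → W)
    (h : ∀ x y, G.Adj x y → H.Reachable (π x) (π y)) {x y : V} (hxy : G.Reachable x y) :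
    H.Reachable (π x) (π y) := by
  obtain ⟨p⟩ := hxy
  induction p with
  | nil => exact SimpleGraph.Reachable.refl _
  | cons hadj _ ih => exact (h _ _ hadj).trans ih

namespace OGraph

variable {Γ : OGraph}

theorem skeleton_adj {A : Set Γ.Edge} {x y : Γ.Vert} : (Γ.skeleton A).Adj x y ↔
    x ≠ y ∧ ∃ a ∈ A, ∃ s, Γ.ends a s = x ∧ Γ.ends a (!s) = y := by
  rw [skeleton, SimpleGraph.fromRel_adj]
  refine and_congr_right fun _ => ⟨?_, ?_⟩
  · rintro (⟨a, ha, h1, h2⟩ | ⟨a, ha, h1, h2⟩)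
    · exact ⟨a, ha, false, h1, h2⟩
    · exact ⟨a, ha, true, h2, h1⟩
  · rintro ⟨a, ha, s, h1, h2⟩
    cases s
    · exact .inl ⟨a, ha, h1, h2⟩
    · exact .inr ⟨a, ha, h2, h1⟩

theorem skeleton_reachable {A : Set Γ.Edge} {a : Γ.Edge} (ha : a ∈ A) (s : Bool) :
    (Γ.skeleton A).Reachable (Γ.ends a s) (Γ.ends a (!s)) := by
  by_cases h : Γ.ends a s = Γ.ends a (!s)
  · rw [h]
  · exact (skeleton_adj.2 ⟨h, a, ha, s, rfl, rfl⟩).reachable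

theorem existsUnique_half (h1 : ∀ u : Γ.Ext, Γ.valence (.inl u) = 1) (u : Γ.Ext) :
    ∃! h : Γ.Edge × Bool, Γ.ends h.1 h.2 = .inl u := by
  obtain ⟨h, hh⟩ := Finset.card_eq_one.1 (h1 u)
  refine ⟨h, mem_halfEdges.1 (hh ▸ Finset.mem_singleton_self h), fun h' hh' => ?_⟩
  have := mem_halfEdges.2 hh'
  rwa [hh, Finset.mem_singleton] at this

/-- In a graph with two loops an edge with a univalent vertex is tree-type. -/
theorem isTreeType_of_ext (hc : (Γ.skeleton Set.univ).Connected)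
    (h1 : ∀ u : Γ.Ext, Γ.valence (.inl u) = 1) (hl : Γ.loops = 2) {a : Γ.Edge} {s : Bool}
    {u : Γ.Ext} (ha : Γ.ends a s = .inl u) : Γ.IsTreeType a := by
  classical
  have hun : ∀ b t, Γ.ends b t = .inl u → b = a ∧ t = s := by
    intro b t hb
    have := (existsUnique_half h1 u).unique (y₁ := (b, t)) (y₂ := (a, s)) hb ha
    exact ⟨congrArg Prod.fst this, congrArg Prod.snd this⟩
  set G := Γ.skeleton {a}ᶜ with hG
  set w := Γ.ends a (!s) with hw
  have hwu : w ≠ .inl u := by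
    intro h
    have := (hun a (!s) h).2
    cases s <;> simp at this
  have hiso : ∀ y, ¬ G.Adj (.inl u) y := by
    intro y h
    obtain ⟨-, b, hb, t, h2, -⟩ := skeleton_adj.1 h
    exact hb (hun b t h2).1
  have hcomp : ∀ y, G.Reachable (.inl u) y → y = .inl u := by
    rintro y ⟨p⟩
    cases p with
    | nil => rfl
    | cons h _ => exact absurd h (hiso _)
  have hrest : ∀ x, x ≠ .inl u → G.Reachable w x := by
    intro x hx
    -- Sending the univalent vertex `u` to its neighbour `w` retracts paths of the whole graph to
    -- paths that avoid the edge `a`.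
    have key := reachable_map (G := Γ.skeleton Set.univ) (H := G)
      (fun y => if y = .inl u then w else y) (fun y z hyz => by
        obtain ⟨-, b, -, t, rfl, rfl⟩ := skeleton_adj.1 hyz
        by_cases hb : b = a
        · subst hb
          by_cases ht : t = s
          · subst ht
            rw [if_pos ha, if_neg hwu]
          · have : t = !s := by cases t <;> cases s <;> simp at ht ⊢
            subst this
            rw [Bool.not_not, if_pos ha, if_neg hwu]
        · rw [if_neg fun h => hb (hun _ _ h).1, if_neg fun h => hb (hun _ _ h).1]
          exact skeleton_reachable (by simpa using hb) t) (hc.preconnected w x)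
    simpa only [if_neg hwu, if_neg hx] using key
  have hsupp : (G.connectedComponentMk (.inl u)).supp = {.inl u} := by
    ext y
    rw [SimpleGraph.ConnectedComponent.mem_supp_iff, SimpleGraph.ConnectedComponent.eq,
      Set.mem_singleton_iff]
    exact ⟨fun h => hcomp y h.symm, fun h => h ▸ SimpleGraph.Reachable.refl _⟩
  refine ⟨fun hcon => hwu (hcomp w (hcon.preconnected _ _)), G.connectedComponentMk (.inl u), ?_, ?_⟩
  · change (G.connectedComponentMk (.inl u)).supp.ncard =
      {b | b ≠ a ∧ Γ.ends b false ∈ (G.connectedComponentMk (.inl u)).supp}.ncard + 1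
    rw [hsupp, Set.ncard_singleton]
    have : {b | b ≠ a ∧ Γ.ends b false ∈ ({.inl u} : Set Γ.Vert)} = ∅ := by
      ext b
      simp only [Set.mem_setOf_eq, Set.mem_empty_iff_false, iff_false, not_and]
      exact fun hb h => hb (hun _ _ h).1
    rw [this, Set.ncard_empty]
  · intro c hcc
    induction c using SimpleGraph.ConnectedComponent.ind with | _ x => ?_
    by_contra hne
    have hx : x ≠ .inl u := by rintro rfl; exact hne rfl
    have hs2 : (G.connectedComponentMk x).supp = {.inl u}ᶜ := by
      ext y
      rw [SimpleGraph.ConnectedComponent.mem_supp_iff, SimpleGraph.ConnectedComponent.eq,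
        Set.mem_compl_iff, Set.mem_singleton_iff]
      constructor
      · rintro h rfl
        exact hx (hcomp x h)
      · exact fun h => (hrest y h).symm.trans (hrest x hx)
    have hs3 : {b | b ≠ a ∧ Γ.ends b false ∈ (G.connectedComponentMk x).supp} = {a}ᶜ := by
      ext b
      rw [hs2]
      simp only [Set.mem_setOf_eq, Set.mem_compl_iff, Set.mem_singleton_iff, and_iff_left_iff_imp]
      exact fun hb h => hb (hun _ _ h).1
    -- The component of the other vertices contains all vertices but one and all edges but one.
    -- Being a tree would contradict that there are two loops.
    have hcount : (G.connectedComponentMk x).supp.ncard =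
        {b | b ≠ a ∧ Γ.ends b false ∈ (G.connectedComponentMk x).supp}.ncard + 1 := hcc
    rw [hs3, hs2, Set.ncard_compl, Set.ncard_compl, Set.ncard_singleton, Set.ncard_singleton,
      Nat.card_eq_fintype_card, Nat.card_eq_fintype_card] at hcount
    have hpos : 0 < Fintype.card Γ.Edge := Fintype.card_pos_iff.2 ⟨a⟩
    rw [loops] at hl
    omega

end OGraph

/-! ### Theta graphs are two-loop hairy graphs -/

section ThetaHairy

variable (s : Bool → Bool) (k : Fin 3 → ℕ)

theorem skeleton_theta_reachable {A : Set (Pos (fun j => k j + 1) ⊕ Hair s k)} (i : Fin 3)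
    {a b : ℕ} (hab : a ≤ b) (hb : b ≤ k i + 1)
    (hA : ∀ n (hn : n < k i + 1), a ≤ n → n < b → Sum.inl ⟨i, n, hn⟩ ∈ A) :
    ((theta s k).skeleton A).Reachable (.inr (tvert k i a)) (.inr (tvert k i b)) := by
  induction b, hab using Nat.le_induction with
  | base => exact SimpleGraph.Reachable.refl _
  | succ b hab ih =>
    refine (ih (by omega) fun n hn h1 h2 => hA n hn h1 (by omega)).trans ?_
    exact skeleton_reachable (Γ := theta s k) (hA b (by omega) hab (by omega)) false

theorem exists_tvert (v : TVert k) : ∃ i n, n ≤ k i + 1 ∧ v = tvert k i n := by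
  rcases v with ⟨i, l, hl⟩ | _ | _
  · exact ⟨i, l + 1, by omega, (tvert_succ hl).symm⟩
  · exact ⟨0, 0, by omega, rfl⟩
  · exact ⟨0, k 0 + 1, le_rfl, (tvert_last (by omega)).symm⟩

/-- If one frame edge is missing, another path still joins the two end points, and each vertex is
reached from one of them. -/
theorem skeleton_theta_connected {A : Set (Pos (fun j => k j + 1) ⊕ Hair s k)}
    (hA : ∀ x, Sum.inr x ∈ A) (j : Fin 3) (l : ℕ)
    (hA' : ∀ i n (hn : n < k i + 1), ¬ (i = j ∧ n = l) → Sum.inl ⟨i, n, hn⟩ ∈ A) :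
    ((theta s k).skeleton A).Connected := by
  obtain ⟨i₀, hi₀⟩ : ∃ i₀ : Fin 3, i₀ ≠ j := by
    by_cases hj : j = 0
    · exact ⟨1, by rw [hj]; decide⟩
    · exact ⟨0, Ne.symm hj⟩
  have hend : ((theta s k).skeleton A).Reachable (.inr (.inr false)) (.inr (.inr true)) := by
    have := skeleton_theta_reachable s k (A := A) i₀ (Nat.zero_le (k i₀ + 1)) le_rfl
      (fun n hn _ _ => hA' _ _ _ fun h => hi₀ h.1)
    rwa [tvert_zero, tvert_last (by omega)] at this
  have hv : ∀ v : TVert k, ((theta s k).skeleton A).Reachable (.inr (.inr false)) (.inr v) := by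
    intro v
    obtain ⟨i, n, hn, rfl⟩ := exists_tvert k v
    by_cases h : i = j ∧ l < n
    · have := skeleton_theta_reachable s k (A := A) i hn le_rfl
        (fun m _ _ _ => hA' _ _ _ fun h' => by omega)
      rw [tvert_last (l := k i + 1) (by omega)] at this
      exact hend.trans this.symm
    · exact skeleton_theta_reachable s k (A := A) i (Nat.zero_le n) hn
        (fun m _ _ _ => hA' _ _ _ fun h' => h ⟨h'.1, by omega⟩)
  have hall : ∀ x, ((theta s k).skeleton A).Reachable (.inr (.inr false)) x := by
    rintro (x | v)
    · exact (hv x.1).trans (skeleton_reachable (Γ := theta s k) (hA x) false)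
    · exact hv v
  haveI : Nonempty (theta s k).Vert := ⟨.inr (.inr false)⟩
  exact ⟨fun x y => (hall x).symm.trans (hall y)⟩

theorem theta_connected : ((theta s k).skeleton Set.univ).Connected :=
  skeleton_theta_connected s k (fun _ => trivial) 0 0 fun _ _ _ _ => trivial

theorem card_hair : Fintype.card (Hair s k) =
    ∑ j, k j + ((s false).toNat + (s true).toNat) := by
  have h1 : Fintype.card {b : Bool // s b = true} = (s false).toNat + (s true).toNat := by
    rw [Fintype.card_subtype, Finset.card_filter]
    simp only [Fintype.univ_bool, Finset.sum_insert (show true ∉ {false} by simp),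
      Finset.sum_singleton]
    cases s false <;> cases s true <;> rfl
  have h2 : Fintype.card {p : Pos k // True} = ∑ j, k j := by
    rw [Fintype.card_congr (Equiv.subtypeUnivEquiv fun _ => trivial)]
    simp
  rw [← h1, ← h2, ← Fintype.card_sum]
  exact Fintype.card_congr Equiv.subtypeSum

theorem hodge_theta : (theta s k).hodge = ∑ j, k j + ((s false).toNat + (s true).toNat) :=
  card_hair s k

theorem card_edge_theta : Fintype.card (theta s k).Edge =
    ∑ j, k j + 3 + Fintype.card (Hair s k) := by
  change Fintype.card (Pos (fun j => k j + 1) ⊕ Hair s k) = _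
  rw [Fintype.card_sum]
  simp [Finset.sum_add_distrib]

theorem card_inn_theta : Fintype.card (theta s k).Inn = ∑ j, k j + 2 := by
  change Fintype.card (Pos k ⊕ Bool) = _
  rw [Fintype.card_sum]
  simp

theorem loops_theta : (theta s k).loops = 2 := by
  rw [loops, card_edge_theta, Fintype.card_sum, card_inn_theta]
  push_cast
  ring

theorem defect_theta : (theta s k).defect = (s false).toNat + (s true).toNat := by
  change ∑ x : Pos k ⊕ Bool, (((theta s k).valence (.inr x) : ℤ) - 3) = _
  rw [Fintype.sum_sum_type]
  simp only [valence]
  rw [Finset.sum_eq_zero, zero_add]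
  · have h : ∀ b, (((theta s k).halfEdges (.inr (.inr b))).card : ℤ) - 3 = (s b).toNat := by
      intro b
      rw [card_halfEdges_end]
      push_cast
      ring
    rw [Fintype.sum_bool, h, h, add_comm]
  · intro p _
    rw [card_halfEdges_interior]
    rfl

theorem valence_ext_theta (x : Hair s k) : (theta s k).valence (.inl x) = 1 := by
  classical
  rw [valence, halfEdges_ext]
  rfl

theorem isTreeType_hair (x : Hair s k) : (theta s k).IsTreeType (.inr x) :=
  isTreeType_of_ext (theta_connected s k) (valence_ext_theta s k) (loops_theta s k)
    (a := .inr x) (s := true) (u := x) rfl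

theorem not_isTreeType_frame (p : Pos fun j => k j + 1) : ¬ (theta s k).IsTreeType (.inl p) := by
  intro h
  refine h.1 (skeleton_theta_connected s k (fun x hx => by cases hx) p.1 p.2 ?_)
  intro i n hn h' he
  have he' : (⟨i, n, hn⟩ : Pos fun j => k j + 1) = p := Sum.inl_injective he
  exact h' (by subst he'; exact ⟨rfl, rfl⟩)

theorem admissible_theta (h : Nonempty (Hair s k)) : (theta s k).Admissible where
  connected := theta_connected s k
  nonempty_ext := h
  valence_ext := valence_ext_theta s k
  valence_inn := by
    rintro (p | b)
    · exact (card_halfEdges_interior p).ge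
    · have := card_halfEdges_end (s := s) (k := k) b
      rw [valence]
      omega

/-- The position of the `n`-th edge on the `i`-th path. -/
abbrev fpos (k : Fin 3 → ℕ) (i : Fin 3) (n : ℕ) (h : n < k i + 1) : Pos fun j => k j + 1 := ⟨i, n, h⟩

/-- Two frame edges that meet at a vertex other than `x` lie on the same side of the partition `A`
(`share`). A theta graph minus a point stays connected, so all frame edges lie on one side; `x` may
be interior to a path, the start, or anything else. -/
theorem not_cut_theta (x : (theta s k).Vert) : ¬ (theta s k).IsFrameCut x := by
  rintro ⟨A, ⟨a, ha, haA⟩, ⟨b, hb, hbA⟩, h⟩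
  rcases a with ⟨ia, na, hna⟩ | a
  swap
  · exact ha (isTreeType_hair s k a)
  rcases b with ⟨ib, nb, hnb⟩ | b
  swap
  · exact hb (isTreeType_hair s k b)
  have share : ∀ (p q : Pos fun j => k j + 1) (c d : Bool),
      tvert k p.1 (p.2 + c.toNat) = tvert k q.1 (q.2 + d.toNat) →
      .inr (tvert k p.1 (p.2 + c.toNat)) ≠ x → (Sum.inl p ∈ A ↔ Sum.inl q ∈ A) := by
    intro p q c d h1 h2
    by_contra hne
    rcases not_iff.1 hne with hiff
    by_cases hp : (Sum.inl p : Pos (fun j => k j + 1) ⊕ Hair s k) ∈ A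
    · have hq : (Sum.inl q : Pos (fun j => k j + 1) ⊕ Hair s k) ∉ A := fun hq => hiff.2 hq hp
      exact h2 (h _ _ c d (not_isTreeType_frame s k p) (not_isTreeType_frame s k q) hp hq
        (congrArg Sum.inr h1))
    · have hq : (Sum.inl q : Pos (fun j => k j + 1) ⊕ Hair s k) ∈ A := hiff.1 hp
      exact h2 ((congrArg Sum.inr h1).trans (h _ _ d c (not_isTreeType_frame s k q)
        (not_isTreeType_frame s k p) hq hp (congrArg Sum.inr h1.symm)))
  have link : ∀ (i : Fin 3) (a b : ℕ) (ha : a < k i + 1) (hb : b < k i + 1), a ≤ b →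
      (∀ n, a ≤ n → n < b → .inr (tvert k i (n + 1)) ≠ x) →
      (Sum.inl (fpos k i a ha) ∈ A ↔ Sum.inl (fpos k i b hb) ∈ A) := by
    intro i a b ha hb hab
    induction b, hab using Nat.le_induction with
    | base => exact fun _ => Iff.rfl
    | succ b hab ih =>
      intro hx
      refine (ih (by omega) fun n h1 h2 => hx n h1 (by omega)).trans ?_
      exact share (fpos k i b (by omega)) (fpos k i (b + 1) hb) true false rfl (hx b hab (by omega))
  have first : .inr (.inr false) ≠ x → ∀ i i' : Fin 3,
      (Sum.inl (fpos k i 0 (by omega)) ∈ A ↔ Sum.inl (fpos k i' 0 (by omega)) ∈ A) :=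
    fun hx i i' => share (fpos k i 0 (by omega)) (fpos k i' 0 (by omega)) false false rfl hx
  have last : .inr (.inr true) ≠ x → ∀ i i' : Fin 3,
      (Sum.inl (fpos k i (k i) (by omega)) ∈ A ↔ Sum.inl (fpos k i' (k i') (by omega)) ∈ A) := by
    intro hx i i'
    refine share (fpos k i (k i) (by omega)) (fpos k i' (k i') (by omega)) true true ?_ ?_
    · change tvert k i (k i + 1) = tvert k i' (k i' + 1)
      rw [tvert_last (by omega), tvert_last (by omega)]
    · change .inr (tvert k i (k i + 1)) ≠ x
      rwa [tvert_last (by omega)]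
  suffices H : ∃ c, ∀ p : Pos fun j => k j + 1, (Sum.inl p ∈ A ↔ c) by
    obtain ⟨c, hc⟩ := H
    exact hbA ((hc _).2 ((hc _).1 haA))
  by_cases hint : ∃ p : Pos k, x = .inr (.inl p)
  · obtain ⟨⟨i₀, l₀, hl₀⟩, rfl⟩ := hint
    obtain ⟨i₁, hi₁⟩ : ∃ i₁ : Fin 3, i₁ ≠ i₀ := by
      by_cases hj : i₀ = 0
      · exact ⟨1, by rw [hj]; decide⟩
      · exact ⟨0, Ne.symm hj⟩
    have hne : ∀ i n, ¬ (i = i₀ ∧ n = l₀) →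
        (.inr (tvert k i (n + 1)) : (theta s k).Vert) ≠ .inr (.inl ⟨i₀, l₀, hl₀⟩) := by
      intro i n hin he
      have := tvert_eq_inl.1 (Sum.inr_injective he)
      exact hin ⟨this.1, by simpa using this.2⟩
    refine ⟨Sum.inl (fpos k i₁ 0 (by omega)) ∈ A, ?_⟩
    rintro ⟨i, n, hn⟩
    replace hn : n < k i + 1 := hn
    -- An edge beyond the removed vertex is connected to the comparison edge through the end point
    -- and another path.
    by_cases hi : i = i₀ ∧ l₀ < n
    · refine (link i n (k i) hn (by omega) (by omega) fun m h1 _ => hne i m (by omega)).trans ?_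
      refine (last (by simp) i i₁).trans ?_
      exact (link i₁ 0 (k i₁) _ (by omega) (by omega) fun m _ _ => hne i₁ m (by tauto)).symm
    · refine (link i 0 n (by omega) hn (by omega) fun m _ h2 => hne i m ?_).symm.trans
        (first (by simp) i i₁)
      rintro ⟨h3, h4⟩
      exact hi ⟨h3, by omega⟩
  · have hlink : ∀ i a b ha hb, a ≤ b →
        (Sum.inl (fpos k i a ha) ∈ A ↔ Sum.inl (fpos k i b hb) ∈ A) := by
      intro i a b ha hb hab
      replace hb : b < k i + 1 := hb
      refine link i a b ha hb hab fun n h1 h2 he => hint ⟨⟨i, n, by omega⟩, ?_⟩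
      rw [← he, tvert_succ (by omega)]
    by_cases hx : .inr (.inr false) = x
    · refine ⟨Sum.inl (fpos k 0 (k 0) (by omega)) ∈ A, ?_⟩
      rintro ⟨i, n, hn⟩
      replace hn : n < k i + 1 := hn
      refine (hlink i n (k i) hn (Nat.lt_succ_self _) (by omega)).trans (last ?_ i 0)
      rw [← hx]
      simp
    · refine ⟨Sum.inl (fpos k 0 0 (by omega)) ∈ A, ?_⟩
      rintro ⟨i, n, hn⟩
      exact (hlink i 0 n (by omega) hn (by omega)).symm.trans (first hx i 0)

theorem isHair_theta (x : Hair s k) : (theta s k).IsHair (.inr x) := by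
  refine ⟨isTreeType_hair s k x, true, valence_ext_theta s k x, ?_, ?_⟩
  · obtain ⟨v, hv⟩ := x
    change (theta s k).InFrame (.inr v)
    obtain ⟨i, n, hn, rfl⟩ := exists_tvert k v
    rcases Nat.eq_zero_or_pos n with rfl | hn0
    · exact ⟨.inl (fpos k i 0 (by omega)), false, not_isTreeType_frame s k _, rfl⟩
    · refine ⟨.inl (fpos k i (n - 1) (by omega)), true, not_isTreeType_frame s k _, ?_⟩
      change Sum.inr (tvert k i (n - 1 + 1)) = _
      rw [Nat.sub_add_cancel hn0]
  · rintro (p | y) hb hty c he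
    · exact not_isTreeType_frame s k p hty
    · cases c
      · exact hb (congrArg Sum.inr (Subtype.ext (Sum.inr_injective he)))
      · cases he

theorem isTwoLoopHairy_theta (h : Nonempty (Hair s k)) : (theta s k).IsTwoLoopHairy where
  admissible := admissible_theta s k h
  loops_eq := loops_theta s k
  not_cut := not_cut_theta s k
  hair := by
    rintro (p | x) ha
    · exact absurd ha (not_isTreeType_frame s k p)
    · exact isHair_theta s k x

end ThetaHairy

end TwoLoop

namespace TwoLoop
open OGraph

/-! ### Recognition of theta graphs -/

section Frame

variable {V E : Type*} [Fintype V] [Fintype E] (ends : E → Bool → V)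

open Classical in
/-- The half-edges at a vertex. -/
noncomputable def halvesAt (x : V) : Finset (E × Bool) :=
  Finset.univ.filter fun h => ends h.1 h.2 = x

variable {ends}

theorem mem_halvesAt {x : V} {h : E × Bool} : h ∈ halvesAt ends x ↔ ends h.1 h.2 = x := by
  simp [halvesAt]

theorem sum_card_halvesAt : ∑ x, (halvesAt ends x).card = 2 * Fintype.card E := by
  classical
  have := Finset.card_eq_sum_card_fiberwise (s := (Finset.univ : Finset (E × Bool)))
    (t := (Finset.univ : Finset V)) (f := fun h => ends h.1 h.2) (fun _ _ => Finset.mem_univ _)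
  rw [Finset.card_univ, Fintype.card_prod, Fintype.card_bool] at this
  rw [mul_comm, this]
  refine Finset.sum_congr rfl fun x _ => ?_
  rw [halvesAt]

/-- The opposite half-edge. -/
def rev (h : E × Bool) : E × Bool := (h.1, !h.2)

theorem rev_rev (h : E × Bool) : rev (rev h) = h := by simp [rev]

theorem eq_or_eq_rev {h h' : E × Bool} (he : h.1 = h'.1) : h = h' ∨ h = rev h' := by
  obtain ⟨a, s⟩ := h
  obtain ⟨b, t⟩ := h'
  cases he
  cases s <;> cases t <;> simp [rev]

theorem eq_of_bivalent {x : V} (hx : (halvesAt ends x).card = 2) {α β γ : E × Bool}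
    (hα : α ∈ halvesAt ends x) (hβ : β ∈ halvesAt ends x) (hγ : γ ∈ halvesAt ends x)
    (h1 : α ≠ γ) (h2 : β ≠ γ) : α = β := by
  by_contra h
  have : 2 < (halvesAt ends x).card := Finset.two_lt_card.2 ⟨α, hα, β, hβ, γ, hγ, h, h1, h2⟩
  omega

variable (ends) in
/-- `nxt δ` continues the walk along `δ` without turning back. -/
def IsNext (nxt : E × Bool → E × Bool) : Prop :=
  ∀ δ, nxt δ ∈ halvesAt ends (ends (rev δ).1 (rev δ).2) ∧ nxt δ ≠ rev δ

theorem exists_isNext (hdeg : ∀ x, 2 ≤ (halvesAt ends x).card) : ∃ nxt, IsNext ends nxt := by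
  have : ∀ δ, ∃ δ', δ' ∈ halvesAt ends (ends (rev δ).1 (rev δ).2) ∧ δ' ≠ rev δ := fun δ =>
    Finset.exists_mem_ne (hdeg _) (rev δ)
  choose nxt h using this
  exact ⟨nxt, h⟩

variable {nxt : E × Bool → E × Bool}

theorem IsNext.tail (h : IsNext ends nxt) (δ : E × Bool) :
    ends (nxt δ).1 (nxt δ).2 = ends (rev δ).1 (rev δ).2 :=
  mem_halvesAt.1 (h δ).1

variable (ends) in
/-- The vertex to which a half-edge leads is bivalent. -/
def Passes (δ : E × Bool) : Prop := (halvesAt ends (ends (rev δ).1 (rev δ).2)).card = 2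

/-- A bivalent vertex has one other half-edge besides the outgoing one, so the incoming half-edge is
determined. -/
theorem IsNext.injOn (h : IsNext ends nxt) {α β : E × Bool} (hα : Passes ends α)
    (he : nxt α = nxt β) : α = β := by
  have h1 := h.tail α
  have h2 := h.tail β
  rw [← he, h1] at h2
  have := eq_of_bivalent hα (mem_halvesAt.2 rfl) (mem_halvesAt.2 h2.symm)
    (h α).1 (h α).2.symm (he ▸ (h β).2.symm)
  rw [← rev_rev α, this, rev_rev]

variable (nxt) in
/-- The walk that starts with `δ`. -/
def walk (δ : E × Bool) (n : ℕ) : E × Bool := nxt^[n] δ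

theorem walk_zero (δ : E × Bool) : walk nxt δ 0 = δ := rfl

theorem walk_succ (δ : E × Bool) (n : ℕ) : walk nxt δ (n + 1) = nxt (walk nxt δ n) :=
  Function.iterate_succ_apply' _ _ _

variable (ends) in
/-- The half-edge starts at a vertex that is not bivalent. -/
def Starts (δ : E × Bool) : Prop := (halvesAt ends (ends δ.1 δ.2)).card ≠ 2

/-- Going back step by step through bivalent vertices is unambiguous, and a walk cannot pass through
the vertex where another one starts, since that vertex is not bivalent. -/
theorem walk_injective (h : IsNext ends nxt) {δ δ' : E × Bool} (hδ : Starts ends δ)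
    (hδ' : Starts ends δ') (m n : ℕ) (hm : ∀ i < m, Passes ends (walk nxt δ i))
    (hn : ∀ i < n, Passes ends (walk nxt δ' i)) (he : walk nxt δ m = walk nxt δ' n) :
    m = n ∧ δ = δ' := by
  induction m generalizing n with
  | zero =>
    cases n with
    | zero => exact ⟨rfl, he⟩
    | succ n =>
      exfalso
      rw [walk_zero, walk_succ] at he
      have h1 := hn n (Nat.lt_succ_self n)
      rw [Passes, ← h.tail, ← he] at h1
      exact hδ h1
  | succ m ih =>
    have h1 := hm m (Nat.lt_succ_self m)
    cases n with
    | zero =>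
      exfalso
      rw [walk_zero, walk_succ] at he
      rw [Passes, ← h.tail, he] at h1
      exact hδ' h1
    | succ n =>
      rw [walk_succ, walk_succ] at he
      obtain ⟨rfl, h2⟩ := ih n (fun i hi => hm i (hi.trans (Nat.lt_succ_self m)))
        (fun i hi => hn i (hi.trans (Nat.lt_succ_self n))) (h.injOn h1 he)
      exact ⟨rfl, h2⟩

/-- A walk that passes through bivalent vertices forever would be an injective sequence of
half-edges of a finite graph. -/
theorem walk_stops (h : IsNext ends nxt) {δ : E × Bool} (hδ : Starts ends δ) :
    ∃ n, ¬ Passes ends (walk nxt δ n) ∧ ∀ i < n, Passes ends (walk nxt δ i) := by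
  classical
  have : ∃ n, ¬ Passes ends (walk nxt δ n) := by
    by_contra hall
    push Not at hall
    exact not_injective_infinite_finite (walk nxt δ) fun m n he =>
      (walk_injective h hδ hδ m n (fun i _ => hall i) (fun i _ => hall i) he).1
  exact ⟨Nat.find this, Nat.find_spec this, fun i hi => not_not.1 (Nat.find_min this hi)⟩

/-- Continuation through bivalent vertices is forced, so a walk that meets another one in the
opposite direction retraces it to its beginning. -/
theorem walk_reverse (h : IsNext ends nxt) {δ δ' : E × Bool} (n : ℕ) (m : ℕ)
    (hm : ∀ i < m, Passes ends (walk nxt δ i)) (hn : ∀ i < n, Passes ends (walk nxt δ' i))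
    (he : walk nxt δ m = rev (walk nxt δ' n)) :
    ∃ l, (∀ i < l, Passes ends (walk nxt δ i)) ∧ walk nxt δ l = rev δ' := by
  induction n generalizing m with
  | zero => exact ⟨m, hm, he⟩
  | succ n ih =>
    have h0 : ends (rev (walk nxt δ m)).1 (rev (walk nxt δ m)).2 =
        ends (rev (walk nxt δ' n)).1 (rev (walk nxt δ' n)).2 := by
      rw [he, rev_rev, walk_succ, h.tail]
    have h1 : Passes ends (walk nxt δ m) := by
      rw [Passes, h0]
      exact hn n (Nat.lt_succ_self n)
    refine ih (m + 1) ?_ (fun i hi => hn i (hi.trans (Nat.lt_succ_self n))) ?_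
    · intro i hi
      rcases Nat.lt_succ_iff_lt_or_eq.1 hi with hi | rfl
      · exact hm i hi
      · exact h1
    · rw [walk_succ]
      refine eq_of_bivalent h1 (γ := rev (walk nxt δ m)) (h _).1 ?_ (mem_halvesAt.2 rfl) (h _).2 ?_
      · exact mem_halvesAt.2 h0.symm
      · rw [he, rev_rev, walk_succ]
        exact (h _).2.symm

theorem walk_end_of_reverse (h : IsNext ends nxt) {δ δ' : E × Bool} (hδ' : Starts ends δ')
    {m n l : ℕ} (hm : ∀ i < m, Passes ends (walk nxt δ i))
    (hn : ∀ i < n, Passes ends (walk nxt δ' i)) (he : walk nxt δ m = rev (walk nxt δ' n))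
    (hl : ¬ Passes ends (walk nxt δ l)) (hl' : ∀ i < l, Passes ends (walk nxt δ i)) :
    ends (rev (walk nxt δ l)).1 (rev (walk nxt δ l)).2 = ends δ'.1 δ'.2 := by
  obtain ⟨l', h1, h2⟩ := walk_reverse h n m hm hn he
  have h3 : ¬ Passes ends (walk nxt δ l') := by
    rw [h2, Passes, rev_rev]
    exact hδ'
  have : l = l' := le_antisymm (not_lt.1 fun hlt => h3 (hl' _ hlt)) (not_lt.1 fun hlt => hl (h1 _ hlt))
  rw [this, h2, rev_rev]

variable (ends) in
/-- The edges split into two sets with only the vertex `x` in common. -/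
def CutsAt (x : V) : Prop :=
  ∃ A : Set E, (∃ a, a ∈ A) ∧ (∃ a, a ∉ A) ∧
    ∀ a b s s', a ∈ A → b ∉ A → ends a s = ends b s' → ends a s = x

/-- The edges of a closed walk form one side of the partition: its other vertices are bivalent, so
the walk meets the remaining edges only at its base point. -/
theorem cutsAt_of_walk (h : IsNext ends nxt) {δ : E × Bool}
    (hδ : 2 < (halvesAt ends (ends δ.1 δ.2)).card) {n : ℕ}
    (hn : ∀ i < n, Passes ends (walk nxt δ i))
    (he : ends (rev (walk nxt δ n)).1 (rev (walk nxt δ n)).2 = ends δ.1 δ.2) :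
    CutsAt ends (ends δ.1 δ.2) := by
  classical
  refine ⟨{a | ∃ i ≤ n, a = (walk nxt δ i).1}, ⟨_, 0, Nat.zero_le n, rfl⟩, ?_, ?_⟩
  -- A third half-edge at the base point, different from those by which the walk leaves and returns,
  -- belongs to an edge outside the walk.
  · obtain ⟨η, h1, h2⟩ := Finset.exists_mem_notMem_of_card_lt_card
      (lt_of_le_of_lt (Finset.card_le_two (a := δ) (b := rev (walk nxt δ n))) hδ)
    rw [mem_halvesAt] at h1
    refine ⟨η.1, ?_⟩
    rintro ⟨i, hi, h3⟩
    rcases eq_or_eq_rev h3 with h3 | h3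
    · cases i with
      | zero => exact h2 (by rw [h3]; simp [walk_zero])
      | succ i =>
        have h4 := hn i hi
        rw [Passes, ← h.tail, ← walk_succ (nxt := nxt) δ i, ← h3, h1] at h4
        omega
    · rcases hi.lt_or_eq with hi | rfl
      · have h4 := hn i hi
        rw [Passes, ← h3, h1] at h4
        omega
      · exact h2 (by rw [h3]; simp)
  · have key : ∀ i ≤ n, ∀ b s', (¬ ∃ i ≤ n, b = (walk nxt δ i).1) →
        ends (walk nxt δ i).1 (walk nxt δ i).2 = ends b s' →
        ends (walk nxt δ i).1 (walk nxt δ i).2 = ends δ.1 δ.2 := by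
      intro i hi b s' hb h1
      cases i with
      | zero => rfl
      | succ i =>
        exfalso
        have h2 := hn i hi
        rw [walk_succ, h.tail] at h1
        have h3 := eq_of_bivalent h2 (α := (b, s')) (β := walk nxt δ (i + 1))
          (γ := rev (walk nxt δ i)) (mem_halvesAt.2 h1.symm) (walk_succ (nxt := nxt) δ i ▸ (h _).1)
          (mem_halvesAt.2 rfl) ?_ (walk_succ (nxt := nxt) δ i ▸ (h _).2)
        · exact hb ⟨i + 1, hi, congrArg Prod.fst h3⟩
        · intro h4
          exact hb ⟨i, by omega, congrArg Prod.fst h4⟩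
    rintro a b s s' ⟨i, hi, rfl⟩ hb hab
    rcases eq_or_eq_rev (h := ((walk nxt δ i).1, s)) (h' := walk nxt δ i) rfl with h1 | h1
    · have hs : s = (walk nxt δ i).2 := congrArg Prod.snd h1
      subst hs
      exact key i hi b s' hb hab
    · have hs : s = (rev (walk nxt δ i)).2 := congrArg Prod.snd h1
      have h2 : ends (walk nxt δ i).1 s = ends (rev (walk nxt δ i)).1 (rev (walk nxt δ i)).2 := by
        rw [hs]; rfl
      rw [h2] at hab ⊢
      rcases hi.lt_or_eq with hi | rfl
      · rw [← h.tail, ← walk_succ (nxt := nxt) δ i] at hab ⊢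
        exact key (i + 1) hi b s' hb hab
      · exact he

/-- A graph with one more edge than vertices, without cut vertices and vertices of valence less than
two is a theta graph. -/
theorem exists_theta (hdeg : ∀ x, 2 ≤ (halvesAt ends x).card)
    (hcard : Fintype.card E = Fintype.card V + 1) (hcut : ∀ x, ¬ CutsAt ends x) :
    ∃ (k : Fin 3 → ℕ) (p : ∀ j, Fin (k j + 2) → V) (e : ∀ j, Fin (k j + 1) → E),
    (∀ j l, ∃ s, ends (e j l) s = p j l.castSucc ∧ ends (e j l) (!s) = p j l.succ) ∧
    (∀ j l j' l', e j l = e j' l' → j = j' ∧ (l : ℕ) = l') ∧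
    (∀ j l j' l', p j l = p j' l' ↔ (j = j' ∧ (l : ℕ) = l') ∨ ((l : ℕ) = 0 ∧ (l' : ℕ) = 0) ∨
      ((l : ℕ) = k j + 1 ∧ (l' : ℕ) = k j' + 1)) := by
  classical
  obtain ⟨nxt, h⟩ := exists_isNext hdeg
  -- The handshake lemma; the truncated subtraction is harmless because all valences are at least
  -- two.
  have hsum : ∑ x, ((halvesAt ends x).card - 2) = 2 := by
    have h1 : ∑ x, (((halvesAt ends x).card - 2) + 2) = 2 * Fintype.card E := by
      rw [← sum_card_halvesAt (ends := ends)]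
      exact Finset.sum_congr rfl fun x _ => Nat.sub_add_cancel (hdeg x)
    rw [Finset.sum_add_distrib, Finset.sum_const, Finset.card_univ, hcard, smul_eq_mul] at h1
    omega
  -- For a half-edge that starts at a bivalent vertex the length is an irrelevant default value.
  have hlast : ∀ δ : E × Bool, ∃ n, Starts ends δ → ¬ Passes ends (walk nxt δ n) ∧
      ∀ i < n, Passes ends (walk nxt δ i) := by
    intro δ
    by_cases hδ : Starts ends δ
    · obtain ⟨n, hn⟩ := walk_stops h hδ
      exact ⟨n, fun _ => hn⟩
    · exact ⟨0, fun h' => absurd h' hδ⟩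
  choose len hlen using hlast
  have hend : ∀ δ, Starts ends δ → ends (rev (walk nxt δ (len δ))).1 (rev (walk nxt δ (len δ))).2 ≠
      ends δ.1 δ.2 := by
    intro δ hδ he
    refine hcut _ (cutsAt_of_walk h ?_ (hlen δ hδ).2 he)
    have h1 : (halvesAt ends (ends δ.1 δ.2)).card ≠ 2 := hδ
    have := hdeg (ends δ.1 δ.2)
    omega
  obtain ⟨v, hv⟩ : ∃ v, (halvesAt ends v).card ≠ 2 := by
    by_contra hall
    push Not at hall
    simp [hall] at hsum
  obtain ⟨δ₀, hδ₀⟩ : (halvesAt ends v).Nonempty := Finset.card_pos.1 (by have := hdeg v; omega)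
  have hs₀ : ∀ δ ∈ halvesAt ends v, Starts ends δ := by
    intro δ hδ
    rw [Starts, mem_halvesAt.1 hδ]
    exact hv
  set w := ends (rev (walk nxt δ₀ (len δ₀))).1 (rev (walk nxt δ₀ (len δ₀))).2 with hw
  have hw2 : (halvesAt ends w).card ≠ 2 := (hlen δ₀ (hs₀ _ hδ₀)).1
  have hwv : w ≠ v := by
    have := hend δ₀ (hs₀ _ hδ₀)
    rwa [mem_halvesAt.1 hδ₀] at this
  -- Both `v` and `w` exceed valence two, and the total excess is two. So `v` has valence three, and
  -- there is no third branch vertex.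
  have hsplit : ((halvesAt ends v).card - 2) + (((halvesAt ends w).card - 2) +
      ∑ x ∈ (Finset.univ.erase v).erase w, ((halvesAt ends x).card - 2)) = 2 := by
    rw [Finset.add_sum_erase _ (fun x => (halvesAt ends x).card - 2)
      (Finset.mem_erase.2 ⟨hwv, Finset.mem_univ w⟩), Finset.add_sum_erase _ (fun x =>
      (halvesAt ends x).card - 2) (Finset.mem_univ v), hsum]
  have hv3 : (halvesAt ends v).card = 3 := by
    have := hdeg v
    have := hdeg w
    omega
  have hother : ∀ x, (halvesAt ends x).card ≠ 2 → x ≠ v → x = w := by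
    intro x hx hxv
    by_contra hxw
    have h1 := Finset.single_le_sum (f := fun x => (halvesAt ends x).card - 2)
      (fun _ _ => Nat.zero_le _) (Finset.mem_erase.2 ⟨hxw, Finset.mem_erase.2 ⟨hxv,
        Finset.mem_univ x⟩⟩)
    have := hdeg x
    have := hdeg v
    have := hdeg w
    omega
  have hendw : ∀ δ ∈ halvesAt ends v,
      ends (rev (walk nxt δ (len δ))).1 (rev (walk nxt δ (len δ))).2 = w := by
    intro δ hδ
    refine hother _ (hlen δ (hs₀ _ hδ)).1 ?_
    have := hend δ (hs₀ _ hδ)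
    rwa [mem_halvesAt.1 hδ] at this
  set ε := (halvesAt ends v).equivFinOfCardEq hv3 with hε
  set d : Fin 3 → E × Bool := fun j => (ε.symm j).1 with hd
  have hdv : ∀ j, d j ∈ halvesAt ends v := fun j => (ε.symm j).2
  have hdinj : Function.Injective d := Subtype.val_injective.comp ε.symm.injective
  have hpass : ∀ j n, n ≤ len (d j) → ∀ i < n, Passes ends (walk nxt (d j) i) :=
    fun j n hn i hi => (hlen (d j) (hs₀ _ (hdv j))).2 i (by omega)
  -- If two of the walks ran through an edge in opposite directions, the first one would end at `v`
  -- instead of `w`.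
  have hne : ∀ j m j' n, m ≤ len (d j) → n ≤ len (d j') →
      walk nxt (d j) m ≠ rev (walk nxt (d j') n) := by
    intro j m j' n hm hn he
    have := walk_end_of_reverse h (hs₀ _ (hdv j')) (hpass j m hm) (hpass j' n hn) he
      (hlen _ (hs₀ _ (hdv j))).1 (hlen _ (hs₀ _ (hdv j))).2
    rw [hendw _ (hdv j), mem_halvesAt.1 (hdv j')] at this
    exact hwv this
  have heq : ∀ j m j' n, m ≤ len (d j) → n ≤ len (d j') →
      walk nxt (d j) m = walk nxt (d j') n → j = j' ∧ m = n := by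
    intro j m j' n hm hn he
    have := walk_injective h (hs₀ _ (hdv j)) (hs₀ _ (hdv j')) m n (hpass j m hm) (hpass j' n hn) he
    exact ⟨hdinj this.2, this.1⟩
  have htail0 : ∀ j, ends (walk nxt (d j) 0).1 (walk nxt (d j) 0).2 = v :=
    fun j => mem_halvesAt.1 (hdv j)
  have htaile : ∀ j, ends (walk nxt (d j) (len (d j) + 1)).1 (walk nxt (d j) (len (d j) + 1)).2 = w := by
    intro j
    rw [walk_succ, h.tail, hendw _ (hdv j)]
  have htailm : ∀ j n, n < len (d j) → (halvesAt ends
      (ends (walk nxt (d j) (n + 1)).1 (walk nxt (d j) (n + 1)).2)).card = 2 := by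
    intro j n hn
    rw [walk_succ, h.tail]
    exact hpass j _ le_rfl n hn
  refine ⟨fun j => len (d j), fun j l => ends (walk nxt (d j) l).1 (walk nxt (d j) l).2,
    fun j l => (walk nxt (d j) l).1, ?_, ?_, ?_⟩
  · intro j l
    refine ⟨(walk nxt (d j) l).2, rfl, ?_⟩
    dsimp only
    rw [Fin.val_succ, walk_succ, h.tail]
    rfl
  · intro j l j' l' he
    have h1 : (l : ℕ) < len (d j) + 1 := l.2
    have h2 : (l' : ℕ) < len (d j') + 1 := l'.2
    rcases eq_or_eq_rev he with h3 | h3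
    · exact heq j l j' l' (by omega) (by omega) h3
    · exact absurd h3 (hne j l j' l' (by omega) (by omega))
  · rintro j ⟨l, hl⟩ j' ⟨l', hl'⟩
    replace hl : l < len (d j) + 2 := hl
    replace hl' : l' < len (d j') + 2 := hl'
    dsimp only
    constructor
    · intro he
      rcases l with _ | l
      · rw [htail0] at he
        rcases l' with _ | l'
        · exact .inr (.inl ⟨rfl, rfl⟩)
        · exfalso
          rcases Nat.lt_or_ge l' (len (d j')) with h1 | h1
          · exact hv (he ▸ htailm j' l' h1)
          · have : l' = len (d j') := by omega
            subst this
            rw [htaile] at he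
            exact hwv he.symm
      · rcases Nat.lt_or_ge l (len (d j)) with h1 | h1
        · have hb := htailm j l h1
          rcases l' with _ | l'
          · rw [htail0] at he
            exact absurd (he ▸ hb) hv
          · rcases Nat.lt_or_ge l' (len (d j')) with h2 | h2
            · left
              have h3 := heq j (l + 1) j' (l' + 1) (by omega) (by omega)
              refine h3 (eq_of_bivalent hb (γ := rev (walk nxt (d j) l)) (mem_halvesAt.2 rfl)
                (mem_halvesAt.2 he.symm) ?_ (hne _ _ _ _ (by omega) (by omega))
                (hne _ _ _ _ (by omega) (by omega)))
              rw [mem_halvesAt, walk_succ, h.tail]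
            · have : l' = len (d j') := by omega
              subst this
              rw [htaile] at he
              exact absurd (he ▸ hb) hw2
        · have : l = len (d j) := by omega
          subst this
          rw [htaile] at he
          rcases l' with _ | l'
          · rw [htail0] at he
            exact absurd he hwv
          · rcases Nat.lt_or_ge l' (len (d j')) with h2 | h2
            · exact absurd (he ▸ htailm j' l' h2) hw2
            · exact .inr (.inr ⟨rfl, by omega⟩)
    · rintro (⟨rfl, rfl⟩ | ⟨rfl, rfl⟩ | ⟨rfl, rfl⟩)
      · rfl
      · rw [htail0, htail0]
      · rw [htaile, htaile]

end Frame

end TwoLoop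

namespace TwoLoop
open OGraph

/-! ### Theta graphs exhaust the frame -/

/-- The vertices of a family of paths with common end points. -/
def pathVert {V : Type*} {k : Fin 3 → ℕ} (p : ∀ j, Fin (k j + 2) → V) : TVert k → V
  | .inl x => p x.1 x.2.succ.castSucc
  | .inr false => p 0 0
  | .inr true => p 0 (Fin.last _)

section Exhaust

variable {V E : Type*} {ends : E → Bool → V} {k : Fin 3 → ℕ}
  {p : ∀ j, Fin (k j + 2) → V} {e : ∀ j, Fin (k j + 1) → E}

theorem pathVert_tvert (h3 : ∀ j l j' l', p j l = p j' l' ↔ (j = j' ∧ (l : ℕ) = l') ∨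
      ((l : ℕ) = 0 ∧ (l' : ℕ) = 0) ∨ ((l : ℕ) = k j + 1 ∧ (l' : ℕ) = k j' + 1))
    (j : Fin 3) (l : Fin (k j + 2)) : pathVert p (tvert k j l) = p j l := by
  obtain ⟨l, hl⟩ := l
  rcases l with _ | l
  · exact (h3 _ _ _ _).2 (.inr (.inl ⟨rfl, rfl⟩))
  · rcases Nat.lt_or_ge l (k j) with h | h
    · rw [tvert_succ h]
      rfl
    · rw [tvert_last (l := l + 1) (by omega)]
      exact (h3 _ _ _ _).2 (.inr (.inr ⟨rfl, by change l + 1 = k j + 1; omega⟩))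

theorem pathVert_injective (h3 : ∀ j l j' l', p j l = p j' l' ↔ (j = j' ∧ (l : ℕ) = l') ∨
      ((l : ℕ) = 0 ∧ (l' : ℕ) = 0) ∨ ((l : ℕ) = k j + 1 ∧ (l' : ℕ) = k j' + 1)) :
    Function.Injective (pathVert p) := by
  rintro (⟨j, l, hl⟩ | _ | _) (⟨j', l', hl'⟩ | _ | _) h
  all_goals
    have h' := (h3 _ _ _ _).1 h
    simp at h'
  · rw [Sum.inl.injEq]
    exact Pos.ext (by dsimp only; omega) (by dsimp only; omega)
  all_goals first | rfl | omega | (rcases h' with ⟨rfl, h'⟩ | h' <;> omega)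

variable [Fintype V] [Fintype E]

/-- A theta subgraph has one edge more than it has vertices, as the whole graph does, so as many
edges as vertices are missing. The half-edges at missing vertices lie on missing edges and, by
counting, exhaust them. Missing edges would thus be disjoint from the theta subgraph, against the
absence of cuts. Interior vertices are bivalent because the two end points use up the total excess.
-/
theorem exhaust (hdeg : ∀ x, 2 ≤ (halvesAt ends x).card)
    (hcard : Fintype.card E = Fintype.card V + 1) (hcut : ∀ x, ¬ CutsAt ends x)
    (h1 : ∀ j l, ∃ s, ends (e j l) s = p j l.castSucc ∧ ends (e j l) (!s) = p j l.succ)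
    (h2 : ∀ j l j' l', e j l = e j' l' → j = j' ∧ (l : ℕ) = l')
    (h3 : ∀ j l j' l', p j l = p j' l' ↔ (j = j' ∧ (l : ℕ) = l') ∨
      ((l : ℕ) = 0 ∧ (l' : ℕ) = 0) ∨ ((l : ℕ) = k j + 1 ∧ (l' : ℕ) = k j' + 1)) :
    Function.Bijective (pathVert p) ∧
    Function.Bijective (fun x : Pos (fun j => k j + 1) => e x.1 x.2) ∧
    ∀ x : Pos k, (halvesAt ends (pathVert p (.inl x))).card = 2 := by
  classical
  have hP := pathVert_injective h3
  have he : Function.Injective (fun x : Pos (fun j => k j + 1) => e x.1 x.2) := by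
    intro x y hxy
    exact Pos.ext (h2 _ _ _ _ hxy).1 (h2 _ _ _ _ hxy).2
  have hcT : Fintype.card (TVert k) = ∑ j, k j + 2 := by simp
  have hcP : Fintype.card (Pos fun j => k j + 1) = ∑ j, k j + 3 := by
    simp [Finset.sum_add_distrib]
  have hends : ∀ (x : Pos fun j => k j + 1) s, ∃ v, ends (e x.1 x.2) s = pathVert p v := by
    intro x s
    obtain ⟨t, ht, ht'⟩ := h1 x.1 x.2
    by_cases hs : s = t
    · exact ⟨_, by rw [hs, ht, ← pathVert_tvert h3]⟩
    · have : s = !t := by cases s <;> cases t <;> simp at hs ⊢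
      exact ⟨_, by rw [this, ht', ← pathVert_tvert h3]⟩
  set RP : Finset V := Finset.univ.image (pathVert p) with hRP
  set RE : Finset E := Finset.univ.image (fun x : Pos (fun j => k j + 1) => e x.1 x.2) with hRE
  have hcRP : RP.card = ∑ j, k j + 2 := by rw [hRP, Finset.card_image_of_injective _ hP,
    Finset.card_univ, hcT]
  have hcRE : RE.card = ∑ j, k j + 3 := by rw [hRE, Finset.card_image_of_injective _ he,
    Finset.card_univ, hcP]
  have hcc : RPᶜ.card = REᶜ.card := by
    rw [Finset.card_compl, Finset.card_compl]
    omega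
  have hsub : RPᶜ.biUnion (halvesAt ends) ⊆ REᶜ ×ˢ Finset.univ := by
    intro h hh
    obtain ⟨x, hx, hhx⟩ := Finset.mem_biUnion.1 hh
    rw [mem_halvesAt] at hhx
    simp only [Finset.mem_product, Finset.mem_univ, and_true, Finset.mem_compl]
    intro hmem
    obtain ⟨y, -, hy⟩ := Finset.mem_image.1 hmem
    obtain ⟨v, hv⟩ := hends y h.2
    rw [hy, hhx] at hv
    exact Finset.mem_compl.1 hx (Finset.mem_image.2 ⟨v, Finset.mem_univ _, hv.symm⟩)
  have hbig : 2 * RPᶜ.card ≤ (RPᶜ.biUnion (halvesAt ends)).card := by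
    rw [Finset.card_biUnion]
    · rw [mul_comm, ← smul_eq_mul]
      exact Finset.card_nsmul_le_sum _ _ _ fun x _ => hdeg x
    · intro x _ y _ hxy
      rw [Function.onFun, Finset.disjoint_left]
      intro h hx hy
      exact hxy ((mem_halvesAt.1 hx).symm.trans (mem_halvesAt.1 hy))
  have heq : RPᶜ.biUnion (halvesAt ends) = REᶜ ×ˢ Finset.univ := by
    refine Finset.eq_of_subset_of_card_le hsub ?_
    rw [Finset.card_product, Finset.card_univ, Fintype.card_bool, ← hcc, mul_comm]
    exact hbig
  have hsurj : Function.Surjective (fun x : Pos (fun j => k j + 1) => e x.1 x.2) := by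
    by_contra hns
    obtain ⟨b, hb⟩ : ∃ b, ∀ x : Pos (fun j => k j + 1), e x.1 x.2 ≠ b := by
      by_contra hall
      push Not at hall
      exact hns hall
    -- The two sets of edges would have no vertex in common, so any vertex serves as the cut.
    refine hcut (p 0 0) ⟨{a | a ∈ RE}, ⟨e 0 0, Finset.mem_image.2
      ⟨(⟨0, 0⟩ : Pos fun j => k j + 1), Finset.mem_univ _, rfl⟩⟩,
      ⟨b, fun h => ?_⟩, ?_⟩
    · obtain ⟨x, -, hx⟩ := Finset.mem_image.1 (show b ∈ RE from h)
      exact hb x hx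
    · intro a c s s' ha hc hac
      exfalso
      have : (c, s') ∈ RPᶜ.biUnion (halvesAt ends) := by
        rw [heq]
        simpa using hc
      obtain ⟨x, hx, hhx⟩ := Finset.mem_biUnion.1 this
      rw [mem_halvesAt] at hhx
      obtain ⟨y, -, hy⟩ := Finset.mem_image.1 (show a ∈ RE from ha)
      obtain ⟨v, hv⟩ := hends y s
      refine Finset.mem_compl.1 hx (Finset.mem_image.2 ⟨v, Finset.mem_univ _, ?_⟩)
      rw [← hv, ← hhx, ← hac]
      exact congrArg (fun z => ends z s) hy
  have hcE := Fintype.card_of_bijective ⟨he, hsurj⟩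
  refine ⟨(Fintype.bijective_iff_injective_and_card _).2 ⟨hP, by omega⟩, ⟨he, hsurj⟩, ?_⟩
  have hsum : ∑ x, ((halvesAt ends x).card - 2) = 2 := by
    have h1 : ∑ x, (((halvesAt ends x).card - 2) + 2) = 2 * Fintype.card E := by
      rw [← sum_card_halvesAt (ends := ends)]
      exact Finset.sum_congr rfl fun x _ => Nat.sub_add_cancel (hdeg x)
    rw [Finset.sum_add_distrib, Finset.sum_const, Finset.card_univ, hcard, smul_eq_mul] at h1
    omega
  have hthree : ∀ (x : V) (d : Fin 3 → E × Bool), (∀ j, ends (d j).1 (d j).2 = x) →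
      (∀ i j, (d i).1 = (d j).1 → i = j) → 3 ≤ (halvesAt ends x).card := by
    intro x d hd hinj
    have : Finset.univ.image d ⊆ halvesAt ends x := by
      intro h hh
      obtain ⟨j, -, rfl⟩ := Finset.mem_image.1 hh
      exact mem_halvesAt.2 (hd j)
    have h4 := Finset.card_le_card this
    rw [Finset.card_image_of_injective _ fun i j hij => hinj i j (congrArg Prod.fst hij)] at h4
    simpa using h4
  have hstart : 3 ≤ (halvesAt ends (p 0 0)).card := by
    choose s hs using fun j => h1 j 0
    refine hthree _ (fun j => (e j 0, s j)) (fun j => ?_) fun i j hij => (h2 _ _ _ _ hij).1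
    rw [(hs j).1]
    exact (h3 _ _ _ _).2 (.inr (.inl ⟨rfl, rfl⟩))
  have hlast : 3 ≤ (halvesAt ends (p 0 (Fin.last _))).card := by
    choose s hs using fun j => h1 j (Fin.last _)
    refine hthree _ (fun j => (e j (Fin.last _), !s j)) (fun j => ?_) fun i j hij =>
      (h2 _ _ _ _ hij).1
    rw [(hs j).2]
    exact (h3 _ _ _ _).2 (.inr (.inr ⟨rfl, rfl⟩))
  intro x
  by_contra hx
  have hne1 : pathVert p (.inl x) ≠ p 0 0 := fun h => by
    have := hP (a₁ := .inl x) (a₂ := .inr false) h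
    cases this
  have hne2 : pathVert p (.inl x) ≠ p 0 (Fin.last _) := fun h => by
    have := hP (a₁ := .inl x) (a₂ := .inr true) h
    cases this
  have hne3 : p 0 0 ≠ p 0 (Fin.last _) := fun h => by
    have := hP (a₁ := .inr false) (a₂ := .inr true) h
    cases this
  -- The two end points already contribute two, which leaves nothing for a third vertex.
  have h5 : ∑ y ∈ {pathVert p (.inl x), p 0 0, p 0 (Fin.last _)},
      ((halvesAt ends y).card - 2) ≤ 2 := by
    refine le_trans ?_ hsum.le
    exact Finset.sum_le_sum_of_subset (Finset.subset_univ _)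
  rw [Finset.sum_insert (by simp [hne1, hne2]), Finset.sum_insert (by simpa using hne3),
    Finset.sum_singleton] at h5
  have := hdeg (pathVert p (.inl x))
  omega

end Exhaust

/-! ### The structure of two-loop hairy graphs -/

namespace OGraph

/-- The frame of a two-loop hairy graph together with the positions of the hairs. -/
structure FrameData (Γ : OGraph) where
  fends : {a // ¬ Γ.IsTreeType a} → Bool → Γ.Inn
  hedge : Γ.Ext → Γ.Edge
  hside : Γ.Ext → Bool
  att : Γ.Ext → Γ.Inn
  fends_eq : ∀ a s, Γ.ends a.1 s = .inr (fends a s)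
  hedge_ext : ∀ u, Γ.ends (hedge u) (hside u) = .inl u
  hedge_inn : ∀ u, Γ.ends (hedge u) (!hside u) = .inr (att u)
  att_injective : Function.Injective att
  hedge_injective : Function.Injective hedge
  isTreeType_iff : ∀ a, Γ.IsTreeType a ↔ ∃ u, a = hedge u

end OGraph

namespace OGraph.IsTwoLoopHairy

variable {Γ : OGraph}

/-- The univalent vertex of a hair must be external, as internal vertices have valence at least
three. -/
theorem isTreeType_iff (h : Γ.IsTwoLoopHairy) {a : Γ.Edge} : Γ.IsTreeType a ↔ ∃ s u, Γ.ends a s = .inl u := by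
  constructor
  · intro ha
    obtain ⟨-, s, h1, -⟩ := h.hair a ha
    rcases hx : Γ.ends a s with u | x
    · exact ⟨s, u, hx⟩
    · have := h.admissible.valence_inn x
      rw [hx] at h1
      omega
  · rintro ⟨s, u, ha⟩
    exact isTreeType_of_ext h.admissible.connected h.admissible.valence_ext h.loops_eq ha

theorem exists_ends (h : Γ.IsTwoLoopHairy) {a : Γ.Edge} (ha : ¬ Γ.IsTreeType a) (s : Bool) :
    ∃ x, Γ.ends a s = .inr x := by
  rcases hx : Γ.ends a s with u | x
  · exact absurd (h.isTreeType_iff.2 ⟨s, u, hx⟩) ha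
  · exact ⟨x, rfl⟩

/-- Every external vertex is joined by a hair to an internal vertex. -/
theorem exists_attach (h : Γ.IsTwoLoopHairy) (u : Γ.Ext) : ∃ (a : Γ.Edge) (s : Bool) (x : Γ.Inn), Γ.ends a s = .inl u ∧
    Γ.ends a (!s) = .inr x ∧ ∀ b, b ≠ a → Γ.IsTreeType b → ∀ s', Γ.ends b s' ≠ .inr x := by
  obtain ⟨⟨a, s⟩, ha, -⟩ := existsUnique_half h.admissible.valence_ext u
  have ht := h.isTreeType_iff.2 ⟨s, u, ha⟩
  obtain ⟨-, s₀, h1, ⟨b, s', hb, hbs⟩, h3⟩ := h.hair a ht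
  obtain ⟨x, hx⟩ := h.exists_ends hb s'
  rw [hx] at hbs
  have : s = s₀ := by
    by_contra hne
    have : s = !s₀ := by cases s <;> cases s₀ <;> simp at hne ⊢
    subst this
    rw [← hbs] at ha
    cases ha
  subst this
  refine ⟨a, s, x, ha, hbs.symm, ?_⟩
  rw [hbs]
  exact h3

theorem nonempty_frameData (h : Γ.IsTwoLoopHairy) : Nonempty Γ.FrameData := by
  choose hedge hside att h1 h2 h3 using h.exists_attach
  choose fends hf using fun (a : {a // ¬ Γ.IsTreeType a}) s => h.exists_ends a.2 s
  have hinj : Function.Injective hedge := by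
    intro u u' he
    by_cases hs : hside u = hside u'
    · exact Sum.inl_injective ((h1 u).symm.trans (by rw [he, hs, h1]))
    · have hs' : (!hside u) = hside u' := by
        revert hs; cases hside u <;> cases hside u' <;> simp
      have := h2 u
      rw [he, hs', h1] at this
      cases this
  refine ⟨⟨fends, hedge, hside, att, hf, h1, h2, ?_, hinj, ?_⟩⟩
  · intro u u' ha
    by_contra hne
    refine h3 u (hedge u') (fun he => hne (hinj he).symm)
      (h.isTreeType_iff.2 ⟨_, _, h1 u'⟩) (!hside u') ?_
    rw [h2, ha]
  · intro a
    rw [h.isTreeType_iff]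
    constructor
    · rintro ⟨s, u, ha⟩
      have := (existsUnique_half h.admissible.valence_ext u).unique (y₁ := (a, s))
        (y₂ := (hedge u, hside u)) ha (h1 u)
      exact ⟨u, congrArg Prod.fst this⟩
    · rintro ⟨u, rfl⟩
      exact ⟨_, _, h1 u⟩

end OGraph.IsTwoLoopHairy

namespace OGraph.FrameData

variable {Γ : OGraph} (D : Γ.FrameData)

open Classical in
theorem valence_eq (x : Γ.Inn) : Γ.valence (.inr x) = (halvesAt D.fends x).card +
    (Finset.univ.filter fun u => D.att u = x).card := by
  have h1 : Γ.halfEdges (.inr x) = (halvesAt D.fends x).image (fun h => (h.1.1, h.2)) ∪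
      (Finset.univ.filter fun u => D.att u = x).image (fun u => (D.hedge u, !D.hside u)) := by
    ext ⟨a, s⟩
    rw [mem_halfEdges, Finset.mem_union, Finset.mem_image, Finset.mem_image]
    by_cases ha : Γ.IsTreeType a
    · obtain ⟨u, rfl⟩ := (D.isTreeType_iff a).1 ha
      constructor
      · intro hx
        right
        have hs : s = !D.hside u := by
          by_contra hne
          have hs : s = D.hside u := by revert hne; cases s <;> cases D.hside u <;> simp
          rw [hs, D.hedge_ext] at hx
          cases hx
        subst hs
        rw [D.hedge_inn] at hx
        exact ⟨u, by simpa using Sum.inr_injective hx, rfl⟩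
      · rintro (⟨⟨b, t⟩, -, hb⟩ | ⟨u', hu', he⟩)
        · have h1 : b.1 = D.hedge u := congrArg Prod.fst hb
          exact absurd (h1 ▸ ha) b.2
        · have h1 := D.hedge_injective (congrArg Prod.fst he)
          subst h1
          have h2 : (!D.hside u') = s := congrArg Prod.snd he
          rw [← h2, D.hedge_inn, (Finset.mem_filter.1 hu').2]
    · constructor
      · intro hx
        left
        exact ⟨(⟨a, ha⟩, s), mem_halvesAt.2 (Sum.inr_injective ((D.fends_eq ⟨a, ha⟩ s).symm.trans hx)),
          rfl⟩
      · rintro (⟨⟨b, t⟩, hb, he⟩ | ⟨u, -, he⟩)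
        · have h1 : b.1 = a := congrArg Prod.fst he
          have h2 : t = s := congrArg Prod.snd he
          subst h2
          rw [← h1, D.fends_eq, mem_halvesAt.1 hb]
        · exact absurd ((D.isTreeType_iff a).2 ⟨u, (congrArg Prod.fst he).symm⟩) ha
  rw [valence, h1, Finset.card_union_of_disjoint, Finset.card_image_of_injective,
    Finset.card_image_of_injective]
  · intro u u' he
    exact D.hedge_injective (congrArg Prod.fst he)
  · rintro ⟨⟨a, ha⟩, s⟩ ⟨⟨b, hb⟩, t⟩ he
    simp only [Prod.mk.injEq] at he
    obtain ⟨rfl, rfl⟩ := he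
    rfl
  · rw [Finset.disjoint_left]
    rintro _ h2 h3
    obtain ⟨⟨b, t⟩, -, rfl⟩ := Finset.mem_image.1 h2
    obtain ⟨u, -, he⟩ := Finset.mem_image.1 h3
    exact b.2 ((D.isTreeType_iff _).2 ⟨u, (congrArg Prod.fst he).symm⟩)

open Classical in
theorem card_att_le (x : Γ.Inn) : (Finset.univ.filter fun u => D.att u = x).card ≤ 1 := by
  rw [Finset.card_le_one]
  intro u hu u' hu'
  exact D.att_injective ((Finset.mem_filter.1 hu).2.trans (Finset.mem_filter.1 hu').2.symm)

open Classical in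
theorem card_edge (D : Γ.FrameData) : Fintype.card Γ.Edge =
    Fintype.card {a // ¬ Γ.IsTreeType a} + Fintype.card Γ.Ext := by
  have h1 : Fintype.card {a // Γ.IsTreeType a} = Fintype.card Γ.Ext := by
    symm
    refine Fintype.card_of_bijective (f := fun u => ⟨D.hedge u, (D.isTreeType_iff _).2 ⟨u, rfl⟩⟩)
      ⟨fun u u' he => D.hedge_injective (congrArg Subtype.val he), ?_⟩
    rintro ⟨a, ha⟩
    obtain ⟨u, rfl⟩ := (D.isTreeType_iff a).1 ha
    exact ⟨u, rfl⟩
  rw [← h1, add_comm, ← Fintype.card_sum]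
  exact Fintype.card_congr (Equiv.sumCompl _).symm

end OGraph.FrameData

namespace OGraph.IsTwoLoopHairy

variable {Γ : OGraph}

-- Each hair accounts for one edge and one external vertex, so deleting the hairs does not change
-- the number of loops.
open Classical in
theorem frame_card (h : Γ.IsTwoLoopHairy) (D : Γ.FrameData) :
    Fintype.card {a // ¬ Γ.IsTreeType a} = Fintype.card Γ.Inn + 1 := by
  have h1 := h.loops_eq
  have h2 := D.card_edge
  rw [loops, Fintype.card_sum, h2] at h1
  push_cast at h1
  omega

-- A vertex of valence at least three loses at most one half-edge when the hairs are deleted.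
open Classical in
theorem two_le_frame (h : Γ.IsTwoLoopHairy) (D : Γ.FrameData) (x : Γ.Inn) :
    2 ≤ (halvesAt D.fends x).card := by
  have h1 := D.valence_eq x
  have h2 := h.admissible.valence_inn x
  have h3 := D.card_att_le x
  omega

theorem not_cutsAt (h : Γ.IsTwoLoopHairy) (D : Γ.FrameData) (x : Γ.Inn) : ¬ CutsAt D.fends x := by
  rintro ⟨A, ⟨a, ha⟩, ⟨b, hb⟩, hA⟩
  refine h.not_cut (.inr x) ⟨Subtype.val '' A, ⟨a.1, a.2, a, ha, rfl⟩, ⟨b.1, b.2, ?_⟩, ?_⟩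
  · rintro ⟨c, hc, hcb⟩
    exact hb (Subtype.ext hcb ▸ hc)
  · rintro c d s s' hc hd ⟨c', hc', rfl⟩ hd' he
    rw [D.fends_eq, D.fends_eq ⟨d, hd⟩] at he
    rw [D.fends_eq, hA c' ⟨d, hd⟩ s s' hc' (fun hmem => hd' ⟨_, hmem, rfl⟩) (Sum.inr_injective he)]

open Classical in
theorem exists_isTheta (h : Γ.IsTwoLoopHairy) : ∃ k, Γ.IsTheta k := by
  obtain ⟨D⟩ := h.nonempty_frameData
  obtain ⟨k, p, e, h1, h2, h3⟩ := exists_theta (h.two_le_frame D) (h.frame_card D) (h.not_cutsAt D)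
  refine ⟨k, p, fun j l => (e j l).1, fun j l => ?_, fun j l j' l' he => h2 _ _ _ _ (Subtype.ext he),
    h3⟩
  obtain ⟨s, hs, hs'⟩ := h1 j l
  exact ⟨s, by rw [D.fends_eq, hs], by rw [D.fends_eq, hs']⟩

open Classical in
/-- A two-loop hairy graph with a given theta subgraph is a standard theta graph. -/
theorem exists_weakIso (h : Γ.IsTwoLoopHairy) {k : Fin 3 → ℕ} (hk : Γ.IsTheta k) :
    ∃ s, Nonempty (WeakIso (theta s k) Γ) := by
  obtain ⟨D⟩ := h.nonempty_frameData
  obtain ⟨p, e₀, h1, h2, h3⟩ := hk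
  have hfr : ∀ j l, ¬ Γ.IsTreeType (e₀ j l) := by
    intro j l ht
    obtain ⟨s, u, hu⟩ := h.isTreeType_iff.1 ht
    obtain ⟨t, ht, ht'⟩ := h1 j l
    by_cases hs : s = t
    · rw [hs, ht] at hu
      cases hu
    · have : s = !t := by cases s <;> cases t <;> simp at hs ⊢
      rw [this, ht'] at hu
      cases hu
  set e : ∀ j, Fin (k j + 1) → {a // ¬ Γ.IsTreeType a} := fun j l => ⟨e₀ j l, hfr j l⟩ with he
  have h1' : ∀ j l, ∃ s, D.fends (e j l) s = p j l.castSucc ∧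
      D.fends (e j l) (!s) = p j l.succ := by
    intro j l
    obtain ⟨t, ht, ht'⟩ := h1 j l
    refine ⟨t, Sum.inr_injective (β := Γ.Inn) (α := Γ.Ext) ?_,
      Sum.inr_injective (β := Γ.Inn) (α := Γ.Ext) ?_⟩
    · rw [← D.fends_eq, ← ht]
    · rw [← D.fends_eq, ← ht']
  obtain ⟨hP, hE, hdeg⟩ := exhaust (h.two_le_frame D) (h.frame_card D) (h.not_cutsAt D) h1'
    (fun j l j' l' hh => h2 _ _ _ _ (congrArg Subtype.val hh)) h3
  set inn : TVert k ≃ Γ.Inn := Equiv.ofBijective _ hP with hinn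
  have hinn' : ∀ v, inn v = pathVert p v := fun v => rfl
  set s : Bool → Bool := fun b => decide (∃ u, D.att u = inn (.inr b)) with hs
  -- Interior vertices of the paths are bivalent in the frame, so their valence in the graph forces
  -- a hair. End points are free, and `s` records their hairs.
  have hair : ∀ v : TVert k, HasHair s v ↔ ∃ u, D.att u = inn v := by
    rintro (x | b)
    · refine ⟨fun _ => ?_, fun _ => trivial⟩
      have hv := D.valence_eq (inn (.inl x))
      have hv3 := h.admissible.valence_inn (inn (.inl x))
      have h5 := hdeg x
      rw [hinn', h5] at hv
      rw [hinn', hv] at hv3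
      obtain ⟨u, hu⟩ := Finset.card_pos.1 (by omega :
        0 < (Finset.univ.filter fun u => D.att u = pathVert p (.inl x)).card)
      exact ⟨u, (Finset.mem_filter.1 hu).2⟩
    · change decide _ = true ↔ _
      rw [decide_eq_true_iff]
  set g : Γ.Ext → Hair s k := fun u => ⟨inn.symm (D.att u),
    (hair _).2 ⟨u, by rw [Equiv.apply_symm_apply]⟩⟩ with hg
  have hgb : Function.Bijective g := by
    constructor
    · intro u u' hu
      exact D.att_injective (inn.symm.injective (congrArg Subtype.val hu))
    · rintro ⟨v, hv⟩
      obtain ⟨u, hu⟩ := (hair v).1 hv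
      exact ⟨u, Subtype.ext (by rw [hg]; simp [hu])⟩
  set ext : Γ.Ext ≃ Hair s k := Equiv.ofBijective g hgb with hext
  have hattext : ∀ x : Hair s k, D.att (ext.symm x) = inn x.1 := by
    intro x
    obtain ⟨u, rfl⟩ := ext.surjective x
    rw [Equiv.symm_apply_apply]
    change _ = inn (inn.symm (D.att u))
    rw [Equiv.apply_symm_apply]
  set f : Pos (fun j => k j + 1) ⊕ Hair s k → Γ.Edge :=
    Sum.elim (fun x => e₀ x.1 x.2) (fun x => D.hedge (ext.symm x)) with hf
  have hfb : Function.Bijective f := by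
    constructor
    · rintro (x | x) (y | y) hxy
      · exact congrArg Sum.inl (hE.1 (Subtype.ext hxy))
      · exact absurd ((D.isTreeType_iff _).2 ⟨_, hxy⟩) (hfr x.1 x.2)
      · exact absurd ((D.isTreeType_iff _).2 ⟨_, hxy.symm⟩) (hfr y.1 y.2)
      · exact congrArg Sum.inr (ext.symm.injective (D.hedge_injective hxy))
    · intro a
      by_cases ha : Γ.IsTreeType a
      · obtain ⟨u, rfl⟩ := (D.isTreeType_iff a).1 ha
        refine ⟨.inr (ext u), ?_⟩
        change D.hedge (ext.symm (ext u)) = _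
        rw [Equiv.symm_apply_apply]
      · obtain ⟨x, hx⟩ := hE.2 ⟨a, ha⟩
        exact ⟨.inl x, congrArg Subtype.val hx⟩
  refine ⟨s, ⟨⟨ext.symm, inn, Equiv.ofBijective f hfb, ?_⟩⟩⟩
  rintro (⟨j, l⟩ | x)
  · obtain ⟨t, ht, ht'⟩ := h1 j l
    refine ⟨t, ?_⟩
    rintro (_ | _)
    · rw [Bool.xor_false]
      refine ht.trans ?_
      exact congrArg Sum.inr (pathVert_tvert h3 j l.castSucc).symm
    · rw [Bool.xor_true]
      refine ht'.trans ?_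
      exact congrArg Sum.inr (pathVert_tvert h3 j l.succ).symm
  · refine ⟨!D.hside (ext.symm x), ?_⟩
    rintro (_ | _)
    · rw [Bool.xor_false]
      refine (D.hedge_inn _).trans ?_
      exact congrArg Sum.inr (hattext x)
    · rw [Bool.xor_true, Bool.not_not]
      exact D.hedge_ext _

end OGraph.IsTwoLoopHairy

end TwoLoop

namespace TwoLoop
open OGraph

/-! ### Invariants of isomorphic graphs -/

namespace WeakIso

variable {Γ Γ' : OGraph}

theorem card_halfEdges_eq (φ : WeakIso Γ Γ') (x : Γ.Vert) :
    (Γ'.halfEdges (Sum.map φ.ext φ.inn x)).card = (Γ.halfEdges x).card := by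
  choose t ht using φ.ends_eq
  symm
  refine Finset.card_bij (fun h _ => (φ.edge h.1, xor (t h.1) h.2)) ?_ ?_ ?_
  · rintro ⟨a, s⟩ h
    rw [mem_halfEdges] at h ⊢
    rw [ht, h]
  · rintro ⟨a, s⟩ - ⟨b, s'⟩ - h
    obtain rfl := φ.edge.injective (congrArg Prod.fst h)
    have h2 : xor (t a) s = xor (t a) s' := congrArg Prod.snd h
    rw [Bool.xor_right_inj.1 h2]
  · rintro ⟨b, s⟩ h
    obtain ⟨a, rfl⟩ := φ.edge.surjective b
    rw [mem_halfEdges] at h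
    refine ⟨(a, xor (t a) s), ?_, ?_⟩
    · rw [mem_halfEdges]
      have h1 := ht a (xor (t a) s)
      rw [← Bool.xor_assoc, Bool.xor_self, Bool.false_xor, h] at h1
      exact (Sum.map_injective.2 ⟨φ.ext.injective, φ.inn.injective⟩ h1).symm
    · change (φ.edge a, xor (t a) (xor (t a) s)) = _
      rw [← Bool.xor_assoc, Bool.xor_self, Bool.false_xor]

theorem defect_eq (φ : WeakIso Γ Γ') : Γ.defect = Γ'.defect := by
  rw [defect, defect, ← Equiv.sum_comp φ.inn]
  refine Finset.sum_congr rfl fun x _ => ?_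
  rw [valence, valence, ← φ.card_halfEdges_eq]
  rfl

theorem hodge_eq (φ : WeakIso Γ Γ') : Γ.hodge = Γ'.hodge := Fintype.card_congr φ.ext

end WeakIso

theorem totalDegree_eq (m N : ℕ) (Γ : OGraph) : Γ.totalDegree m N =
    -(m : ℤ) * Fintype.card Γ.Ext - N * Fintype.card Γ.Inn + (N - 1) * Fintype.card Γ.Edge := by
  rw [totalDegree, Fintype.sum_sum_type, Fintype.sum_sum_type]
  simp only [elemDegree, Finset.sum_const, Finset.card_univ, nsmul_eq_mul]
  ring

theorem WeakIso.totalDegree_eq (m N : ℕ) {Γ Γ' : OGraph} (φ : WeakIso Γ Γ') :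
    Γ.totalDegree m N = Γ'.totalDegree m N := by
  rw [TwoLoop.totalDegree_eq, TwoLoop.totalDegree_eq, Fintype.card_congr φ.ext,
    Fintype.card_congr φ.inn, Fintype.card_congr φ.edge]

/-! ### Isomorphisms of theta graphs -/

section Rigid

variable {s s' : Bool → Bool} {k k' : Fin 3 → ℕ}

/-- Hairs are recognized as the edges with an external end, hence they go to hairs and frame edges
to frame edges. -/
theorem weakIso_edge_inr (φ : WeakIso (theta s k) (theta s' k')) (x : Hair s k) :
    φ.edge (.inr x) = .inr (φ.ext x) ∧ (φ.ext x).1 = φ.inn x.1 := by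
  obtain ⟨t, ht⟩ := φ.ends_eq (.inr x)
  have h1 := ht true
  have h2 := ht false
  rw [Bool.xor_true] at h1
  rw [Bool.xor_false] at h2
  change thetaEnds s' k' (φ.edge (.inr x)) (!t) = .inl (φ.ext x) at h1
  change thetaEnds s' k' (φ.edge (.inr x)) t = .inr (φ.inn x.1) at h2
  rcases he : (φ.edge (.inr x) : Pos (fun j => k' j + 1) ⊕ Hair s' k') with p | y
  · rw [he] at h1
    cases h1
  · rw [he] at h1 h2
    cases t
    · have h3 : y = φ.ext x := Sum.inl_injective h1
      refine ⟨by rw [h3], ?_⟩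
      rw [← h3]
      exact Sum.inr_injective h2
    · cases h2

theorem weakIso_edge_inl (φ : WeakIso (theta s k) (theta s' k')) (p : Pos fun j => k j + 1) :
    ∃ q : Pos fun j => k' j + 1, φ.edge (.inl p) = .inl q := by
  rcases he : (φ.edge (.inl p) : Pos (fun j => k' j + 1) ⊕ Hair s' k') with q | y
  · exact ⟨q, rfl⟩
  · exfalso
    have h1 := (weakIso_edge_inr φ (φ.ext.symm y)).1
    rw [Equiv.apply_symm_apply] at h1
    have := φ.edge.injective (he.trans h1.symm)
    cases this

/-- The bijection of frame edges underlying an isomorphism of theta graphs. -/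
theorem exists_frame_map (φ : WeakIso (theta s k) (theta s' k')) :
    ∃ f : Pos (fun j => k j + 1) → Pos (fun j => k' j + 1), Function.Injective f ∧
      (∀ p, φ.edge (.inl p) = .inl (f p)) ∧
      ∀ p, ∃ t, ∀ b : Bool, tvert k' (f p).1 ((f p).2 + (xor t b).toNat) =
        φ.inn (tvert k p.1 (p.2 + b.toNat)) := by
  choose f hf using weakIso_edge_inl φ
  refine ⟨f, fun p q h => ?_, hf, fun p => ?_⟩
  · have := φ.edge.injective ((hf p).trans ((congrArg Sum.inl h).trans (hf q).symm))
    exact Sum.inl_injective this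
  · obtain ⟨t, ht⟩ := φ.ends_eq (.inl p)
    refine ⟨t, fun b => ?_⟩
    have h1 := ht b
    rw [hf] at h1
    exact Sum.inr_injective h1

/-- Three frame edges meet at an end point, but only two at an interior vertex. -/
theorem weakIso_inn_end (φ : WeakIso (theta s k) (theta s' k')) (b : Bool) :
    ∃ b', φ.inn (.inr b) = .inr b' := by
  rcases hx : (φ.inn (.inr b) : TVert k') with x | b'
  swap
  · exact ⟨b', rfl⟩
  exfalso
  obtain ⟨f, hinj, -, hf⟩ := exists_frame_map φ
  have key : ∀ j, f ⟨j, if b then Fin.last _ else 0⟩ ∈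
      ({⟨x.1, x.2.castSucc⟩, ⟨x.1, x.2.succ⟩} : Finset (Pos fun j => k' j + 1)) := by
    intro j
    obtain ⟨t, ht⟩ := hf ⟨j, if b then Fin.last _ else 0⟩
    have h1 := ht b
    have h2 : tvert k j (((if b then Fin.last _ else 0 : Fin (k j + 1)) : ℕ) + b.toNat) = .inr b := by
      cases b
      · exact tvert_zero k j
      · exact tvert_last (by simp)
    rw [h2] at h1
    have h3 := tvert_eq_inl.1 (h1.trans hx)
    rw [Finset.mem_insert, Finset.mem_singleton]
    cases hb : xor t b
    · right
      refine Pos.ext h3.1 ?_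
      have := h3.2
      rw [hb] at this
      simpa using this
    · left
      refine Pos.ext h3.1 ?_
      have := h3.2
      rw [hb] at this
      simpa using this
  have hcard := Finset.card_le_card (s := Finset.univ.image fun j : Fin 3 =>
    f ⟨j, if b then Fin.last _ else 0⟩) (fun p hp => by
      obtain ⟨j, -, rfl⟩ := Finset.mem_image.1 hp
      exact key j)
  rw [Finset.card_image_of_injective] at hcard
  · have := hcard.trans Finset.card_le_two
    simp at this
  · intro i j hij
    exact congrArg Sigma.fst (hinj hij)

/-- The images of the first edges define the permutation of the paths. By induction along each path
the isomorphism is then forced on the frame, and the frame alone determines the sign. -/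
theorem weakIso_of_start (φ : WeakIso (theta s k) (theta s' k'))
    (h0 : φ.inn (.inr false) = .inr false) :
    ∃ (σ : Equiv.Perm (Fin 3)) (h : ∀ j, k' (σ j) = k j), (∀ b, s' b = s b) ∧
      φ.sign = (permIso s σ h).sign := by
  have h1 : φ.inn (.inr true) = .inr true := by
    obtain ⟨b, hb⟩ := weakIso_inn_end φ true
    cases b
    · have := φ.inn.injective (hb.trans h0.symm)
      cases this
    · exact hb
  obtain ⟨f, hinj, hfe, hf⟩ := exists_frame_map φ
  have hstart : ∀ j, ((f ⟨j, 0⟩).2 : ℕ) = 0 := by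
    intro j
    obtain ⟨t, ht⟩ := hf ⟨j, 0⟩
    have h2 := (ht false).trans h0
    rw [tvert_eq_false] at h2
    omega
  have hσinj : Function.Injective fun j => (f ⟨j, 0⟩).1 := by
    intro i j hij
    have := hinj (Pos.ext hij ((hstart i).trans (hstart j).symm))
    exact congrArg Sigma.fst this
  set σ : Equiv.Perm (Fin 3) := Equiv.ofBijective _ (Finite.injective_iff_bijective.1 hσinj) with hσ
  have hind : ∀ j l (hl : l < k j + 1), (f ⟨j, l, hl⟩).1 = σ j ∧ ((f ⟨j, l, hl⟩).2 : ℕ) = l ∧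
      φ.inn (tvert k j l) = tvert k' (σ j) l ∧
      φ.inn (tvert k j (l + 1)) = tvert k' (σ j) (l + 1) := by
    intro j l
    have hstep : ∀ (l : ℕ) (hl : l < k j + 1), (f ⟨j, l, hl⟩).1 = σ j →
        ((f ⟨j, l, hl⟩).2 : ℕ) = l → φ.inn (tvert k j l) = tvert k' (σ j) l →
        φ.inn (tvert k j (l + 1)) = tvert k' (σ j) (l + 1) := by
      intro l hl h2 h3 h4
      obtain ⟨t, ht⟩ := hf ⟨j, l, hl⟩
      have h5 := ht true
      have h6 := ht false
      rw [h3, h2] at h5 h6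
      cases t
      · exact h5.symm
      -- Reversing the edge would make two consecutive vertices of a path coincide.
      · exfalso
        have hlt : l < k' (σ j) + 1 := by
          have := (f ⟨j, l, hl⟩).2.2
          rw [h3] at this
          rwa [h2] at this
        have h7 : tvert k' (σ j) (l + 1) = tvert k' (σ j) l := h6.trans h4
        rcases Nat.eq_zero_or_pos l with rfl | hl0
        · rw [tvert_zero, tvert_eq_false] at h7
          omega
        · rw [tvert_pos (l := l) hl0.ne' (by omega), tvert_eq_inl] at h7
          have := h7.2
          dsimp only at this
          omega
    induction l with
    | zero =>
      intro hl
      have h4 : φ.inn (tvert k j 0) = tvert k' (σ j) 0 := h0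
      exact ⟨rfl, hstart j, h4, hstep 0 hl rfl (hstart j) h4⟩
    | succ l ih =>
      intro hl
      obtain ⟨h2, h3, -, h5⟩ := ih (by omega)
      have hlk : l < k' (σ j) := by
        by_contra hge
        rw [tvert_last (k := k') (by omega), tvert_succ (show l < k j by omega), ← h1] at h5
        have := φ.inn.injective h5
        cases this
      obtain ⟨t, ht⟩ := hf ⟨j, l + 1, hl⟩
      have h6 := ht false
      rw [Bool.toNat_false, add_zero] at h6
      rw [h5, tvert_succ hlk, tvert_eq_inl] at h6
      obtain ⟨h7, h8⟩ := h6
      dsimp only at h7 h8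
      have h9 : ((f ⟨j, l + 1, hl⟩).2 : ℕ) = l + 1 := by
        cases t
        · simpa using h8
        -- The only other frame edge at this vertex is the previous one, which is already an image.
        · exfalso
          have h10 : ((f ⟨j, l + 1, hl⟩).2 : ℕ) = l := by simpa using h8
          have h11 := hinj (a₁ := ⟨j, l + 1, hl⟩) (a₂ := ⟨j, l, Nat.lt_of_succ_lt hl⟩)
            (Pos.ext (h7.trans h2.symm) (h10.trans h3.symm))
          have := (Pos.mk_inj (n := fun j => k j + 1)).1 h11
          exact absurd this.2 (by simp)
      exact ⟨h7, h9, h5, hstep (l + 1) hl h7 h9 h5⟩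
  have hk : ∀ j, k' (σ j) = k j := by
    intro j
    obtain ⟨h2, h3, -, h5⟩ := hind j (k j) (Nat.lt_succ_self _)
    rw [tvert_last (k := k) (Nat.lt_succ_self _), h1] at h5
    have h6 := tvert_eq_true.1 h5.symm
    have h7 := (f ⟨j, k j, Nat.lt_succ_self _⟩).2.2
    rw [h3] at h7
    replace h7 : k j < k' (f ⟨j, k j, Nat.lt_succ_self _⟩).1 + 1 := h7
    rw [h2] at h7
    omega
  have hext : ∀ x : Hair s k, (φ.ext x).1 = φ.inn x.1 := fun x => (weakIso_edge_inr φ x).2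
  have hend : ∀ b, φ.inn (.inr b) = .inr b := by
    rintro (_ | _)
    · exact h0
    · exact h1
  have hs : ∀ b, s' b = s b := by
    intro b
    rw [Bool.eq_iff_iff]
    constructor
    · intro hb
      obtain ⟨x, hx⟩ := φ.ext.surjective (⟨.inr b, hb⟩ : Hair s' k')
      have h2 := hext x
      rw [hx] at h2
      replace h2 := (hend b).trans h2
      have h3 := φ.inn.injective h2
      have h4 := x.2
      rw [← h3] at h4
      exact h4
    · intro hb
      have h2 := (φ.ext (⟨.inr b, hb⟩ : Hair s k)).2
      rw [hext] at h2
      change HasHair s' (φ.inn (.inr b)) at h2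
      rw [hend] at h2
      exact h2
  refine ⟨σ, hk, hs, ?_⟩
  rw [sign_theta_eq φ f φ.ext (fun _ => rfl), permIso, sign_thetaIso]
  · congr 1
    funext p
    congr 1
    obtain ⟨h2, h3, -⟩ := hind p.1 p.2 p.2.2
    exact Pos.ext h2 h3
  · rintro (p | x)
    · exact hfe p
    · exact (weakIso_edge_inr φ x).1

/-- The isomorphisms of theta graphs are generated by the renumberings of the paths and the exchange of
the end points. -/
theorem weakIso_theta (φ : WeakIso (theta s k) (theta s' k')) :
    ∃ (σ : Equiv.Perm (Fin 3)) (h : ∀ j, k' (σ j) = k j),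
      ((∀ b, s' b = s b) ∧ φ.sign = (permIso s σ h).sign) ∨
      ((∀ b, s' (!b) = s b) ∧
        φ.sign = (permIso s σ h).sign * (-1) ^ (∑ j, k j * (k j + 1) / 2)) := by
  obtain ⟨b, hb⟩ := weakIso_inn_end φ false
  cases b
  · obtain ⟨σ, h, hs, hsign⟩ := weakIso_of_start φ hb
    exact ⟨σ, h, .inl ⟨hs, hsign⟩⟩
  -- Composition with the exchange of the end points reduces to the case in which the start is
  -- fixed.
  · have h' : ∀ b, (fun b => s' (!b)) (!b) = s' b := fun b => by simp
    obtain ⟨σ, h, hs, hsign⟩ := weakIso_of_start (φ.trans (flipIso (s' := fun b => s' (!b)) h' k')) (by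
      change Sum.map _ _ (φ.inn (.inr false)) = _
      rw [hb]
      rfl)
    refine ⟨σ, h, .inr ⟨hs, ?_⟩⟩
    rw [← hsign, WeakIso.sign_trans, sign_flipIso, mul_assoc]
    have : ∑ j, k j * (k j + 1) / 2 = ∑ j, k' j * (k' j + 1) / 2 := by
      rw [← Equiv.sum_comp σ fun j => k' j * (k' j + 1) / 2]
      exact Finset.sum_congr rfl fun j _ => by rw [h]
    rw [this, ← mul_pow]
    simp

end Rigid

end TwoLoop

namespace TwoLoop
open OGraph

/-! ### The algebra -/

theorem neg_one_pow_congr {R : Type*} [Ring R] {a b : ℕ} (h : (a : ZMod 2) = b) :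
    (-1 : R) ^ a = (-1) ^ b := by
  have := (ZMod.natCast_eq_natCast_iff' a b 2).1 h
  rw [neg_one_pow_eq_pow_mod_two, this, ← neg_one_pow_eq_pow_mod_two]

/-- With the values of the six permutations made explicit, identities between signs become
identities modulo 2 in the three exponents. -/
theorem perm_cases (σ : Equiv.Perm (Fin 3)) :
    (σ 0 = 0 ∧ σ 1 = 1 ∧ σ 2 = 2 ∧ σ.symm 0 = 0 ∧ σ.symm 1 = 1 ∧ σ.symm 2 = 2 ∧ Equiv.Perm.sign σ = 1) ∨
    (σ 0 = 1 ∧ σ 1 = 0 ∧ σ 2 = 2 ∧ σ.symm 0 = 1 ∧ σ.symm 1 = 0 ∧ σ.symm 2 = 2 ∧ Equiv.Perm.sign σ = -1) ∨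
    (σ 0 = 2 ∧ σ 1 = 1 ∧ σ 2 = 0 ∧ σ.symm 0 = 2 ∧ σ.symm 1 = 1 ∧ σ.symm 2 = 0 ∧ Equiv.Perm.sign σ = -1) ∨
    (σ 0 = 0 ∧ σ 1 = 2 ∧ σ 2 = 1 ∧ σ.symm 0 = 0 ∧ σ.symm 1 = 2 ∧ σ.symm 2 = 1 ∧ Equiv.Perm.sign σ = -1) ∨
    (σ 0 = 1 ∧ σ 1 = 2 ∧ σ 2 = 0 ∧ σ.symm 0 = 2 ∧ σ.symm 1 = 0 ∧ σ.symm 2 = 1 ∧ Equiv.Perm.sign σ = 1) ∨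
    (σ 0 = 2 ∧ σ 1 = 0 ∧ σ 2 = 1 ∧ σ.symm 0 = 1 ∧ σ.symm 1 = 2 ∧ σ.symm 2 = 0 ∧ Equiv.Perm.sign σ = 1) := by
  revert σ
  decide

namespace SkewPoly

theorem hom_ext {M : Type*} [AddCommGroup M] [Module ℚ M] {L L' : SkewPoly →ₗ[ℚ] M}
    (h : ∀ k, L (monomial k) = L' (monomial k)) : L = L' :=
  monomialBasis.ext h

theorem A_monomial (k : Fin 3 → ℕ) :
    A (monomial k) = (-1 : ℚ) ^ (∑ j, k j * (k j + 1) / 2) • monomial k :=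
  monomialBasis.constr_basis _ _ _

theorem parity_monomial (k : Fin 3 → ℕ) :
    parity (monomial k) = (-1 : ℚ) ^ (∑ j, k j) • monomial k :=
  monomialBasis.constr_basis _ _ _

/-- The number of transpositions of generators in the renumbering of a monomial. -/
def inversions (σ : Equiv.Perm (Fin 3)) (k : Fin 3 → ℕ) : ℕ :=
  ∑ i, ∑ j, if i < j ∧ σ j < σ i then k i * k j else 0

theorem monomial_congr {a b : ℕ} {k l : Fin 3 → ℕ} (h : (a : ZMod 2) = b) (hk : ∀ j, k j = l j) :
    (-1 : ℚ) ^ a • monomial k = (-1 : ℚ) ^ b • monomial l := by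
  rw [neg_one_pow_congr h, funext hk]

theorem renumber_monomial (σ : Equiv.Perm (Fin 3)) (k : Fin 3 → ℕ) :
    renumber σ (monomial k) = (-1 : ℚ) ^ inversions σ k • monomial (k ∘ σ.symm) := by
  rw [renumber, ← monomialBasis_apply, Module.Basis.constr_basis, ξ_pow, ξ_pow, ξ_pow,
    monomial_mul_monomial, smul_mul_assoc, monomial_mul_monomial, smul_smul, ← pow_add]
  rcases perm_cases σ with h | h | h | h | h | h <;> obtain ⟨h0, h1, h2, h3, h4, h5, -⟩ := h <;>
    refine monomial_congr ?_ ?_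
  all_goals first
    | (intro j; fin_cases j <;> simp [h0, h1, h2, h3, h4, h5])
    | (simp [inversions, Fin.sum_univ_three, swaps, h0, h1, h2, h3, h4, h5]
       try ring)

theorem renumber_mul (σ : Equiv.Perm (Fin 3)) (f g : SkewPoly) :
    renumber σ (f * g) = renumber σ f * renumber σ g := by
  have : mulHom.compr₂ (renumber σ) = (mulHom.comp (renumber σ)).compl₂ (renumber σ) := by
    refine hom_ext fun a => hom_ext fun b => ?_
    simp only [LinearMap.compr₂_apply, LinearMap.compl₂_apply, LinearMap.comp_apply,
      mulHom_monomial, renumber_monomial, map_smul, LinearMap.smul_apply, smul_smul, ← pow_add]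
    refine monomial_congr ?_ fun j => rfl
    rcases perm_cases σ with h | h | h | h | h | h <;> obtain ⟨h0, h1, h2, h3, h4, h5, -⟩ := h <;>
    · simp [inversions, Fin.sum_univ_three, swaps, h0, h1, h2, h3, h4, h5]
      all_goals
        generalize (a 0 : ZMod 2) = a0
        generalize (a 1 : ZMod 2) = a1
        generalize (a 2 : ZMod 2) = a2
        generalize (b 0 : ZMod 2) = b0
        generalize (b 1 : ZMod 2) = b1
        generalize (b 2 : ZMod 2) = b2
        revert a0 a1 a2 b0 b1 b2
        decide
  exact congrArg (fun L => L f g) this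

theorem renumber_ξ (σ : Equiv.Perm (Fin 3)) (i : Fin 3) : renumber σ (ξ i) = ξ (σ i) := by
  rw [ξ, renumber_monomial, ξ]
  have h : inversions σ (Pi.single i 1) = 0 := by
    refine Finset.sum_eq_zero fun a _ => Finset.sum_eq_zero fun b _ => ?_
    split_ifs with h
    · rcases eq_or_ne a i with rfl | ha
      · rw [Pi.single_eq_of_ne h.1.ne', mul_zero]
      · rw [Pi.single_eq_of_ne ha, zero_mul]
    · rfl
  rw [h, pow_zero, one_smul]
  congr 1
  funext j
  rw [Function.comp_apply, Pi.single_apply, Pi.single_apply]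
  simp only [Equiv.symm_apply_eq]

theorem renumber_one (σ : Equiv.Perm (Fin 3)) : renumber σ 1 = 1 := by
  rw [one_def, renumber_monomial]
  simp [inversions]

theorem renumber_pow (σ : Equiv.Perm (Fin 3)) (f : SkewPoly) (n : ℕ) :
    renumber σ (f ^ n) = renumber σ f ^ n := by
  induction n with
  | zero => rw [pow_zero, pow_zero, renumber_one]
  | succ n ih => rw [pow_succ, pow_succ, renumber_mul, ih]

theorem renumber_renumber (σ τ : Equiv.Perm (Fin 3)) (f : SkewPoly) :
    renumber σ (renumber τ f) = renumber (σ * τ) f := by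
  have : (renumber σ).comp (renumber τ) = renumber (σ * τ) := by
    refine hom_ext fun k => ?_
    rw [LinearMap.comp_apply, monomial_eq]
    simp only [renumber_mul, renumber_pow, renumber_ξ, Equiv.Perm.mul_apply]
  exact congrArg (fun L => L f) this

theorem renumber_e₁ (σ : Equiv.Perm (Fin 3)) : renumber σ e₁ = e₁ := by
  have h : e₁ = ∑ i, ξ i := by rw [Fin.sum_univ_three, e₁]
  rw [h, map_sum]
  simp only [renumber_ξ]
  exact Equiv.sum_comp σ ξ

theorem A_renumber (σ : Equiv.Perm (Fin 3)) (f : SkewPoly) : A (renumber σ f) = renumber σ (A f) := by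
  have : A.comp (renumber σ) = (renumber σ).comp A := by
    refine hom_ext fun k => ?_
    simp only [LinearMap.comp_apply, renumber_monomial, A_monomial, map_smul]
    have h : ∑ j, (k ∘ σ.symm) j * ((k ∘ σ.symm) j + 1) / 2 = ∑ j, k j * (k j + 1) / 2 :=
      Equiv.sum_comp σ.symm fun j => k j * (k j + 1) / 2
    rw [smul_comm, h]
  exact congrArg (fun L => L f) this

theorem parity_renumber (σ : Equiv.Perm (Fin 3)) (f : SkewPoly) :
    parity (renumber σ f) = renumber σ (parity f) := by
  have : parity.comp (renumber σ) = (renumber σ).comp parity := by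
    refine hom_ext fun k => ?_
    simp only [LinearMap.comp_apply, renumber_monomial, parity_monomial, map_smul]
    have h : ∑ j, (k ∘ σ.symm) j = ∑ j, k j := Equiv.sum_comp σ.symm k
    rw [smul_comm, h]
  exact congrArg (fun L => L f) this

theorem neg_one_pow_mul_self (n : ℕ) : (-1 : ℚ) ^ n * (-1) ^ n = 1 := by
  rw [← mul_pow]
  simp

theorem A_A (f : SkewPoly) : A (A f) = f := by
  have : A.comp A = LinearMap.id := by
    refine hom_ext fun k => ?_
    simp only [LinearMap.comp_apply, A_monomial, map_smul, smul_smul, neg_one_pow_mul_self,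
      one_smul, LinearMap.id_apply]
  exact congrArg (fun L => L f) this

theorem ξ_mul_monomial (j : Fin 3) (k : Fin 3 → ℕ) :
    ξ j * monomial k = (-1 : ℚ) ^ (∑ i, if i < j then k i else 0) • monomial (bump k j) := by
  rw [ξ, monomial_mul_monomial]
  refine monomial_congr ?_ ?_
  · fin_cases j <;> simp [swaps, Fin.sum_univ_three]
  · intro i
    rw [Pi.add_apply, Pi.single_apply, bump, add_comm]

theorem monomial_mul_ξ (j : Fin 3) (k : Fin 3 → ℕ) :
    monomial k * ξ j = (-1 : ℚ) ^ (∑ i, if j < i then k i else 0) • monomial (bump k j) := by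
  rw [ξ, monomial_mul_monomial]
  refine monomial_congr ?_ ?_
  · fin_cases j <;> simp [swaps, Fin.sum_univ_three]
  · intro i
    rw [Pi.add_apply, Pi.single_apply, bump]

theorem e₁_mul_monomial (k : Fin 3 → ℕ) : e₁ * monomial k =
    ∑ j, (-1 : ℚ) ^ (∑ i, if i < j then k i else 0) • monomial (bump k j) := by
  rw [e₁, add_mul, add_mul, Fin.sum_univ_three, ξ_mul_monomial, ξ_mul_monomial, ξ_mul_monomial]

theorem monomial_mul_e₁ (k : Fin 3 → ℕ) : monomial k * e₁ =
    ∑ j, (-1 : ℚ) ^ (∑ i, if j < i then k i else 0) • monomial (bump k j) := by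
  rw [e₁, mul_add, mul_add, Fin.sum_univ_three, monomial_mul_ξ, monomial_mul_ξ, monomial_mul_ξ]

theorem parity_e₁_mul (f : SkewPoly) : parity (e₁ * f) = -(e₁ * parity f) := by
  have : parity.comp (mulHom e₁) = -(mulHom e₁).comp parity := by
    refine hom_ext fun k => ?_
    simp only [LinearMap.comp_apply, LinearMap.neg_apply, parity_monomial, map_smul, ← mul_def,
      e₁_mul_monomial, map_sum, Finset.smul_sum, ← Finset.sum_neg_distrib]
    refine Finset.sum_congr rfl fun j _ => ?_
    rw [smul_smul, smul_smul, ← neg_smul]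
    congr 1
    have : ∑ i, bump k j i = ∑ i, k i + 1 := by simp [bump, Finset.sum_add_distrib]
    rw [this, pow_succ]
    ring
  exact congrArg (fun L => L f) this

theorem triangle_succ (n : ℕ) : (n + 1) * (n + 1 + 1) / 2 = n * (n + 1) / 2 + (n + 1) := by
  rw [show (n + 1) * (n + 1 + 1) = n * (n + 1) + (n + 1) * 2 by ring,
    Nat.add_mul_div_right _ _ (by norm_num)]

theorem sum_triangle_bump (k : Fin 3 → ℕ) (j : Fin 3) :
    ∑ i, bump k j i * (bump k j i + 1) / 2 = ∑ i, k i * (k i + 1) / 2 + (k j + 1) := by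
  have : ∀ i, bump k j i * (bump k j i + 1) / 2 = k i * (k i + 1) / 2 + if i = j then k i + 1 else 0 := by
    intro i
    unfold bump
    split_ifs
    · rw [triangle_succ]
    · simp
  simp_rw [this, Finset.sum_add_distrib]
  simp

/-- Raising `k j` changes the exponent in `A` by `k j + 1`, so conjugation by `A` replaces the sign
from the variables before `j` by minus the sign from those before and including `j`. Up to the total
degree these are the variables after `j`. Geometrically, exchanging the end points turns expansions
at the start into expansions at the end. -/
theorem A_e₁_mul_A (f : SkewPoly) : A (e₁ * A f) = -(parity f * e₁) := by
  have : A.comp ((mulHom e₁).comp A) = -(mulHom.flip e₁).comp parity := by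
    refine hom_ext fun k => ?_
    simp only [LinearMap.comp_apply, LinearMap.neg_apply, parity_monomial, A_monomial, map_smul,
      LinearMap.flip_apply, ← mul_def,
      e₁_mul_monomial, monomial_mul_e₁, map_sum, Finset.smul_sum, ← Finset.sum_neg_distrib]
    refine Finset.sum_congr rfl fun j _ => ?_
    rw [smul_smul, smul_smul, smul_smul, sum_triangle_bump, ← pow_add, ← pow_add, ← pow_add, ← neg_smul,
      ← neg_one_mul ((-1 : ℚ) ^ _), ← pow_succ']
    refine monomial_congr ?_ fun _ => rfl
    generalize ∑ i, k i * (k i + 1) / 2 = n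
    push_cast
    generalize (n : ZMod 2) = a
    fin_cases j <;> simp [Fin.sum_univ_three] <;> generalize (k 0 : ZMod 2) = a0 <;>
      generalize (k 1 : ZMod 2) = a1 <;> generalize (k 2 : ZMod 2) = a2 <;>
      revert a a0 a1 a2 <;> decide
  exact congrArg (fun L => L f) this

end SkewPoly

end TwoLoop

namespace TwoLoop
open OGraph SkewPoly

/-! ### Antisymmetrization -/

namespace SkewPoly

/-- The projection onto the antisymmetric elements. -/
noncomputable def antisym : SkewPoly →ₗ[ℚ] SkewPoly :=
  (1 / 6 : ℚ) • ∑ σ : Equiv.Perm (Fin 3), ((Equiv.Perm.sign σ : ℤ) : ℚ) • renumber σ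

theorem antisym_apply (f : SkewPoly) : antisym f =
    (1 / 6 : ℚ) • ∑ σ : Equiv.Perm (Fin 3), ((Equiv.Perm.sign σ : ℤ) : ℚ) • renumber σ f := by
  rw [antisym, LinearMap.smul_apply, LinearMap.sum_apply]
  rfl

theorem antisym_monomial (k : Fin 3 → ℕ) : antisym (monomial k) = (1 / 6 : ℚ) • signedSum k :=
  antisym_apply _

theorem sign_mul_self (σ : Equiv.Perm (Fin 3)) :
    ((Equiv.Perm.sign σ : ℤ) : ℚ) * ((Equiv.Perm.sign σ : ℤ) : ℚ) = 1 := by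
  rcases Int.units_eq_one_or (Equiv.Perm.sign σ) with h | h <;> simp [h]

theorem antisym_renumber (σ : Equiv.Perm (Fin 3)) (f : SkewPoly) :
    antisym (renumber σ f) = ((Equiv.Perm.sign σ : ℤ) : ℚ) • antisym f := by
  rw [antisym_apply, antisym_apply, smul_comm]
  congr 1
  rw [Finset.smul_sum, ← Equiv.sum_comp (Equiv.mulRight σ⁻¹)]
  refine Finset.sum_congr rfl fun τ _ => ?_
  rw [Equiv.coe_mulRight]
  dsimp only
  rw [renumber_renumber, smul_smul, Equiv.Perm.sign_mul, Equiv.Perm.sign_inv,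
    inv_mul_cancel_right]
  congr 1
  push_cast
  ring

theorem mem_ASym {f : SkewPoly} :
    f ∈ ASym ↔ ∀ σ, renumber σ f = ((Equiv.Perm.sign σ : ℤ) : ℚ) • f := by
  simp [ASym, Submodule.mem_iInf, LinearMap.mem_eqLocus]

theorem antisym_mem (f : SkewPoly) : antisym f ∈ ASym := by
  rw [mem_ASym]
  intro σ
  rw [antisym_apply, map_smul, map_sum, smul_comm]
  congr 1
  rw [Finset.smul_sum, ← Equiv.sum_comp (Equiv.mulLeft σ⁻¹)]
  refine Finset.sum_congr rfl fun τ _ => ?_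
  rw [Equiv.coe_mulLeft]
  dsimp only
  rw [map_smul, renumber_renumber, smul_smul, Equiv.Perm.sign_mul, Equiv.Perm.sign_inv,
    mul_inv_cancel_left]
  congr 1
  push_cast
  ring

theorem antisym_of_mem {f : SkewPoly} (hf : f ∈ ASym) : antisym f = f := by
  rw [antisym_apply]
  simp_rw [mem_ASym.1 hf, smul_smul, sign_mul_self, one_smul]
  rw [Finset.sum_const, Finset.card_univ, Fintype.card_perm, Fintype.card_fin,
    ← Nat.cast_smul_eq_nsmul ℚ, smul_smul]
  norm_num [Nat.factorial]

theorem A_antisym (f : SkewPoly) : A (antisym f) = antisym (A f) := by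
  simp only [antisym_apply, map_smul, map_sum, A_renumber]

theorem antisym_e₁_mul (f : SkewPoly) : antisym (e₁ * f) = e₁ * antisym f := by
  simp only [antisym_apply, renumber_mul, renumber_e₁, mul_smul_comm, Finset.mul_sum]

theorem starEvenPart_apply (f : SkewPoly) : starEvenPart f = (1 / 2 : ℚ) • (f + A f) := rfl

theorem A_starEvenPart (f : SkewPoly) : A (starEvenPart f) = starEvenPart f := by
  rw [starEvenPart_apply, map_smul, map_add, A_A, add_comm]

theorem starEvenPart_A (f : SkewPoly) : starEvenPart (A f) = starEvenPart f := by
  rw [starEvenPart_apply, starEvenPart_apply, A_A, add_comm]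

theorem starEvenPart_of_A {f : SkewPoly} (h : A f = f) : starEvenPart f = f := by
  rw [starEvenPart_apply, h, ← two_smul ℚ, smul_smul]
  norm_num

theorem mem_starEven {f : SkewPoly} : f ∈ starEven ↔ A f = f := by
  simp [starEven, LinearMap.mem_eqLocus]

theorem A_mem_ASym {f : SkewPoly} (hf : f ∈ ASym) : A f ∈ ASym := by
  rw [mem_ASym] at hf ⊢
  intro σ
  rw [← A_renumber, hf, map_smul]

theorem starEvenPart_mem_ASym {f : SkewPoly} (hf : f ∈ ASym) : starEvenPart f ∈ ASym :=
  Submodule.smul_mem _ _ (Submodule.add_mem _ hf (A_mem_ASym hf))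

theorem e₁_mul_mem_ASym {f : SkewPoly} (hf : f ∈ ASym) : e₁ * f ∈ ASym := by
  rw [mem_ASym] at hf ⊢
  intro σ
  rw [renumber_mul, renumber_e₁, hf, mul_smul_comm]

theorem parity_mul_e₁_mem_ASym {f : SkewPoly} (hf : f ∈ ASym) : parity f * e₁ ∈ ASym := by
  rw [mem_ASym] at hf ⊢
  intro σ
  rw [renumber_mul, renumber_e₁, ← parity_renumber, hf, map_smul, smul_mul_assoc]

/-! ### Homogeneous parts -/

/-- Diagonal maps preserve the degree. -/
theorem map_homogeneous {d d' : ℕ} {L : SkewPoly →ₗ[ℚ] SkewPoly}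
    (h : ∀ k : Fin 3 → ℕ, ∑ j, k j = d → L (monomial k) ∈ homogeneous d') {f : SkewPoly}
    (hf : f ∈ homogeneous d) : L f ∈ homogeneous d' := by
  have : homogeneous d ≤ (homogeneous d').comap L := by
    refine Submodule.span_le.2 ?_
    rintro _ ⟨k, hk, rfl⟩
    exact h k hk
  exact this hf

theorem monomial_mem {k : Fin 3 → ℕ} {d : ℕ} (h : ∑ j, k j = d) : monomial k ∈ homogeneous d :=
  Submodule.subset_span ⟨k, h, rfl⟩

theorem A_mem_homogeneous {d : ℕ} {f : SkewPoly} (hf : f ∈ homogeneous d) : A f ∈ homogeneous d :=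
  map_homogeneous (fun k hk => by
    rw [A_monomial]; exact Submodule.smul_mem _ _ (monomial_mem hk)) hf

theorem parity_mem_homogeneous {d : ℕ} {f : SkewPoly} (hf : f ∈ homogeneous d) :
    parity f ∈ homogeneous d :=
  map_homogeneous (fun k hk => by
    rw [parity_monomial]; exact Submodule.smul_mem _ _ (monomial_mem hk)) hf

theorem renumber_mem_homogeneous (σ : Equiv.Perm (Fin 3)) {d : ℕ} {f : SkewPoly}
    (hf : f ∈ homogeneous d) : renumber σ f ∈ homogeneous d :=
  map_homogeneous (fun k hk => by
    rw [renumber_monomial]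
    exact Submodule.smul_mem _ _ (monomial_mem ((Equiv.sum_comp σ.symm k).trans hk))) hf

theorem antisym_mem_homogeneous {d : ℕ} {f : SkewPoly} (hf : f ∈ homogeneous d) :
    antisym f ∈ homogeneous d := by
  rw [antisym_apply]
  exact Submodule.smul_mem _ _ (Submodule.sum_mem _ fun σ _ =>
    Submodule.smul_mem _ _ (renumber_mem_homogeneous σ hf))

theorem starEvenPart_mem_homogeneous {d : ℕ} {f : SkewPoly} (hf : f ∈ homogeneous d) :
    starEvenPart f ∈ homogeneous d :=
  Submodule.smul_mem _ _ (Submodule.add_mem _ hf (A_mem_homogeneous hf))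

theorem sum_bump (k : Fin 3 → ℕ) (j : Fin 3) : ∑ i, bump k j i = ∑ i, k i + 1 := by
  simp [bump, Finset.sum_add_distrib]

theorem e₁_mul_mem_homogeneous {d : ℕ} {f : SkewPoly} (hf : f ∈ homogeneous d) :
    e₁ * f ∈ homogeneous (d + 1) :=
  map_homogeneous (L := mulHom e₁) (fun k hk => by
    rw [← mul_def, e₁_mul_monomial]
    exact Submodule.sum_mem _ fun j _ => Submodule.smul_mem _ _
      (monomial_mem (by rw [sum_bump, hk]))) hf

theorem mul_e₁_mem_homogeneous {d : ℕ} {f : SkewPoly} (hf : f ∈ homogeneous d) :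
    f * e₁ ∈ homogeneous (d + 1) :=
  map_homogeneous (L := mulHom.flip e₁) (fun k hk => by
    rw [LinearMap.flip_apply, ← mul_def, monomial_mul_e₁]
    exact Submodule.sum_mem _ fun j _ => Submodule.smul_mem _ _
      (monomial_mem (by rw [sum_bump, hk]))) hf

/-- The supremum in the definition of `modelPart` is a way to say degree `t - i` that gives zero,
not degree zero, for `t < i`. -/
theorem iSup_homogeneous (i t : ℕ) :
    (⨆ (d : ℕ) (_ : d + i = t), homogeneous d) = if i ≤ t then homogeneous (t - i) else ⊥ := by
  split_ifs with h
  · refine le_antisymm (iSup₂_le fun d hd => ?_) (le_iSup₂_of_le (t - i) (by omega) le_rfl)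
    rw [show t - i = d by omega]
  · exact le_antisymm (iSup₂_le fun d hd => absurd hd (by omega)) bot_le

theorem mem_modelPart {i d : ℕ} {f : SkewPoly} :
    f ∈ modelPart i (d + i) ↔ f ∈ model i ∧ f ∈ homogeneous d := by
  rw [modelPart, iSup_homogeneous, if_pos (by omega), Nat.add_sub_cancel, Submodule.mem_inf]

theorem modelPart_of_lt {i t : ℕ} (h : t < i) : modelPart i t = ⊥ := by
  rw [modelPart, iSup_homogeneous, if_neg (by omega), inf_bot_eq]

theorem model_of_two_lt {i : ℕ} (h : 2 < i) : model i = ⊥ := by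
  obtain ⟨i, rfl⟩ := Nat.exists_eq_add_of_lt h
  rw [show 2 + i + 1 = i + 3 by omega]
  rfl

end SkewPoly

/-! ### The elements of the model that represent theta graphs -/

/-- The sign in the comparison of theta graphs with monomials. -/
def midSign (k : Fin 3 → ℕ) : ℚ := (-1) ^ k 1

theorem midSign_mul_self (k : Fin 3 → ℕ) : midSign k * midSign k = 1 := neg_one_pow_mul_self _

theorem unitCast_sign_permIso (s : Bool → Bool) (σ : Equiv.Perm (Fin 3)) {k k' : Fin 3 → ℕ}
    (h : ∀ j, k' (σ j) = k j) :
    unitCast (permIso s σ h).sign = (-1) ^ inversions σ fun j => k j + 1 := by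
  rw [sign_permIso, inversions, ← Finset.prod_pow_eq_pow_sum, unitCast]
  push_cast
  refine Finset.prod_congr rfl fun i _ => ?_
  rw [← Finset.prod_pow_eq_pow_sum]
  refine Finset.prod_congr rfl fun j _ => ?_
  split_ifs <;> simp

/-- Expand `(k i + 1) * (k j + 1)` and sum over the inversions of `σ`: the products give the sign of
the renumbered monomial, the constants give the sign of `σ`, and the linear terms give the change of
the middle exponent modulo 2. `midSign` absorbs the last contribution. -/
theorem sign_permIso_mul (σ : Equiv.Perm (Fin 3)) (k : Fin 3 → ℕ) :
    (-1 : ℚ) ^ (inversions σ fun j => k j + 1) * midSign k =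
      midSign (k ∘ σ.symm) * ((Equiv.Perm.sign σ : ℤ) : ℚ) * (-1) ^ inversions σ k := by
  have key : ∀ n : ℕ, ((Equiv.Perm.sign σ : ℤ) : ℚ) = (-1) ^ n →
      ((inversions σ (fun j => k j + 1) + k 1 : ℕ) : ZMod 2) =
        (k (σ.symm 1) + n + inversions σ k : ℕ) →
      (-1 : ℚ) ^ (inversions σ fun j => k j + 1) * midSign k =
      midSign (k ∘ σ.symm) * ((Equiv.Perm.sign σ : ℤ) : ℚ) * (-1) ^ inversions σ k := by
    intro n hn h
    rw [midSign, midSign, hn, ← pow_add, ← pow_add, ← pow_add]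
    exact neg_one_pow_congr h
  rcases perm_cases σ with h | h | h | h | h | h <;> obtain ⟨h0, h1, h2, h3, h4, h5, hs⟩ := h
  on_goal 1 => refine key 0 (by simp [hs]) ?_
  on_goal 2 => refine key 1 (by simp [hs]) ?_
  on_goal 3 => refine key 1 (by simp [hs]) ?_
  on_goal 4 => refine key 1 (by simp [hs]) ?_
  on_goal 5 => refine key 0 (by simp [hs]) ?_
  on_goal 6 => refine key 0 (by simp [hs]) ?_
  all_goals
    simp [inversions, Fin.sum_univ_three, h0, h1, h2, h3, h4, h5]
    try
      generalize (k 0 : ZMod 2) = a0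
      generalize (k 1 : ZMod 2) = a1
      generalize (k 2 : ZMod 2) = a2
      revert a0 a1 a2
      decide

/-- The map applied to antisymmetric elements for each distribution of hairs at the end points. -/
noncomputable def endPart (s : Bool → Bool) : SkewPoly →ₗ[ℚ] SkewPoly :=
  if s false = s true then starEvenPart else if s false = true then LinearMap.id else A

/-- The element of the model that represents a standard theta graph. -/
noncomputable def thetaVal (s : Bool → Bool) (k : Fin 3 → ℕ) : SkewPoly :=
  midSign k • endPart s (antisym (monomial k))

/-- Exchanging the end points swaps the two distributions with a single hair, for which `endPart` is
the identity and `A`; for the symmetric distributions the `*`even part absorbs `A`. -/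
theorem endPart_A {s s' : Bool → Bool} (h : ∀ b, s' (!b) = s b) (f : SkewPoly) :
    endPart s' (A f) = endPart s f := by
  have h0 := h false
  have h1 := h true
  rw [Bool.not_false] at h0
  rw [Bool.not_true] at h1
  unfold endPart
  rw [h0, h1]
  cases s false <;> cases s true <;> simp [starEvenPart_A, A_A]

theorem thetaVal_perm (s : Bool → Bool) (σ : Equiv.Perm (Fin 3)) {k k' : Fin 3 → ℕ}
    (h : ∀ j, k' (σ j) = k j) :
    thetaVal s k = unitCast (permIso s σ h).sign • thetaVal s k' := by
  obtain rfl : k' = k ∘ σ.symm := by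
    funext j
    rw [Function.comp_apply, ← h, Equiv.apply_symm_apply]
  have h1 := antisym_renumber σ (monomial k)
  rw [renumber_monomial, map_smul] at h1
  have h2 : antisym (monomial (k ∘ σ.symm)) =
      ((-1 : ℚ) ^ inversions σ k * ((Equiv.Perm.sign σ : ℤ) : ℚ)) • antisym (monomial k) := by
    rw [mul_smul, ← h1, smul_smul, neg_one_pow_mul_self, one_smul]
  rw [unitCast_sign_permIso, thetaVal, thetaVal, h2, map_smul, smul_smul, smul_smul]
  congr 1
  have h3 := sign_permIso_mul σ k
  have h4 := midSign_mul_self k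
  have h5 := midSign_mul_self (k ∘ σ.symm)
  have h6 := sign_mul_self σ
  have h7 := neg_one_pow_mul_self (inversions σ k)
  have h8 : (-1 : ℚ) ^ (inversions σ fun j => k j + 1) = midSign (k ∘ σ.symm) *
      ((Equiv.Perm.sign σ : ℤ) : ℚ) * (-1) ^ inversions σ k * midSign k := by
    rw [← h3, mul_assoc, h4, mul_one]
  rw [h8]
  generalize ((Equiv.Perm.sign σ : ℤ) : ℚ) = x at *
  generalize (-1 : ℚ) ^ inversions σ k = y at *
  generalize midSign (k ∘ σ.symm) = z at *
  symm
  calc _ = midSign k * (x * x) * (y * y) * (z * z) := by ring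
    _ = _ := by rw [h5, h6, h7]; ring

theorem thetaVal_flip {s s' : Bool → Bool} (h : ∀ b, s' (!b) = s b) (k : Fin 3 → ℕ) :
    thetaVal s k = unitCast (flipIso h k).sign • thetaVal s' k := by
  rw [sign_flipIso, thetaVal, thetaVal, ← endPart_A h, A_antisym, A_monomial, map_smul, map_smul,
    smul_comm, unitCast_pow, unitCast_neg, unitCast_one]

theorem thetaVal_weakIso {s s' : Bool → Bool} {k k' : Fin 3 → ℕ}
    (φ : WeakIso (theta s k) (theta s' k')) :
    thetaVal s k = unitCast φ.sign • thetaVal s' k' := by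
  obtain ⟨σ, h, (⟨hs, hsign⟩ | ⟨hs, hsign⟩)⟩ := weakIso_theta φ
  · obtain rfl : s' = s := funext hs
    rw [hsign]
    exact thetaVal_perm _ σ h
  · have h1 : ∑ j, k j * (k j + 1) / 2 = ∑ j, k' j * (k' j + 1) / 2 := by
      rw [← Equiv.sum_comp σ fun j => k' j * (k' j + 1) / 2]
      exact Finset.sum_congr rfl fun j _ => by rw [h]
    rw [hsign, h1, ← sign_flipIso hs k', unitCast_mul, mul_smul, ← thetaVal_flip hs k']
    exact thetaVal_perm s σ h

/-! ### The isomorphism with the model -/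

section Model

variable {m N : ℕ}

open Classical in
/-- The element of the model that represents a graph. -/
noncomputable def graphVal (Γ : OGraph) : SkewPoly :=
  if h : ∃ s k, Nonempty (WeakIso Γ (theta s k)) then
    unitCast h.choose_spec.choose_spec.some.sign • thetaVal h.choose h.choose_spec.choose
  else 0

/-- Any two identifications with theta graphs differ by an isomorphism of theta graphs, under which
`thetaVal` is equivariant. So the choice in the definition is immaterial. -/
theorem graphVal_eq {Γ : OGraph} {s : Bool → Bool} {k : Fin 3 → ℕ} (φ : WeakIso Γ (theta s k)) :
    graphVal Γ = unitCast φ.sign • thetaVal s k := by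
  have h : ∃ s k, Nonempty (WeakIso Γ (theta s k)) := ⟨s, k, ⟨φ⟩⟩
  rw [graphVal, dif_pos h]
  generalize h.choose_spec.choose_spec.some = ψ
  rw [thetaVal_weakIso (ψ.symm.trans φ), smul_smul, ← unitCast_mul, WeakIso.sign_trans,
    WeakIso.sign_symm, ← mul_assoc, Int.units_mul_self, one_mul]

theorem graphVal_weakIso {Γ Γ' : OGraph} (φ : WeakIso Γ Γ') :
    graphVal Γ = unitCast φ.sign • graphVal Γ' := by
  by_cases h : ∃ s k, Nonempty (WeakIso Γ' (theta s k))
  · obtain ⟨s, k, ⟨ψ⟩⟩ := h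
    rw [graphVal_eq ψ, graphVal_eq (φ.trans ψ), WeakIso.sign_trans, unitCast_mul, mul_smul]
  · have h' : ¬ ∃ s k, Nonempty (WeakIso Γ (theta s k)) := fun ⟨s, k, ⟨ψ⟩⟩ =>
      h ⟨s, k, ⟨φ.symm.trans ψ⟩⟩
    rw [graphVal, graphVal, dif_neg h, dif_neg h', smul_zero]

theorem exists_modelMap (hm : Odd m) (hN : Even N) : ∃ F : GraphSpace m N →ₗ[ℚ] SkewPoly,
    ∀ s k, F (graphClass m N (theta s k)) = thetaVal s k := by
  obtain ⟨L, hL⟩ := map_graphClass graphVal hm hN fun Γ Γ' φ => graphVal_weakIso φ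
  refine ⟨L, fun s k => ?_⟩
  rw [hL, graphVal_eq (WeakIso.refl _), WeakIso.sign_refl, unitCast_one, one_smul]

variable (m N) in
/-- The graphs represented by the monomials. -/
noncomputable def thetaMap (s : Bool → Bool) : SkewPoly →ₗ[ℚ] GraphSpace m N :=
  monomialBasis.constr ℚ fun k => midSign k • graphClass m N (theta s k)

theorem thetaMap_monomial (s : Bool → Bool) (k : Fin 3 → ℕ) :
    thetaMap m N s (monomial k) = midSign k • graphClass m N (theta s k) :=
  monomialBasis.constr_basis _ _ _

theorem graphClass_theta (s : Bool → Bool) (k : Fin 3 → ℕ) :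
    graphClass m N (theta s k) = thetaMap m N s (midSign k • monomial k) := by
  rw [map_smul, thetaMap_monomial, smul_smul, midSign_mul_self, one_smul]

theorem thetaMap_renumber (hm : Odd m) (hN : Even N) (s : Bool → Bool) (σ : Equiv.Perm (Fin 3))
    (f : SkewPoly) : thetaMap m N s (renumber σ f) =
      ((Equiv.Perm.sign σ : ℤ) : ℚ) • thetaMap m N s f := by
  have : (thetaMap m N s).comp (renumber σ) = ((Equiv.Perm.sign σ : ℤ) : ℚ) • thetaMap m N s := by
    refine hom_ext fun k => ?_
    have h : ∀ j, (k ∘ σ.symm) (σ j) = k j := fun j => by simp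
    rw [LinearMap.comp_apply, LinearMap.smul_apply, renumber_monomial, map_smul,
      thetaMap_monomial, thetaMap_monomial, graphClass_eq hm hN (permIso s σ h),
      unitCast_sign_permIso, smul_smul, smul_smul, smul_smul]
    congr 1
    have h3 := sign_permIso_mul σ k
    have h4 := midSign_mul_self k
    have h6 := sign_mul_self σ
    rw [mul_assoc, mul_comm (midSign k), h3]
    generalize ((Equiv.Perm.sign σ : ℤ) : ℚ) = x at *
    symm
    calc _ = (x * x) * ((-1 : ℚ) ^ inversions σ k * midSign (k ∘ σ.symm)) := by ring
      _ = _ := by rw [h6, one_mul]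
  exact congrArg (fun L => L f) this

theorem thetaMap_antisym (hm : Odd m) (hN : Even N) (s : Bool → Bool) (f : SkewPoly) :
    thetaMap m N s (antisym f) = thetaMap m N s f := by
  rw [antisym_apply, map_smul, map_sum]
  simp_rw [map_smul, thetaMap_renumber hm hN, smul_smul, sign_mul_self, one_smul]
  rw [Finset.sum_const, Finset.card_univ, Fintype.card_perm, Fintype.card_fin,
    ← Nat.cast_smul_eq_nsmul ℚ, smul_smul]
  norm_num [Nat.factorial]

theorem thetaMap_A (hm : Odd m) (hN : Even N) {s s' : Bool → Bool} (h : ∀ b, s' (!b) = s b)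
    (f : SkewPoly) : thetaMap m N s' (A f) = thetaMap m N s f := by
  have : (thetaMap m N s').comp A = thetaMap m N s := by
    refine hom_ext fun k => ?_
    rw [LinearMap.comp_apply, A_monomial, map_smul, thetaMap_monomial, thetaMap_monomial,
      graphClass_eq hm hN (flipIso h k), sign_flipIso, unitCast_pow, unitCast_neg, unitCast_one,
      smul_comm]
  exact congrArg (fun L => L f) this

theorem thetaMap_starEvenPart (hm : Odd m) (hN : Even N) {s : Bool → Bool} (h : ∀ b, s (!b) = s b)
    (f : SkewPoly) : thetaMap m N s (starEvenPart f) = thetaMap m N s f := by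
  rw [starEvenPart_apply, map_smul, map_add, thetaMap_A hm hN h, ← two_smul ℚ, smul_smul]
  norm_num

theorem unitCast_expandSign (b : Bool) (j : Fin 3) (k : Fin 3 → ℕ) :
    unitCast (expandSign b j k) = (-1) ^ ∑ i, if i < j ∨ i = j ∧ b = true then k i + 1 else 0 := by
  rw [expandSign, ← Finset.prod_pow_eq_pow_sum, unitCast]
  push_cast
  refine Finset.prod_congr rfl fun i _ => ?_
  split_ifs <;> simp

/-- The expansions of the end point of a theta graph. -/
theorem sum_expand (b : Bool) (s : Bool → Bool) (k : Fin 3 → ℕ) :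
    midSign k • ∑ j, unitCast (expandSign b j k) • graphClass m N (theta s (bump k j)) =
      thetaMap m N s (if b then -(parity (monomial k) * e₁) else e₁ * monomial k) := by
  have h : (if b then -(parity (monomial k) * e₁) else e₁ * monomial k) =
      ∑ j, (if b then -((-1 : ℚ) ^ (∑ i, k i) * (-1) ^ (∑ i, if j < i then k i else 0)) else
        (-1) ^ (∑ i, if i < j then k i else 0)) • monomial (bump k j) := by
    cases b
    · exact e₁_mul_monomial k
    · simp only [if_true, parity_monomial, smul_mul_assoc, monomial_mul_e₁, Finset.smul_sum, smul_smul,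
        neg_smul, Finset.sum_neg_distrib]
  rw [h, map_sum, Finset.smul_sum]
  refine Finset.sum_congr rfl fun j _ => ?_
  rw [map_smul, thetaMap_monomial, smul_smul, smul_smul, unitCast_expandSign]
  congr 1
  cases b
  · simp only [midSign, ← pow_add, Bool.false_eq_true, if_false, and_false, or_false]
    refine neg_one_pow_congr ?_
    fin_cases j <;> simp [Fin.sum_univ_three, bump]
    all_goals
      generalize (k 0 : ZMod 2) = a0
      generalize (k 1 : ZMod 2) = a1
      revert a0 a1
      decide
  · simp only [midSign, ← pow_add, if_true, and_true]
    rw [neg_mul, ← pow_add, ← neg_one_mul ((-1 : ℚ) ^ _), ← pow_succ']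
    refine neg_one_pow_congr ?_
    fin_cases j <;> simp [Fin.sum_univ_three, bump]
    all_goals
      generalize (k 0 : ZMod 2) = a0
      generalize (k 1 : ZMod 2) = a1
      generalize (k 2 : ZMod 2) = a2
      revert a0 a1 a2
      decide

theorem differential_thetaMap (hm : Odd m) (hN : Even N) (s : Bool → Bool) (f : SkewPoly) :
    differential m N (thetaMap m N s f) =
      (if s false = true then thetaMap m N (Function.update s false false) (e₁ * f) else 0) -
      (if s true = true then thetaMap m N (Function.update s true false) (parity f * e₁) else 0) := by
  induction f using SkewPoly.induction_linear with
  | zero => simp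
  | add f g hf hg =>
    rw [map_add, map_add, hf, hg, mul_add, map_add, map_add, add_mul, map_add]
    split_ifs <;> abel
  | mon c k =>
    have h : differential m N (thetaMap m N s (monomial k)) =
      (if s false = true then thetaMap m N (Function.update s false false) (e₁ * monomial k) else 0) -
      (if s true = true then thetaMap m N (Function.update s true false)
        (parity (monomial k) * e₁) else 0) := by
      rw [thetaMap_monomial, map_smul, differential_theta hm hN, Fintype.univ_bool,
        Finset.sum_insert (by simp), Finset.sum_singleton, add_comm, smul_add, sub_eq_add_neg]
      congr 1
      · split_ifs
        · rw [sum_expand, if_neg (by simp)]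
        · rw [smul_zero]
      · split_ifs
        · rw [sum_expand, if_pos rfl, map_neg]
        · rw [smul_zero, neg_zero]
    rw [map_smul, map_smul, h, map_smul, mul_smul_comm, map_smul, smul_mul_assoc, map_smul, smul_sub]
    split_ifs <;> simp

end Model

end TwoLoop

namespace TwoLoop
open OGraph SkewPoly

/-! ### The model of the complex of two-loop hairy graphs -/

section Complex

variable {m N : ℕ}

theorem IsTwoLoopHairy.exists_theta {Γ : OGraph} (h : Γ.IsTwoLoopHairy) :
    ∃ s k, Nonempty (WeakIso (theta s k) Γ) := by
  obtain ⟨k, hk⟩ := h.exists_isTheta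
  obtain ⟨s, hs⟩ := h.exists_weakIso hk
  exact ⟨s, k, hs⟩

theorem defect_bounds {Γ : OGraph} (h : Γ.IsTwoLoopHairy) : 0 ≤ Γ.defect ∧ Γ.defect ≤ 2 := by
  obtain ⟨s, k, ⟨φ⟩⟩ := IsTwoLoopHairy.exists_theta h
  rw [← φ.defect_eq, defect_theta]
  cases s false <;> cases s true <;> simp

/-- The distribution of hairs at the end points of the standard theta graphs of defect `i`. -/
def endHairs : ℕ → Bool → Bool
  | 0 => fun _ => false
  | 1 => fun b => !b
  | _ => fun _ => true

/-- In defect one there are two distributions of hairs; a hair at the start is the normal form, and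
the other case is its mirror image. -/
theorem endHairs_cases {s : Bool → Bool} {i : ℕ} (h : (s false).toNat + (s true).toNat = i) :
    s = endHairs i ∨ i = 1 ∧ s = id := by
  subst h
  have hs : ∀ s' : Bool → Bool, s' false = s false → s' true = s true → s = s' := fun s' h h' => by
    funext b; cases b <;> simp [h, h']
  cases h0 : s false <;> cases h1 : s true
  · exact .inl (hs _ h0.symm h1.symm)
  · exact .inr ⟨rfl, hs _ h0.symm h1.symm⟩
  · exact .inl (hs _ h0.symm h1.symm)
  · exact .inl (hs _ h0.symm h1.symm)

theorem endPart_zero : endPart (endHairs 0) = starEvenPart := by simp [endPart, endHairs]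

theorem endPart_one : endPart (endHairs 1) = LinearMap.id := by simp [endPart, endHairs]

theorem endPart_id : endPart id = A := by simp [endPart]

theorem endPart_two : endPart (endHairs 2) = starEvenPart := by simp [endPart, endHairs]

theorem starEvenPart_mem_model {f : SkewPoly} (hf : f ∈ ASym) :
    starEvenPart f ∈ ASym ⊓ starEven :=
  ⟨starEvenPart_mem_ASym hf, mem_starEven.2 (A_starEvenPart f)⟩

theorem endPart_mem_model {s : Bool → Bool} {i : ℕ} (h : (s false).toNat + (s true).toNat = i)
    {f : SkewPoly} (hf : f ∈ ASym) : endPart s f ∈ model i := by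
  have hi : i ≤ 2 := by rw [← h]; cases s false <;> cases s true <;> simp
  rcases endHairs_cases h with rfl | ⟨rfl, rfl⟩
  · interval_cases i
    · rw [endPart_zero]
      exact starEvenPart_mem_model hf
    · rw [endPart_one]
      exact hf
    · rw [endPart_two]
      exact starEvenPart_mem_model hf
  · rw [endPart_id]
    exact A_mem_ASym hf

theorem endPart_mem_homogeneous (s : Bool → Bool) {d : ℕ} {f : SkewPoly} (hf : f ∈ homogeneous d) :
    endPart s f ∈ homogeneous d := by
  unfold endPart
  split_ifs
  · exact starEvenPart_mem_homogeneous hf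
  · exact hf
  · exact A_mem_homogeneous hf

theorem thetaVal_mem {s : Bool → Bool} {i : ℕ} (h : (s false).toNat + (s true).toNat = i)
    (k : Fin 3 → ℕ) : thetaVal s k ∈ modelPart i (∑ j, k j + i) :=
  Submodule.smul_mem _ _ (mem_modelPart.2 ⟨endPart_mem_model h (antisym_mem _),
    endPart_mem_homogeneous s (antisym_mem_homogeneous (monomial_mem rfl))⟩)

theorem endPart_of_mem_model {i : ℕ} {f : SkewPoly} (hf : f ∈ model i) :
    endPart (endHairs i) f = f := by
  rcases lt_or_ge 2 i with hi | hi
  · rw [model_of_two_lt hi, Submodule.mem_bot] at hf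
    rw [hf, map_zero]
  · interval_cases i
    · rw [endPart_zero, starEvenPart_of_A (mem_starEven.1 hf.2)]
    · rw [endPart_one, LinearMap.id_apply]
    · rw [endPart_two, starEvenPart_of_A (mem_starEven.1 hf.2)]

theorem model_le_ASym (i : ℕ) : model i ≤ ASym := by
  rcases lt_or_ge 2 i with hi | hi
  · rw [model_of_two_lt hi]
    exact bot_le
  · interval_cases i
    · exact inf_le_left
    · exact le_rfl
    · exact inf_le_left

theorem thetaMap_thetaVal (hm : Odd m) (hN : Even N) {s : Bool → Bool} {i : ℕ}
    (h : (s false).toNat + (s true).toNat = i) (k : Fin 3 → ℕ) :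
    thetaMap m N (endHairs i) (thetaVal s k) = graphClass m N (theta s k) := by
  have hi : i ≤ 2 := by rw [← h]; cases s false <;> cases s true <;> simp
  rw [thetaVal, map_smul, graphClass_theta, map_smul]
  congr 1
  rcases endHairs_cases h with rfl | ⟨rfl, rfl⟩
  · interval_cases i
    · rw [endPart_zero, thetaMap_starEvenPart hm hN fun _ => rfl, thetaMap_antisym hm hN]
    · rw [endPart_one, LinearMap.id_apply, thetaMap_antisym hm hN]
    · rw [endPart_two, thetaMap_starEvenPart hm hN fun _ => rfl, thetaMap_antisym hm hN]
  · rw [endPart_id, thetaMap_A hm hN (s := id) (fun b => by simp [endHairs]), thetaMap_antisym hm hN]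

/-- Without hairs on the paths, swapping two paths is an odd symmetry. This matters because the
graph without any hairs is not admissible, although the constant monomial has a place in the
algebra. -/
theorem thetaMap_one (hm : Odd m) (hN : Even N) (s : Bool → Bool) : thetaMap m N s 1 = 0 := by
  have h := thetaMap_renumber (m := m) (N := N) hm hN s (Equiv.swap 0 1) 1
  rw [renumber_one, Equiv.Perm.sign_swap (by decide)] at h
  have h2 : thetaMap m N s 1 = -thetaMap m N s 1 := by simpa using h
  have h3 : (2 : ℚ) • thetaMap m N s 1 = 0 := by
    rw [two_smul]
    exact eq_neg_iff_add_eq_zero.1 h2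
  exact (smul_eq_zero.1 h3).resolve_left (by norm_num)

theorem thetaMap_mem_hairy (hm : Odd m) (hN : Even N) {i d : ℕ} (hi : i ≤ 2) {f : SkewPoly}
    (hf : f ∈ homogeneous d) : thetaMap m N (endHairs i) f ∈ hairy m N i (d + i) := by
  have : homogeneous d ≤ (hairy m N i (d + i)).comap (thetaMap m N (endHairs i)) := by
    refine Submodule.span_le.2 ?_
    rintro _ ⟨k, hk, rfl⟩
    rw [SetLike.mem_coe, Submodule.mem_comap]
    have hi' : (endHairs i false).toNat + (endHairs i true).toNat = i := by
      interval_cases i <;> rfl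
    by_cases h0 : d + i = 0
    · have : k = 0 := by
        funext j
        have := Finset.sum_eq_zero_iff.1 (show ∑ j, k j = 0 by omega) j (Finset.mem_univ j)
        exact this
      rw [this, ← one_def, thetaMap_one hm hN]
      exact Submodule.zero_mem _
    · rw [thetaMap_monomial]
      refine Submodule.smul_mem _ _ (Submodule.subset_span ⟨_, isTwoLoopHairy_theta _ _ ?_, ?_, ?_, rfl⟩)
      · refine Fintype.card_pos_iff.1 ?_
        rw [card_hair, hi', hk]
        omega
      · rw [defect_theta]
        exact_mod_cast hi'
      · rw [hodge_theta, hk, hi']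
  exact this hf

theorem hairy_of_two_lt {i : ℕ} (hi : 2 < i) (t : ℕ) : hairy m N i t = ⊥ := by
  rw [hairy, Submodule.span_eq_bot]
  rintro _ ⟨Γ, h, hd, -⟩
  have := (defect_bounds h).2
  omega

/-- The value of a map with the values `thetaVal` on theta graphs determines the element of the span of
two-loop hairy graphs. -/
theorem modelMap_hairy (hm : Odd m) (hN : Even N) {F : GraphSpace m N →ₗ[ℚ] SkewPoly}
    (hF : ∀ s k, F (graphClass m N (theta s k)) = thetaVal s k) {i t : ℕ} {z : GraphSpace m N}
    (hz : z ∈ hairy m N i t) : F z ∈ modelPart i t ∧ thetaMap m N (endHairs i) (F z) = z := by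
  induction hz using Submodule.span_induction with
  | mem z hz =>
    obtain ⟨Γ, h, hd, ht, rfl⟩ := hz
    obtain ⟨s, k, ⟨φ⟩⟩ := IsTwoLoopHairy.exists_theta h
    rw [← φ.defect_eq, defect_theta] at hd
    have hs : (s false).toNat + (s true).toNat = i := by exact_mod_cast hd
    rw [← φ.hodge_eq, hodge_theta, hs] at ht
    rw [graphClass_eq hm hN φ.symm, map_smul, hF, map_smul, thetaMap_thetaVal hm hN hs, ← ht]
    exact ⟨Submodule.smul_mem _ _ (thetaVal_mem hs k), rfl⟩
  | zero => exact ⟨by rw [map_zero]; exact Submodule.zero_mem _, by rw [map_zero, map_zero]⟩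
  | add x y _ _ hx hy =>
    exact ⟨by rw [map_add]; exact Submodule.add_mem _ hx.1 hy.1, by rw [map_add, map_add, hx.2, hy.2]⟩
  | smul c x _ hx =>
    exact ⟨by rw [map_smul]; exact Submodule.smul_mem _ _ hx.1, by rw [map_smul, map_smul, hx.2]⟩

theorem modelMap_thetaMap {F : GraphSpace m N →ₗ[ℚ] SkewPoly}
    (hF : ∀ s k, F (graphClass m N (theta s k)) = thetaVal s k) (s : Bool → Bool) (f : SkewPoly) :
    F (thetaMap m N s f) = endPart s (antisym f) := by
  have : F.comp (thetaMap m N s) = (endPart s).comp antisym := by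
    refine hom_ext fun k => ?_
    rw [LinearMap.comp_apply, LinearMap.comp_apply, thetaMap_monomial, map_smul, hF, thetaVal,
      smul_smul, midSign_mul_self, one_smul]
  exact congrArg (fun L => L f) this

theorem modelMap_of_mem {F : GraphSpace m N →ₗ[ℚ] SkewPoly}
    (hF : ∀ s k, F (graphClass m N (theta s k)) = thetaVal s k) {i : ℕ} {f : SkewPoly}
    (hf : f ∈ model i) : F (thetaMap m N (endHairs i) f) = f := by
  rw [modelMap_thetaMap hF, antisym_of_mem (model_le_ASym i hf), endPart_of_mem_model hf]

theorem thetaMap_mem_hairy_of_modelPart (hm : Odd m) (hN : Even N) {i t : ℕ} {f : SkewPoly}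
    (hf : f ∈ modelPart i t) : thetaMap m N (endHairs i) f ∈ hairy m N i t := by
  rcases lt_or_ge t i with ht | ht
  · rw [modelPart_of_lt ht, Submodule.mem_bot] at hf
    rw [hf, map_zero]
    exact Submodule.zero_mem _
  · obtain ⟨d, rfl⟩ := Nat.exists_eq_add_of_le' ht
    rw [mem_modelPart] at hf
    rcases lt_or_ge 2 i with hi | hi
    · rw [model_of_two_lt hi, Submodule.mem_bot] at hf
      rw [hf.1, map_zero]
      exact Submodule.zero_mem _
    · exact thetaMap_mem_hairy hm hN hi hf.2

/-- The sign of the isomorphism with the model. -/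
def modelSign (i : ℕ) : ℚ := if i = 2 then -1 else 1

theorem modelSign_mul_self (i : ℕ) : modelSign i * modelSign i = 1 := by
  unfold modelSign
  split_ifs <;> norm_num

/-- The isomorphism of the span of two-loop hairy graphs with the model. -/
noncomputable def modelEquiv (hm : Odd m) (hN : Even N) {F : GraphSpace m N →ₗ[ℚ] SkewPoly}
    (hF : ∀ s k, F (graphClass m N (theta s k)) = thetaVal s k) (i t : ℕ) :
    hairy m N i t ≃ₗ[ℚ] modelPart i t :=
  LinearEquiv.ofLinear
    (((modelSign i • F).comp (hairy m N i t).subtype).codRestrict (modelPart i t) fun z =>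
      Submodule.smul_mem _ _ (modelMap_hairy hm hN hF z.2).1)
    (((modelSign i • thetaMap m N (endHairs i)).comp (modelPart i t).subtype).codRestrict
      (hairy m N i t) fun f => Submodule.smul_mem _ _ (thetaMap_mem_hairy_of_modelPart hm hN f.2))
    (by
      ext f
      change modelSign i • F (modelSign i • thetaMap m N (endHairs i) f) = f
      rw [map_smul, smul_smul, modelSign_mul_self, one_smul, modelMap_of_mem hF f.2.1])
    (by
      refine LinearMap.ext fun z => Subtype.ext ?_
      change modelSign i • thetaMap m N (endHairs i) (modelSign i • F z) = z
      rw [map_smul, smul_smul, modelSign_mul_self, one_smul, (modelMap_hairy hm hN hF z.2).2])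

theorem modelEquiv_apply (hm : Odd m) (hN : Even N) {F : GraphSpace m N →ₗ[ℚ] SkewPoly}
    (hF : ∀ s k, F (graphClass m N (theta s k)) = thetaVal s k) (i t : ℕ) (z : hairy m N i t) :
    (modelEquiv hm hN hF i t z : SkewPoly) = modelSign i • F z := rfl

theorem thetaVal_eq_or (s : Bool → Bool) (k : Fin 3 → ℕ) {i : ℕ}
    (h : (s false).toNat + (s true).toNat = i) :
    thetaVal s k = thetaElement i k ∨ thetaVal s k = -thetaElement i k := by
  have hi : i ≤ 2 := by rw [← h]; cases s false <;> cases s true <;> simp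
  have hsign : ∀ (n : ℕ) (f : SkewPoly), (-1 : ℚ) ^ n • f = f ∨ (-1 : ℚ) ^ n • f = -f := fun n f => by
    rcases neg_one_pow_eq_or ℚ n with h | h <;> simp [h]
  rw [thetaVal, antisym_monomial]
  rcases endHairs_cases h with rfl | ⟨rfl, rfl⟩
  · have : endPart (endHairs i) ((1 / 6 : ℚ) • signedSum k) = thetaElement i k := by
      interval_cases i
      · rw [endPart_zero]; rfl
      · rw [endPart_one]; rfl
      · rw [endPart_two]; rfl
    rw [this]
    exact hsign _ _
  · rw [endPart_id, ← antisym_monomial, A_antisym, A_monomial, map_smul, smul_smul, midSign,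
      ← pow_add, antisym_monomial]
    exact hsign _ _

theorem differential_thetaMap_zero (hm : Odd m) (hN : Even N) (f : SkewPoly) :
    differential m N (thetaMap m N (endHairs 0) f) = 0 := by
  rw [differential_thetaMap hm hN]
  simp [endHairs]

theorem differential_thetaMap_one (hm : Odd m) (hN : Even N) (f : SkewPoly) :
    differential m N (thetaMap m N (endHairs 1) f) = thetaMap m N (endHairs 0) (e₁ * f) := by
  have h : Function.update (endHairs 1) false false = endHairs 0 := by
    funext b; cases b <;> rfl
  rw [differential_thetaMap hm hN, h]
  simp [endHairs]

/-- For a `*`even `f` the expansions at the two end points agree after the mirror image, since `A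
(e₁ * f)` is minus `parity f * e₁`; hence the factor two. The global sign is compensated by
`modelSign 2`. -/
theorem differential_thetaMap_two (hm : Odd m) (hN : Even N) {f : SkewPoly} (hf : A f = f) :
    differential m N (thetaMap m N (endHairs 2) f) =
      -thetaMap m N (endHairs 1) ((2 : ℚ) • (parity f * e₁)) := by
  have h : Function.update (endHairs 2) false false = id := by
    funext b; cases b <;> rfl
  have h' : Function.update (endHairs 2) true false = endHairs 1 := by
    funext b; cases b <;> rfl
  have h1 := A_e₁_mul_A f
  rw [hf] at h1
  rw [differential_thetaMap hm hN, h, h', if_pos (show endHairs 2 false = true from rfl),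
    if_pos (show endHairs 2 true = true from rfl), ← thetaMap_A hm hN (s := id) (s' := endHairs 1) (fun b => by simp [endHairs]), h1, map_neg,
    map_smul, two_smul]
  abel

theorem differential_hairy_zero (hm : Odd m) (hN : Even N) {t : ℕ} {z : GraphSpace m N}
    (hz : z ∈ hairy m N 0 t) : differential m N z = 0 := by
  obtain ⟨F, hF⟩ := exists_modelMap (m := m) (N := N) hm hN
  rw [← (modelMap_hairy hm hN hF hz).2, differential_thetaMap_zero hm hN]

theorem e₁_mem_modelPart {t : ℕ} {f : SkewPoly} (hf : f ∈ modelPart 1 t) :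
    starEvenPart (e₁ * f) ∈ modelPart 0 t := by
  rcases lt_or_ge t 1 with ht | ht
  · rw [modelPart_of_lt ht, Submodule.mem_bot] at hf
    rw [hf, mul_zero, map_zero]
    exact Submodule.zero_mem _
  · obtain ⟨d, rfl⟩ := Nat.exists_eq_add_of_le' ht
    rw [mem_modelPart] at hf
    exact (mem_modelPart (i := 0) (d := d + 1)).2 ⟨starEvenPart_mem_model (e₁_mul_mem_ASym hf.1),
      starEvenPart_mem_homogeneous (e₁_mul_mem_homogeneous hf.2)⟩

theorem mul_e₁_mem_modelPart {t : ℕ} {f : SkewPoly} (hf : f ∈ modelPart 2 t) :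
    parity f * e₁ ∈ modelPart 1 t := by
  rcases lt_or_ge t 2 with ht | ht
  · rw [modelPart_of_lt ht, Submodule.mem_bot] at hf
    rw [hf, map_zero, zero_mul]
    exact Submodule.zero_mem _
  · obtain ⟨d, rfl⟩ := Nat.exists_eq_add_of_le' ht
    rw [mem_modelPart] at hf
    exact (mem_modelPart (i := 1) (d := d + 1)).2 ⟨parity_mul_e₁_mem_ASym hf.1.1,
      mul_e₁_mem_homogeneous (parity_mem_homogeneous hf.2)⟩

/-- Up to signs `A` exchanges left and right multiplication by `e₁`, so it maps the two-sided
product to its negative, whose `*`even part vanishes. -/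
theorem starEvenPart_e₁_parity {f : SkewPoly} (hf : A f = f) :
    starEvenPart (e₁ * (parity f * e₁)) = 0 := by
  have h1 := A_e₁_mul_A f
  rw [hf] at h1
  have h2 : A (e₁ * (parity f * e₁)) = -(e₁ * (parity f * e₁)) := by
    have h3 : parity f * e₁ = -A (e₁ * f) := by rw [h1, neg_neg]
    rw [h3, mul_neg, map_neg, A_e₁_mul_A, parity_e₁_mul, neg_neg, neg_mul, mul_assoc, h3, mul_neg,
      neg_neg]
  rw [starEvenPart_apply, h2, add_neg_cancel, smul_zero]

/-- The differential of the model, as a map on the graded parts. -/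
theorem differential_hairy (hm : Odd m) (hN : Even N) {F : GraphSpace m N →ₗ[ℚ] SkewPoly}
    (hF : ∀ s k, F (graphClass m N (theta s k)) = thetaVal s k) (i t : ℕ) {z : GraphSpace m N}
    (hz : z ∈ hairy m N (i + 1) t) :
    differential m N z ∈ hairy m N i t ∧
    differential m N (differential m N z) = 0 ∧
    modelSign i • F (differential m N z) =
      modelDifferential (i + 1) (modelSign (i + 1) • F z) := by
  obtain ⟨h1, h2⟩ := modelMap_hairy hm hN hF hz
  rcases i with _ | _ | i
  · have h3 : differential m N z = thetaMap m N (endHairs 0) (starEvenPart (e₁ * F z)) := by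
      rw [thetaMap_starEvenPart hm hN fun _ => rfl, ← differential_thetaMap_one hm hN, h2]
    have h4 := e₁_mem_modelPart h1
    refine ⟨?_, ?_, ?_⟩
    · rw [h3]
      exact thetaMap_mem_hairy_of_modelPart hm hN h4
    · rw [h3, differential_thetaMap_zero hm hN]
    · rw [h3, modelMap_of_mem hF h4.1]
      simp [modelSign, modelDifferential]
  · have hA : A (F z) = F z := mem_starEven.1 h1.1.2
    have h3 : differential m N z = -thetaMap m N (endHairs 1) ((2 : ℚ) • (parity (F z) * e₁)) := by
      rw [← differential_thetaMap_two hm hN hA]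
      exact congrArg _ h2.symm
    have h4 := Submodule.smul_mem _ (2 : ℚ) (mul_e₁_mem_modelPart h1)
    refine ⟨?_, ?_, ?_⟩
    · rw [h3]
      exact Submodule.neg_mem _ (thetaMap_mem_hairy_of_modelPart hm hN h4)
    · rw [h3, map_neg, differential_thetaMap_one hm hN,
        ← thetaMap_starEvenPart hm hN (s := endHairs 0) fun _ => rfl, mul_smul_comm, map_smul,
        starEvenPart_e₁_parity hA, smul_zero, map_zero, neg_zero]
    · rw [h3, map_neg, modelMap_of_mem hF h4.1]
      simp [modelSign, modelDifferential]
  · rw [hairy_of_two_lt (by omega), Submodule.mem_bot] at hz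
    subst hz
    simp [modelDifferential]

end Complex

end TwoLoop

namespace TwoLoop
open OGraph SkewPoly

/-! ### Multiplication by `e₁` on even and on odd exponents -/

namespace SkewPoly

theorem hom_ext_three {M : Type*} [AddCommGroup M] [Module ℚ M] {L L' : SkewPoly →ₗ[ℚ] M}
    (h : ∀ a b c, L (monomial ![a, b, c]) = L' (monomial ![a, b, c])) : L = L' := by
  refine hom_ext fun k => ?_
  have : k = ![k 0, k 1, k 2] := by
    funext j
    fin_cases j <;> rfl
  rw [this]
  exact h _ _ _

/-- The part of the multiplication by `e₁` that increases an even exponent. -/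
noncomputable def mulEven : SkewPoly →ₗ[ℚ] SkewPoly :=
  monomialBasis.constr ℚ fun k => ∑ j, if k j % 2 = 0 then
    (-1 : ℚ) ^ (∑ i, if i < j then k i else 0) • monomial (bump k j) else 0

/-- The part of the multiplication by `e₁` that increases an odd exponent. -/
noncomputable def mulOdd : SkewPoly →ₗ[ℚ] SkewPoly :=
  monomialBasis.constr ℚ fun k => ∑ j, if k j % 2 = 1 then
    (-1 : ℚ) ^ (∑ i, if i < j then k i else 0) • monomial (bump k j) else 0

theorem mulEven_monomial (k : Fin 3 → ℕ) : mulEven (monomial k) = ∑ j, if k j % 2 = 0 then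
    (-1 : ℚ) ^ (∑ i, if i < j then k i else 0) • monomial (bump k j) else 0 :=
  monomialBasis.constr_basis _ _ _

theorem mulOdd_monomial (k : Fin 3 → ℕ) : mulOdd (monomial k) = ∑ j, if k j % 2 = 1 then
    (-1 : ℚ) ^ (∑ i, if i < j then k i else 0) • monomial (bump k j) else 0 :=
  monomialBasis.constr_basis _ _ _

theorem bump_three (a b c : ℕ) : bump ![a, b, c] 0 = ![a + 1, b, c] ∧
    bump ![a, b, c] 1 = ![a, b + 1, c] ∧ bump ![a, b, c] 2 = ![a, b, c + 1] := by
  refine ⟨?_, ?_, ?_⟩ <;> funext j <;> fin_cases j <;> simp [bump]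

theorem mulEven_three (a b c : ℕ) : mulEven (monomial ![a, b, c]) =
    (if a % 2 = 0 then monomial ![a + 1, b, c] else 0) +
    (if b % 2 = 0 then (-1 : ℚ) ^ a • monomial ![a, b + 1, c] else 0) +
    (if c % 2 = 0 then (-1 : ℚ) ^ (a + b) • monomial ![a, b, c + 1] else 0) := by
  obtain ⟨h0, h1, h2⟩ := bump_three a b c
  rw [mulEven_monomial, Fin.sum_univ_three, h0, h1, h2]
  simp [Fin.sum_univ_three]

theorem mulOdd_three (a b c : ℕ) : mulOdd (monomial ![a, b, c]) =
    (if a % 2 = 1 then monomial ![a + 1, b, c] else 0) +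
    (if b % 2 = 1 then (-1 : ℚ) ^ a • monomial ![a, b + 1, c] else 0) +
    (if c % 2 = 1 then (-1 : ℚ) ^ (a + b) • monomial ![a, b, c + 1] else 0) := by
  obtain ⟨h0, h1, h2⟩ := bump_three a b c
  rw [mulOdd_monomial, Fin.sum_univ_three, h0, h1, h2]
  simp [Fin.sum_univ_three]

theorem e₁_mul_eq (f : SkewPoly) : e₁ * f = mulOdd f + mulEven f := by
  have : mulHom e₁ = mulOdd + mulEven := by
    refine hom_ext fun k => ?_
    rw [LinearMap.add_apply, ← mul_def, e₁_mul_monomial, mulOdd_monomial, mulEven_monomial,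
      ← Finset.sum_add_distrib]
    refine Finset.sum_congr rfl fun j _ => ?_
    rcases Nat.mod_two_eq_zero_or_one (k j) with h | h <;> simp [h]
  exact congrArg (fun L => L f) this

/-- Raising the exponent `k j` changes the exponent of the sign in `A` by `k j + 1`, which is even
here. In `A_mulEven` it is odd. -/
theorem A_mulOdd (f : SkewPoly) : A (mulOdd f) = mulOdd (A f) := by
  have : A.comp mulOdd = mulOdd.comp A := by
    refine hom_ext fun k => ?_
    rw [LinearMap.comp_apply, LinearMap.comp_apply, A_monomial, map_smul, mulOdd_monomial, map_sum,
      Finset.smul_sum]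
    refine Finset.sum_congr rfl fun j _ => ?_
    split_ifs with h
    · rw [map_smul, A_monomial, smul_comm, sum_triangle_bump]
      congr 1
      refine neg_one_pow_congr ?_
      have : ((k j + 1 : ℕ) : ZMod 2) = 0 := by
        rw [ZMod.natCast_eq_zero_iff]
        omega
      rw [Nat.cast_add, this, add_zero]
    · rw [map_zero, smul_zero]
  exact congrArg (fun L => L f) this

theorem A_mulEven (f : SkewPoly) : A (mulEven f) = -mulEven (A f) := by
  have : A.comp mulEven = -mulEven.comp A := by
    refine hom_ext fun k => ?_
    rw [LinearMap.neg_apply, LinearMap.comp_apply, LinearMap.comp_apply, A_monomial, map_smul,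
      mulEven_monomial, map_sum, Finset.smul_sum, ← Finset.sum_neg_distrib]
    refine Finset.sum_congr rfl fun j _ => ?_
    split_ifs with h
    · rw [map_smul, A_monomial, smul_comm, sum_triangle_bump, ← neg_smul]
      congr 1
      rw [← neg_one_mul ((-1 : ℚ) ^ _), ← pow_succ']
      refine neg_one_pow_congr ?_
      have : ((k j : ℕ) : ZMod 2) = 0 := by
        rw [ZMod.natCast_eq_zero_iff]
        omega
      push_cast
      rw [this, zero_add]
    · rw [map_zero, smul_zero, neg_zero]
  exact congrArg (fun L => L f) this

theorem parity_mul_e₁ (f : SkewPoly) : parity f * e₁ = mulEven f - mulOdd f := by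
  have h := A_e₁_mul_A f
  rw [e₁_mul_eq, map_add, A_mulOdd, A_mulEven, A_A] at h
  rw [← neg_eq_iff_eq_neg.2 h]
  abel

/-- Antisymmetrization commutes with multiplication by `e₁` and with `A`, hence with the part of
this multiplication that commutes with `A`. -/
theorem antisym_mulOdd (f : SkewPoly) : antisym (mulOdd f) = mulOdd (antisym f) := by
  have h1 := antisym_e₁_mul f
  have h2 := antisym_e₁_mul (A f)
  rw [e₁_mul_eq, e₁_mul_eq, map_add] at h1
  rw [e₁_mul_eq, e₁_mul_eq, map_add, ← A_antisym] at h2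
  have h3 := congrArg A h2
  rw [map_add, map_add, A_antisym, A_antisym, A_mulOdd, A_mulOdd, A_mulEven, A_mulEven, A_A, A_A,
    map_neg] at h3
  have h4 : (2 : ℚ) • antisym (mulOdd f) = (2 : ℚ) • mulOdd (antisym f) := by
    linear_combination (norm := module) (1 : ℚ) • h1 + (1 : ℚ) • h3
  exact smul_right_injective _ (by norm_num) h4

theorem antisym_mulEven (f : SkewPoly) : antisym (mulEven f) = mulEven (antisym f) := by
  have h1 := antisym_e₁_mul f
  rw [e₁_mul_eq, e₁_mul_eq, map_add, antisym_mulOdd] at h1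
  exact add_left_cancel h1

/-- Multiplication by the central element `ξ₁² + ξ₂² + ξ₃²`. -/
noncomputable def mulSq : SkewPoly →ₗ[ℚ] SkewPoly :=
  monomialBasis.constr ℚ fun k => ∑ j, monomial (bump (bump k j) j)

theorem mulSq_monomial (k : Fin 3 → ℕ) : mulSq (monomial k) = ∑ j, monomial (bump (bump k j) j) :=
  monomialBasis.constr_basis _ _ _

theorem mulSq_three (a b c : ℕ) : mulSq (monomial ![a, b, c]) =
    monomial ![a + 2, b, c] + monomial ![a, b + 2, c] + monomial ![a, b, c + 2] := by
  rw [mulSq_monomial, Fin.sum_univ_three, (bump_three a b c).1, (bump_three _ b c).1,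
    (bump_three a b c).2.1, (bump_three a _ c).2.1, (bump_three a b c).2.2, (bump_three a b _).2.2]

theorem mod_two_cases (n : ℕ) : (∃ x, n = 2 * x) ∨ ∃ x, n = 2 * x + 1 := by
  rcases Nat.even_or_odd' n with ⟨x, h | h⟩
  · exact .inl ⟨x, h⟩
  · exact .inr ⟨x, h⟩

/-- Raising two different exponents in the two possible orders gives opposite signs, and an exponent
that was just raised is even and cannot be raised again. -/
theorem mulOdd_mulOdd (f : SkewPoly) : mulOdd (mulOdd f) = 0 := by
  have : mulOdd.comp mulOdd = 0 := by
    refine hom_ext_three fun a b c => ?_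
    rw [LinearMap.comp_apply, LinearMap.zero_apply]
    rcases mod_two_cases a with ⟨a, rfl⟩ | ⟨a, rfl⟩ <;> rcases mod_two_cases b with ⟨b, rfl⟩ | ⟨b, rfl⟩ <;>
    rcases mod_two_cases c with ⟨c, rfl⟩ | ⟨c, rfl⟩ <;>
    simp [mulOdd_three, Nat.add_mod, pow_add, pow_mul]
    all_goals try abel
  exact congrArg (fun L => L f) this

theorem mulEven_mulEven (f : SkewPoly) : mulEven (mulEven f) = 0 := by
  have : mulEven.comp mulEven = 0 := by
    refine hom_ext_three fun a b c => ?_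
    rw [LinearMap.comp_apply, LinearMap.zero_apply]
    rcases mod_two_cases a with ⟨a, rfl⟩ | ⟨a, rfl⟩ <;> rcases mod_two_cases b with ⟨b, rfl⟩ | ⟨b, rfl⟩ <;>
    rcases mod_two_cases c with ⟨c, rfl⟩ | ⟨c, rfl⟩ <;>
    simp [mulEven_three, Nat.add_mod, pow_add, pow_mul]
    all_goals try abel
  exact congrArg (fun L => L f) this

/-- Terms that raise two different exponents cancel. Raising one exponent twice occurs in exactly
one of the two compositions, depending on its parity, and has sign one. -/
theorem mulOdd_mulEven_add (f : SkewPoly) : mulOdd (mulEven f) + mulEven (mulOdd f) = mulSq f := by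
  have : mulOdd.comp mulEven + mulEven.comp mulOdd = mulSq := by
    refine hom_ext_three fun a b c => ?_
    rw [LinearMap.add_apply, LinearMap.comp_apply, LinearMap.comp_apply, mulSq_three]
    rcases mod_two_cases a with ⟨a, rfl⟩ | ⟨a, rfl⟩ <;> rcases mod_two_cases b with ⟨b, rfl⟩ | ⟨b, rfl⟩ <;>
    rcases mod_two_cases c with ⟨c, rfl⟩ | ⟨c, rfl⟩ <;>
    simp [mulEven_three, mulOdd_three, Nat.add_mod, pow_add, pow_mul]
    all_goals try abel
  exact congrArg (fun L => L f) this

/-! ### Contractions -/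

/-- A contraction for `mulEven`. -/
noncomputable def contractEven : SkewPoly →ₗ[ℚ] SkewPoly :=
  monomialBasis.constr ℚ fun k => if k 0 % 2 = 1 then monomial ![k 0 - 1, k 1, k 2] else 0

theorem contractEven_three (a b c : ℕ) : contractEven (monomial ![a, b, c]) =
    if a % 2 = 1 then monomial ![a - 1, b, c] else 0 :=
  monomialBasis.constr_basis _ _ _

/-- A contraction for `mulOdd`. -/
noncomputable def contractOdd : SkewPoly →ₗ[ℚ] SkewPoly :=
  monomialBasis.constr ℚ fun k =>
    if k 0 ≠ 0 then (if k 0 % 2 = 0 then monomial ![k 0 - 1, k 1, k 2] else 0) else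
    if k 1 ≠ 0 then (if k 1 % 2 = 0 then monomial ![k 0, k 1 - 1, k 2] else 0) else
    if k 2 ≠ 0 then (if k 2 % 2 = 0 then monomial ![k 0, k 1, k 2 - 1] else 0) else 0

theorem contractOdd_three (a b c : ℕ) : contractOdd (monomial ![a, b, c]) =
    if a ≠ 0 then (if a % 2 = 0 then monomial ![a - 1, b, c] else 0) else
    if b ≠ 0 then (if b % 2 = 0 then monomial ![a, b - 1, c] else 0) else
    if c ≠ 0 then (if c % 2 = 0 then monomial ![a, b, c - 1] else 0) else 0 :=
  monomialBasis.constr_basis _ _ _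

/-- The first variable alone gives the contraction: lowering an odd first exponent inverts raising
an even one, and the terms in the other variables cancel. -/
theorem contractEven_add (f : SkewPoly) :
    mulEven (contractEven f) + contractEven (mulEven f) = f := by
  have : mulEven.comp contractEven + contractEven.comp mulEven = LinearMap.id := by
    refine hom_ext_three fun a b c => ?_
    rw [LinearMap.add_apply, LinearMap.comp_apply, LinearMap.comp_apply, LinearMap.id_apply]
    rcases mod_two_cases a with ⟨a, rfl⟩ | ⟨a, rfl⟩ <;> rcases mod_two_cases b with ⟨b, rfl⟩ | ⟨b, rfl⟩ <;>
    rcases mod_two_cases c with ⟨c, rfl⟩ | ⟨c, rfl⟩ <;>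
    simp [mulEven_three, contractEven_three, Nat.add_mod, pow_add, pow_mul]
    all_goals try abel
  exact congrArg (fun L => L f) this

theorem pos_cases (n : ℕ) : n = 0 ∨ (∃ x, n = 2 * x + 1) ∨ ∃ x, n = 2 * x + 1 + 1 := by
  rcases mod_two_cases n with ⟨x, h⟩ | ⟨x, h⟩
  · rcases x with _ | x
    · exact .inl h
    · exact .inr (.inr ⟨x, by omega⟩)
  · exact .inr (.inl ⟨x, h⟩)

/-- An exponent zero is even and not reached by raising an odd one, so the contraction lowers the
first nonzero exponent; only the constant monomial has none. -/
theorem contractOdd_add (k : Fin 3 → ℕ) :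
    mulOdd (contractOdd (monomial k)) + contractOdd (mulOdd (monomial k)) =
      if k = 0 then 0 else monomial k := by
  obtain ⟨a, b, c, rfl⟩ : ∃ a b c, k = ![a, b, c] := ⟨k 0, k 1, k 2, by
    funext j
    fin_cases j <;> rfl⟩
  rcases pos_cases a with rfl | ⟨a, rfl⟩ | ⟨a, rfl⟩ <;>
    rcases pos_cases b with rfl | ⟨b, rfl⟩ | ⟨b, rfl⟩ <;>
    rcases pos_cases c with rfl | ⟨c, rfl⟩ | ⟨c, rfl⟩ <;>
    simp [mulOdd_three, contractOdd_three, Nat.add_mod, pow_add, pow_mul]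
  all_goals try abel

end SkewPoly

end TwoLoop

namespace TwoLoop
open OGraph SkewPoly

namespace SkewPoly

/-! ### Coefficients and supports -/

/-- The coefficient of a monomial. -/
noncomputable def coeff (k : Fin 3 → ℕ) : SkewPoly →ₗ[ℚ] ℚ := monomialBasis.coord k

theorem coeff_monomial (k l : Fin 3 → ℕ) : coeff k (monomial l) = if l = k then 1 else 0 := by
  rw [coeff, Module.Basis.coord_apply, ← monomialBasis_apply, Module.Basis.repr_self,
    Finsupp.single_apply]

/-- The elements whose monomials have exponents in a given set. -/
noncomputable def supp (S : Set (Fin 3 → ℕ)) : Submodule ℚ SkewPoly :=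
  Submodule.span ℚ (monomialBasis '' S)

theorem mem_supp {S : Set (Fin 3 → ℕ)} {f : SkewPoly} :
    f ∈ supp S ↔ ∀ k, coeff k f ≠ 0 → k ∈ S := by
  rw [supp, Module.Basis.mem_span_image]
  constructor
  · intro h k hk
    exact h (Finsupp.mem_support_iff.2 hk)
  · intro h k hk
    exact h k (Finsupp.mem_support_iff.1 hk)

theorem monomial_mem_supp {S : Set (Fin 3 → ℕ)} {k : Fin 3 → ℕ} (h : k ∈ S) : monomial k ∈ supp S :=
  Submodule.subset_span ⟨k, h, rfl⟩

theorem map_mem_supp {S : Set (Fin 3 → ℕ)} {L : SkewPoly →ₗ[ℚ] SkewPoly} {W : Submodule ℚ SkewPoly}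
    (h : ∀ k ∈ S, L (monomial k) ∈ W) {f : SkewPoly} (hf : f ∈ supp S) : L f ∈ W := by
  have : supp S ≤ W.comap L := by
    refine Submodule.span_le.2 ?_
    rintro _ ⟨k, hk, rfl⟩
    exact h k hk
  exact this hf

theorem eq_on_supp {S : Set (Fin 3 → ℕ)} {M : Type*} [AddCommGroup M] [Module ℚ M]
    {L L' : SkewPoly →ₗ[ℚ] M} (h : ∀ k ∈ S, L (monomial k) = L' (monomial k)) {f : SkewPoly}
    (hf : f ∈ supp S) : L f = L' f := by
  have : supp S ≤ LinearMap.eqLocus L L' := by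
    refine Submodule.span_le.2 ?_
    rintro _ ⟨k, hk, rfl⟩
    exact h k hk
  exact this hf

theorem mem_supp_self (f : SkewPoly) : f ∈ supp {k | coeff k f ≠ 0} := mem_supp.2 fun _ h => h

theorem eq_zero_of_coeff {f : SkewPoly} (h : ∀ k, coeff k f = 0) : f = 0 :=
  monomialBasis.ext_elem fun k => by
    rw [map_zero, Finsupp.zero_apply]
    exact h k

theorem supp_mono {S T : Set (Fin 3 → ℕ)} (h : S ⊆ T) : supp S ≤ supp T :=
  Submodule.span_mono (Set.image_mono h)

theorem homogeneous_eq (d : ℕ) : homogeneous d = supp {k | ∑ j, k j = d} := by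
  rw [homogeneous, supp]
  congr 1
  ext f
  constructor
  · rintro ⟨k, hk, rfl⟩
    exact ⟨k, hk, rfl⟩
  · rintro ⟨k, hk, rfl⟩
    exact ⟨k, hk, rfl⟩

theorem iSup_homogeneous_eq (i t : ℕ) :
    (⨆ (d : ℕ) (_ : d + i = t), homogeneous d) = supp {k | ∑ j, k j + i = t} := by
  rw [iSup_homogeneous]
  split_ifs with h
  · rw [homogeneous_eq]
    congr 1
    ext k
    simp only [Set.mem_setOf_eq]
    omega
  · symm
    rw [eq_bot_iff]
    intro f hf
    rw [Submodule.mem_bot]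
    refine eq_zero_of_coeff fun k => ?_
    by_contra hk
    have h2 : ∑ j, k j + i = t := mem_supp.1 hf k hk
    omega

theorem coeff_renumber (σ : Equiv.Perm (Fin 3)) (k : Fin 3 → ℕ) (f : SkewPoly) :
    coeff (k ∘ σ.symm) (renumber σ f) = (-1) ^ inversions σ k * coeff k f := by
  have : (coeff (k ∘ σ.symm)).comp (renumber σ) = ((-1 : ℚ) ^ inversions σ k) • coeff k := by
    refine hom_ext fun l => ?_
    rw [LinearMap.comp_apply, LinearMap.smul_apply, renumber_monomial, map_smul, coeff_monomial,
      coeff_monomial]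
    by_cases h : l = k
    · subst h
      simp
    · have h' : l ∘ σ.symm ≠ k ∘ σ.symm := fun he =>
        h (σ.symm.surjective.injective_comp_right he)
      simp [h, h']
  exact congrArg (fun L => L f) this

theorem coeff_comp {f : SkewPoly} (hf : f ∈ ASym) (σ : Equiv.Perm (Fin 3)) (k : Fin 3 → ℕ) :
    ((Equiv.Perm.sign σ : ℤ) : ℚ) * coeff (k ∘ σ.symm) f = (-1) ^ inversions σ k * coeff k f := by
  rw [← coeff_renumber, mem_ASym.1 hf, map_smul, smul_eq_mul]

theorem coeff_comp_ne_zero {f : SkewPoly} (hf : f ∈ ASym) (σ : Equiv.Perm (Fin 3)) {k : Fin 3 → ℕ}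
    (h : coeff k f ≠ 0) : coeff (k ∘ σ) f ≠ 0 := by
  intro h0
  have := coeff_comp hf σ⁻¹ k
  have hs : (σ⁻¹).symm = σ := rfl
  rw [hs, h0, mul_zero] at this
  exact mul_ne_zero (pow_ne_zero _ (by norm_num)) h this.symm

theorem antisym_mem_supp {S : Set (Fin 3 → ℕ)} (hS : ∀ k ∈ S, ∀ σ : Equiv.Perm (Fin 3), k ∘ σ ∈ S)
    {f : SkewPoly} (hf : f ∈ supp S) : antisym f ∈ supp S := by
  rw [antisym_apply]
  refine Submodule.smul_mem _ _ (Submodule.sum_mem _ fun σ _ => Submodule.smul_mem _ _ ?_)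
  refine map_mem_supp (fun k hk => ?_) hf
  rw [renumber_monomial]
  exact Submodule.smul_mem _ _ (monomial_mem_supp (hS k hk _))

theorem coeff_antisym_monomial (k l : Fin 3 → ℕ) : coeff l (antisym (monomial k)) =
    (1 / 6) * ∑ σ : Equiv.Perm (Fin 3), if k ∘ σ.symm = l then
      ((Equiv.Perm.sign σ : ℤ) : ℚ) * (-1) ^ inversions σ k else 0 := by
  rw [antisym_apply, map_smul, smul_eq_mul, map_sum]
  congr 1
  refine Finset.sum_congr rfl fun σ _ => ?_
  rw [map_smul, renumber_monomial, map_smul, coeff_monomial]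
  split_ifs <;> simp

theorem antisym_one : antisym 1 = 0 := by
  have h := antisym_renumber (Equiv.swap 0 1) 1
  rw [renumber_one, Equiv.Perm.sign_swap (by decide)] at h
  have h2 : antisym 1 = -antisym 1 := by simpa using h
  have h3 : (2 : ℚ) • antisym 1 = 0 := by
    rw [two_smul]
    exact eq_neg_iff_add_eq_zero.1 h2
  exact (smul_eq_zero.1 h3).resolve_left (by norm_num)

/-! ### The grading by the number of odd exponents -/

/-- The antisymmetric elements of degree `t - i` with `q` odd exponents. -/
noncomputable def part (q i t : ℕ) : Submodule ℚ SkewPoly :=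
  ASym ⊓ supp {k | ∑ j, k j % 2 = q ∧ ∑ j, k j + i = t}

theorem comp_mem_part_set {q i t : ℕ} (k : Fin 3 → ℕ)
    (hk : k ∈ {k : Fin 3 → ℕ | ∑ j, k j % 2 = q ∧ ∑ j, k j + i = t}) (σ : Equiv.Perm (Fin 3)) :
    k ∘ σ ∈ {k : Fin 3 → ℕ | ∑ j, k j % 2 = q ∧ ∑ j, k j + i = t} := by
  refine ⟨(Equiv.sum_comp σ fun j => k j % 2).trans hk.1, ?_⟩
  have : ∑ j, (k ∘ σ) j = ∑ j, k j := Equiv.sum_comp σ k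
  rw [this]
  exact hk.2

theorem antisym_mem_part {q i t : ℕ} {f : SkewPoly}
    (hf : f ∈ supp {k | ∑ j, k j % 2 = q ∧ ∑ j, k j + i = t}) : antisym f ∈ part q i t :=
  ⟨antisym_mem f, antisym_mem_supp comp_mem_part_set hf⟩

theorem sum_bump_mod_even {k : Fin 3 → ℕ} {j : Fin 3} (h : k j % 2 = 0) :
    ∑ i, bump k j i % 2 = ∑ i, k i % 2 + 1 := by
  have : ∀ i, bump k j i % 2 = k i % 2 + if i = j then 1 else 0 := by
    intro i
    unfold bump
    split_ifs with hi
    · subst hi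
      omega
    · rfl
  simp_rw [this, Finset.sum_add_distrib]
  simp

theorem sum_bump_mod_odd {k : Fin 3 → ℕ} {j : Fin 3} (h : k j % 2 = 1) :
    ∑ i, bump k j i % 2 + 1 = ∑ i, k i % 2 := by
  have : ∀ i, k i % 2 = bump k j i % 2 + if i = j then 1 else 0 := by
    intro i
    unfold bump
    split_ifs with hi
    · subst hi
      omega
    · rfl
  simp_rw [fun i => this i, Finset.sum_add_distrib]
  simp [bump, Nat.add_mod]
  

/-- Replacing `f` by `antisym f` and moving `antisym` outside reduces the claim about supports to
single monomials. -/
theorem mulEven_mem_part {q i t : ℕ} {f : SkewPoly} (hf : f ∈ part q (i + 1) t) :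
    mulEven f ∈ part (q + 1) i t := by
  rw [← antisym_of_mem hf.1, ← antisym_mulEven]
  refine antisym_mem_part (map_mem_supp (fun k hk => ?_) hf.2)
  rw [mulEven_monomial]
  refine Submodule.sum_mem _ fun j _ => ?_
  split_ifs with h
  · refine Submodule.smul_mem _ _ (monomial_mem_supp ⟨?_, ?_⟩)
    · rw [sum_bump_mod_even h, hk.1]
    · have := hk.2
      rw [sum_bump]
      omega
  · exact Submodule.zero_mem _

theorem mulOdd_mem_part {q i t : ℕ} {f : SkewPoly} (hf : f ∈ part (q + 1) (i + 1) t) :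
    mulOdd f ∈ part q i t := by
  rw [← antisym_of_mem hf.1, ← antisym_mulOdd]
  refine antisym_mem_part (map_mem_supp (fun k hk => ?_) hf.2)
  rw [mulOdd_monomial]
  refine Submodule.sum_mem _ fun j _ => ?_
  split_ifs with h
  · refine Submodule.smul_mem _ _ (monomial_mem_supp ⟨?_, ?_⟩)
    · have := sum_bump_mod_odd h
      have := hk.1
      omega
    · have := hk.2
      rw [sum_bump]
      omega
  · exact Submodule.zero_mem _

theorem mod_of_sum_three {k : Fin 3 → ℕ} (h : ∑ j, k j % 2 = 3) (j : Fin 3) : k j % 2 = 1 := by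
  rw [Fin.sum_univ_three] at h
  fin_cases j <;> simp <;> omega

theorem mod_of_sum_zero {k : Fin 3 → ℕ} (h : ∑ j, k j % 2 = 0) (j : Fin 3) : k j % 2 = 0 := by
  rw [Fin.sum_univ_three] at h
  fin_cases j <;> simp <;> omega

theorem mulEven_of_three {i t : ℕ} {f : SkewPoly} (hf : f ∈ part 3 i t) : mulEven f = 0 := by
  refine eq_on_supp (L' := 0) (fun k hk => ?_) hf.2
  rw [mulEven_monomial]
  exact Finset.sum_eq_zero fun j _ => if_neg (by rw [mod_of_sum_three hk.1]; norm_num)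

theorem mulOdd_of_zero {i t : ℕ} {f : SkewPoly} (hf : f ∈ part 0 i t) : mulOdd f = 0 := by
  refine eq_on_supp (L' := 0) (fun k hk => ?_) hf.2
  rw [mulOdd_monomial]
  exact Finset.sum_eq_zero fun j _ => if_neg (by rw [mod_of_sum_zero hk.1]; norm_num)

theorem eq_vec (k : Fin 3 → ℕ) : k = ![k 0, k 1, k 2] := by
  funext j
  fin_cases j <;> rfl

/-- Exactness of the multiplication that increases even exponents. -/
theorem exists_mulEven {q i t : ℕ} {f : SkewPoly} (hf : f ∈ part (q + 1) i t) (h : mulEven f = 0) :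
    ∃ g ∈ part q (i + 1) t, mulEven g = f := by
  -- The contraction prefers the first variable and does not preserve antisymmetry, but its
  -- antisymmetrization is still a preimage because `antisym` commutes with `mulEven`.
  refine ⟨antisym (contractEven f), antisym_mem_part (map_mem_supp (fun k hk => ?_) hf.2), ?_⟩
  · obtain ⟨h1, h2⟩ := hk
    rw [eq_vec k, contractEven_three]
    rw [Fin.sum_univ_three] at h1 h2
    split_ifs with h0
    · refine monomial_mem_supp ⟨?_, ?_⟩ <;> rw [Fin.sum_univ_three] <;> simp <;> omega
    · exact Submodule.zero_mem _
  · have := contractEven_add f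
    rw [h, map_zero, add_zero] at this
    rw [← antisym_mulEven, this, antisym_of_mem hf.1]

/-- The constant monomial, where the contraction fails, is killed by antisymmetrization. -/
theorem contractOdd_antisym {f : SkewPoly} (hf : f ∈ ASym) :
    antisym (mulOdd (contractOdd f) + contractOdd (mulOdd f)) = f := by
  have : antisym.comp (mulOdd.comp contractOdd + contractOdd.comp mulOdd) = antisym := by
    refine hom_ext fun k => ?_
    rw [LinearMap.comp_apply, LinearMap.add_apply, LinearMap.comp_apply, LinearMap.comp_apply,
      contractOdd_add]
    split_ifs with h
    · rw [h, ← one_def, antisym_one, map_zero]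
    · rfl
  have h2 := congrArg (fun L => L f) this
  exact h2.trans (antisym_of_mem hf)

/-- Exactness of the multiplication that increases odd exponents. -/
theorem exists_mulOdd {q i t : ℕ} {f : SkewPoly} (hf : f ∈ part q i t) (h : mulOdd f = 0) :
    ∃ g ∈ part (q + 1) (i + 1) t, mulOdd g = f := by
  refine ⟨antisym (contractOdd f), antisym_mem_part (map_mem_supp (fun k hk => ?_) hf.2), ?_⟩
  · obtain ⟨h1, h2⟩ := hk
    rw [eq_vec k, contractOdd_three]
    rw [Fin.sum_univ_three] at h1 h2
    split_ifs
    all_goals try exact Submodule.zero_mem _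
    all_goals
      refine monomial_mem_supp ⟨?_, ?_⟩ <;> rw [Fin.sum_univ_three] <;> simp <;> omega
  · have := contractOdd_antisym hf.1
    rw [h, map_zero, add_zero, antisym_mulOdd] at this
    exact this

/-! ### Division by `ξ₁² + ξ₂² + ξ₃²` -/

/-- If no first exponent exceeds `k 0`, then `k 0 + 2` can only be reached by raising the first
exponent. -/
theorem coeff_mulSq {f : SkewPoly} {k : Fin 3 → ℕ} (h : ∀ l, coeff l f ≠ 0 → l 0 ≤ k 0) :
    coeff (bump (bump k 0) 0) (mulSq f) = coeff k f := by
  refine eq_on_supp (S := {l | l 0 ≤ k 0}) (L := (coeff (bump (bump k 0) 0)).comp mulSq) ?_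
    (mem_supp.2 h)
  intro l hl
  replace hl : l 0 ≤ k 0 := hl
  rw [LinearMap.comp_apply, mulSq_monomial, map_sum, Fin.sum_univ_three, coeff_monomial,
    coeff_monomial, coeff_monomial, coeff_monomial]
  have h1 : bump (bump l 1) 1 ≠ bump (bump k 0) 0 := fun he => by
    have := congrFun he 0
    simp [bump] at this
    omega
  have h2 : bump (bump l 2) 2 ≠ bump (bump k 0) 0 := fun he => by
    have := congrFun he 0
    simp [bump] at this
    omega
  rw [if_neg h1, if_neg h2, add_zero, add_zero]
  congr 1
  rw [eq_iff_iff]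
  constructor
  · intro he
    funext j
    have := congrFun he j
    simp only [bump] at this
    omega
  · rintro rfl
    rfl

theorem exists_max {f : SkewPoly} (hf : f ≠ 0) :
    ∃ k, coeff k f ≠ 0 ∧ ∀ l, coeff l f ≠ 0 → l 0 ≤ k 0 := by
  have hfin : {k | coeff k f ≠ 0}.Finite := (monomialBasis.repr f).finite_support
  have hne : {k | coeff k f ≠ 0}.Nonempty := by
    by_contra h
    refine hf (eq_zero_of_coeff fun k => ?_)
    by_contra hk
    exact h ⟨k, hk⟩
  obtain ⟨k, hk, h⟩ := Set.exists_max_image _ (fun k : Fin 3 → ℕ => k 0) hfin hne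
  exact ⟨k, hk, h⟩

theorem mulSq_injective {f : SkewPoly} (h : mulSq f = 0) : f = 0 := by
  by_contra hf
  obtain ⟨k, hk, hmax⟩ := exists_max hf
  have := coeff_mulSq hmax
  rw [h, map_zero] at this
  exact hk this.symm

end SkewPoly

end TwoLoop

namespace TwoLoop
open OGraph SkewPoly

namespace SkewPoly

/-! ### Representatives modulo `ξ₁² + ξ₂² + ξ₃²` -/

/-- Sorted exponents, all even and distinct if `ε = 0`, all odd if `ε = 1`. -/
def Lead (ε : ℕ) (k : Fin 3 → ℕ) : Prop :=
  (∀ j, k j % 2 = ε) ∧ k 1 < k 0 + ε ∧ k 2 < k 1 + ε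

/-- The sorted exponents that do not stay sorted if the first one is decreased by two. -/
def Rest (ε : ℕ) (k : Fin 3 → ℕ) : Prop := Lead ε k ∧ k 0 + 2 * ε = k 1 + 2

variable {ε : ℕ}

theorem mod_of_coeff (hε : ε ≤ 1) {i t : ℕ} {f : SkewPoly} (hf : f ∈ part (3 * ε) i t)
    {k : Fin 3 → ℕ} (hk : coeff k f ≠ 0) (j : Fin 3) : k j % 2 = ε := by
  have h := (mem_supp.1 hf.2 k hk).1
  interval_cases ε
  · exact mod_of_sum_zero h j
  · exact mod_of_sum_three h j

theorem sum_of_coeff {q i t : ℕ} {f : SkewPoly} (hf : f ∈ part q i t) {k : Fin 3 → ℕ}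
    (hk : coeff k f ≠ 0) : ∑ j, k j + i = t :=
  (mem_supp.1 hf.2 k hk).2

theorem sum_mod {k : Fin 3 → ℕ} (h : ∀ j, k j % 2 = ε) : ∑ j, k j % 2 = 3 * ε := by
  simp [h]

theorem even_inversions {k : Fin 3 → ℕ} (h : ∀ j, k j % 2 = 0) (σ : Equiv.Perm (Fin 3)) :
    (-1 : ℚ) ^ inversions σ k = 1 := by
  refine Even.neg_one_pow ?_
  refine Finset.even_sum _ fun a _ => Finset.even_sum _ fun b _ => ?_
  split_ifs
  · exact (Nat.even_iff.2 (h a)).mul_right _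
  · exact Even.zero

/-- Odd powers of different variables anticommute, which compensates the sign of the permutation:
antisymmetric elements have symmetric coefficients on odd exponents. -/
theorem odd_inversions {k : Fin 3 → ℕ} (h : ∀ j, k j % 2 = 1) (σ : Equiv.Perm (Fin 3)) :
    ((Equiv.Perm.sign σ : ℤ) : ℚ) * (-1) ^ inversions σ k = 1 := by
  have hk : ∀ j, (k j : ZMod 2) = 1 := fun j => by
    rw [← Nat.cast_one, ZMod.natCast_eq_natCast_iff']
    exact h j
  have key : ∀ n : ℕ, ((Equiv.Perm.sign σ : ℤ) : ℚ) = (-1) ^ n →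
      ((n + inversions σ k : ℕ) : ZMod 2) = (0 : ℕ) →
      ((Equiv.Perm.sign σ : ℤ) : ℚ) * (-1) ^ inversions σ k = 1 := by
    intro n hn h
    rw [hn, ← pow_add, neg_one_pow_congr h, pow_zero]
  rcases perm_cases σ with h | h | h | h | h | h <;> obtain ⟨h0, h1, h2, h3, h4, h5, hs⟩ := h
  on_goal 1 => refine key 0 (by simp [hs]) ?_
  on_goal 2 => refine key 1 (by simp [hs]) ?_
  on_goal 3 => refine key 1 (by simp [hs]) ?_
  on_goal 4 => refine key 1 (by simp [hs]) ?_
  on_goal 5 => refine key 0 (by simp [hs]) ?_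
  on_goal 6 => refine key 0 (by simp [hs]) ?_
  all_goals
    simp [inversions, Fin.sum_univ_three, h0, h1, h2, hk]
    try decide

/-- Even powers are central, so a monomial with two equal even exponents is fixed by a transposition
and cannot occur in an antisymmetric element. -/
theorem ne_of_coeff {i t : ℕ} {f : SkewPoly} (hf : f ∈ part 0 i t) {k : Fin 3 → ℕ}
    (hk : coeff k f ≠ 0) {a b : Fin 3} (hab : a ≠ b) : k a ≠ k b := by
  intro he
  have h := coeff_comp hf.1 (Equiv.swap a b) k
  have hc : k ∘ (Equiv.swap a b).symm = k := by
    funext j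
    rw [Function.comp_apply, Equiv.symm_swap, Equiv.swap_apply_def]
    split_ifs with h1 h2
    · rw [h1, he]
    · rw [h2, he]
    · rfl
  rw [hc, even_inversions (mod_of_coeff (ε := 0) (by norm_num) hf hk), Equiv.Perm.sign_swap hab] at h
  refine hk ?_
  have : -coeff k f = coeff k f := by simpa using h
  linarith

theorem Lead.antitone (hε : ε ≤ 1) {k : Fin 3 → ℕ} (h : Lead ε k) : Antitone k := by
  obtain ⟨-, h1, h2⟩ := h
  intro a b hab
  fin_cases a <;> fin_cases b <;> simp at hab ⊢ <;> omega

theorem exists_antitone (k : Fin 3 → ℕ) : ∃ σ : Equiv.Perm (Fin 3), Antitone (k ∘ σ) := by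
  refine ⟨Fin.revPerm.trans (Tuple.sort k), fun a b hab => ?_⟩
  exact Tuple.monotone_sort k (Fin.rev_le_rev.2 hab)

theorem lead_of_antitone (hε : ε ≤ 1) {i t : ℕ} {f : SkewPoly} (hf : f ∈ part (3 * ε) i t)
    {k : Fin 3 → ℕ} (hk : coeff k f ≠ 0) (h01 : k 1 ≤ k 0) (h12 : k 2 ≤ k 1) : Lead ε k := by
  refine ⟨mod_of_coeff hε hf hk, ?_⟩
  interval_cases ε
  · have h1 := ne_of_coeff hf hk (show (0 : Fin 3) ≠ 1 by decide)
    have h2 := ne_of_coeff hf hk (show (1 : Fin 3) ≠ 2 by decide)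
    omega
  · omega

theorem coeff_antisym_of_ne (hε : ε ≤ 1) {k l : Fin 3 → ℕ} (hk : Lead ε k) (hl : Lead ε l)
    (h : l ≠ k) : coeff l (antisym (monomial k)) = 0 := by
  rw [coeff_antisym_monomial, Finset.sum_eq_zero, mul_zero]
  intro σ _
  refine if_neg fun he => h ?_
  have h1 : Antitone (k ∘ σ.symm) := he ▸ hl.antitone hε
  have h2 : Antitone (k ∘ (1 : Equiv.Perm (Fin 3))) := hk.antitone hε
  rw [← he, Tuple.unique_antitone h1 h2]
  rfl

/-- The permutations that fix `k` all contribute `+1`: even exponents are distinct and only the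
identity fixes them, while for odd exponents the signs cancel. -/
theorem coeff_antisym_self (hε : ε ≤ 1) {k : Fin 3 → ℕ} (hk : Lead ε k) :
    coeff k (antisym (monomial k)) ≠ 0 := by
  rw [coeff_antisym_monomial]
  refine mul_ne_zero (by norm_num) (ne_of_gt ?_)
  have hterm : ∀ σ : Equiv.Perm (Fin 3), (if k ∘ σ.symm = k then
      ((Equiv.Perm.sign σ : ℤ) : ℚ) * (-1) ^ inversions σ k else 0) =
      if k ∘ σ.symm = k then 1 else 0 := by
    intro σ
    split_ifs with h
    · interval_cases ε
      · have hinj : Function.Injective k := by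
          have h1 := hk.2.1
          have h2 := hk.2.2
          intro a b hab
          fin_cases a <;> fin_cases b <;> simp at hab ⊢ <;> omega
        have hσ : σ = 1 := by
          ext j
          have := congrFun h (σ j)
          rw [Function.comp_apply, Equiv.symm_apply_apply] at this
          rw [← hinj this]
          rfl
        rw [even_inversions hk.1, hσ]
        simp
      · exact odd_inversions hk.1 σ
    · rfl
  simp_rw [hterm]
  refine Finset.sum_pos' (fun σ _ => ?_) ⟨1, Finset.mem_univ _, ?_⟩
  · split_ifs <;> norm_num
  · rw [if_pos (by rfl)]
    norm_num

/-- The antisymmetrized monomials with exponents in a given set. -/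
noncomputable def antisymSpan (S : Set (Fin 3 → ℕ)) : Submodule ℚ SkewPoly :=
  Submodule.span ℚ ((fun k => antisym (monomial k)) '' S)

theorem antisym_mem_antisymSpan {S : Set (Fin 3 → ℕ)} {k : Fin 3 → ℕ} (σ : Equiv.Perm (Fin 3))
    (h : k ∘ σ ∈ S) : antisym (monomial k) ∈ antisymSpan S := by
  have h1 := antisym_renumber σ⁻¹ (monomial k)
  have hs : (σ⁻¹).symm = σ := rfl
  rw [renumber_monomial, map_smul, hs] at h1
  have h2 : antisym (monomial k) = (((Equiv.Perm.sign σ⁻¹ : ℤ) : ℚ) * (-1) ^ inversions σ⁻¹ k) •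
      antisym (monomial (k ∘ σ)) := by
    rw [mul_smul, h1, smul_smul, sign_mul_self, one_smul]
  rw [h2]
  exact Submodule.smul_mem _ _ (Submodule.subset_span ⟨_, h, rfl⟩)

theorem mem_antisymSpan {S : Set (Fin 3 → ℕ)} {f : SkewPoly} (hf : f ∈ ASym)
    (h : ∀ k, coeff k f ≠ 0 → ∃ σ : Equiv.Perm (Fin 3), k ∘ σ ∈ S) : f ∈ antisymSpan S := by
  rw [← antisym_of_mem hf]
  refine map_mem_supp (fun k hk => ?_) (mem_supp_self f)
  obtain ⟨σ, hσ⟩ := h k hk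
  exact antisym_mem_antisymSpan σ hσ

/-- The first exponent of any rearrangement of a triple in `Rest` fails to exceed all other
exponents by a sufficient margin; this is a form of the condition that makes sense for unsorted
exponents. -/
theorem antisymSpan_rest_supp (hε : ε ≤ 1) : antisymSpan {k | Rest ε k} ≤
    supp {k | ∃ j, j ≠ 0 ∧ k 0 + 2 * ε ≤ k j + 2} := by
  refine Submodule.span_le.2 ?_
  rintro _ ⟨k, ⟨⟨-, h1, h2⟩, h3⟩, rfl⟩
  refine supp_mono (S := {l | ∃ σ : Equiv.Perm (Fin 3), l = k ∘ σ}) ?_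
    (antisym_mem_supp ?_ (monomial_mem_supp ⟨1, rfl⟩))
  swap
  · rintro _ ⟨σ, rfl⟩ τ
    exact ⟨σ * τ, rfl⟩
  · rintro _ ⟨σ, rfl⟩
    rcases perm_cases σ with h | h | h | h | h | h <;> obtain ⟨s0, s1, s2, -⟩ := h
    · exact ⟨1, by decide, by simp only [Function.comp_apply, s0, s1]; omega⟩
    · exact ⟨1, by decide, by simp only [Function.comp_apply, s0, s1]; omega⟩
    · exact ⟨1, by decide, by simp only [Function.comp_apply, s0, s1]; omega⟩
    · exact ⟨2, by decide, by simp only [Function.comp_apply, s0, s2]; omega⟩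
    · exact ⟨2, by decide, by simp only [Function.comp_apply, s0, s2]; omega⟩
    · exact ⟨1, by decide, by simp only [Function.comp_apply, s0, s1]; omega⟩

/-- A monomial that is maximal for the first exponent can be chosen with sorted exponents. -/
theorem exists_lead_max (hε : ε ≤ 1) {i t : ℕ} {f : SkewPoly} (hf : f ∈ part (3 * ε) i t)
    (h0 : f ≠ 0) : ∃ k, Lead ε k ∧ coeff k f ≠ 0 ∧ ∀ l, coeff l f ≠ 0 → l 0 ≤ k 0 := by
  obtain ⟨k, hk, hmax⟩ := exists_max h0
  have hle : ∀ k', coeff k' f ≠ 0 → ∀ j, k' j ≤ k 0 := by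
    intro k' hk' j
    have := hmax _ (coeff_comp_ne_zero hf.1 (Equiv.swap 0 j) hk')
    simpa using this
  rcases le_total (k 2) (k 1) with h | h
  · exact ⟨k, lead_of_antitone hε hf hk (hle k hk 1) h, hk, hmax⟩
  · have h1 := coeff_comp_ne_zero hf.1 (Equiv.swap 1 2) hk
    have e0 : (k ∘ Equiv.swap (1 : Fin 3) 2) 0 = k 0 := by
      rw [Function.comp_apply, Equiv.swap_apply_of_ne_of_ne (by decide) (by decide)]
    have e1 : (k ∘ Equiv.swap (1 : Fin 3) 2) 1 = k 2 := by simp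
    have e2 : (k ∘ Equiv.swap (1 : Fin 3) 2) 2 = k 1 := by simp
    refine ⟨_, lead_of_antitone hε hf h1 ?_ ?_, h1, ?_⟩
    · rw [e0, e1]
      exact hle k hk 2
    · rw [e1, e2]
      exact h
    · rw [e0]
      exact hmax

/-- The term of `g` with the largest first exponent yields a term of `mulSq g` whose first exponent
is larger by two, hence too far ahead of the others. -/
theorem mulSq_rest (hε : ε ≤ 1) {i t : ℕ} {g : SkewPoly} (hg : g ∈ part (3 * ε) i t)
    (h : mulSq g ∈ antisymSpan {k | Rest ε k}) : g = 0 := by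
  by_contra h0
  obtain ⟨k, hk, hc, hmax⟩ := exists_lead_max hε hg h0
  have h1 := coeff_mulSq hmax
  rw [← h1] at hc
  obtain ⟨j, hj, h2⟩ := mem_supp.1 (antisymSpan_rest_supp hε h) _ hc
  have h3 := hk.antitone hε (show (1 : Fin 3) ≤ j by
    fin_cases j <;> simp at hj ⊢)
  have h4 := hk.2.1
  simp only [bump, if_true, if_neg hj] at h2
  omega

theorem mulSq_mem_part {q i t : ℕ} {f : SkewPoly} (hf : f ∈ part q (i + 2) t) :
    mulSq f ∈ part q i t := by
  rw [← mulOdd_mulEven_add]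
  refine Submodule.add_mem _ (mulOdd_mem_part (mulEven_mem_part hf)) ?_
  rcases q with _ | q
  · rw [mulOdd_of_zero hf, map_zero]
    exact Submodule.zero_mem _
  · exact mulEven_mem_part (mulOdd_mem_part hf)

/-- Division with remainder. The equations asking that `mulSq g` agree with `f` at all sorted
exponents obtained by raising a first entry by two are as many as the unknown coefficients of `g`.
They are uniquely solvable by looking at the term with the largest first exponent; the remainder has
only exponents in `Rest`. -/
theorem exists_sub_mulSq (hε : ε ≤ 1) {i t : ℕ} {f : SkewPoly} (hf : f ∈ part (3 * ε) i t) :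
    ∃ g ∈ part (3 * ε) (i + 2) t, f - mulSq g ∈ antisymSpan {k | Rest ε k ∧ ∑ j, k j + i = t} := by
  classical
  set X : Set (Fin 3 → ℕ) := {k | Lead ε k ∧ ∑ j, k j + (i + 2) = t} with hX
  have hXfin : X.Finite := by
    refine (Set.finite_Iic (fun _ => t)).subset ?_
    intro k hk j
    have h1 := Finset.single_le_sum (f := k) (fun _ _ => Nat.zero_le _) (Finset.mem_univ j)
    have h2 : ∑ j, k j + (i + 2) = t := hk.2
    change k j ≤ t
    omega
  haveI : Fintype X := hXfin.fintype
  set G : (X → ℚ) →ₗ[ℚ] SkewPoly := Fintype.linearCombination ℚ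
    (fun k : X => antisym (monomial k.1)) with hG
  have hGmem : ∀ c, G c ∈ part (3 * ε) (i + 2) t := by
    intro c
    rw [hG, Fintype.linearCombination_apply]
    exact Submodule.sum_mem _ fun k _ => Submodule.smul_mem _ _ (antisym_mem_part
      (monomial_mem_supp ⟨sum_mod k.2.1.1, k.2.2⟩))
  have hGcoeff : ∀ (c : X → ℚ) (k : X), coeff k.1 (G c) = c k * coeff k.1 (antisym (monomial k.1)) := by
    intro c k
    rw [hG, Fintype.linearCombination_apply, map_sum, Finset.sum_eq_single k]
    · rw [map_smul, smul_eq_mul]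
    · intro l _ hl
      rw [map_smul, coeff_antisym_of_ne hε l.2.1 k.2.1 (fun h => hl (Subtype.ext h.symm)), smul_zero]
    · intro h
      exact absurd (Finset.mem_univ _) h
  set L : (X → ℚ) →ₗ[ℚ] (X → ℚ) :=
    LinearMap.pi fun k => (coeff (bump (bump k.1 0) 0)).comp (mulSq.comp G) with hL
  have hinj : Function.Injective L := by
    rw [← LinearMap.ker_eq_bot, LinearMap.ker_eq_bot']
    intro c hc
    have hG0 : G c = 0 := by
      by_contra h0
      obtain ⟨k, hk, hck, hmax⟩ := exists_lead_max hε (hGmem c) h0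
      have h1 := congrFun hc ⟨k, hk, sum_of_coeff (hGmem c) hck⟩
      exact hck ((coeff_mulSq hmax).symm.trans h1)
    funext k
    have h1 := hGcoeff c k
    rw [hG0, map_zero] at h1
    exact (mul_eq_zero.1 h1.symm).resolve_right (coeff_antisym_self hε k.2.1)
  -- `L` is an endomorphism of a finite dimensional space, so injectivity suffices to solve the
  -- equations.
  obtain ⟨c, hc⟩ := LinearMap.injective_iff_surjective.1 hinj
    fun k => coeff (bump (bump k.1 0) 0) f
  refine ⟨G c, hGmem c, ?_⟩
  have hmem : f - mulSq (G c) ∈ part (3 * ε) i t := Submodule.sub_mem _ hf (mulSq_mem_part (hGmem c))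
  refine mem_antisymSpan hmem.1 fun k hk => ?_
  obtain ⟨σ, hσ⟩ := exists_antitone k
  have hkσ := coeff_comp_ne_zero hmem.1 σ hk
  have hlead := lead_of_antitone hε hmem hkσ (hσ (by decide)) (hσ (by decide))
  have hsum := sum_of_coeff hmem hkσ
  refine ⟨σ, ⟨hlead, ?_⟩, hsum⟩
  generalize k ∘ σ = l at *
  by_contra hne
  obtain ⟨hmod, h1, h2⟩ := hlead
  have m0 := hmod 0
  have m1 := hmod 1
  have m2 := hmod 2
  -- Outside `Rest` the largest exponent can be lowered by two within the sorted triples, so the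
  -- coefficient at `l` is one of those matched by the choice of `c`.
  set l' : Fin 3 → ℕ := Function.update l 0 (l 0 - 2) with hl'
  have e0 : l' 0 = l 0 - 2 := by simp [hl']
  have e1 : l' 1 = l 1 := by simp [hl']
  have e2 : l' 2 = l 2 := by simp [hl']
  have hb : bump (bump l' 0) 0 = l := by
    funext j
    fin_cases j <;> simp [bump, e0, e1, e2]
    omega
  have hmem' : l' ∈ X := by
    refine ⟨⟨fun j => ?_, ?_, ?_⟩, ?_⟩
    · fin_cases j <;> simp [e0, e1, e2] <;> omega
    · rw [e0, e1]
      omega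
    · rw [e1, e2]
      omega
    · rw [Fin.sum_univ_three] at hsum ⊢
      rw [e0, e1, e2]
      omega
  have h3 := congrFun hc ⟨l', hmem'⟩
  change coeff (bump (bump l' 0) 0) (mulSq (G c)) = coeff (bump (bump l' 0) 0) f at h3
  rw [hb] at h3
  rw [map_sub, h3, sub_self] at hkσ
  exact hkσ rfl

theorem linearIndependent_of_coeff {ι : Type*} {v : ι → SkewPoly} (κ : ι → Fin 3 → ℕ)
    (h0 : ∀ i, coeff (κ i) (v i) ≠ 0) (h : ∀ i j, i ≠ j → coeff (κ i) (v j) = 0) :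
    LinearIndependent ℚ v := by
  rw [linearIndependent_iff]
  intro c hc
  ext i
  have h1 := congrArg (coeff (κ i)) hc
  rw [Finsupp.linearCombination_apply, Finsupp.sum, map_sum, map_zero] at h1
  by_contra hi
  rw [Finset.sum_eq_single_of_mem i (Finsupp.mem_support_iff.2 hi), map_smul, smul_eq_mul] at h1
  · exact (mul_eq_zero.1 h1).elim hi (h0 i)
  · intro j _ hj
    rw [map_smul, h i j hj.symm, smul_zero]

end SkewPoly

end TwoLoop

namespace TwoLoop
open OGraph SkewPoly

/-! ### Bases modulo a submodule -/

/-- The classes of the vectors `B i` form a basis of `Z` modulo `D`. -/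
structure IsBasisMod {M ι : Type*} [AddCommGroup M] [Module ℚ M] (Z D : Submodule ℚ M)
    (B : ι → M) : Prop where
  mem : ∀ i, B i ∈ Z
  indep : ∀ c : ι →₀ ℚ, Finsupp.linearCombination ℚ B c ∈ D → c = 0
  span : ∀ f ∈ Z, ∃ c : ι →₀ ℚ, f - Finsupp.linearCombination ℚ B c ∈ D

theorem isBasisMod_of_le {M ι : Type*} [AddCommGroup M] [Module ℚ M] [IsEmpty ι]
    {Z D : Submodule ℚ M} (B : ι → M) (h : Z ≤ D) : IsBasisMod Z D B where
  mem i := isEmptyElim i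
  indep c _ := Subsingleton.elim _ _
  span f hf := ⟨0, by rw [map_zero, sub_zero]; exact h hf⟩

namespace SkewPoly

/-! ### The model in terms of the grading by odd exponents -/

/-- Modulo 2 the triangular number of `n` equals `(n + n % 2) / 2`. Summing, `A` depends only on the
degree plus the number of odd exponents modulo 4. -/
theorem neg_one_pow_triangle (k : Fin 3 → ℕ) :
    (-1 : ℚ) ^ (∑ j, k j * (k j + 1) / 2) =
      if (∑ j, k j % 2 + ∑ j, k j) % 4 = 0 then 1 else -1 := by
  have h : ∀ n : ℕ, ∃ y, n * (n + 1) / 2 = 2 * y + (n % 2 + n) / 2 ∧ (n % 2 + n) % 2 = 0 := by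
    intro n
    obtain ⟨x, rfl | rfl⟩ := Nat.even_or_odd' n
    · refine ⟨x * x, ?_, by omega⟩
      have e : 2 * x * (2 * x + 1) = 2 * (2 * (x * x) + x) := by ring
      rw [e]
      omega
    · refine ⟨x * x + x, ?_, by omega⟩
      have e : (2 * x + 1) * (2 * x + 1 + 1) = 2 * (2 * (x * x + x) + (x + 1)) := by ring
      rw [e]
      omega
  obtain ⟨y0, h0, h0'⟩ := h (k 0)
  obtain ⟨y1, h1, h1'⟩ := h (k 1)
  obtain ⟨y2, h2, h2'⟩ := h (k 2)
  simp only [Fin.sum_univ_three]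
  split_ifs with hc
  · exact Even.neg_one_pow (Nat.even_iff.2 (by omega))
  · exact Odd.neg_one_pow (Nat.odd_iff.2 (by omega))

theorem A_of_part {q i t : ℕ} {f : SkewPoly} (hf : f ∈ part q i t) (h : (q + t) % 4 = i % 4) :
    A f = f := by
  refine eq_on_supp (L := A) (L' := LinearMap.id) (fun k hk => ?_) hf.2
  rw [A_monomial, neg_one_pow_triangle, if_pos, one_smul, LinearMap.id_apply]
  obtain ⟨h1, h2⟩ := hk
  omega

theorem A_of_part_neg {q i t : ℕ} {f : SkewPoly} (hf : f ∈ part q i t)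
    (h : (q + t) % 4 = (i + 2) % 4) : A f = -f := by
  refine eq_on_supp (L := A) (L' := -LinearMap.id) (fun k hk => ?_) hf.2
  rw [A_monomial, neg_one_pow_triangle, if_neg, neg_one_smul]
  · rfl
  obtain ⟨h1, h2⟩ := hk
  omega

theorem coeff_A (k : Fin 3 → ℕ) (f : SkewPoly) :
    coeff k (A f) = (-1 : ℚ) ^ (∑ j, k j * (k j + 1) / 2) * coeff k f := by
  have h : (coeff k).comp A = (-1 : ℚ) ^ (∑ j, k j * (k j + 1) / 2) • coeff k := by
    refine hom_ext fun l => ?_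
    rw [LinearMap.comp_apply, A_monomial, map_smul, LinearMap.smul_apply, coeff_monomial]
    split_ifs with hl
    · rw [hl]
    · simp
  exact LinearMap.congr_fun h f

/-- In a fixed degree the eigenvalue of `A` fixes the number of odd exponents modulo 4, and this
number is at most three. -/
theorem mem_part_of_A {q i t : ℕ} (hq : q < 4) {f : SkewPoly} (h1 : f ∈ ASym)
    (h2 : f ∈ supp {k | ∑ j, k j + i = t}) (h : (q + t) % 4 = i % 4 ∧ A f = f ∨
      (q + t) % 4 = (i + 2) % 4 ∧ A f = -f) : f ∈ part q i t := by
  refine ⟨h1, mem_supp.2 fun k hk => ?_⟩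
  have hs : ∑ j, k j + i = t := mem_supp.1 h2 k hk
  refine ⟨?_, hs⟩
  have h3 := coeff_A k f
  rw [neg_one_pow_triangle] at h3
  have hpar : (∑ j, k j % 2 + ∑ j, k j) % 2 = 0 := by
    simp only [Fin.sum_univ_three]
    omega
  have hle : ∑ j, k j % 2 < 4 := by
    simp only [Fin.sum_univ_three]
    omega
  rcases h with ⟨h, hA⟩ | ⟨h, hA⟩
  · rw [hA] at h3
    split_ifs at h3 with hc
    · omega
    · exact absurd (by linarith) hk
  · rw [hA, map_neg] at h3
    split_ifs at h3 with hc
    · exact absurd (by linarith) hk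
    · omega

theorem part_succ (q i t : ℕ) : part q (i + 1) (t + 1) = part q i t := by
  unfold part
  congr 3
  funext k
  refine propext (and_congr_right fun _ => ?_)
  omega

theorem mem_modelPart_iff {i t : ℕ} {f : SkewPoly} :
    f ∈ modelPart i t ↔ f ∈ model i ∧ f ∈ supp {k | ∑ j, k j + i = t} := by
  rw [modelPart, iSup_homogeneous_eq, Submodule.mem_inf]

theorem part_le_supp (q i t : ℕ) : part q i t ≤ supp {k | ∑ j, k j + i = t} :=
  fun _ hf => supp_mono (fun _ hk => hk.2) hf.2

/-- In a fixed Hodge degree, being `*`even is the same as having the one admissible number of odd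
exponents. -/
theorem modelPart_eq_part {q i t : ℕ} (hq : q < 4) (h : (q + t) % 4 = i % 4) (hi : i = 0 ∨ i = 2) :
    modelPart i t = part q i t := by
  have hmodel : model i = ASym ⊓ starEven := by
    rcases hi with rfl | rfl <;> rfl
  ext f
  rw [mem_modelPart_iff, hmodel]
  constructor
  · rintro ⟨⟨h1, h2⟩, h3⟩
    exact mem_part_of_A hq h1 h3 (Or.inl ⟨h, h2⟩)
  · intro hf
    exact ⟨⟨hf.1, A_of_part hf h⟩, part_le_supp _ _ _ hf⟩

theorem part_le_modelPart_one (q t : ℕ) : part q 1 t ≤ modelPart 1 t :=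
  fun _ hf => mem_modelPart_iff.2 ⟨hf.1, part_le_supp _ _ _ hf⟩

theorem A_mem_supp {S : Set (Fin 3 → ℕ)} {f : SkewPoly} (hf : f ∈ supp S) : A f ∈ supp S := by
  refine mem_supp.2 fun k hk => mem_supp.1 hf k fun h => hk ?_
  rw [coeff_A, h, mul_zero]

theorem exists_part_add_part {q q' t : ℕ} (hq : q < 4) (hq' : q' < 4) (h : (q + t) % 4 = 1)
    (h' : (q' + t) % 4 = 3) {f : SkewPoly} (hf : f ∈ modelPart 1 t) :
    ∃ a ∈ part q 1 t, ∃ b ∈ part q' 1 t, f = a + b := by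
  obtain ⟨h1, h2⟩ := mem_modelPart_iff.1 hf
  have h3 := A_mem_ASym h1
  have h4 := A_mem_supp h2
  refine ⟨(1 / 2 : ℚ) • (f + A f), mem_part_of_A hq ?_ ?_ (Or.inl ⟨h, ?_⟩),
    (1 / 2 : ℚ) • (f - A f), mem_part_of_A hq' ?_ ?_ (Or.inr ⟨h', ?_⟩), by module⟩
  · exact Submodule.smul_mem _ _ (Submodule.add_mem _ h1 h3)
  · exact Submodule.smul_mem _ _ (Submodule.add_mem _ h2 h4)
  · rw [map_smul, map_add, A_A]
    module
  · exact Submodule.smul_mem _ _ (Submodule.sub_mem _ h1 h3)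
  · exact Submodule.smul_mem _ _ (Submodule.sub_mem _ h2 h4)
  · rw [map_smul, map_sub, A_A]
    module

/-- The differential `∂₁` of the model. -/
noncomputable def dOne : SkewPoly →ₗ[ℚ] SkewPoly := starEvenPart.comp (mulOdd + mulEven)

theorem dOne_apply (f : SkewPoly) : dOne f = starEvenPart (e₁ * f) := by
  rw [e₁_mul_eq]
  rfl

/-- The differential `∂₂` of the model. -/
noncomputable def dTwo : SkewPoly →ₗ[ℚ] SkewPoly := (2 : ℚ) • (mulEven - mulOdd)

theorem dTwo_apply (f : SkewPoly) : dTwo f = (2 : ℚ) • (parity f * e₁) := by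
  rw [parity_mul_e₁]
  rfl

theorem dTwo_eq (f : SkewPoly) : dTwo f = (2 : ℚ) • (mulEven f - mulOdd f) := rfl

/-- For `f` fixed by `A`, the summand `mulOdd f` is `*`even and `mulEven f` is negated by `A`, so
the projection keeps only the former; `dOne_of_A_neg` is the opposite case. -/
theorem dOne_of_A {f : SkewPoly} (h : A f = f) : dOne f = mulOdd f := by
  change starEvenPart (mulOdd f + mulEven f) = _
  rw [starEvenPart_apply, map_add, A_mulOdd, A_mulEven, h]
  module

theorem dOne_of_A_neg {f : SkewPoly} (h : A f = -f) : dOne f = mulEven f := by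
  change starEvenPart (mulOdd f + mulEven f) = _
  rw [starEvenPart_apply, map_add, A_mulOdd, A_mulEven, h, map_neg, map_neg]
  module

theorem dOne_part {q t : ℕ} (h : (q + t) % 4 = 1) {f : SkewPoly} (hf : f ∈ part q 1 t) :
    dOne f = mulOdd f := dOne_of_A (A_of_part hf h)

theorem dOne_part' {q t : ℕ} (h : (q + t) % 4 = 3) {f : SkewPoly} (hf : f ∈ part q 1 t) :
    dOne f = mulEven f := dOne_of_A_neg (A_of_part_neg hf h)

/-- Components of opposite `*`-parity can be compared separately. -/
theorem separate {f f' g g' : SkewPoly} (hf : A f = f) (hg : A g = g) (hf' : A f' = -f')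
    (hg' : A g' = -g') (h : f + f' = g + g') : f = g ∧ f' = g' := by
  have h2 := congrArg A h
  rw [map_add, map_add, hf, hf', hg, hg'] at h2
  constructor
  · linear_combination (norm := module) (1 / 2 : ℚ) • h + (1 / 2 : ℚ) • h2
  · linear_combination (norm := module) (1 / 2 : ℚ) • h - (1 / 2 : ℚ) • h2

/-- Cycles and boundaries of the model. -/
noncomputable def modelBoundaries₀ (t : ℕ) : Submodule ℚ SkewPoly := (modelPart 1 t).map dOne

noncomputable def modelCycles₁ (t : ℕ) : Submodule ℚ SkewPoly :=
  modelPart 1 t ⊓ LinearMap.ker dOne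

noncomputable def modelBoundaries₁ (t : ℕ) : Submodule ℚ SkewPoly := (modelPart 2 t).map dTwo

theorem mem_modelBoundaries₀ {q t : ℕ} (h : (q + t) % 4 = 1) {f : SkewPoly}
    (hf : f ∈ part q 1 t) : mulOdd f ∈ modelBoundaries₀ t :=
  ⟨f, part_le_modelPart_one _ _ hf, dOne_part h hf⟩

theorem mem_modelBoundaries₀' {q t : ℕ} (h : (q + t) % 4 = 3) {f : SkewPoly}
    (hf : f ∈ part q 1 t) : mulEven f ∈ modelBoundaries₀ t :=
  ⟨f, part_le_modelPart_one _ _ hf, dOne_part' h hf⟩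

theorem exists_of_mem_modelBoundaries₀ {q q' t : ℕ} (hq : q < 4) (hq' : q' < 4)
    (h : (q + t) % 4 = 1) (h' : (q' + t) % 4 = 3) {f : SkewPoly} (hf : f ∈ modelBoundaries₀ t) :
    ∃ a ∈ part q 1 t, ∃ b ∈ part q' 1 t, f = mulOdd a + mulEven b := by
  obtain ⟨g, hg, rfl⟩ := hf
  obtain ⟨a, ha, b, hb, rfl⟩ := exists_part_add_part hq hq' h h' hg
  exact ⟨a, ha, b, hb, by rw [map_add, dOne_part h ha, dOne_part' h' hb]⟩

theorem exists_of_mem_modelCycles₁ {q q' t : ℕ} (hq : q < 4) (hq' : q' < 4)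
    (h : (q + t) % 4 = 1) (h' : (q' + t) % 4 = 3) {f : SkewPoly} (hf : f ∈ modelCycles₁ t) :
    ∃ a ∈ part q 1 t, ∃ b ∈ part q' 1 t, f = a + b ∧ mulOdd a + mulEven b = 0 := by
  obtain ⟨a, ha, b, hb, rfl⟩ := exists_part_add_part hq hq' h h' hf.1
  refine ⟨a, ha, b, hb, rfl, ?_⟩
  rw [← dOne_part h ha, ← dOne_part' h' hb, ← map_add]
  exact hf.2

theorem mem_modelBoundaries₁ {q t : ℕ} (hq : q < 4) (h : (q + t) % 4 = 2) {f : SkewPoly}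
    (hf : f ∈ part q 2 t) : mulEven f - mulOdd f ∈ modelBoundaries₁ t := by
  refine ⟨(1 / 2 : ℚ) • f, ?_, ?_⟩
  · rw [modelPart_eq_part hq h (Or.inr rfl)]
    exact Submodule.smul_mem _ _ hf
  · rw [map_smul, dTwo_eq]
    module

theorem exists_of_mem_modelBoundaries₁ {q t : ℕ} (hq : q < 4) (h : (q + t) % 4 = 2)
    {f : SkewPoly} (hf : f ∈ modelBoundaries₁ t) :
    ∃ y ∈ part q 2 t, A y = y ∧ f = mulEven y - mulOdd y := by
  obtain ⟨g, hg, rfl⟩ := hf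
  rw [SetLike.mem_coe, modelPart_eq_part hq h (Or.inr rfl)] at hg
  have h2 := Submodule.smul_mem _ (2 : ℚ) hg
  refine ⟨(2 : ℚ) • g, h2, A_of_part h2 h, ?_⟩
  rw [dTwo_eq, map_smul, map_smul, smul_sub]

/-- The components `mulEven f` and `mulOdd f` have opposite `*`-parity and vanish separately. Then
`mulSq f` vanishes too, and `mulSq` is injective. -/
theorem dTwo_injective {t : ℕ} {f : SkewPoly} (hf : f ∈ modelPart 2 t) (h : dTwo f = 0) :
    f = 0 := by
  have hA : A f = f := (mem_modelPart_iff.1 hf).1.2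
  rw [dTwo_eq] at h
  have h0 := (smul_eq_zero.1 h).resolve_left (by norm_num)
  have h1 := separate (f := mulOdd f) (g := 0) (f' := -mulEven f) (g' := 0)
    (by rw [A_mulOdd, hA]) (map_zero _) (by rw [map_neg, A_mulEven, hA]) (by simp)
    (by linear_combination (norm := module) (-1 : ℚ) • h0)
  apply mulSq_injective
  rw [← mulOdd_mulEven_add, h1.1, neg_eq_zero.1 h1.2, map_zero, map_zero, add_zero]

end SkewPoly

end TwoLoop

/-! ### Cokernels of `mulSq` and the diagram chases. -/

namespace TwoLoop
open OGraph SkewPoly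

namespace SkewPoly

/-- A family of nonzero multiples of the antisymmetrized monomials with exponents in `Rest ε`, of
degree `d`. -/
structure IsRestFamily {ι : Type*} (ε d : ℕ) (β : ι → SkewPoly) (κ : ι → Fin 3 → ℕ) : Prop where
  eq_smul : ∀ i, ∃ a : ℚ, a ≠ 0 ∧ β i = a • antisym (monomial (κ i))
  rest : ∀ i, Rest ε (κ i)
  injective : Function.Injective κ
  surjective : ∀ k, Rest ε k → ∑ j, k j = d → ∃ i, κ i = k

namespace IsRestFamily

variable {ι : Type*} {ε d : ℕ} {β : ι → SkewPoly} {κ : ι → Fin 3 → ℕ}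

/-- Independence modulo the image of `mulSq`: the image meets the span of the `Rest` elements only
in zero, and the latter have distinct leading exponents. -/
theorem eq_zero (h : IsRestFamily ε d β κ) (hε : ε ≤ 1) {i t : ℕ} {g : SkewPoly}
    (hg : g ∈ part (3 * ε) i t) {c : ι →₀ ℚ}
    (hc : Finsupp.linearCombination ℚ β c = mulSq g) : c = 0 := by
  have hmem : Finsupp.linearCombination ℚ β c ∈ antisymSpan {k | Rest ε k} := by
    rw [Finsupp.linearCombination_apply]
    refine Submodule.sum_mem _ fun i _ => Submodule.smul_mem _ _ ?_
    obtain ⟨a, -, ha⟩ := h.eq_smul i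
    rw [ha]
    exact Submodule.smul_mem _ _ (Submodule.subset_span ⟨_, h.rest i, rfl⟩)
  have hg0 := mulSq_rest hε hg (hc ▸ hmem)
  rw [hg0, map_zero] at hc
  refine linearIndependent_iff.1 (linearIndependent_of_coeff κ (fun i => ?_) fun i j hij => ?_) c hc
  · obtain ⟨a, h0, ha⟩ := h.eq_smul i
    rw [ha, map_smul]
    exact smul_ne_zero h0 (coeff_antisym_self hε (h.rest i).1)
  · obtain ⟨a, -, ha⟩ := h.eq_smul j
    rw [ha, map_smul, coeff_antisym_of_ne hε (h.rest j).1 (h.rest i).1 (h.injective.ne hij),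
      smul_zero]

theorem exists_sub (h : IsRestFamily ε d β κ) (hε : ε ≤ 1) {i t : ℕ} (hd : d + i = t)
    {f : SkewPoly} (hf : f ∈ part (3 * ε) i t) : ∃ c : ι →₀ ℚ, ∃ g ∈ part (3 * ε) (i + 2) t,
      f = Finsupp.linearCombination ℚ β c + mulSq g := by
  obtain ⟨g, hg, h1⟩ := exists_sub_mulSq hε hf
  have h2 : antisymSpan {k | Rest ε k ∧ ∑ j, k j + i = t} ≤ Submodule.span ℚ (Set.range β) := by
    refine Submodule.span_le.2 ?_
    rintro _ ⟨k, ⟨hk, hs⟩, rfl⟩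
    obtain ⟨i, rfl⟩ := h.surjective k hk (by omega)
    obtain ⟨a, h0, ha⟩ := h.eq_smul i
    have : antisym (monomial (κ i)) = a⁻¹ • β i := by
      rw [ha, smul_smul, inv_mul_cancel₀ h0, one_smul]
    change antisym (monomial (κ i)) ∈ _
    rw [this]
    exact Submodule.smul_mem _ _ (Submodule.subset_span ⟨i, rfl⟩)
  obtain ⟨c, hc⟩ := (Finsupp.mem_span_range_iff_exists_finsupp).1 (h2 h1)
  refine ⟨c, g, hg, ?_⟩
  rw [Finsupp.linearCombination_apply, hc]
  abel

end IsRestFamily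

/-! ### Homology of the model in the four residue classes -/

variable {ι : Type*} {t : ℕ} {B : ι → SkewPoly} {κ : ι → Fin 3 → ℕ}

/-- The complex is `2 → 1 ⊕ 3 → 0` in terms of numbers of odd exponents. On the last term `mulOdd`
vanishes, so it is covered by exactness. -/
theorem homology₀_zero (h : t % 4 = 0) : modelPart 0 t ≤ modelBoundaries₀ t := by
  intro f hf
  rw [modelPart_eq_part (q := 0) (by norm_num) (by omega) (Or.inl rfl)] at hf
  obtain ⟨g, hg, rfl⟩ := exists_mulOdd hf (mulOdd_of_zero hf)
  exact mem_modelBoundaries₀ (q := 1) (by omega) hg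

theorem homology₀_one (h : t % 4 = 1) : modelPart 0 t ≤ modelBoundaries₀ t := by
  intro f hf
  rw [modelPart_eq_part (q := 3) (by norm_num) (by omega) (Or.inl rfl)] at hf
  obtain ⟨g, hg, rfl⟩ := exists_mulEven (q := 2) hf (mulEven_of_three hf)
  exact mem_modelBoundaries₀' (q := 2) (by omega) hg

theorem linearCombination_map (L : SkewPoly →ₗ[ℚ] SkewPoly) (c : ι →₀ ℚ) :
    L (Finsupp.linearCombination ℚ B c) = Finsupp.linearCombination ℚ (fun i => L (B i)) c :=
  Finsupp.apply_linearCombination ℚ L B c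

/-- The complex is `0 → 1 ⊕ 3 → 2`. The map `mulEven` identifies `H 0` with the cokernel of `mulSq`
on three odd exponents: it kills the boundaries coming from `1` and turns those coming from `3` into
`mulEven (mulOdd a) = mulSq a`. -/
theorem homology₀_two (h : t % 4 = 2) (hB : ∀ i, B i ∈ part 2 0 t)
    (hκ : IsRestFamily 1 (t + 1) (fun i => mulEven (B i)) κ) :
    IsBasisMod (modelPart 0 t) (modelBoundaries₀ t) B := by
  have hmodel := modelPart_eq_part (q := 2) (i := 0) (t := t) (by norm_num) (by omega) (Or.inl rfl)
  have hBc : ∀ c, Finsupp.linearCombination ℚ B c ∈ part 2 0 t := fun c => by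
    rw [Finsupp.linearCombination_apply]
    exact Submodule.sum_mem _ fun i _ => Submodule.smul_mem _ _ (hB i)
  refine ⟨fun i => hmodel ▸ hB i, fun c hc => ?_, fun f hf => ?_⟩
  · obtain ⟨a, ha, b, hb, h1⟩ := exists_of_mem_modelBoundaries₀ (q := 3) (q' := 1) (by norm_num)
      (by norm_num) (by omega) (by omega) hc
    refine hκ.eq_zero le_rfl (g := a) ha ?_
    rw [← linearCombination_map, h1, map_add, mulEven_mulEven, ← mulOdd_mulEven_add,
      mulEven_of_three ha, map_zero, add_zero, zero_add]
  · rw [hmodel] at hf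
    have h1 := mulEven_mem_part (i := 0) (t := t + 1) (by rw [part_succ]; exact hf)
    -- The element `g` gives the boundary `mulOdd g`; subtracting it and the combination of the `B
    -- i` leaves an element of the kernel of `mulEven`, which is a boundary by exactness.
    obtain ⟨c, g, hg, h2⟩ := hκ.exists_sub le_rfl (add_zero _) h1
    rw [part_succ] at hg
    have hgO : mulOdd g ∈ part 2 0 t := mulOdd_mem_part (q := 2) hg
    have h3 : f - Finsupp.linearCombination ℚ B c - mulOdd g ∈ part 2 0 t :=
      Submodule.sub_mem _ (Submodule.sub_mem _ hf (hBc c)) hgO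
    obtain ⟨y, hy, h4⟩ := exists_mulEven (q := 1) h3 (by
      rw [map_sub, map_sub, linearCombination_map, h2, ← mulOdd_mulEven_add,
        mulEven_of_three (t := t) hg, map_zero]
      abel)
    refine ⟨c, ?_⟩
    have h5 : f - Finsupp.linearCombination ℚ B c = mulOdd g + mulEven y := by
      rw [h4]
      abel
    rw [h5]
    exact Submodule.add_mem _ (mem_modelBoundaries₀ (q := 3) (by omega) hg)
      (mem_modelBoundaries₀' (q := 1) (by omega) hy)

/-- The complex is `3 → 0 ⊕ 2 → 1`, and the roles of `mulOdd` and `mulEven` are exchanged: `mulOdd`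
identifies `H 0` with the cokernel of `mulSq` on even exponents. -/
theorem homology₀_three (h : t % 4 = 3) (hB : ∀ i, B i ∈ part 1 0 t)
    (hκ : IsRestFamily 0 (t + 1) (fun i => mulOdd (B i)) κ) :
    IsBasisMod (modelPart 0 t) (modelBoundaries₀ t) B := by
  have hmodel := modelPart_eq_part (q := 1) (i := 0) (t := t) (by norm_num) (by omega) (Or.inl rfl)
  have hBc : ∀ c, Finsupp.linearCombination ℚ B c ∈ part 1 0 t := fun c => by
    rw [Finsupp.linearCombination_apply]
    exact Submodule.sum_mem _ fun i _ => Submodule.smul_mem _ _ (hB i)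
  refine ⟨fun i => hmodel ▸ hB i, fun c hc => ?_, fun f hf => ?_⟩
  · obtain ⟨a, ha, b, hb, h1⟩ := exists_of_mem_modelBoundaries₀ (q := 2) (q' := 0) (by norm_num)
      (by norm_num) (by omega) (by omega) hc
    refine hκ.eq_zero zero_le_one (g := b) hb ?_
    rw [← linearCombination_map, h1, map_add, mulOdd_mulOdd, ← mulOdd_mulEven_add,
      mulOdd_of_zero hb, map_zero, add_zero, zero_add]
  · rw [hmodel] at hf
    have h1 := mulOdd_mem_part (q := 0) (i := 0) (t := t + 1) (by rw [part_succ]; exact hf)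
    obtain ⟨c, g, hg, h2⟩ := hκ.exists_sub zero_le_one (add_zero _) h1
    rw [part_succ] at hg
    have hgE : mulEven g ∈ part 1 0 t := mulEven_mem_part (q := 0) hg
    have h3 : f - Finsupp.linearCombination ℚ B c - mulEven g ∈ part 1 0 t :=
      Submodule.sub_mem _ (Submodule.sub_mem _ hf (hBc c)) hgE
    obtain ⟨y, hy, h4⟩ := exists_mulOdd (q := 1) h3 (by
      rw [map_sub, map_sub, linearCombination_map, h2, ← mulOdd_mulEven_add,
        mulOdd_of_zero (t := t) hg, map_zero]
      abel)
    refine ⟨c, ?_⟩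
    have h5 : f - Finsupp.linearCombination ℚ B c = mulOdd y + mulEven g := by
      rw [h4]
      abel
    rw [h5]
    exact Submodule.add_mem _ (mem_modelBoundaries₀ (q := 2) (by omega) hy)
      (mem_modelBoundaries₀' (q := 0) (by omega) hg)

/-- In `2 → 1 ⊕ 3 → 0` all elements of `3` are cycles. A cycle in `1` is `mulOdd y` and is
homologous to `mulEven y` in `3`; there the boundaries that remain are the images of `mulSq`. -/
theorem homology₁_zero (h : t % 4 = 0) {d : ℕ} (hd : d + 1 = t) (hB : ∀ i, B i ∈ part 3 1 t)
    (hκ : IsRestFamily 1 d B κ) : IsBasisMod (modelCycles₁ t) (modelBoundaries₁ t) B := by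
  have hBc : ∀ c, Finsupp.linearCombination ℚ B c ∈ part 3 1 t := fun c => by
    rw [Finsupp.linearCombination_apply]
    exact Submodule.sum_mem _ fun i _ => Submodule.smul_mem _ _ (hB i)
  refine ⟨fun i => ⟨part_le_modelPart_one _ _ (hB i), ?_⟩, fun c hc => ?_, fun f hf => ?_⟩
  · exact (dOne_part' (by omega) (hB i)).trans (mulEven_of_three (hB i))
  · obtain ⟨y, hy, hA, h1⟩ := exists_of_mem_modelBoundaries₁ (q := 2) (by norm_num) (by omega) hc
    obtain ⟨h2, h3⟩ := separate (f := mulOdd y) (g := 0) (f' := Finsupp.linearCombination ℚ B c)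
      (g' := mulEven y) (by rw [A_mulOdd, hA]) (map_zero _)
      (A_of_part_neg (hBc c) (by omega)) (by rw [A_mulEven, hA]) (by rw [h1]; abel)
    obtain ⟨g, hg, rfl⟩ := exists_mulOdd hy h2
    refine hκ.eq_zero le_rfl hg ?_
    rw [h3, ← mulOdd_mulEven_add, mulEven_of_three hg, map_zero, zero_add]
  · obtain ⟨a, ha, b, hb, rfl, h1⟩ := exists_of_mem_modelCycles₁ (q := 1) (q' := 3) (by norm_num)
      (by norm_num) (by omega) (by omega) hf
    rw [mulEven_of_three hb, add_zero] at h1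
    obtain ⟨y, hy, rfl⟩ := exists_mulOdd ha h1
    obtain ⟨c, g, hg, h2⟩ := hκ.exists_sub le_rfl hd
      (Submodule.add_mem _ hb (mulEven_mem_part (q := 2) hy))
    refine ⟨c, ?_⟩
    have h3 : mulOdd y + b - Finsupp.linearCombination ℚ B c =
        mulEven (mulOdd g - y) - mulOdd (mulOdd g - y) := by
      have h4 := mulOdd_mulEven_add g
      rw [mulEven_of_three hg, map_zero, zero_add] at h4
      rw [map_sub, map_sub, mulOdd_mulOdd, h4]
      linear_combination (norm := module) h2
    rw [h3]
    exact mem_modelBoundaries₁ (q := 2) (by norm_num) (by omega)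
      (Submodule.sub_mem _ (mulOdd_mem_part (q := 2) hg) hy)

/-- In `1 → 0 ⊕ 2 → 3` all elements of `0` are cycles, and `H 1` is the cokernel of `mulSq` on them.
The representatives `mulEven (B i)` in `2` are homologous to `mulOdd (B i)` in `0`, the images
required to form a rest family. -/
theorem homology₁_one (h : t % 4 = 1) {d : ℕ} (hd : d + 1 = t) (hB : ∀ i, B i ∈ part 1 2 t)
    (hκ : IsRestFamily 0 d (fun i => mulOdd (B i)) κ) :
    IsBasisMod (modelCycles₁ t) (modelBoundaries₁ t) fun i => mulEven (B i) := by
  have hBc : ∀ c, Finsupp.linearCombination ℚ B c ∈ part 1 2 t := fun c => by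
    rw [Finsupp.linearCombination_apply]
    exact Submodule.sum_mem _ fun i _ => Submodule.smul_mem _ _ (hB i)
  refine ⟨fun i => ⟨part_le_modelPart_one 2 _ (mulEven_mem_part (hB i)), ?_⟩, fun c hc => ?_,
    fun f hf => ?_⟩
  · exact (dOne_part' (q := 2) (by omega) (mulEven_mem_part (hB i))).trans (mulEven_mulEven _)
  · rw [← linearCombination_map] at hc
    obtain ⟨y, hy, hA, h1⟩ := exists_of_mem_modelBoundaries₁ (q := 1) (by norm_num) (by omega) hc
    have hAc := A_of_part (hBc c) (by omega)
    obtain ⟨h2, h3⟩ := separate (f := mulOdd y) (g := 0)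
      (f' := mulEven (Finsupp.linearCombination ℚ B c))
      (g' := mulEven y) (by rw [A_mulOdd, hA]) (map_zero _)
      (by rw [A_mulEven, hAc]) (by rw [A_mulEven, hA]) (by rw [h1]; abel)
    obtain ⟨g, hg, h4⟩ := exists_mulEven (q := 0) (Submodule.sub_mem _ (hBc c) hy)
      (by rw [map_sub, h3, sub_self])
    refine hκ.eq_zero zero_le_one (g := g) hg ?_
    have h5 := congrArg mulOdd h4
    rw [map_sub, h2, sub_zero] at h5
    rw [← linearCombination_map, ← mulOdd_mulEven_add, h5, mulOdd_of_zero hg, map_zero, add_zero]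
  · obtain ⟨a, ha, b, hb, rfl, h1⟩ := exists_of_mem_modelCycles₁ (q := 0) (q' := 2) (by norm_num)
      (by norm_num) (by omega) (by omega) hf
    rw [mulOdd_of_zero ha, zero_add] at h1
    obtain ⟨y, hy, rfl⟩ := exists_mulEven (q := 1) hb h1
    obtain ⟨c, g, hg, h2⟩ := hκ.exists_sub zero_le_one hd
      (Submodule.add_mem _ ha (mulOdd_mem_part (q := 0) hy))
    refine ⟨c, ?_⟩
    rw [← linearCombination_map] at h2 ⊢
    have h3 : a + mulEven y - mulEven (Finsupp.linearCombination ℚ B c) =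
        mulEven (y - Finsupp.linearCombination ℚ B c - mulEven g) -
          mulOdd (y - Finsupp.linearCombination ℚ B c - mulEven g) := by
      have h4 := mulOdd_mulEven_add g
      rw [mulOdd_of_zero hg, map_zero, add_zero] at h4
      simp only [map_sub, mulEven_mulEven, h4]
      linear_combination (norm := module) h2
    rw [h3]
    exact mem_modelBoundaries₁ (q := 1) (by norm_num) (by omega)
      (Submodule.sub_mem _ (Submodule.sub_mem _ hy (hBc c)) (mulEven_mem_part (q := 0) hg))

/-- Applying `mulEven` to the cycle equation gives `mulSq a = 0` for the component with three odd
exponents. So `a` vanishes, and the other component is a boundary by exactness. -/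
theorem homology₁_two (h : t % 4 = 2) : modelCycles₁ t ≤ modelBoundaries₁ t := by
  intro f hf
  obtain ⟨a, ha, b, hb, rfl, h1⟩ := exists_of_mem_modelCycles₁ (q := 3) (q' := 1) (by norm_num)
    (by norm_num) (by omega) (by omega) hf
  have h2 := mulOdd_mulEven_add a
  have h3 := congrArg mulEven h1
  rw [map_add, mulEven_mulEven, add_zero, map_zero] at h3
  rw [mulEven_of_three ha, map_zero, zero_add, h3] at h2
  obtain rfl := mulSq_injective h2.symm
  rw [map_zero, zero_add] at h1
  obtain ⟨y, hy, rfl⟩ := exists_mulEven (q := 0) hb h1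
  have h4 := mem_modelBoundaries₁ (q := 0) (by norm_num) (by omega) hy
  rwa [mulOdd_of_zero hy, sub_zero, ← zero_add (mulEven y)] at h4

/-- Now `mulOdd` shows that the component `b` with even exponents vanishes. -/
theorem homology₁_three (h : t % 4 = 3) : modelCycles₁ t ≤ modelBoundaries₁ t := by
  intro f hf
  obtain ⟨a, ha, b, hb, rfl, h1⟩ := exists_of_mem_modelCycles₁ (q := 2) (q' := 0) (by norm_num)
    (by norm_num) (by omega) (by omega) hf
  have h2 := mulOdd_mulEven_add b
  have h3 := congrArg mulOdd h1
  rw [map_add, mulOdd_mulOdd, zero_add, map_zero] at h3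
  rw [mulOdd_of_zero hb, map_zero, add_zero, h3] at h2
  obtain rfl := mulSq_injective h2.symm
  rw [map_zero, add_zero] at h1
  obtain ⟨y, hy, rfl⟩ := exists_mulOdd (q := 2) ha h1
  have h4 := mem_modelBoundaries₁ (q := 3) (by norm_num) (by omega) hy
  rw [mulEven_of_three hy, zero_sub] at h4
  rw [add_zero]
  simpa using Submodule.neg_mem _ h4

end SkewPoly

end TwoLoop

namespace TwoLoop
open OGraph SkewPoly

namespace SkewPoly

/-! ### The bases of the homology of the model -/

/-- The brackets differ from antisymmetrized monomials only by nonzero factors, which do not matter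
for being a rest family. -/
theorem bracket_eq (a b c : ℕ) : ∃ r : ℚ, r ≠ 0 ∧ bracket a b c = r • antisym (monomial ![a, b, c]) := by
  set n := Nat.card {σ : Equiv.Perm (Fin 3) // ![a, b, c] ∘ σ = ![a, b, c]} with hn
  have h0 : n ≠ 0 := Nat.card_ne_zero.2 ⟨⟨⟨1, rfl⟩⟩, inferInstance⟩
  refine ⟨(n : ℚ)⁻¹ * 6, mul_ne_zero (inv_ne_zero (Nat.cast_ne_zero.2 h0)) (by norm_num), ?_⟩
  rw [antisym_monomial, smul_smul, bracket, ← hn]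
  congr 1
  ring

theorem comp_perm_eq_iff {a b c : ℕ} (σ : Equiv.Perm (Fin 3)) :
    ![a, b, c] ∘ σ = ![a, b, c] ↔
      ![a, b, c] (σ 0) = a ∧ ![a, b, c] (σ 1) = b ∧ ![a, b, c] (σ 2) = c := by
  constructor
  · intro h
    exact ⟨congrFun h 0, congrFun h 1, congrFun h 2⟩
  · rintro ⟨h0, h1, h2⟩
    funext j
    fin_cases j
    · exact h0
    · exact h1
    · exact h2

theorem bracket_of_ne {a b c : ℕ} (hab : a ≠ b) (hac : a ≠ c) (hbc : b ≠ c) :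
    bracket a b c = signedSum ![a, b, c] := by
  have h : ∀ σ : Equiv.Perm (Fin 3), ![a, b, c] ∘ σ = ![a, b, c] ↔ σ = 1 := by
    intro σ
    refine ⟨fun h => ?_, fun h => by rw [h]; rfl⟩
    rw [comp_perm_eq_iff] at h
    rcases perm_cases σ with h' | h' | h' | h' | h' | h' <;> obtain ⟨s0, s1, s2, -⟩ := h' <;>
      simp [s0, s1, s2, hab, hac, hbc, hab.symm, hac.symm, hbc.symm] at h
    ext j
    fin_cases j <;> simp [s0, s1, s2]
  rw [bracket, Nat.card_congr (Equiv.subtypeEquivRight h), Nat.card_unique]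
  simp

theorem bracket_of_eq {a c : ℕ} (h : a ≠ c) :
    bracket a a c = (1 / 2 : ℚ) • signedSum ![a, a, c] := by
  have h1 : ∀ σ : Equiv.Perm (Fin 3), ![a, a, c] ∘ σ = ![a, a, c] ↔ σ 2 = 2 := by
    intro σ
    rw [comp_perm_eq_iff]
    rcases perm_cases σ with h' | h' | h' | h' | h' | h' <;> obtain ⟨s0, s1, s2, -⟩ := h' <;>
      simp [s0, s1, s2, h, h.symm]
  have h2 : Nat.card {σ : Equiv.Perm (Fin 3) // σ 2 = 2} = 2 := by
    rw [Nat.card_eq_fintype_card]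
    decide
  rw [bracket, Nat.card_congr (Equiv.subtypeEquivRight h1), h2]
  norm_num

theorem antisym_three_mem_part {q i t a b c : ℕ} (h : a % 2 + b % 2 + c % 2 = q)
    (h' : a + b + c + i = t) : antisym (monomial ![a, b, c]) ∈ part q i t := by
  refine antisym_mem_part (monomial_mem_supp ⟨?_, ?_⟩)
  · rw [Fin.sum_univ_three]
    exact h
  · rw [Fin.sum_univ_three]
    exact h'

theorem bracket_mem_part {q i t a b c : ℕ} (h : a % 2 + b % 2 + c % 2 = q)
    (h' : a + b + c + i = t) : bracket a b c ∈ part q i t := by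
  obtain ⟨r, -, hr⟩ := bracket_eq a b c
  rw [hr]
  exact Submodule.smul_mem _ _ (antisym_three_mem_part h h')

theorem mulEven_bracket {a b c : ℕ} {k : Fin 3 → ℕ} {s : ℚ} (hs : s ≠ 0)
    (h : mulEven (monomial ![a, b, c]) = s • monomial k) :
    ∃ r : ℚ, r ≠ 0 ∧ mulEven (bracket a b c) = r • antisym (monomial k) := by
  obtain ⟨r, hr0, hr⟩ := bracket_eq a b c
  refine ⟨r * s, mul_ne_zero hr0 hs, ?_⟩
  rw [hr, map_smul, ← antisym_mulEven, h, map_smul, smul_smul]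

theorem mulOdd_bracket {a b c : ℕ} {k : Fin 3 → ℕ} {s : ℚ} (hs : s ≠ 0)
    (h : mulOdd (monomial ![a, b, c]) = s • monomial k) :
    ∃ r : ℚ, r ≠ 0 ∧ mulOdd (bracket a b c) = r • antisym (monomial k) := by
  obtain ⟨r, hr0, hr⟩ := bracket_eq a b c
  refine ⟨r * s, mul_ne_zero hr0 hs, ?_⟩
  rw [hr, map_smul, ← antisym_mulOdd, h, map_smul, smul_smul]

theorem basisTriples_cases {k : ℕ × ℕ × ℕ} (h : k ∈ basisTriples) :
    (k.1 = k.2.1 + 1 ∧ k.2.1 % 2 = 0 ∧ (k.2.2 % 4 = 1 ∨ k.2.2 % 4 = 2) ∧ k.2.2 < k.2.1) ∨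
    (k.1 = k.2.2 + 1 ∧ k.2.1 = k.2.2 + 1 ∧ k.2.2 % 4 = 0) := by
  rcases h with (⟨a, b, rfl, h1, h2, h3⟩ | ⟨a, b, rfl, h1, h2, h3⟩) | ⟨b, rfl, h⟩
  · exact Or.inl ⟨rfl, Nat.even_iff.1 h1, Or.inl h2, h3⟩
  · exact Or.inl ⟨rfl, Nat.even_iff.1 h1, Or.inr h2, h3⟩
  · exact Or.inr ⟨rfl, rfl, h⟩

/-- The index type of the basis of `H 0` in Hodge degree `t`. -/
abbrev Index₀ (t : ℕ) : Type := {k : ℕ × ℕ × ℕ // k ∈ basisTriples ∧ k.1 + k.2.1 + k.2.2 = t}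

theorem vec_inj {a b c a' b' c' : ℕ} (h : ![a, b, c] = ![a', b', c']) : a = a' ∧ b = b' ∧ c = c' :=
  ⟨congrFun h 0, congrFun h 1, congrFun h 2⟩

theorem rest_three {ε a b c : ℕ} (ha : a % 2 = ε) (hb : b % 2 = ε) (hc : c % 2 = ε)
    (h : c < b + ε) (h' : a + 2 * ε = b + 2) (hε : ε ≤ 1) : Rest ε ![a, b, c] := by
  refine ⟨⟨fun j => ?_, ?_, h⟩, h'⟩
  · fin_cases j
    · exact ha
    · exact hb
    · exact hc
  · change b < a + ε
    omega

/-- By degree, the families with `k₃ ≡ 1` and `k₃ ≡ 0` modulo 4 occur for `t ≡ 2`, and the one with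
`k₃ ≡ 2` occurs for `t ≡ 3`. It remains to match their images under `mulEven` and `mulOdd` with
`Rest`. -/
theorem isBasisMod₀ (t : ℕ) : IsBasisMod (modelPart 0 t) (modelBoundaries₀ t)
    fun k : Index₀ t => bracket k.1.1 k.1.2.1 k.1.2.2 := by
  have hcases := fun k : Index₀ t => basisTriples_cases k.2.1
  have hsum := fun k : Index₀ t => k.2.2
  have h4 : t % 4 = 0 ∨ t % 4 = 1 ∨ t % 4 = 2 ∨ t % 4 = 3 := by omega
  rcases h4 with ht | ht | ht | ht
  · haveI : IsEmpty (Index₀ t) := ⟨fun k => by have := hcases k; have := hsum k; omega⟩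
    exact isBasisMod_of_le _ (homology₀_zero ht)
  · haveI : IsEmpty (Index₀ t) := ⟨fun k => by have := hcases k; have := hsum k; omega⟩
    exact isBasisMod_of_le _ (homology₀_one ht)
  -- Raising the single even exponent gives `(a, a, c)` with odd entries. The third family produces
  -- the triples with all entries equal, the first family all others.
  · refine homology₀_two ht (κ := fun k => if k.1.1 = k.1.2.1 then
      ![k.1.1, k.1.1, k.1.2.2 + 1] else ![k.1.1, k.1.1, k.1.2.2]) (fun k => ?_) ⟨fun k => ?_,
        fun k => ?_, fun k l h => ?_, fun l hl hs => ?_⟩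
    · have := hcases k
      have := hsum k
      exact bracket_mem_part (by omega) (by omega)
    · have h1 := hcases k
      have h2 := hsum k
      obtain ⟨⟨a, b, c⟩, h⟩ := k
      dsimp only at h1 h2 ⊢
      split_ifs with hc
      · obtain rfl : a = c + 1 := by omega
        obtain rfl : b = c + 1 := hc.symm
        refine mulEven_bracket one_ne_zero ?_
        rw [mulEven_three, if_neg (by omega), if_neg (by omega), if_pos (by omega),
          Even.neg_one_pow (Nat.even_iff.2 (by omega)), zero_add, zero_add]
      · obtain rfl : a = b + 1 := by omega
        refine mulEven_bracket (s := -1) (by norm_num) ?_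
        rw [mulEven_three, if_neg (by omega), if_pos (by omega), if_neg (by omega),
          Odd.neg_one_pow (Nat.odd_iff.2 (by omega)), zero_add, add_zero]
    · have h1 := hcases k
      have h2 := hsum k
      split_ifs with hc
      · exact rest_three (by omega) (by omega) (by omega) (by omega) (by omega) le_rfl
      · exact rest_three (by omega) (by omega) (by omega) (by omega) (by omega) le_rfl
    · have h1 := hcases k
      have h2 := hsum k
      have h1' := hcases l
      have h2' := hsum l
      refine Subtype.ext (Prod.ext ?_ (Prod.ext ?_ ?_)) <;>
        split_ifs at h <;> have h3 := vec_inj h <;> omega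
    · obtain ⟨⟨hmod, hl1, hl2⟩, hl3⟩ := hl
      have m0 := hmod 0
      have m1 := hmod 1
      have m2 := hmod 2
      rw [Fin.sum_univ_three] at hs
      have hl0 : l = ![l 0, l 0, l 2] := by
        rw [eq_vec l]
        have : l 1 = l 0 := by omega
        simp [this]
      by_cases h : l 2 = l 0
      · refine ⟨⟨(l 0, l 0, l 0 - 1), Or.inr ⟨l 0 - 1, ?_, by omega⟩, by dsimp only; omega⟩, ?_⟩
        · have : l 0 - 1 + 1 = l 0 := by omega
          rw [this]
        · dsimp only
          have : l 0 - 1 + 1 = l 0 := by omega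
          rw [if_pos rfl, this]
          exact Eq.trans (by rw [h]) hl0.symm
      · refine ⟨⟨(l 0, l 0 - 1, l 2), Or.inl (Or.inl ⟨l 0 - 1, l 2, ?_, ?_, by omega, by omega⟩),
          by dsimp only; omega⟩, ?_⟩
        · have : l 0 - 1 + 1 = l 0 := by omega
          rw [this]
        · exact Nat.even_iff.2 (by omega)
        · dsimp only
          have hne : ¬ l 0 = l 0 - 1 := by omega
          rw [if_neg hne]
          exact hl0.symm
  -- Raising the single odd exponent `k₂ + 1` gives the strictly decreasing even triples with first
  -- entry `k₂ + 2`.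
  · refine homology₀_three ht (κ := fun k => ![k.1.2.1 + 2, k.1.2.1, k.1.2.2]) (fun k => ?_)
      ⟨fun k => ?_, fun k => ?_, fun k l h => ?_, fun l hl hs => ?_⟩
    · have := hcases k
      have := hsum k
      exact bracket_mem_part (by omega) (by omega)
    · have h1 := hcases k
      have h2 := hsum k
      obtain ⟨⟨a, b, c⟩, h⟩ := k
      simp only at h1 h2 ⊢
      obtain rfl : a = b + 1 := by omega
      refine mulOdd_bracket one_ne_zero ?_
      rw [mulOdd_three, if_pos (by omega), if_neg (by omega), if_neg (by omega), one_smul,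
        add_zero, add_zero]
    · have h1 := hcases k
      have h2 := hsum k
      exact rest_three (by omega) (by omega) (by omega) (by omega) (by omega) zero_le_one
    · have h1 := hcases k
      have h2 := hsum k
      have h1' := hcases l
      have h2' := hsum l
      have h3 := vec_inj h
      refine Subtype.ext (Prod.ext ?_ (Prod.ext ?_ ?_)) <;> omega
    · obtain ⟨⟨hmod, hl1, hl2⟩, hl3⟩ := hl
      have m0 := hmod 0
      have m1 := hmod 1
      have m2 := hmod 2
      rw [Fin.sum_univ_three] at hs
      refine ⟨⟨(l 1 + 1, l 1, l 2), Or.inl (Or.inr ⟨l 1, l 2, rfl, Nat.even_iff.2 m1, by omega,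
        by omega⟩), by dsimp only; omega⟩, ?_⟩
      dsimp only
      have : l 1 + 2 = l 0 := by omega
      rw [this]
      exact (eq_vec l).symm

/-- The index types of the two families of basis elements of `H 1` in Hodge degree `t`. -/
abbrev Index₁ (t : ℕ) : Type := {k : ℕ × ℕ // Even k.1 ∧ k.2 % 4 = 2 ∧ k.2 < k.1 ∧
  (k.1 + 1) + (k.1 + 1) + k.2 + 1 = t}

abbrev Index₁' (t : ℕ) : Type :=
  {k : ℕ × ℕ // Odd k.1 ∧ k.2 % 4 = 1 ∧ k.2 ≤ k.1 ∧ k.1 + k.1 + k.2 + 1 = t}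

/-- The basis of `H 1` in Hodge degree `t`. -/
noncomputable def basis₁ (t : ℕ) : Index₁ t ⊕ Index₁' t → SkewPoly :=
  Sum.elim (fun k => (2 : ℚ) • bracket (k.1.1 + 1) (k.1.1 + 1) k.1.2 +
    bracket (k.1.1 + 1) k.1.1 (k.1.2 + 1)) fun k => bracket k.1.1 k.1.1 k.1.2

/-- Both terms produced by `mulEven` carry the sign `-1`, and `6` is the order of the symmetric
group. The coefficient `2` of the first bracket compensates its stabilizer of order two. -/
theorem basis₁_inl_eq {t : ℕ} (k : Index₁ t) : basis₁ t (Sum.inl k) =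
    mulEven ((-6 : ℚ) • antisym (monomial ![k.1.1 + 1, k.1.1, k.1.2])) := by
  obtain ⟨⟨b, c⟩, h1, h2, h3, h4⟩ := k
  dsimp only at h1 h2 h3 h4 ⊢
  change (2 : ℚ) • bracket (b + 1) (b + 1) c + bracket (b + 1) b (c + 1) = _
  have h1' := Nat.even_iff.1 h1
  rw [bracket_of_eq (by omega), bracket_of_ne (by omega) (by omega) (by omega), map_smul,
    ← antisym_mulEven, mulEven_three, if_neg (by omega), if_pos h1', if_pos (by omega),
    Odd.neg_one_pow (Nat.odd_iff.2 (by omega)), Odd.neg_one_pow (Nat.odd_iff.2 (by omega)),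
    map_add, map_add, map_zero, map_smul, map_smul, antisym_monomial, antisym_monomial]
  module

/-- The family of single brackets lives in `t ≡ 0`, where it is itself a rest family with odd
exponents. The family of sums lives in `t ≡ 1`, where it consists of images under `mulEven` of
elements that `mulOdd` maps to a rest family with even exponents. -/
theorem isBasisMod₁ (t : ℕ) : IsBasisMod (modelCycles₁ t) (modelBoundaries₁ t) (basis₁ t) := by
  have h1 : ∀ k : Index₁ t, k.1.1 % 2 = 0 ∧ k.1.2 % 4 = 2 ∧ k.1.2 < k.1.1 ∧
      (k.1.1 + 1) + (k.1.1 + 1) + k.1.2 + 1 = t := fun k => ⟨Nat.even_iff.1 k.2.1, k.2.2⟩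
  have h2 : ∀ k : Index₁' t, k.1.1 % 2 = 1 ∧ k.1.2 % 4 = 1 ∧ k.1.2 ≤ k.1.1 ∧
      k.1.1 + k.1.1 + k.1.2 + 1 = t := fun k => ⟨Nat.odd_iff.1 k.2.1, k.2.2⟩
  have h4 : t % 4 = 0 ∨ t % 4 = 1 ∨ t % 4 = 2 ∨ t % 4 = 3 := by omega
  rcases h4 with ht | ht | ht | ht
  · haveI : IsEmpty (Index₁ t) := ⟨fun k => by have := h1 k; omega⟩
    -- In Hodge degree zero the degree `t - 1` does not exist, and the model of defect one vanishes.
    rcases t with _ | d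
    · haveI : IsEmpty (Index₁' 0) := ⟨fun k => by have := h2 k; omega⟩
      refine isBasisMod_of_le _ fun f hf => ?_
      have h := hf.1
      rw [SetLike.mem_coe, modelPart_of_lt one_pos, Submodule.mem_bot] at h
      rw [h]
      exact Submodule.zero_mem _
    refine homology₁_zero ht rfl (κ := Sum.elim (fun k => isEmptyElim k) fun k =>
      ![k.1.1, k.1.1, k.1.2]) ?_ ⟨?_, ?_, ?_, fun l hl hs => ?_⟩
    · rintro (k | k)
      · exact isEmptyElim k
      · have := h2 k
        exact bracket_mem_part (by omega) (by omega)
    · rintro (k | k)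
      · exact isEmptyElim k
      · exact bracket_eq _ _ _
    · rintro (k | k)
      · exact isEmptyElim k
      · have := h2 k
        exact rest_three (by omega) (by omega) (by omega) (by omega) (by omega) le_rfl
    · rintro (k | k) (l | l) h
      · exact isEmptyElim k
      · exact isEmptyElim k
      · exact isEmptyElim l
      · have h3 := vec_inj h
        exact congrArg Sum.inr (Subtype.ext (Prod.ext h3.1 h3.2.2))
    · obtain ⟨⟨hmod, hl1, hl2⟩, hl3⟩ := hl
      have m0 := hmod 0
      have m1 := hmod 1
      have m2 := hmod 2
      rw [Fin.sum_univ_three] at hs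
      refine ⟨Sum.inr ⟨(l 0, l 2), Nat.odd_iff.2 m0, by dsimp only; omega, by dsimp only; omega,
        by dsimp only; omega⟩, ?_⟩
      have : l 1 = l 0 := by omega
      exact Eq.trans (by rw [this]; rfl) (eq_vec l).symm
  · haveI : IsEmpty (Index₁' t) := ⟨fun k => by have := h2 k; omega⟩
    obtain ⟨d, rfl⟩ : ∃ d, t = d + 1 := ⟨t - 1, by omega⟩
    have key := homology₁_one ht rfl (B := Sum.elim (fun k : Index₁ (d + 1) =>
        (-6 : ℚ) • antisym (monomial ![k.1.1 + 1, k.1.1, k.1.2])) fun k : Index₁' (d + 1) =>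
        isEmptyElim k)
      (κ := Sum.elim (fun k => ![k.1.1 + 2, k.1.1, k.1.2]) fun k => isEmptyElim k) ?_
      ⟨?_, ?_, ?_, fun l hl hs => ?_⟩
    · convert key using 1
      funext k
      rcases k with k | k
      · exact basis₁_inl_eq k
      · exact isEmptyElim k
    · rintro (k | k)
      · have := h1 k
        exact Submodule.smul_mem _ _ (antisym_three_mem_part (by omega) (by omega))
      · exact isEmptyElim k
    · rintro (k | k)
      · have := h1 k
        refine ⟨-6, by norm_num, ?_⟩
        simp only [Sum.elim_inl]
        rw [map_smul, ← antisym_mulOdd, mulOdd_three, if_pos (by omega), if_neg (by omega),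
          if_neg (by omega), add_zero, add_zero]
      · exact isEmptyElim k
    · rintro (k | k)
      · have := h1 k
        exact rest_three (by omega) (by omega) (by omega) (by omega) (by omega) zero_le_one
      · exact isEmptyElim k
    · rintro (k | k) (l | l) h
      · have h3 := vec_inj h
        exact congrArg Sum.inl (Subtype.ext (Prod.ext h3.2.1 h3.2.2))
      · exact isEmptyElim l
      · exact isEmptyElim k
      · exact isEmptyElim k
    · obtain ⟨⟨hmod, hl1, hl2⟩, hl3⟩ := hl
      have m0 := hmod 0
      have m1 := hmod 1
      have m2 := hmod 2
      rw [Fin.sum_univ_three] at hs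
      refine ⟨Sum.inl ⟨(l 1, l 2), Nat.even_iff.2 m1, by dsimp only; omega, by dsimp only; omega,
        by dsimp only; omega⟩, ?_⟩
      have : l 1 + 2 = l 0 := by omega
      simp only [Sum.elim_inl]
      rw [this]
      exact (eq_vec l).symm
  · haveI : IsEmpty (Index₁ t) := ⟨fun k => by have := h1 k; omega⟩
    haveI : IsEmpty (Index₁' t) := ⟨fun k => by have := h2 k; omega⟩
    exact isBasisMod_of_le _ (homology₁_two ht)
  · haveI : IsEmpty (Index₁ t) := ⟨fun k => by have := h1 k; omega⟩
    haveI : IsEmpty (Index₁' t) := ⟨fun k => by have := h2 k; omega⟩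
    exact isBasisMod_of_le _ (homology₁_three ht)

end SkewPoly

end TwoLoop

namespace TwoLoop
open OGraph SkewPoly

/-! ### Homology of the graph complex -/

/-- The hypotheses say that `L` induces an isomorphism of `C` modulo `E` with `Z` modulo `D`; lifts
of the `B i` give the basis. -/
theorem IsBasisMod.exists_basis {M M' ι : Type*} [AddCommGroup M] [Module ℚ M] [AddCommGroup M']
    [Module ℚ M'] {Z D : Submodule ℚ M'} {B : ι → M'} (h : IsBasisMod Z D B)
    (C E : Submodule ℚ M) (L : M →ₗ[ℚ] M') (h1 : ∀ x ∈ C, L x ∈ Z)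
    (h2 : ∀ f ∈ Z, ∃ x ∈ C, L x = f) (h3 : ∀ x ∈ C, L x ∈ D ↔ x ∈ E) :
    ∃ b : Module.Basis ι ℚ (C ⧸ E.submoduleOf C),
      ∀ i, ∃ z : C, b i = Submodule.Quotient.mk z ∧ L z = B i := by
  choose z hz hL using fun i => h2 _ (h.mem i)
  set v : ι → C := fun i => ⟨z i, hz i⟩ with hv
  have hcoe : ∀ c : ι →₀ ℚ, L (Finsupp.linearCombination ℚ v c : C) =
      Finsupp.linearCombination ℚ B c := by
    intro c
    have := Finsupp.apply_linearCombination ℚ (L.comp C.subtype) v c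
    refine this.trans ?_
    congr 2
    funext i
    exact hL i
  have hmk : ∀ c : ι →₀ ℚ, Finsupp.linearCombination ℚ
      (fun i => (E.submoduleOf C).mkQ (v i)) c =
      (E.submoduleOf C).mkQ (Finsupp.linearCombination ℚ v c) :=
    fun c => (Finsupp.apply_linearCombination ℚ (E.submoduleOf C).mkQ v c).symm
  have hli : LinearIndependent ℚ fun i => (E.submoduleOf C).mkQ (v i) := by
    rw [linearIndependent_iff]
    intro c hc
    rw [hmk, Submodule.mkQ_apply, Submodule.Quotient.mk_eq_zero] at hc
    refine h.indep c ?_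
    rw [← hcoe]
    exact (h3 _ (Subtype.mem _)).2 hc
  have hsp : ⊤ ≤ Submodule.span ℚ (Set.range fun i => (E.submoduleOf C).mkQ (v i)) := by
    rintro x -
    obtain ⟨x, rfl⟩ := (E.submoduleOf C).mkQ_surjective x
    obtain ⟨c, hc⟩ := h.span _ (h1 x x.2)
    rw [← hcoe, ← map_sub, ← Submodule.coe_sub, h3 _ (Subtype.mem _)] at hc
    rw [Finsupp.mem_span_range_iff_exists_finsupp]
    refine ⟨c, ?_⟩
    change Finsupp.linearCombination ℚ (fun i => (E.submoduleOf C).mkQ (v i)) c = _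
    rw [hmk, eq_comm, ← sub_eq_zero, ← map_sub, Submodule.mkQ_apply, Submodule.Quotient.mk_eq_zero]
    exact hc
  exact ⟨Module.Basis.mk hli hsp, fun i => ⟨v i, Module.Basis.mk_apply hli hsp i, hL i⟩⟩

section Homology

variable {m N : ℕ} {F : GraphSpace m N →ₗ[ℚ] SkewPoly}

theorem exists_hairy (hm : Odd m) (hN : Even N)
    (hF : ∀ s k, F (graphClass m N (theta s k)) = thetaVal s k) {i t : ℕ} {f : SkewPoly}
    (hf : f ∈ modelPart i t) : ∃ w ∈ hairy m N i t, modelSign i • F w = f := by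
  refine ⟨(modelEquiv hm hN hF i t).symm ⟨f, hf⟩, Subtype.mem _, ?_⟩
  rw [← modelEquiv_apply hm hN hF i t, LinearEquiv.apply_symm_apply]

theorem eq_of_modelMap_eq (hm : Odd m) (hN : Even N)
    (hF : ∀ s k, F (graphClass m N (theta s k)) = thetaVal s k) {i t : ℕ} {z w : GraphSpace m N}
    (hz : z ∈ hairy m N i t) (hw : w ∈ hairy m N i t)
    (h : modelSign i • F z = modelSign i • F w) : z = w := by
  have : modelEquiv hm hN hF i t ⟨z, hz⟩ = modelEquiv hm hN hF i t ⟨w, hw⟩ := Subtype.ext h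
  exact congrArg Subtype.val ((modelEquiv hm hN hF i t).injective this)

theorem modelMap_mem (hm : Odd m) (hN : Even N)
    (hF : ∀ s k, F (graphClass m N (theta s k)) = thetaVal s k) {i t : ℕ} {z : GraphSpace m N}
    (hz : z ∈ hairy m N i t) : modelSign i • F z ∈ modelPart i t :=
  (modelEquiv hm hN hF i t ⟨z, hz⟩).2

theorem modelMap_differential_one (hm : Odd m) (hN : Even N)
    (hF : ∀ s k, F (graphClass m N (theta s k)) = thetaVal s k) {t : ℕ} {z : GraphSpace m N}
    (hz : z ∈ hairy m N 1 t) :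
    modelSign 0 • F (differential m N z) = dOne (modelSign 1 • F z) := by
  rw [(differential_hairy hm hN hF 0 t hz).2.2, dOne_apply]
  rfl

theorem modelMap_differential_two (hm : Odd m) (hN : Even N)
    (hF : ∀ s k, F (graphClass m N (theta s k)) = thetaVal s k) {t : ℕ} {z : GraphSpace m N}
    (hz : z ∈ hairy m N 2 t) :
    modelSign 1 • F (differential m N z) = dTwo (modelSign 2 • F z) := by
  rw [(differential_hairy hm hN hF 1 t hz).2.2, dTwo_apply]
  rfl

theorem cycles_zero (hm : Odd m) (hN : Even N)
    (hF : ∀ s k, F (graphClass m N (theta s k)) = thetaVal s k) (t : ℕ) :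
    cycles m N 0 t = hairy m N 0 t :=
  inf_eq_left.2 fun _ hz => differential_hairy_zero hm hN hz

theorem exists_basis_homology_zero (hm : Odd m) (hN : Even N)
    (hF : ∀ s k, F (graphClass m N (theta s k)) = thetaVal s k) (t : ℕ) :
    ∃ b : Module.Basis (Index₀ t) ℚ (Homology m N 0 t), ∀ k, ∃ z : cycles m N 0 t,
      b k = Submodule.Quotient.mk z ∧
        modelSign 0 • F z = bracket k.1.1 k.1.2.1 k.1.2.2 := by
  refine (isBasisMod₀ t).exists_basis _ _ (modelSign 0 • F) (fun x hx => modelMap_mem hm hN hF hx.1)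
    (fun f hf => ?_) fun x hx => ⟨?_, ?_⟩
  · obtain ⟨w, hw, rfl⟩ := exists_hairy hm hN hF hf
    exact ⟨w, ⟨hw, differential_hairy_zero hm hN hw⟩, rfl⟩
  · rintro ⟨g, hg, h⟩
    obtain ⟨w, hw, rfl⟩ := exists_hairy hm hN hF hg
    refine ⟨w, hw, eq_of_modelMap_eq hm hN hF (differential_hairy hm hN hF 0 t hw).1 hx.1 ?_⟩
    rw [modelMap_differential_one hm hN hF hw]
    exact h
  · rintro ⟨w, hw, rfl⟩
    exact ⟨_, modelMap_mem hm hN hF hw, (modelMap_differential_one hm hN hF hw).symm⟩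

theorem exists_basis_homology_one (hm : Odd m) (hN : Even N)
    (hF : ∀ s k, F (graphClass m N (theta s k)) = thetaVal s k) (t : ℕ) :
    ∃ b : Module.Basis (Index₁ t ⊕ Index₁' t) ℚ (Homology m N 1 t), ∀ k, ∃ z : cycles m N 1 t,
      b k = Submodule.Quotient.mk z ∧ modelSign 1 • F z = basis₁ t k := by
  refine (isBasisMod₁ t).exists_basis _ _ (modelSign 1 • F)
    (fun x hx => ⟨modelMap_mem hm hN hF hx.1, ?_⟩) (fun f hf => ?_) fun x hx => ⟨?_, ?_⟩
  · refine (modelMap_differential_one hm hN hF hx.1).symm.trans ?_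
    rw [LinearMap.mem_ker.1 hx.2, map_zero, smul_zero]
  · obtain ⟨w, hw, rfl⟩ := exists_hairy hm hN hF hf.1
    refine ⟨w, ⟨hw, eq_of_modelMap_eq hm hN hF (differential_hairy hm hN hF 0 t hw).1
      (Submodule.zero_mem _) ?_⟩, rfl⟩
    rw [modelMap_differential_one hm hN hF hw, LinearMap.mem_ker.1 hf.2, map_zero, smul_zero]
  · rintro ⟨g, hg, h⟩
    obtain ⟨w, hw, rfl⟩ := exists_hairy hm hN hF hg
    refine ⟨w, hw, eq_of_modelMap_eq hm hN hF (differential_hairy hm hN hF 1 t hw).1 hx.1 ?_⟩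
    rw [modelMap_differential_two hm hN hF hw]
    exact h
  · rintro ⟨w, hw, rfl⟩
    exact ⟨_, modelMap_mem hm hN hF hw, (modelMap_differential_two hm hN hF hw).symm⟩

theorem finite_supp {S : Set (Fin 3 → ℕ)} (hS : S.Finite) : Module.Finite ℚ (supp S) :=
  Module.Finite.span_of_finite ℚ (hS.image _)

theorem finite_modelPart (i t : ℕ) : Module.Finite ℚ (modelPart i t) := by
  have hS : {k : Fin 3 → ℕ | ∑ j, k j + i = t}.Finite := by
    refine (Set.finite_Iic (fun _ => t)).subset fun k hk j => ?_
    have h1 := Finset.single_le_sum (f := k) (fun _ _ => Nat.zero_le _) (Finset.mem_univ j)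
    have h2 : ∑ j, k j + i = t := hk
    change k j ≤ t
    omega
  haveI := finite_supp hS
  exact Submodule.finiteDimensional_of_le (S₂ := supp {k | ∑ j, k j + i = t})
    fun f hf => (mem_modelPart_iff.1 hf).2

theorem finite_hairy (hm : Odd m) (hN : Even N)
    (hF : ∀ s k, F (graphClass m N (theta s k)) = thetaVal s k) (i t : ℕ) :
    Module.Finite ℚ (hairy m N i t) :=
  haveI := finite_modelPart i t
  Module.Finite.equiv (modelEquiv hm hN hF i t).symm

theorem thetaElement_hairy (hm : Odd m) (hN : Even N)
    (hF : ∀ s k, F (graphClass m N (theta s k)) = thetaVal s k) {Γ : OGraph} {k : Fin 3 → ℕ} {i : ℕ}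
    (h : Γ.IsTwoLoopHairy) (hd : Γ.defect = i) (hk : Γ.IsTheta k) :
    modelSign i • F (graphClass m N Γ) = thetaElement i k ∨
      modelSign i • F (graphClass m N Γ) = -thetaElement i k := by
  obtain ⟨s, ⟨φ⟩⟩ := h.exists_weakIso hk
  rw [← φ.defect_eq, defect_theta] at hd
  have hs : (s false).toNat + (s true).toNat = i := by exact_mod_cast hd
  have hsign : ∀ f : SkewPoly, modelSign i • f = f ∨ modelSign i • f = -f := fun f => by
    unfold modelSign
    split_ifs <;> simp
  have hunit : ∀ f : SkewPoly, unitCast φ.symm.sign • f = f ∨ unitCast φ.symm.sign • f = -f := by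
    intro f
    rcases Int.units_eq_one_or φ.symm.sign with h | h <;> rw [h] <;> simp [unitCast]
  rw [graphClass_eq hm hN φ.symm, map_smul, hF]
  rcases hsign (unitCast φ.symm.sign • thetaVal s k) with h1 | h1 <;> rw [h1] <;>
  rcases hunit (thetaVal s k) with h2 | h2 <;> rw [h2] <;>
  rcases thetaVal_eq_or s k hs with h3 | h3 <;> rw [h3] <;> simp

end Homology

end TwoLoop

namespace TwoLoop
open OGraph SkewPoly

/-! ### Generating functions -/

/-- The generating function of the number of elements of given weight. -/
noncomputable def weightSeries {α : Type*} (w : α → ℕ) : PowerSeries ℤ :=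
  PowerSeries.mk fun t => (Nat.card {x // w x = t} : ℤ)

theorem finite_weight {α : Type*} {w : α → ℕ} (hw : ∀ t, Finite {x // w x = t}) {a : ℕ}
    (ha : 0 < a) (t : ℕ) : Finite {p : ℕ × α // a * p.1 + w p.2 = t} := by
  refine Finite.of_injective (β := Fin (t + 1) × Σ s : Fin (t + 1), {x // w x = s})
    (fun p => (⟨p.1.1, ?_⟩, ⟨⟨w p.1.2, ?_⟩, p.1.2, rfl⟩)) fun p q h => ?_
  · have := Nat.le_mul_of_pos_left p.1.1 ha
    have := p.2
    omega
  · have := p.2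
    omega
  · simp only [Prod.mk.injEq, Fin.mk.injEq, Sigma.mk.injEq] at h
    obtain ⟨h1, h2, h3⟩ := h
    refine Subtype.ext (Prod.ext h1 ?_)
    have key : ∀ (s s' : ℕ) (hs : s = s') (x : {x // w x = s}) (y : {x // w x = s'}),
        HEq x y → x.1 = y.1 := by
      rintro s _ rfl x y hxy
      rw [eq_of_heq hxy]
    exact key _ _ h2 _ _ h3

/-- Pairs with positive first entry are shifted copies of all pairs, and multiplication by `1 - X ^
a` leaves those with first entry zero. Finiteness is needed for the cardinality of a disjoint union
to be a sum. -/
theorem weightSeries_mul {α : Type*} {w : α → ℕ} (hw : ∀ t, Finite {x // w x = t}) {a : ℕ}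
    (ha : 0 < a) : weightSeries (fun p : ℕ × α => a * p.1 + w p.2) * (1 - PowerSeries.X ^ a) =
      weightSeries w := by
  ext t
  rw [mul_sub, mul_one, map_sub, PowerSeries.coeff_mul_X_pow', weightSeries, weightSeries,
    PowerSeries.coeff_mk, PowerSeries.coeff_mk]
  haveI := finite_weight hw ha
  haveI := hw
  split_ifs with h
  · obtain ⟨t, rfl⟩ := Nat.exists_eq_add_of_le' h
    rw [PowerSeries.coeff_mk, Nat.add_sub_cancel]
    have e : {p : ℕ × α // a * p.1 + w p.2 = t} ⊕ {x // w x = t + a} ≃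
        {p : ℕ × α // a * p.1 + w p.2 = t + a} := by
      refine Equiv.ofBijective (Sum.elim (fun p => ⟨(p.1.1 + 1, p.1.2), ?_⟩)
        fun x => ⟨(0, x.1), ?_⟩) ⟨?_, ?_⟩
      · have := p.2
        dsimp only
        rw [mul_add]
        omega
      · have := x.2
        dsimp only
        omega
      · rintro (⟨⟨i, x⟩, h⟩ | ⟨x, h⟩) (⟨⟨j, y⟩, h'⟩ | ⟨y, h'⟩) he <;> simp at he ⊢
        · exact he
        · exact he
      · rintro ⟨⟨i, x⟩, h⟩
        rcases i with _ | i
        · exact ⟨Sum.inr ⟨x, by simpa using h⟩, rfl⟩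
        · refine ⟨Sum.inl ⟨(i, x), ?_⟩, rfl⟩
          dsimp only at h ⊢
          rw [mul_add] at h
          omega
    rw [← Nat.card_congr e, Nat.card_sum]
    push_cast
    ring
  · rw [sub_zero]
    congr 1
    refine Nat.card_congr (Equiv.ofBijective (fun p => ⟨p.1.2, ?_⟩) ⟨?_, ?_⟩)
    · obtain ⟨⟨i, x⟩, hp⟩ := p
      rcases i with _ | i
      · simpa using hp
      · dsimp only at hp
        rw [mul_add] at hp
        omega
    · rintro ⟨⟨i, x⟩, hp⟩ ⟨⟨j, y⟩, hq⟩ he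
      rcases i with _ | i <;> rcases j with _ | j
      · simpa using he
      all_goals
        dsimp only at hp hq
        rw [mul_add] at *
        omega
    · rintro ⟨x, hx⟩
      exact ⟨⟨(0, x), by simpa using hx⟩, rfl⟩

theorem weightSeries_bool {a b : ℕ} (h : a ≠ b) :
    weightSeries (fun c : Bool => if c then b else a) = PowerSeries.X ^ a + PowerSeries.X ^ b := by
  ext t
  rw [weightSeries, PowerSeries.coeff_mk, map_add, PowerSeries.coeff_X_pow, PowerSeries.coeff_X_pow,
    Nat.card_eq_fintype_card, Fintype.card_subtype, Fintype.univ_bool]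
  by_cases h1 : t = a
  · subst h1
    simp [Finset.filter_insert, Finset.filter_singleton, h, h.symm]
  · by_cases h2 : t = b
    · subst h2
      simp [Finset.filter_insert, Finset.filter_singleton, h, h.symm]
    · simp [Finset.filter_insert, Finset.filter_singleton, h1, h2, Ne.symm h1, Ne.symm h2, eq_comm]

/-- The weights of the basis elements of the homology. -/
def weight (a b : ℕ) (p : ℕ × ℕ × Bool) : ℕ := 4 * p.1 + (12 * p.2.1 + if p.2.2 then b else a)

theorem weightSeries_weight {a b : ℕ} (h : a ≠ b) :
    weightSeries (weight a b) * ((1 - PowerSeries.X ^ 4) * (1 - PowerSeries.X ^ 12)) =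
      PowerSeries.X ^ a + PowerSeries.X ^ b := by
  have h0 : ∀ t, Finite {x : Bool // (if x then b else a) = t} := fun t => inferInstance
  have h1 := weightSeries_mul h0 (a := 12) (by norm_num)
  have h2 := weightSeries_mul (finite_weight h0 (a := 12) (by norm_num)) (a := 4) (by norm_num)
  rw [← weightSeries_bool h, ← h1, ← h2, mul_assoc]
  rfl

/-- The basis element of `H 0` with given parameters. -/
def triple₀ : ℕ × ℕ × Bool → ℕ × ℕ × ℕ
  | (0, j, false) => (4 * j + 1, 4 * j + 1, 4 * j)
  | (i + 1, j, false) => (4 * j + 2 + 2 * i + 1, 4 * j + 2 + 2 * i, 4 * j + 1)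
  | (i, j, true) => (4 * j + 4 + 2 * i + 1, 4 * j + 4 + 2 * i, 4 * j + 2)

/-- Adding four to all exponents accounts for `12`, and adding two to the two large ones accounts
for `4`. The family with two equal entries is the missing first member of the series with `k₃ ≡ 1`,
and together they start in degree 2; the series with `k₃ ≡ 2` starts in degree 11. -/
theorem card_index₀ (t : ℕ) : Nat.card (Index₀ t) = Nat.card {p // weight 2 11 p = t} := by
  symm
  refine Nat.card_congr (Equiv.ofBijective (fun p => ⟨triple₀ p.1, ?_⟩) ⟨?_, ?_⟩)
  · obtain ⟨⟨i, j, b⟩, hp⟩ := p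
    rcases b with _ | _
    · rcases i with _ | i
      · refine ⟨Or.inr ⟨4 * j, rfl, by omega⟩, ?_⟩
        simp [triple₀, weight] at hp ⊢
        omega
      · refine ⟨Or.inl (Or.inl ⟨4 * j + 2 + 2 * i, 4 * j + 1, rfl, Nat.even_iff.2 (by omega),
          by omega, by omega⟩), ?_⟩
        simp [triple₀, weight] at hp ⊢
        omega
    · refine ⟨Or.inl (Or.inr ⟨4 * j + 4 + 2 * i, 4 * j + 2, by simp [triple₀], Nat.even_iff.2 (by omega),
          by omega, by omega⟩), ?_⟩
      simp [triple₀, weight] at hp ⊢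
      omega
  · rintro ⟨⟨i, j, b⟩, hp⟩ ⟨⟨i', j', b'⟩, hq⟩ h
    replace h := congrArg Subtype.val h
    refine Subtype.ext ?_
    rcases b with _ | _ <;> rcases b' with _ | _ <;> rcases i with _ | i <;> rcases i' with _ | i' <;>
      simp [triple₀] at h ⊢ <;> omega
  · rintro ⟨⟨a, b, c⟩, hk, hs⟩
    have hk' := basisTriples_cases hk
    dsimp only at hk' hs
    by_cases h1 : a = b
    · refine ⟨⟨(0, c / 4, false), ?_⟩, Subtype.ext ?_⟩
      · simp [weight]
        omega
      · simp [triple₀]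
        omega
    · by_cases h2 : c % 4 = 1
      · refine ⟨⟨((b - c - 1) / 2 + 1, c / 4, false), ?_⟩, Subtype.ext ?_⟩
        · simp [weight]
          omega
        · simp [triple₀]
          omega
      · refine ⟨⟨((b - c - 2) / 2, c / 4, true), ?_⟩, Subtype.ext ?_⟩
        · simp [weight]
          omega
        · simp [triple₀]
          omega

/-- The series start with `(1, 1, 1)` in Hodge degree 4 and with `(k₂, k₃) = (4, 2)` in Hodge degree
13. -/
theorem card_index₁ (t : ℕ) :
    Nat.card (Index₁ t ⊕ Index₁' t) = Nat.card {p // weight 4 13 p = t} := by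
  refine Nat.card_congr (Equiv.ofBijective (Sum.elim
    (fun k => ⟨((k.1.1 - k.1.2 - 2) / 2, k.1.2 / 4, true), ?_⟩)
    fun k => ⟨((k.1.1 - k.1.2) / 2, k.1.2 / 4, false), ?_⟩) ⟨?_, ?_⟩)
  · obtain ⟨⟨a, b⟩, h1, h2⟩ := k
    have := Nat.even_iff.1 h1
    simp [weight] at h2 this ⊢
    omega
  · obtain ⟨⟨a, b⟩, h1, h2⟩ := k
    have := Nat.odd_iff.1 h1
    simp [weight] at h2 this ⊢
    omega
  · rintro (⟨⟨a, b⟩, h1, h2⟩ | ⟨⟨a, b⟩, h1, h2⟩) (⟨⟨c, d⟩, h3, h4⟩ | ⟨⟨c, d⟩, h3, h4⟩) h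
    · have h1' := Nat.even_iff.1 h1
      have h3' := Nat.even_iff.1 h3
      simp at h h2 h4 h1' h3' ⊢
      omega
    · simp at h
    · simp at h
    · have h1' := Nat.odd_iff.1 h1
      have h3' := Nat.odd_iff.1 h3
      simp at h h2 h4 h1' h3' ⊢
      omega
  · rintro ⟨⟨i, j, b⟩, hp⟩
    rcases b with _ | _
    · refine ⟨Sum.inr ⟨(4 * j + 1 + 2 * i, 4 * j + 1), Nat.odd_iff.2 ?_, ?_⟩, Subtype.ext ?_⟩
      · dsimp only
        omega
      · simp [weight] at hp ⊢
        omega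
      · simp
        omega
    · refine ⟨Sum.inl ⟨(4 * j + 4 + 2 * i, 4 * j + 2), Nat.even_iff.2 ?_, ?_⟩, Subtype.ext ?_⟩
      · dsimp only
        omega
      · simp [weight] at hp ⊢
        omega
      · simp
        omega

section Series

variable {m N : ℕ}

theorem homologySeries_zero (hm : Odd m) (hN : Even N) :
    homologySeries m N 0 = weightSeries (weight 2 11) := by
  obtain ⟨F, hF⟩ := exists_modelMap hm hN
  ext t
  obtain ⟨b, -⟩ := exists_basis_homology_zero hm hN hF t
  rw [homologySeries, weightSeries, PowerSeries.coeff_mk, PowerSeries.coeff_mk,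
    Module.finrank_eq_nat_card_basis b, card_index₀]

theorem homologySeries_one (hm : Odd m) (hN : Even N) :
    homologySeries m N 1 = weightSeries (weight 4 13) := by
  obtain ⟨F, hF⟩ := exists_modelMap hm hN
  ext t
  obtain ⟨b, -⟩ := exists_basis_homology_one hm hN hF t
  rw [homologySeries, weightSeries, PowerSeries.coeff_mk, PowerSeries.coeff_mk,
    Module.finrank_eq_nat_card_basis b, card_index₁]

/-! ### Euler characteristics -/

/-- In a standard theta graph the Hodge degree and the defect determine the numbers of vertices and
edges, and with them the total degree. So for fixed Hodge degree the gradings by total degree and by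
defect agree up to a shift. -/
theorem totalDegree_hairy {Γ : OGraph} (h : Γ.IsTwoLoopHairy) :
    Γ.totalDegree m N = N * (Γ.hodge + 1) - 2 * Γ.hodge - 3 - m * Γ.hodge + Γ.defect := by
  obtain ⟨s, k, ⟨φ⟩⟩ := IsTwoLoopHairy.exists_theta h
  rw [← φ.totalDegree_eq m N, ← φ.hodge_eq, ← φ.defect_eq, totalDegree_eq, card_edge_theta,
    card_inn_theta, defect_theta, hodge_theta]
  have : Fintype.card (theta s k).Ext = ∑ j, k j + ((s false).toNat + (s true).toNat) := card_hair s k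
  rw [this]
  push_cast
  ring

theorem hairyOfDegree_eq (t i : ℕ) : hairyOfDegree m N t
    (N * (t + 1) - 2 * t - 3 - m * t + i) = hairy m N i t := by
  unfold hairyOfDegree hairy
  congr 1
  ext z
  refine exists_congr fun Γ => and_congr_right fun h => ?_
  rw [totalDegree_hairy h]
  constructor
  · rintro ⟨rfl, h2, rfl⟩
    exact ⟨by linarith, rfl, rfl⟩
  · rintro ⟨h2, rfl, rfl⟩
    exact ⟨rfl, by linarith, rfl⟩

theorem hairyOfDegree_eq_bot {t : ℕ} {d : ℤ} (h : d < N * (t + 1) - 2 * t - 3 - m * t ∨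
    N * (t + 1) - 2 * t - 3 - m * t + 2 < d) : hairyOfDegree m N t d = ⊥ := by
  rw [hairyOfDegree, Submodule.span_eq_bot]
  rintro z ⟨Γ, hΓ, rfl, hd, -⟩
  rw [totalDegree_hairy hΓ] at hd
  have := defect_bounds hΓ
  omega

theorem finrank_map_add {M M' : Type*} [AddCommGroup M] [Module ℚ M] [AddCommGroup M'] [Module ℚ M']
    (V : Submodule ℚ M) [Module.Finite ℚ V] (L : M →ₗ[ℚ] M') :
    Module.finrank ℚ (V.map L) + Module.finrank ℚ (V ⊓ LinearMap.ker L : Submodule ℚ M) =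
      Module.finrank ℚ V := by
  have h := LinearMap.finrank_range_add_finrank_ker (L.domRestrict V)
  rw [LinearMap.range_domRestrict, LinearMap.ker_domRestrict] at h
  rw [← h, ← Submodule.map_comap_subtype, Submodule.finrank_map_subtype_eq]

theorem finrank_quotient_add {M : Type*} [AddCommGroup M] [Module ℚ M] {C E : Submodule ℚ M}
    [Module.Finite ℚ C] (h : E ≤ C) : Module.finrank ℚ (C ⧸ E.submoduleOf C) +
      Module.finrank ℚ E = Module.finrank ℚ C := by
  rw [← Submodule.finrank_quotient_add_finrank (E.submoduleOf C),
    (Submodule.submoduleOfEquivOfLe h).finrank_eq]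

/-- The Euler–Poincaré formula; there is no contribution of `H 2` because `∂₂` is injective. -/
theorem finrank_hairy (hm : Odd m) (hN : Even N) (t : ℕ) :
    (Module.finrank ℚ (hairy m N 0 t) : ℤ) - Module.finrank ℚ (hairy m N 1 t) +
      Module.finrank ℚ (hairy m N 2 t) =
    Module.finrank ℚ (Homology m N 0 t) - Module.finrank ℚ (Homology m N 1 t) := by
  obtain ⟨F, hF⟩ := exists_modelMap hm hN
  haveI := finite_hairy hm hN hF
  have hle : ∀ i, boundaries m N i t ≤ cycles m N i t := by
    rintro i _ ⟨w, hw, rfl⟩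
    have h := differential_hairy hm hN hF i t hw
    exact ⟨h.1, h.2.1⟩
  haveI : ∀ i, Module.Finite ℚ (cycles m N i t) := fun i =>
    Submodule.finiteDimensional_of_le (inf_le_left : cycles m N i t ≤ hairy m N i t)
  have h0 := finrank_quotient_add (hle 0)
  have h1 := finrank_quotient_add (hle 1)
  have h2 := finrank_map_add (hairy m N 1 t) (differential m N)
  have h3 := finrank_map_add (hairy m N 2 t) (differential m N)
  have h4 : hairy m N 2 t ⊓ LinearMap.ker (differential m N) = ⊥ := by
    refine (Submodule.eq_bot_iff _).2 fun z hz => ?_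
    refine eq_of_modelMap_eq hm hN hF hz.1 (Submodule.zero_mem _) ?_
    rw [map_zero, smul_zero]
    refine dTwo_injective (modelMap_mem hm hN hF hz.1) ?_
    rw [← modelMap_differential_two hm hN hF hz.1, LinearMap.mem_ker.1 hz.2, map_zero, smul_zero]
  rw [h4, finrank_bot, add_zero] at h3
  have hz : Module.finrank ℚ (cycles m N 0 t) = Module.finrank ℚ (hairy m N 0 t) := by
    rw [cycles_zero hm hN hF]
  change Module.finrank ℚ (Homology m N 0 t) + _ = _ at h0
  change Module.finrank ℚ (Homology m N 1 t) + _ = _ at h1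
  change Module.finrank ℚ (boundaries m N 0 t) + Module.finrank ℚ (cycles m N 1 t) = _ at h2
  change Module.finrank ℚ (boundaries m N 1 t) = _ at h3
  omega

theorem negOnePow_degree (hm : Odd m) (hN : Even N) (t i : ℕ) :
    (((N * (t + 1) - 2 * t - 3 - m * t + i : ℤ).negOnePow : ℤˣ) : ℤ) = (-1) ^ (t + 1 + i) := by
  obtain ⟨a, rfl⟩ := hm
  obtain ⟨b, rfl⟩ := hN
  have h : (((b + b : ℕ) : ℤ) * (t + 1) - 2 * t - 3 - ((2 * a + 1 : ℕ) : ℤ) * t + i : ℤ) =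
      ((t + 1 + i : ℕ) : ℤ) + 2 * (b * (t + 1) - t - 2 - a * t - t) := by
    push_cast
    ring
  rw [h, Int.negOnePow_add, Int.negOnePow_even _ (even_two_mul _), mul_one, Int.negOnePow_def,
    zpow_natCast]
  simp

/-- Only three total degrees occur, those of defect 0, 1 and 2, and the parity of the lowest one is
that of `t + 1`. -/
theorem coeff_eulerSeries (hm : Odd m) (hN : Even N) (t : ℕ) :
    PowerSeries.coeff t (eulerSeries m N) =
      (-1) ^ (t + 1) * PowerSeries.coeff t (homologySeries m N 0 - homologySeries m N 1) := by
  rw [map_sub, eulerSeries, homologySeries, homologySeries, PowerSeries.coeff_mk,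
    PowerSeries.coeff_mk, PowerSeries.coeff_mk, ← finrank_hairy hm hN]
  set D : ℤ := N * (t + 1) - 2 * t - 3 - m * t with hD
  have h0 := hairyOfDegree_eq (m := m) (N := N) t 0
  have h1 := hairyOfDegree_eq (m := m) (N := N) t 1
  have h2 := hairyOfDegree_eq (m := m) (N := N) t 2
  have s0 := negOnePow_degree hm hN t 0
  have s1 := negOnePow_degree hm hN t 1
  have s2 := negOnePow_degree hm hN t 2
  rw [← hD] at h0 h1 h2 s0 s1 s2
  rw [finsum_eq_sum_of_support_subset (s := {D + (0 : ℕ), D + (1 : ℕ), D + (2 : ℕ)}),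
    Finset.sum_insert (by simp), Finset.sum_insert (by simp), Finset.sum_singleton, h0, h1, h2,
    s0, s1, s2]
  · ring
  · intro d hd
    by_contra hne
    simp at hne
    refine hd ?_
    dsimp only
    rw [hairyOfDegree_eq_bot (by omega), finrank_bot]
    simp

/-- The sign `(-1) ^ (t + 1)` amounts to the substitution of `-X` for `X` and a change of sign. In
the difference of the two rank series the numerator contains the factor `1 - X ^ 2`, which is
cancelled against `1 - X ^ 4`. -/
theorem eulerSeries_mul (hm : Odd m) (hN : Even N) :
    eulerSeries m N * ((1 + PowerSeries.X ^ 2) * (1 - PowerSeries.X ^ 12)) =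
      -PowerSeries.X ^ 2 + PowerSeries.X ^ 11 := by
  have h : eulerSeries m N =
      -PowerSeries.rescale (-1) (homologySeries m N 0 - homologySeries m N 1) := by
    ext t
    rw [coeff_eulerSeries hm hN, map_neg, PowerSeries.coeff_rescale]
    ring
  have h0 := weightSeries_weight (a := 2) (b := 11) (by norm_num)
  have h1 := weightSeries_weight (a := 4) (b := 13) (by norm_num)
  rw [← homologySeries_zero hm hN] at h0
  rw [← homologySeries_one hm hN] at h1
  have h2 : (homologySeries m N 0 - homologySeries m N 1) *
      ((1 - PowerSeries.X ^ 4) * (1 - PowerSeries.X ^ 12)) =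
      (PowerSeries.X ^ 2 + PowerSeries.X ^ 11) * (1 - PowerSeries.X ^ 2) := by
    linear_combination h0 - h1
  have h3 := congrArg (PowerSeries.rescale (-1)) h2
  simp only [map_mul, map_sub, map_add, map_pow, map_one, PowerSeries.rescale_X] at h3
  have hX : (PowerSeries.C (-1 : ℤ) : PowerSeries ℤ) = -1 := by simp
  have hne : (1 - PowerSeries.X ^ 2 : PowerSeries ℤ) ≠ 0 := by
    intro h
    have := congrArg (PowerSeries.coeff 0) h
    simp at this
  rw [hX] at h3
  refine mul_right_cancel₀ hne ?_
  rw [h, map_sub]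
  linear_combination -h3

end Series

end TwoLoop

/-! ### Assembly of the theorem. -/

theorem mainTheorem4 (m N : ℕ) (hm : Odd m) (hN : Even N) :
    -- two-loop hairy graphs have theta-shaped frames and defect 0, 1 or 2
    (∀ Γ : TwoLoop.OGraph, Γ.IsTwoLoopHairy →
      0 ≤ Γ.defect ∧ Γ.defect ≤ 2 ∧ ∃ k, Γ.IsTheta k) ∧
    -- they form a complex, finite dimensional in every Hodge degree
    (∀ i t, Module.Finite ℚ (TwoLoop.hairy m N i t)) ∧
    (∀ t, ∀ z ∈ TwoLoop.hairy m N 0 t, TwoLoop.differential m N z = 0) ∧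
    (∀ i t, ∀ z ∈ TwoLoop.hairy m N (i + 1) t,
      TwoLoop.differential m N z ∈ TwoLoop.hairy m N i t ∧
      TwoLoop.differential m N (TwoLoop.differential m N z) = 0) ∧
    -- the algebraic model of the complex
    (∃ Φ : ∀ i t, TwoLoop.hairy m N i t ≃ₗ[ℚ] TwoLoop.SkewPoly.modelPart i t,
      (∀ (Γ : TwoLoop.OGraph) (k : Fin 3 → ℕ) (i t : ℕ) (z : TwoLoop.hairy m N i t),
        Γ.IsTwoLoopHairy → Γ.defect = i → Γ.hodge = t → Γ.IsTheta k →
        (z : TwoLoop.GraphSpace m N) = TwoLoop.graphClass m N Γ →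
        (Φ i t z : TwoLoop.SkewPoly) = TwoLoop.SkewPoly.thetaElement i k ∨
        (Φ i t z : TwoLoop.SkewPoly) = -TwoLoop.SkewPoly.thetaElement i k) ∧
      (∀ (i t : ℕ) (z : TwoLoop.hairy m N (i + 1) t) (w : TwoLoop.hairy m N i t),
        (w : TwoLoop.GraphSpace m N) = TwoLoop.differential m N z →
        (Φ i t w : TwoLoop.SkewPoly) =
          TwoLoop.SkewPoly.modelDifferential (i + 1) (Φ (i + 1) t z)) ∧
      -- the basis of `H 0`
      (∀ t, ∃ b : Module.Basis
          {k : ℕ × ℕ × ℕ // k ∈ TwoLoop.SkewPoly.basisTriples ∧ k.1 + k.2.1 + k.2.2 = t} ℚ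
          (TwoLoop.Homology m N 0 t),
        ∀ k, ∃ z : TwoLoop.cycles m N 0 t, b k = Submodule.Quotient.mk z ∧
          (Φ 0 t ⟨z, z.2.1⟩ : TwoLoop.SkewPoly) =
            TwoLoop.SkewPoly.bracket k.1.1 k.1.2.1 k.1.2.2) ∧
      -- the basis of `H 1`
      (∀ t, ∃ b : Module.Basis
          ({k : ℕ × ℕ // Even k.1 ∧ k.2 % 4 = 2 ∧ k.2 < k.1 ∧
              (k.1 + 1) + (k.1 + 1) + k.2 + 1 = t} ⊕
            {k : ℕ × ℕ // Odd k.1 ∧ k.2 % 4 = 1 ∧ k.2 ≤ k.1 ∧ k.1 + k.1 + k.2 + 1 = t}) ℚ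
          (TwoLoop.Homology m N 1 t),
        (∀ k, ∃ z : TwoLoop.cycles m N 1 t, b (Sum.inl k) = Submodule.Quotient.mk z ∧
          (Φ 1 t ⟨z, z.2.1⟩ : TwoLoop.SkewPoly) =
            (2 : ℚ) • TwoLoop.SkewPoly.bracket (k.1.1 + 1) (k.1.1 + 1) k.1.2 +
              TwoLoop.SkewPoly.bracket (k.1.1 + 1) k.1.1 (k.1.2 + 1)) ∧
        (∀ k, ∃ z : TwoLoop.cycles m N 1 t, b (Sum.inr k) = Submodule.Quotient.mk z ∧
          (Φ 1 t ⟨z, z.2.1⟩ : TwoLoop.SkewPoly) =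
            TwoLoop.SkewPoly.bracket k.1.1 k.1.1 k.1.2))) ∧
    -- the generating functions
    TwoLoop.homologySeries m N 0 * ((1 - PowerSeries.X ^ 4) * (1 - PowerSeries.X ^ 12)) =
      PowerSeries.X ^ 2 + PowerSeries.X ^ 11 ∧
    TwoLoop.homologySeries m N 1 * ((1 - PowerSeries.X ^ 4) * (1 - PowerSeries.X ^ 12)) =
      PowerSeries.X ^ 4 + PowerSeries.X ^ 13 ∧
    TwoLoop.eulerSeries m N * ((1 + PowerSeries.X ^ 2) * (1 - PowerSeries.X ^ 12)) =
      -PowerSeries.X ^ 2 + PowerSeries.X ^ 11 := by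
  obtain ⟨F, hF⟩ := TwoLoop.exists_modelMap (m := m) (N := N) hm hN
  refine ⟨fun Γ h => ⟨(TwoLoop.defect_bounds h).1, (TwoLoop.defect_bounds h).2, h.exists_isTheta⟩,
    TwoLoop.finite_hairy hm hN hF, fun t z hz => TwoLoop.differential_hairy_zero hm hN hz,
    fun i t z hz => ?_, ⟨TwoLoop.modelEquiv hm hN hF, fun Γ k i t z h hd _ hk hz => ?_,
      fun i t z w hw => ?_, fun t => ?_, fun t => ?_⟩, ?_, ?_, TwoLoop.eulerSeries_mul hm hN⟩
  · have h := TwoLoop.differential_hairy hm hN hF i t hz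
    exact ⟨h.1, h.2.1⟩
  · rw [TwoLoop.modelEquiv_apply, hz]
    exact TwoLoop.thetaElement_hairy hm hN hF h hd hk
  · rw [TwoLoop.modelEquiv_apply, TwoLoop.modelEquiv_apply, hw]
    exact (TwoLoop.differential_hairy hm hN hF i t z.2).2.2
  · exact TwoLoop.exists_basis_homology_zero hm hN hF t
  · obtain ⟨b, hb⟩ := TwoLoop.exists_basis_homology_one hm hN hF t
    exact ⟨b, fun k => hb (Sum.inl k), fun k => hb (Sum.inr k)⟩
  · rw [TwoLoop.homologySeries_zero hm hN]
    exact TwoLoop.weightSeries_weight (by norm_num)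
  · rw [TwoLoop.homologySeries_one hm hN]
    exact TwoLoop.weightSeries_weight (by norm_num)
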